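/- **Setting.** Let $\alpha\in(0,1)$ and let $f:\mathbb R\to\mathbb R$ be real-analytic on $\mathbb R\setminus\{0\}$ with $f(0)=0$ and $f(\alpha x)=\alpha f(x)$ for all $x$. Let $\Gamma=\{(x,f(x)):x\in\mathbb R\}\subset\mathbb R^2$, with arc-length measure $ds=\sqrt{1+f'(x)^2}\,dx$ and unit normal $n=(-f',1)/\sqrt{1+f'^2}$, and let $D_\Gamma$ be the double-layer operator on the complex space $L^2(\Gamma)$, $$D_\Gamma\phi(x)=\frac1{2\pi}\,\mathrm{p.v.}\!\int_\Gamma\frac{(x-y)\cdot n(y)}{|x-y|^2}\,\phi(y)\,ds(y)\quad\text{for a.e. }x\in\Gamma.$$ Let $\rho$ denote the spectral radius and $\rho_{\rm ess}$ the essential spectral radius (the supremum of $|\lambda|$ over those $\lambda$ for which $D_\Gamma-\lambda I$ is not Fredholm). Put $f_\pm(x)=f(\pm x)$ for $x>0$ and $g_\pm(x)=\alpha^{-x}f_\pm(\alpha^x)$ for $x\in\mathbb R$. For $c>0$ let $\Sigma_c=\{z\in\mathbb C:|\mathrm{Im}\,z|<c\}$, let $\Sigma_0=\mathbb R$, and let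 $\|h\|_c=\sup_{\Sigma_c}|h|$. Write $\lambda_\alpha=|\log\alpha|$. **Conditions on $c$.** (i) $g_\pm$ continue analytically to $\Sigma_c$, with $g_\pm,g_\pm',g_\pm''$ bounded there. (ii) For both choices of sign $$c\le\frac{\arccos\alpha}{\lambda_\alpha},\qquad \mathfrak I_{c,\pm}<1,\qquad \|\mathrm{Im}\,g_\pm\|_c+\alpha c\,\mathfrak K_{c,\pm}<\alpha^2,$$ where, for $d\in\{0,c\}$, $\mathfrak I_{c,\pm}=\|\mathrm{Im}\,g_\pm\|_c+\|\mathrm{Im}\,g_\pm'\|_c/\lambda_\alpha$, $\mathfrak K_{d,\pm}=\alpha^{-1}\lambda_\alpha\max(\|g_\pm\|_d,\|g_\mp\|_0)$, $\mathfrak F_{d,\pm}=\|g_\pm\|_d+\|g'_\pm\|_d/\lambda_\alpha$, $\mathfrak G_{d,\pm}=\|g'_\pm\|_d+\|g''_\pm\|_d/\lambda_\alpha$. Put $\mathfrak K_0=\mathfrak K_{0,+}=\mathfrak K_{0,-}$. **Constants.** Let $\mathcal B_n=\dfrac{\log\tanh((n-1)\lambda_\alpha/4)}{\alpha^{1/2}\log\alpha}$,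 $\mathcal B^*=\sum_{j=2}^{10}\dfrac{\alpha^{j/2}}{\alpha-\alpha^j}+\mathcal B_{10}$, $\mathcal C_n=\dfrac{2\arctan(\alpha^{n/2})}{\alpha^2\lambda_\alpha}$, $\mathcal C^*=\dfrac1{2\alpha^2}+\dfrac2{\alpha^2}\sum_{j=1}^{10}\dfrac1{\alpha^{j/2}+\alpha^{-j/2}}+2\mathcal C_{10}$ and $\mathfrak R=\dfrac{1+\alpha^{1/2}+\alpha^{-1/2}}{2\alpha^2}$. Then, the maxima being over the two choices of sign, $$C_1(M)=\tfrac1\pi\max_\pm\,(1+\mathfrak F_{0,\pm}^2)^{1/4}\big(2\lambda_\alpha\mathfrak F_{0,\pm}\mathcal B_M+(\lambda_\alpha\mathfrak F_{0,\mp}+\mathfrak K_0)\mathcal C_M\big),$$ $$C_3=\tfrac1{2\pi}\max_\pm\,(1+\mathfrak F_{0,\pm}^2)^{1/4}\big(\mathfrak G_{0,\pm}\mathfrak R+4\lambda_\alpha\mathfrak F_{0,\pm}\mathcal B^*+(\lambda_\alpha\mathfrak F_{0,\mp}+\mathfrak K_0)\mathcal C^*\big),$$ $$C_4=2e^{2\pi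 c}\max_\pm\big(k^{\pm}_{0c}k^{\pm}_{c0}+\ell^{\pm}_{0c}\ell^{\mp}_{c0}+k^{\pm}_{0c}\ell^{\pm}_{c0}+\ell^{\pm}_{0c}k^{\mp}_{c0}\big),$$ where $$k^\pm_{c0}=\frac{(1+\mathfrak F_{c,\pm}^2)^{1/4}}{\pi(1-\mathfrak I_{c,\pm}^2)}\Big[\tfrac12\mathfrak G_{c,\pm}\mathfrak R+\lambda_\alpha(\mathfrak F_{c,\pm}+\mathfrak F_{0,\pm})\mathcal B^*\Big],\qquad k^\pm_{0c}=\frac{(1+\mathfrak F_{0,\pm}^2)^{1/4}}{\pi(1-\mathfrak I_{c,\pm}^2)^{5/4}}\Big[\tfrac12\mathfrak G_{c,\pm}\mathfrak R+2\lambda_\alpha\mathfrak F_{c,\pm}\mathcal B^*\Big],$$ $$\ell^\pm_{c0}=\frac{\mathcal C^*}{2\pi}\,\frac{(\lambda_\alpha\mathfrak F_{0,\mp}+\mathfrak K_{c,\pm})(1+\mathfrak F_{c,\pm}^2)^{1/4}}{1-\alpha^{-4}(\|\mathrm{Im}\,g_\pm\|_c+\alpha c\mathfrak K_{c,\pm})^2},\qquad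 \ell^\pm_{0c}=\frac{\mathcal C^*}{2\pi}\,\frac{\lambda_\alpha\mathfrak F_{c,\mp}+\mathfrak K_{c,\mp}}{1-\alpha^{-4}(\|\mathrm{Im}\,g_\mp\|_c+\alpha c\mathfrak K_{c,\mp})^2}\Big(\frac{1+\mathfrak F_{0,\pm}^2}{1-\mathfrak I_{c,\mp}^2}\Big)^{1/4}.$$ **Matrices.** For $\sigma,\tau\in\{+,-\}$, $j\in\mathbb Z$ and $x,y\in[0,1]$ put $$T_j^{\sigma\tau}(x,y)=\frac{p}{1+q^2}\left(\frac{1+f_\sigma'(\alpha^x)^2}{1+f_\tau'(\alpha^y)^2}\right)^{1/4}\alpha^{(x+y+j)/2}\lambda_\alpha,$$ where, with $r=\alpha^{x+j}$, $s=\alpha^y$ and $\epsilon=1$ if $\sigma=\tau$, $\epsilon=-1$ if $\sigma\ne\tau$, $$p=\frac{(s-\epsilon r)f_\tau'(s)+f_\sigma(r)-f_\tau(s)}{(r-\epsilon s)^2},\qquad q=\frac{f_\sigma(r)-f_\tau(s)}{r-\epsilon s},$$ except that $p=\tfrac12f_\sigma''(s)$ and $q=f'_\sigma(s)$ if $\sigma=\tau$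 and $r=s$. With $x_q=(q-\frac12)/N$, $q=1,\dots,N$, let $A^M_{t,N}$ and $B^M_N$ be the $2N\times2N$ matrices with $N\times N$ blocks indexed by $(\sigma,\tau)$, in the order $-,+$, with entries $$\frac1{2\pi N}\sum_{j=-M}^Me^{ijt}\,T_j^{\sigma\tau}(x_p,x_q)\qquad\text{and}\qquad\frac1{2\pi N}\sum_{j=-M}^M|j|\,|T_j^{\sigma\tau}(x_p,x_q)|$$ respectively. Let $\|\cdot\|_\infty$ be the maximal absolute row sum of a matrix. **Resolvent quantities.** Given $\rho_0>0$ and $m\ge1$, put $t_k=(k-\frac12)\pi/m$ for $k=1,\dots,m$. If $\rho(A^M_{t_k,N})<\rho_0$ put $\mu_{k,1}=\rho_0$, $\nu_{k,\ell}=\|(A^M_{t_k,N}-\mu_{k,\ell}I)^{-1}\|_\infty^{-1}$ and $\mu_{k,\ell+1}=\mu_{k,\ell}e^{i\nu_{k,\ell}/(2\rho_0)}$ for $\ell\ge1$, and let $n_k$ be the smallest integer with $\sum_{\ell=1}^{n_k}\nu_{k,\ell}\ge4\pi\rho_0$. Put $$R_{m,M,N}=\min_{1\le k\le m,\ 1\le\ell\le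 n_k}\Big(\frac{\nu_{k,\ell}}4+\frac{\nu_{k,\ell+1}}2\Big),\qquad \Delta=R_{m,M,N}-C_1(M)-\frac{\pi}{2m}\|B^M_N\|_\infty,$$ and consider the criterion $$\Delta>0\quad\text{and}\quad \mathcal L_c(f,N):=\frac{C_4}{e^{2\pi Nc}-1}<\mathcal R_c(f,m,M,N):=\rho_0^2\left(1+C_3\,\Delta^{-1}\right)^{-1}.\tag{$*$}$$ **Theorem.** The formula above defines a unique bounded operator $D_\Gamma$ on $L^2(\Gamma)$, and $\rho(D_\Gamma)=\rho_{\rm ess}(D_\Gamma)$. The conditions (i), (ii) hold for all sufficiently small $c>0$. For every $c>0$ satisfying (i), (ii) and every $\rho_0>0$: 1. If $m,N\ge1$ and $M\ge2$ are integers such that $\rho(A^M_{t_k,N})<\rho_0$ for $k=1,\dots,m$ and $(*)$ holds, then $\rho(D_\Gamma;L^2(\Gamma))=\rho_{\rm ess}(D_\Gamma)<\rho_0$. 2. Conversely, if $\rho(D_\Gamma;L^2(\Gamma))<\rho_0$, there are $m_0,M_0,N_0$ such that for all $m\ge m_0$, $M\ge M_0$, $N\ge N_0$ the criterion $(*)$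 holds and $\rho(A^M_{t,N})<\rho_0$ for all $t\in[0,\pi]$. -/

import Mathlib

open MeasureTheory Filter Topology

noncomputable section

namespace DilationGraph

/-! ### The double-layer operator on a graph in the plane -/

/-- Arc-length measure on `Γ = {(s, f s) : s ∈ ℝ}`: the image of `√(1 + f'(s)²) ds` under the
parametrisation `s ↦ (s, f s)`, as a measure on the Euclidean plane concentrated on `Γ`. -/
def graphMeasure (f : ℝ → ℝ) : Measure (EuclideanSpace ℝ (Fin 2)) :=
  ((volume : Measure ℝ).withDensity fun s => ENNReal.ofReal (√(1 + deriv f s ^ 2))).map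
    fun s => !₂[s, f s]

/-- The complex Hilbert space `L²(Γ)`. -/
abbrev L2Graph (f : ℝ → ℝ) : Type := Lp ℂ 2 (graphMeasure f)

/-- The (upward) unit normal `n(y)` to the graph at `y = (s, f s)`. -/
def unitNormal (f : ℝ → ℝ) (y : EuclideanSpace ℝ (Fin 2)) : EuclideanSpace ℝ (Fin 2) :=
  (√(1 + deriv f (y 0) ^ 2))⁻¹ • !₂[-deriv f (y 0), 1]

/-- The double-layer kernel `(2π)⁻¹ (x - y) ⬝ n(y) / |x - y|²`. -/
def dlKernel (f : ℝ → ℝ) (x y : EuclideanSpace ℝ (Fin 2)) : ℝ :=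
  1 / (2 * Real.pi) * (inner ℝ (x - y) (unitNormal f y) / ‖x - y‖ ^ 2)

/-- `D` is the double-layer operator `D_Γ` on `L²(Γ)`: for each `φ ∈ L²(Γ)`, `D φ (x)` is, for
almost every `x ∈ Γ`, the Cauchy principal value of the integral of `dlKernel f x y * φ y`. -/
def IsDoubleLayerOperator (f : ℝ → ℝ) (D : L2Graph f →L[ℂ] L2Graph f) : Prop :=
  ∀ φ : L2Graph f, ∀ᵐ x ∂(graphMeasure f),
    Tendsto
      (fun ε : ℝ => ∫ y in {y | ε < ‖x - y‖}, (dlKernel f x y : ℂ) * φ y ∂(graphMeasure f))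
      (𝓝[>] 0) (𝓝 (D φ x))

/-- The essential spectrum: the `z` for which `T - z I` is not Fredholm. -/
def essSpectrum {E : Type*} [NormedAddCommGroup E] [NormedSpace ℂ E] (T : E →L[ℂ] E) : Set ℂ :=
  {z | ¬ (T - z • ContinuousLinearMap.id ℂ E).IsFredholm}

/-- The essential spectral radius. -/
def essSpectralRadius {E : Type*} [NormedAddCommGroup E] [NormedSpace ℂ E] (T : E →L[ℂ] E) :
    ENNReal :=
  ⨆ z ∈ essSpectrum T, (‖z‖₊ : ENNReal)

/-! ### The two branches of `f`, and analytic continuation to strips -/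

/-- `f₊(x) = f(x)`, used for `x > 0`. -/
def fPlus (f : ℝ → ℝ) : ℝ → ℝ := fun x => f x

/-- `f₋(x) = f(-x)`, used for `x > 0`. -/
def fMinus (f : ℝ → ℝ) : ℝ → ℝ := fun x => f (-x)

/-- `g(x) = α⁻ˣ φ(αˣ)`. -/
def logProfile (α : ℝ) (φ : ℝ → ℝ) : ℝ → ℝ := fun x => α ^ (-x) * φ (α ^ x)

/-- `Σ_c = {z : |Im z| < c}` for `c > 0`, and `Σ_0 = ℝ`. -/
def strip (c : ℝ) : Set ℂ := {z | z.im = 0 ∨ |z.im| < c}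

/-- `‖h‖_c`, the supremum of `|h|` over `Σ_c`. -/
def stripNorm (c : ℝ) (h : ℂ → ℂ) : ℝ := ⨆ z : strip c, ‖h z‖

/-- `‖Im h‖_c`, the supremum of `|Im h|` over `Σ_c`. -/
def stripImNorm (c : ℝ) (h : ℂ → ℂ) : ℝ := ⨆ z : strip c, |(h z).im|

/-- `G` is an analytic continuation of `g` from `ℝ` to `Σ_c` such that `G`, `G'` and `G''` are
bounded on `Σ_c`. -/
structure IsStripContinuation (c : ℝ) (g : ℝ → ℝ) (G : ℂ → ℂ) : Prop where
  differentiableOn : DifferentiableOn ℂ G (strip c)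
  eq_on_real : ∀ x : ℝ, G x = g x
  bounded : ∃ C, ∀ z ∈ strip c, ‖G z‖ ≤ C
  bounded_deriv : ∃ C, ∀ z ∈ strip c, ‖deriv G z‖ ≤ C
  bounded_deriv_deriv : ∃ C, ∀ z ∈ strip c, ‖deriv (deriv G) z‖ ≤ C

/-! ### Norm quantities -/

/-- `𝔉_d = ‖g‖_d + ‖g'‖_d / |log α|`. -/
def quantF (α d : ℝ) (g : ℂ → ℂ) : ℝ := stripNorm d g + stripNorm d (deriv g) / |Real.log α|

/-- `𝔊_d = ‖g'‖_d + ‖g''‖_d / |log α|`. -/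
def quantG (α d : ℝ) (g : ℂ → ℂ) : ℝ :=
  stripNorm d (deriv g) + stripNorm d (deriv (deriv g)) / |Real.log α|

/-- `ℑ_c = ‖Im g‖_c + ‖Im g'‖_c / |log α|`. -/
def quantI (α c : ℝ) (g : ℂ → ℂ) : ℝ :=
  stripImNorm c g + stripImNorm c (deriv g) / |Real.log α|

/-- `𝔎_{c,±} = α⁻¹ |log α| max(‖g_±‖_c, ‖g_∓‖_0)`, where `g = g_±` and `h = g_∓`. -/
def quantK (α c : ℝ) (g h : ℂ → ℂ) : ℝ :=
  α⁻¹ * |Real.log α| * max (stripNorm c g) (stripNorm 0 h)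

/-- The smallness conditions on `c`. -/
def AdmissibleWidth (α c : ℝ) (Gp Gm : ℂ → ℂ) : Prop :=
  c ≤ Real.arccos α / |Real.log α| ∧
  quantI α c Gp < 1 ∧ quantI α c Gm < 1 ∧
  stripImNorm c Gp + α * c * quantK α c Gp Gm < α ^ 2 ∧
  stripImNorm c Gm + α * c * quantK α c Gm Gp < α ^ 2

/-- `ℬ_n(α) = log(tanh((n-1)|log α|/4)) / (α^{1/2} log α)`, for `n ≥ 2`. -/
def calB (α : ℝ) (n : ℕ) : ℝ :=
  Real.log (Real.tanh (((n : ℝ) - 1) * |Real.log α| / 4)) / (α ^ (1 / 2 : ℝ) * Real.log α)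

/-- `ℬ*_n(α) = ∑_{j=2}^n α^{j/2}/(α - α^j) + ℬ_n(α)`. -/
def calBStar (α : ℝ) (n : ℕ) : ℝ :=
  ∑ j ∈ Finset.Icc 2 n, α ^ ((j : ℝ) / 2) / (α - α ^ j) + calB α n

/-- `𝒞_n(α) = 2 arctan(α^{n/2}) / (α² |log α|)`. -/
def calC (α : ℝ) (n : ℕ) : ℝ :=
  2 * Real.arctan (α ^ ((n : ℝ) / 2)) / (α ^ 2 * |Real.log α|)

/-- `𝒞*_n(α) = 1/(2α²) + 2α⁻² ∑_{j=1}^n (α^{j/2} + α^{-j/2})⁻¹ + 2𝒞_n(α)`. -/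
def calCStar (α : ℝ) (n : ℕ) : ℝ :=
  1 / (2 * α ^ 2)
    + 2 / α ^ 2 * ∑ j ∈ Finset.Icc 1 n, (α ^ ((j : ℝ) / 2) + α ^ (-((j : ℝ) / 2)))⁻¹
    + 2 * calC α n

/-- `ℜ(α) = (1 + α^{1/2} + α^{-1/2}) / (2α²)`. -/
def calR (α : ℝ) : ℝ := (1 + α ^ (1 / 2 : ℝ) + α ^ (-(1 / 2) : ℝ)) / (2 * α ^ 2)

/-! ### The constants `C₁(M)`, `C₃` and `C₄` -/

/-- One of the two entries of the maximum defining `C₁(M)`; `g = g_±` and `h = g_∓`. -/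
def constC1Entry (α : ℝ) (M : ℕ) (g h : ℂ → ℂ) : ℝ :=
  (1 + quantF α 0 g ^ 2) ^ (1 / 4 : ℝ) *
    (2 * |Real.log α| * quantF α 0 g * calB α M
      + (|Real.log α| * quantF α 0 h + quantK α 0 g h) * calC α M)

/-- `C₁(M)`. -/
def constC1 (α : ℝ) (M : ℕ) (Gp Gm : ℂ → ℂ) : ℝ :=
  1 / Real.pi * max (constC1Entry α M Gp Gm) (constC1Entry α M Gm Gp)

/-- One of the two entries of the maximum defining `C₃`; `g = g_±` and `h = g_∓`. -/
def constC3Entry (α : ℝ) (g h : ℂ → ℂ) : ℝ :=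
  (1 + quantF α 0 g ^ 2) ^ (1 / 4 : ℝ) *
    (quantG α 0 g * calR α
      + 4 * |Real.log α| * quantF α 0 g * calBStar α 10
      + (|Real.log α| * quantF α 0 h + quantK α 0 g h) * calCStar α 10)

/-- `C₃`. -/
def constC3 (α : ℝ) (Gp Gm : ℂ → ℂ) : ℝ :=
  1 / (2 * Real.pi) * max (constC3Entry α Gp Gm) (constC3Entry α Gm Gp)

/-- The upper bound used for `‖K̃^±_t‖_{c,0}`; `g = g_±`. -/
def boundKc0 (α c : ℝ) (g : ℂ → ℂ) : ℝ :=
  (1 + quantF α c g ^ 2) ^ (1 / 4 : ℝ) / (Real.pi * (1 - quantI α c g ^ 2)) *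
    (quantG α c g * ((1 + α ^ (1 / 2 : ℝ) + α ^ (-(1 / 2) : ℝ)) / (4 * α ^ 2))
      + |Real.log α| * (quantF α c g + quantF α 0 g) * calBStar α 10)

/-- The upper bound used for `‖K̃^±_t‖_{0,c}`; `g = g_±`. -/
def boundK0c (α c : ℝ) (g : ℂ → ℂ) : ℝ :=
  (1 + quantF α 0 g ^ 2) ^ (1 / 4 : ℝ) /
      (Real.pi * (1 - quantI α c g ^ 2) ^ (5 / 4 : ℝ)) *
    (quantG α c g * ((1 + α ^ (1 / 2 : ℝ) + α ^ (-(1 / 2) : ℝ)) / (4 * α ^ 2))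
      + 2 * |Real.log α| * quantF α c g * calBStar α 10)

/-- The upper bound used for `‖L̃^±_t‖_{c,0}`; `g = g_±` and `h = g_∓`. -/
def boundLc0 (α c : ℝ) (g h : ℂ → ℂ) : ℝ :=
  1 / (2 * Real.pi) *
    ((|Real.log α| * quantF α 0 h + quantK α c g h) /
      (1 - (stripImNorm c g + α * c * quantK α c g h) ^ 2 / α ^ 4)) *
    (1 + quantF α c g ^ 2) ^ (1 / 4 : ℝ) * calCStar α 10

/-- The upper bound used for `‖L̃^±_t‖_{0,c}`; `g = g_±` and `h = g_∓`. -/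
def boundL0c (α c : ℝ) (g h : ℂ → ℂ) : ℝ :=
  1 / (2 * Real.pi) *
    ((|Real.log α| * quantF α c h + quantK α c h g) /
      (1 - (stripImNorm c h + α * c * quantK α c h g) ^ 2 / α ^ 4)) *
    ((1 + quantF α 0 g ^ 2) / (1 - quantI α c h ^ 2)) ^ (1 / 4 : ℝ) * calCStar α 10

/-- `C₄`. -/
def constC4 (α c : ℝ) (Gp Gm : ℂ → ℂ) : ℝ :=
  2 * Real.exp (2 * Real.pi * c) *
    max
      (boundK0c α c Gm * boundKc0 α c Gm + boundL0c α c Gm Gp * boundLc0 α c Gp Gm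
        + boundK0c α c Gm * boundLc0 α c Gm Gp + boundL0c α c Gm Gp * boundKc0 α c Gp)
      (boundL0c α c Gp Gm * boundKc0 α c Gm + boundK0c α c Gp * boundLc0 α c Gp Gm
        + boundL0c α c Gp Gm * boundLc0 α c Gm Gp + boundK0c α c Gp * boundKc0 α c Gp)

/-! ### Kernels and Nyström matrices -/

/-- `p_j(x, y)` for the branch `φ`, extended by its limit to `y = x + j`. -/
def pSame (α : ℝ) (φ : ℝ → ℝ) (j : ℤ) (x y : ℝ) : ℝ :=
  if x + j = y then deriv (deriv φ) (α ^ y) / 2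
  else ((α ^ y - α ^ (x + j)) * deriv φ (α ^ y) + φ (α ^ (x + j)) - φ (α ^ y)) /
    (α ^ (x + j) - α ^ y) ^ 2

/-- `q_j(x, y)` for the branch `φ`, extended by its limit to `y = x + j`. -/
def qSame (α : ℝ) (φ : ℝ → ℝ) (j : ℤ) (x y : ℝ) : ℝ :=
  if x + j = y then deriv φ (α ^ y)
  else (φ (α ^ (x + j)) - φ (α ^ y)) / (α ^ (x + j) - α ^ y)

/-- `p̃^±_j(x, y)`, with `φ = f_±` and `ψ = f_∓`. -/
def pCross (α : ℝ) (φ ψ : ℝ → ℝ) (j : ℤ) (x y : ℝ) : ℝ :=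
  ((α ^ y + α ^ (x + j)) * deriv ψ (α ^ y) + φ (α ^ (x + j)) - ψ (α ^ y)) /
    (α ^ (x + j) + α ^ y) ^ 2

/-- `q̃^±_j(x, y)`, with `φ = f_±` and `ψ = f_∓`. -/
def qCross (α : ℝ) (φ ψ : ℝ → ℝ) (j : ℤ) (x y : ℝ) : ℝ :=
  (φ (α ^ (x + j)) - ψ (α ^ y)) / (α ^ (x + j) + α ^ y)

/-- `((1 + φ'(αˣ)²) / (1 + ψ'(α^y)²))^{1/4} α^{(x+y+j)/2} |log α|`. -/
def kernelWeight (α : ℝ) (φ ψ : ℝ → ℝ) (j : ℤ) (x y : ℝ) : ℝ :=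
  ((1 + deriv φ (α ^ x) ^ 2) / (1 + deriv ψ (α ^ y) ^ 2)) ^ (1 / 4 : ℝ) *
    α ^ ((x + y + j) / 2) * |Real.log α|

/-- The `j`-th term, without `e^{ijt}` and `1/(2π)`, of the kernel of `K̃^±_t`; `φ = f_±`. -/
def termSame (α : ℝ) (φ : ℝ → ℝ) (j : ℤ) (x y : ℝ) : ℝ :=
  pSame α φ j x y / (1 + qSame α φ j x y ^ 2) * kernelWeight α φ φ j x y

/-- The `j`-th term, without `e^{ijt}` and `1/(2π)`, of the kernel of `L̃^±_t`; `φ = f_±` and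
`ψ = f_∓`. -/
def termCross (α : ℝ) (φ ψ : ℝ → ℝ) (j : ℤ) (x y : ℝ) : ℝ :=
  pCross α φ ψ j x y / (1 + qCross α φ ψ j x y ^ 2) * kernelWeight α φ ψ j x y

/-- The midpoint `(q - 1/2)/N`, with `q = 1, …, N` indexed from zero. -/
def node (N : ℕ) (q : Fin N) : ℝ := ((q : ℝ) + 1 / 2) / N

/-- The Nyström matrix, with entries `N⁻¹ k(x_p, x_q)`, of the kernel
`k = (2π)⁻¹ ∑_{|j| ≤ M} e^{ijt} T_j`. -/
def nystromBlock (T : ℤ → ℝ → ℝ → ℝ) (t : ℝ) (M N : ℕ) : Matrix (Fin N) (Fin N) ℂ :=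
  Matrix.of fun p q => 1 / (N : ℂ) * (1 / (2 * (Real.pi : ℂ)) *
    ∑ j ∈ Finset.Icc (-(M : ℤ)) (M : ℤ),
      Complex.exp (Complex.I * (j : ℂ) * (t : ℂ)) * (T j (node N p) (node N q) : ℂ))

/-- The matrix with entries `(2πN)⁻¹ ∑_{|j| ≤ M} |j| |T_j(x_p, x_q)|`. -/
def derivBlock (T : ℤ → ℝ → ℝ → ℝ) (M N : ℕ) : Matrix (Fin N) (Fin N) ℝ :=
  Matrix.of fun p q => 1 / (2 * Real.pi * N) *
    ∑ j ∈ Finset.Icc (-(M : ℤ)) (M : ℤ), |(j : ℝ)| * |T j (node N p) (node N q)|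

/-- The `2N × 2N` matrix `A^M_{t,N}`. -/
def nystromMatrix (α : ℝ) (f : ℝ → ℝ) (t : ℝ) (M N : ℕ) :
    Matrix (Fin N ⊕ Fin N) (Fin N ⊕ Fin N) ℂ :=
  Matrix.fromBlocks
    (nystromBlock (termSame α (fMinus f)) t M N)
    (nystromBlock (termCross α (fMinus f) (fPlus f)) t M N)
    (nystromBlock (termCross α (fPlus f) (fMinus f)) t M N)
    (nystromBlock (termSame α (fPlus f)) t M N)

/-- The `2N × 2N` matrix `B^M_N`. -/
def derivMatrix (α : ℝ) (f : ℝ → ℝ) (M N : ℕ) :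
    Matrix (Fin N ⊕ Fin N) (Fin N ⊕ Fin N) ℝ :=
  Matrix.fromBlocks
    (derivBlock (termSame α (fMinus f)) M N)
    (derivBlock (termCross α (fMinus f) (fPlus f)) M N)
    (derivBlock (termCross α (fPlus f) (fMinus f)) M N)
    (derivBlock (termSame α (fPlus f)) M N)

/-! ### Adaptively chosen resolvent norms -/

open scoped Matrix.Norms.Operator in
/-- `‖A‖_∞`, the infinity norm of a square matrix (its largest absolute row sum). -/
def matInfNorm {ι 𝕜 : Type*} [Fintype ι] [DecidableEq ι] [RCLike 𝕜] (A : Matrix ι ι 𝕜) : ℝ := ‖A‖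

/-- `‖(A - μ I)⁻¹‖_∞⁻¹`. -/
def lowerNorm {ι : Type*} [Fintype ι] [DecidableEq ι] (A : Matrix ι ι ℂ) (μ : ℂ) : ℝ :=
  (matInfNorm (A - μ • (1 : Matrix ι ι ℂ))⁻¹)⁻¹

/-- The points `μ_ℓ`, indexed from zero: `μ_0 = r` and
`μ_{ℓ+1} = μ_ℓ exp(i ν_ℓ / (2 r))` with `ν_ℓ = ‖(A - μ_ℓ I)⁻¹‖_∞⁻¹`. -/
def muSeq {ι : Type*} [Fintype ι] [DecidableEq ι] (A : Matrix ι ι ℂ) (r : ℝ) : ℕ → ℂ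
  | 0 => (r : ℂ)
  | l + 1 => muSeq A r l *
      Complex.exp (Complex.I * ((lowerNorm A (muSeq A r l) / (2 * r) : ℝ) : ℂ))

/-- `ν_ℓ = ‖(A - μ_ℓ I)⁻¹‖_∞⁻¹`, indexed from zero. -/
def nuSeq {ι : Type*} [Fintype ι] [DecidableEq ι] (A : Matrix ι ι ℂ) (r : ℝ) (l : ℕ) : ℝ :=
  lowerNorm A (muSeq A r l)

/-- The smallest `n` for which the sum of the first `n` of the `ν_ℓ` is at least `4πr`. -/
def numSteps {ι : Type*} [Fintype ι] [DecidableEq ι] (A : Matrix ι ι ℂ) (r : ℝ) : ℕ :=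
  sInf {n : ℕ | 4 * Real.pi * r ≤ ∑ l ∈ Finset.range n, nuSeq A r l}

/-- `t_k = (k - 1/2)π/m`, with `k = 1, …, m` indexed from zero. -/
def sampleT (m : ℕ) (k : Fin m) : ℝ := ((k : ℝ) + 1 / 2) * Real.pi / m

/-- `R_{m,M,N}`: the minimum of `ν_{k,ℓ}/4 + ν_{k,ℓ+1}/2` over the `m` sample points and the
first `n_k` indices `ℓ` for each of them. -/
def resolventMin (α : ℝ) (f : ℝ → ℝ) (r : ℝ) (m M N : ℕ) : ℝ :=
  ⨅ k : Fin m, ⨅ l : Fin (numSteps (nystromMatrix α f (sampleT m k) M N) r),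
    (nuSeq (nystromMatrix α f (sampleT m k) M N) r l / 4
      + nuSeq (nystromMatrix α f (sampleT m k) M N) r (l + 1) / 2)

/-- `R_{m,M,N} - C₁(M) - (π/(2m)) ‖B^M_N‖_∞`. -/
def resolventGap (α : ℝ) (f : ℝ → ℝ) (Gp Gm : ℂ → ℂ) (r : ℝ) (m M N : ℕ) : ℝ :=
  resolventMin α f r m M N - constC1 α M Gp Gm
    - Real.pi / (2 * m) * matInfNorm (derivMatrix α f M N)

/-- `ℒ_c(f, N) = C₄ / (e^{2πNc} - 1)`. -/
def lhsL (α c : ℝ) (Gp Gm : ℂ → ℂ) (N : ℕ) : ℝ :=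
  constC4 α c Gp Gm / (Real.exp (2 * Real.pi * N * c) - 1)

/-- `ℛ_c(f, m, M, N) = r² (1 + C₃ (R_{m,M,N} - C₁(M) - (π/(2m)) ‖B^M_N‖_∞)⁻¹)⁻¹`, to be used
only where the quantity in the inner brackets is positive. -/
def rhsR (α : ℝ) (f : ℝ → ℝ) (Gp Gm : ℂ → ℂ) (r : ℝ) (m M N : ℕ) : ℝ :=
  r ^ 2 * (1 + constC3 α Gp Gm * (resolventGap α f Gp Gm r m M N)⁻¹)⁻¹

end DilationGraph

end

open DilationGraph

/-! In the logarithmic coordinate s = ±αˣ the dilation by α is the translation x ↦ x + 1. It cuts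
the graph into tiles indexed by ℤ, each a copy of the fibre {−,+} × (0,1], and L²(Γ) becomes ℓ²(ℤ;
H) with H = L² of the fibre (`graphTiling`, `Tiling.decomposition`). The double-layer kernel is
homogeneous of degree −1, so after conjugation with the square root of the density the blocks of D_Γ
depend only on the difference of the tile indices and decay like α^{|j|/2}. Hence D_Γ is a block
Toeplitz operator with symbol K_t = Σ e^{ijt} K_j, an integral operator on H with the bounded kernel
`kerF` (`BranchPair.exists_doubleLayerOperator`). Absolute convergence makes the principal value an
ordinary integral.

An operator commuting with the shift of tiles is Fredholm only if it is invertible, because the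
shift leaves no nonzero finite-dimensional subspace invariant (`eq_bot_of_shift_invariant`); so the
essential spectrum is the spectrum. The condition ρ(D) < ρ₀ is equivalent to lower bounds for D − z,
|z| ≥ ρ₀. These bounds pass between D and the symbols K_t: Parseval gives one direction
(`bounded_below_of_symbol`), damped plane waves the other (`symbol_bounded_below`).

The fibre operators are compared with matrices by Nyström's method. The logarithmic profile of each
branch is periodic and analytic in a strip; the conditions on c keep 1 + q² and r + s away from zero
there, so the kernel of K_t is analytic in either variable while the other stays real. It is
quasi-periodic with opposite phases in its two variables, so the integrand z ↦ k(x,z)k(z,y) of the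
iterated kernel is periodic and analytic, and the midpoint rule errs by O(e^{−2πNc})
(`midpoint_error`, `quadrature_error`). Thus K_t² − K_{t,N}K_t is small, where K_{t,N} replaces the
integral by the midpoint sum, and this suffices to transfer resolvent bounds from the matrix to the
operator (`norm_le_of_nystrom`) and back (`nystrom_bounded_below`).

A lower bound for the untruncated matrix at all t and all |z| ≥ ρ₀ follows from finitely many
computed numbers. Truncation to |j| ≤ M costs C₁(M), moving t to the nearest sample costs π‖B‖/(2m),
negative t are complex conjugates of positive ones, discs about the points μ_ℓ cover the circle |z|
= ρ₀ (`bounded_below_of_covering`), and the maximum principle handles the exterior. For the converse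
all three losses tend to zero: C₁(M) through the tails, ‖B‖/m because ‖B‖ is bounded uniformly in M
and N, and ℒ_c exponentially in N. -/

noncomputable section

namespace DilationGraph

/-! ### Hilbert spaces decomposed into countably many copies of a fibre -/

/-- An identification of `E` with `ℓ²(ℤ; H)`, given by the coordinate maps `π j` and the
embeddings `ι j`. -/
structure BlockDecomposition (E H : Type*) [NormedAddCommGroup E] [InnerProductSpace ℂ E]
    [NormedAddCommGroup H] [InnerProductSpace ℂ H] where
  π : ℤ → E →L[ℂ] H
  ι : ℤ → H →L[ℂ] E
  π_ι_self : ∀ j u, π j (ι j u) = u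
  π_ι_of_ne : ∀ j k, k ≠ j → ∀ u, π k (ι j u) = 0
  hasSum_norm_sq : ∀ φ, HasSum (fun j => ‖π j φ‖ ^ 2) (‖φ‖ ^ 2)

namespace BlockDecomposition

variable {E H : Type*} [NormedAddCommGroup E] [InnerProductSpace ℂ E]
  [NormedAddCommGroup H] [InnerProductSpace ℂ H] (B : BlockDecomposition E H)

include B in
theorem ext_coord {φ ψ : E} (h : ∀ j, B.π j φ = B.π j ψ) : φ = ψ := by
  have h1 := B.hasSum_norm_sq (φ - ψ)
  have h2 : (fun j => ‖B.π j (φ - ψ)‖ ^ 2) = fun _ => 0 := by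
    funext j; simp [h j]
  rw [h2] at h1
  have := h1.unique hasSum_zero
  exact sub_eq_zero.mp (by simpa using this)

theorem norm_ι (j : ℤ) (u : H) : ‖B.ι j u‖ = ‖u‖ := by
  have h1 := B.hasSum_norm_sq (B.ι j u)
  have h2 := hasSum_single (f := fun k => ‖B.π k (B.ι j u)‖ ^ 2) j
    (fun k hk => by simp [B.π_ι_of_ne j k hk])
  have := h1.unique h2
  rw [B.π_ι_self] at this
  exact (sq_eq_sq₀ (norm_nonneg _) (norm_nonneg _)).mp this

/-- The coordinates of the difference between a partial sum and φ vanish on the finite set and are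
those of −φ elsewhere. Its squared norm is therefore a tail of the convergent series
`hasSum_norm_sq`. -/
theorem hasSum_ι_π (φ : E) : HasSum (fun j => B.ι j (B.π j φ)) φ := by
  have hcoord : ∀ (s : Finset ℤ) k, B.π k (∑ j ∈ s, B.ι j (B.π j φ) - φ)
      = if k ∈ s then 0 else - B.π k φ := by
    intro s k
    rw [map_sub, map_sum]
    by_cases hk : k ∈ s
    · rw [Finset.sum_eq_single k (fun j _ hj => B.π_ι_of_ne j k hj.symm _) (fun h => absurd hk h),
        B.π_ι_self]
      simp [hk]
    · rw [Finset.sum_eq_zero (fun j hj => B.π_ι_of_ne j k (by rintro rfl; exact hk hj) _)]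
      simp [hk]
  have hn : ∀ s : Finset ℤ, ‖∑ j ∈ s, B.ι j (B.π j φ) - φ‖ ^ 2
      = ‖φ‖ ^ 2 - ∑ j ∈ s, ‖B.π j φ‖ ^ 2 := by
    intro s
    have h1 := B.hasSum_norm_sq (∑ j ∈ s, B.ι j (B.π j φ) - φ)
    have h2 : HasSum (fun j => ‖B.π j φ‖ ^ 2 - if j ∈ s then ‖B.π j φ‖ ^ 2 else 0)
        (‖φ‖ ^ 2 - ∑ j ∈ s, ‖B.π j φ‖ ^ 2) := by
      refine (B.hasSum_norm_sq φ).sub ?_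
      have := hasSum_sum_of_ne_finset_zero (L := .unconditional ℤ)
        (f := fun j => if j ∈ s then ‖B.π j φ‖ ^ 2 else 0)
        (s := s) (fun j hj => by simp [hj])
      rwa [Finset.sum_congr rfl (fun j hj => if_pos hj)] at this
    refine h1.unique ?_
    convert h2 using 2 with j
    rw [hcoord]
    split_ifs <;> simp
  have h0 : Tendsto (fun s : Finset ℤ => ‖φ‖ ^ 2 - ∑ j ∈ s, ‖B.π j φ‖ ^ 2) atTop (𝓝 0) := by
    have := (tendsto_const_nhds (x := ‖φ‖ ^ 2)).sub (B.hasSum_norm_sq φ)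
    simpa using this
  rw [HasSum, tendsto_iff_norm_sub_tendsto_zero]
  have h1 : Tendsto (fun s : Finset ℤ => √(‖∑ j ∈ s, B.ι j (B.π j φ) - φ‖ ^ 2)) atTop (𝓝 0) := by
    simp_rw [hn]
    simpa using h0.sqrt
  simpa using h1

theorem norm_sq_add (i j : ℤ) (hij : i ≠ j) (u v : H) :
    ‖B.ι i u + B.ι j v‖ ^ 2 = ‖u‖ ^ 2 + ‖v‖ ^ 2 := by
  have h1 := B.hasSum_norm_sq (B.ι i u + B.ι j v)
  have h2 : HasSum (fun k => ‖B.π k (B.ι i u + B.ι j v)‖ ^ 2)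
      (∑ k ∈ {i, j}, ‖B.π k (B.ι i u + B.ι j v)‖ ^ 2) := by
    refine hasSum_sum_of_ne_finset_zero (fun k hk => ?_)
    simp only [Finset.mem_insert, Finset.mem_singleton, not_or] at hk
    simp [B.π_ι_of_ne _ _ hk.1, B.π_ι_of_ne _ _ hk.2]
  rw [h1.unique h2, Finset.sum_pair hij]
  simp [B.π_ι_self, B.π_ι_of_ne _ _ hij, B.π_ι_of_ne _ _ hij.symm]

/-- Pythagoras kills the real part of the inner product; replacing v by iv kills the imaginary part.
-/
theorem inner_ι_ι (i j : ℤ) (hij : i ≠ j) (u v : H) : inner ℂ (B.ι i u) (B.ι j v) = 0 := by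
  have key : ∀ v : H, (inner ℂ (B.ι i u) (B.ι j v)).re = 0 := by
    intro v
    have h := norm_add_sq (𝕜 := ℂ) (B.ι i u) (B.ι j v)
    rw [B.norm_sq_add i j hij, B.norm_ι, B.norm_ι] at h
    simp only [RCLike.re_to_complex] at h
    linarith
  apply Complex.ext
  · exact key v
  · have := key (Complex.I • v)
    rw [map_smul, inner_smul_right] at this
    simpa using this

/-- The embeddings as linear isometries. -/
def ιₗᵢ (j : ℤ) : H →ₗᵢ[ℂ] E := ⟨(B.ι j).toLinearMap, B.norm_ι j⟩

variable [CompleteSpace E] [CompleteSpace H]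

/-- The offset m gives a different labelling of the same orthogonal sum. Comparing the labellings
with m = 0 and m = 1 produces the shift as a unitary map. -/
theorem isHilbertSum (m : ℤ) : IsHilbertSum ℂ (fun _ : ℤ => H) (fun j => B.ιₗᵢ (j + m)) := by
  refine IsHilbertSum.mk (fun i j hij u v => B.inner_ι_ι _ _ (by omega) u v) ?_
  intro φ _
  refine mem_closure_of_tendsto (B.hasSum_ι_π φ) (Eventually.of_forall fun s => ?_)
  refine Submodule.sum_mem _ fun j _ => ?_
  refine Submodule.mem_iSup_of_mem (j - m) ⟨B.π j φ, ?_⟩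
  simp [ιₗᵢ]

/-- The shift `ι j u ↦ ι (j + 1) u`. -/
def shift : E ≃ₗᵢ[ℂ] E :=
  (B.isHilbertSum 0).linearIsometryEquiv.trans (B.isHilbertSum 1).linearIsometryEquiv.symm

theorem shift_ι (j : ℤ) (u : H) : B.shift (B.ι j u) = B.ι (j + 1) u := by
  have h0 := (B.isHilbertSum 0).linearIsometryEquiv_symm_apply_single (i := j) u
  have h1 := (B.isHilbertSum 1).linearIsometryEquiv_symm_apply_single (i := j) u
  have h2 : B.ι j u = (B.isHilbertSum 0).linearIsometryEquiv.symm (lp.single 2 j u) := by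
    rw [h0]; simp [ιₗᵢ]
  rw [shift, h2, LinearIsometryEquiv.trans_apply, LinearIsometryEquiv.apply_symm_apply, h1]
  simp [ιₗᵢ]

theorem π_shift (k : ℤ) (φ : E) : B.π (k + 1) (B.shift φ) = B.π k φ := by
  have h1 := (B.hasSum_ι_π φ).mapL ((B.π (k + 1)).comp B.shift.toContinuousLinearEquiv.toContinuousLinearMap)
  have h2 := (B.hasSum_ι_π φ).mapL (B.π k)
  have : (fun j => ((B.π (k + 1)).comp B.shift.toContinuousLinearEquiv.toContinuousLinearMap)
      (B.ι j (B.π j φ))) = fun j => B.π k (B.ι j (B.π j φ)) := by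
    funext j
    change B.π (k + 1) (B.shift _) = _
    rw [B.shift_ι]
    by_cases hj : k = j
    · subst hj; rw [B.π_ι_self, B.π_ι_self]
    · rw [B.π_ι_of_ne _ _ (by omega), B.π_ι_of_ne _ _ hj]
  rw [this] at h1
  exact h1.unique h2

/-- A nonzero finite-dimensional invariant subspace would contain an eigenvector of the shift. The
shift is isometric, so the eigenvalue is unimodular and all coordinates of the eigenvector have the
same norm; square summability then forces them to vanish. -/
theorem eq_bot_of_shift_invariant (S : Submodule ℂ E) [FiniteDimensional ℂ S]
    (hS : ∀ v ∈ S, B.shift v ∈ S) : S = ⊥ := by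
  by_contra hne
  have : Nontrivial S := Submodule.nontrivial_iff_ne_bot.mpr hne
  let V : Module.End ℂ S := B.shift.toLinearEquiv.toLinearMap.restrict hS
  obtain ⟨μ, hμ⟩ := Module.End.exists_eigenvalue V
  obtain ⟨v, hv⟩ := hμ.exists_hasEigenvector
  have hv1 : B.shift (v : E) = μ • (v : E) := by
    have := congrArg Subtype.val hv.apply_eq_smul
    simpa [V] using this
  have hv0 : (v : E) ≠ 0 := by simpa using hv.2
  have hμ1 : ‖μ‖ = 1 := by
    have := congrArg norm hv1
    rw [B.shift.norm_map, norm_smul] at this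
    have hp : 0 < ‖(v : E)‖ := norm_pos_iff.mpr hv0
    nlinarith
  have hstep : ∀ k, ‖B.π (k + 1) (v : E)‖ = ‖B.π k (v : E)‖ := by
    intro k
    rw [← B.π_shift k, hv1, map_smul, norm_smul, hμ1, one_mul]
  have hconst : ∀ k : ℤ, ‖B.π k (v : E)‖ = ‖B.π 0 (v : E)‖ := by
    intro k
    induction k using Int.induction_on with
    | zero => rfl
    | succ n ih => rw [hstep, ih]
    | pred n ih => rw [← ih, ← hstep (-(n : ℤ) - 1)]; congr 3; ring
  have hs := (B.hasSum_norm_sq (v : E)).summable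
  simp_rw [hconst] at hs
  have h0 : ‖B.π 0 (v : E)‖ ^ 2 = 0 := by
    have := (summable_const_iff (β := ℤ) _).mp hs
    exact this
  apply hv0
  apply B.ext_coord
  intro j
  have : ‖B.π j (v : E)‖ = 0 := by rw [hconst]; exact pow_eq_zero_iff (two_ne_zero) |>.mp h0
  simpa using this

/-- A Fredholm operator commuting with the shift is invertible. -/
theorem isUnit_of_isFredholm (T : E →L[ℂ] E) (hT : ∀ φ, T (B.shift φ) = B.shift (T φ))
    (hF : T.IsFredholm) : IsUnit T := by
  have hT' : ∀ φ, T (B.shift.symm φ) = B.shift.symm (T φ) := by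
    intro φ
    apply B.shift.injective
    rw [← hT, LinearIsometryEquiv.apply_symm_apply, LinearIsometryEquiv.apply_symm_apply]
  rw [ContinuousLinearMap.isUnit_iff_bijective]
  constructor
  · have := hF.finite_ker
    have hk := B.eq_bot_of_shift_invariant T.ker (fun v hv => by
      rw [LinearMap.mem_ker] at hv ⊢
      change T (B.shift v) = 0
      rw [hT]
      change T v = 0 at hv
      simp [hv])
    exact LinearMap.ker_eq_bot.mp hk
  -- The range is closed with finite codimension, so its orthogonal complement is
  -- finite-dimensional. Since the shift is unitary and the range is invariant under its inverse,
  -- the complement is invariant under the shift.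
  · have hcl := hF.isClosed_range
    have : CompleteSpace T.range := hcl.completeSpace_coe
    have hfin : FiniteDimensional ℂ (E ⧸ T.range) := hF.finite_coker
    have hfin2 : FiniteDimensional ℂ (T.range)ᗮ := by
      refine LinearEquiv.finiteDimensional
        (Submodule.quotientEquivOfIsCompl T.range (T.range)ᗮ ?_)
      exact Submodule.isCompl_orthogonal T.range
    have hr := B.eq_bot_of_shift_invariant (T.range)ᗮ (fun v hv => by
      rw [Submodule.mem_orthogonal] at hv ⊢
      rintro _ ⟨φ, rfl⟩
      have h1 := hv (T (B.shift.symm φ)) ⟨_, rfl⟩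
      rw [hT'] at h1
      rw [← B.shift.inner_map_map] at h1
      simpa using h1)
    have := (Submodule.orthogonal_eq_bot_iff).mp hr
    exact LinearMap.range_eq_top.mp this

omit [CompleteSpace E] [CompleteSpace H] in
theorem isFredholm_of_isUnit (T : E →L[ℂ] E) (hT : IsUnit T) : T.IsFredholm := by
  obtain ⟨U, rfl⟩ := hT
  let e := ContinuousLinearEquiv.unitsEquiv ℂ E U
  exact ContinuousLinearMap.IsFredholm.of_isQuasiInverse (v := (e.symm : E →L[ℂ] E))
    (e.toLinearEquiv.isQuasiInverse)

/-- For an operator commuting with the shift, the essential spectrum is the whole spectrum. -/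
theorem essSpectralRadius_eq (D : E →L[ℂ] E) (hD : ∀ φ, D (B.shift φ) = B.shift (D φ)) :
    essSpectralRadius D = spectralRadius ℂ D := by
  have : essSpectrum D = spectrum ℂ D := by
    ext z
    rw [spectrum.mem_iff]
    refine not_congr ?_
    have e : algebraMap ℂ (E →L[ℂ] E) z - D = -(D - z • ContinuousLinearMap.id ℂ E) := by
      rw [neg_sub]; rfl
    rw [e, IsUnit.neg_iff]
    constructor
    · exact B.isUnit_of_isFredholm _ (fun φ => by simp [hD])
    · exact isFredholm_of_isUnit _
  rw [essSpectralRadius, this, spectralRadius]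

/-- The block matrix of an operator determines whether it commutes with the shift. -/
theorem comm_shift (D : E →L[ℂ] E) (K : ℤ → H →L[ℂ] H)
    (hD : ∀ j k u, B.π k (D (B.ι j u)) = K (k - j) u) (φ : E) :
    D (B.shift φ) = B.shift (D φ) := by
  have h1 := (B.hasSum_ι_π φ).mapL (D.comp B.shift.toContinuousLinearEquiv.toContinuousLinearMap)
  have h2 := (B.hasSum_ι_π φ).mapL (B.shift.toContinuousLinearEquiv.toContinuousLinearMap.comp D)
  refine h1.unique ?_
  have : (fun j => (D.comp B.shift.toContinuousLinearEquiv.toContinuousLinearMap)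
      (B.ι j (B.π j φ))) = fun j =>
      (B.shift.toContinuousLinearEquiv.toContinuousLinearMap.comp D) (B.ι j (B.π j φ)) := by
    funext j
    change D (B.shift _) = B.shift (D _)
    apply B.ext_coord
    intro k
    obtain ⟨k, rfl⟩ : ∃ k', k = k' + 1 := ⟨k - 1, by ring⟩
    rw [B.π_shift, B.shift_ι, hD, hD]
    congr 2; ring
  rw [this]
  exact h2

end BlockDecomposition

/-- If `D - z` is bounded below for all `|z| ≥ r` then the spectral radius is less than `r`. -/
theorem spectralRadius_lt_of_bounded_below {E : Type*} [NormedAddCommGroup E] [NormedSpace ℂ E]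
    [CompleteSpace E] (D : E →L[ℂ] E) (r : ℝ) (hr : 0 < r)
    (h : ∀ z : ℂ, r ≤ ‖z‖ → ∃ δ > 0, ∀ φ, δ * ‖φ‖ ≤ ‖D φ - z • φ‖) :
    spectralRadius ℂ D < ENNReal.ofReal r := by
  rcases subsingleton_or_nontrivial E with hE | hE
  · rw [spectralRadius]
    have : spectrum ℂ D = ∅ := by
      have : Subsingleton (E →L[ℂ] E) := ⟨fun a b => by ext x; exact Subsingleton.elim _ _⟩
      exact spectrum.of_subsingleton D
    rw [this]; simpa using hr
  by_contra hcon
  push Not at hcon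
  -- A spectral point of largest modulus is a limit of resolvent points w lying slightly further
  -- out. The lower bound at z bounds the inverse at w by 2/δ while |w − z| < δ/2, so a Neumann
  -- series makes z a resolvent point, a contradiction.
  obtain ⟨z, hz, hzr⟩ := spectrum.exists_nnnorm_eq_spectralRadius D
  have hzr2 : r ≤ ‖z‖ := by
    rw [← hzr] at hcon
    have := ENNReal.toReal_mono (by simp) hcon
    rw [ENNReal.toReal_ofReal hr.le] at this
    simpa using this
  obtain ⟨δ, hδ, hb⟩ := h z hzr2
  -- a nearby point of the resolvent set
  obtain ⟨w, hw1, hw2⟩ : ∃ w : ℂ, ‖z‖ < ‖w‖ ∧ ‖w - z‖ < δ / 2 := by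
    have hz0 : 0 < ‖z‖ := hr.trans_le hzr2
    set e := δ / (4 * ‖z‖) with he
    have hepos : 0 < e := by positivity
    refine ⟨((1 + e : ℝ) : ℂ) * z, ?_, ?_⟩
    · rw [norm_mul, Complex.norm_real, Real.norm_of_nonneg (by positivity)]
      nlinarith
    · have : ((1 + e : ℝ) : ℂ) * z - z = ((e : ℝ) : ℂ) * z := by push_cast; ring
      rw [this, norm_mul, Complex.norm_real, Real.norm_of_nonneg hepos.le, he]
      rw [div_mul_eq_mul_div, mul_div_mul_right _ _ hz0.ne']
      linarith
  have hwres : w ∈ resolventSet ℂ D := by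
    apply spectrum.mem_resolventSet_of_spectralRadius_lt
    rw [← hzr]
    exact_mod_cast hw1
  obtain ⟨U, hU⟩ : IsUnit (algebraMap ℂ (E →L[ℂ] E) w - D) := hwres
  have hUb : ∀ φ, δ / 2 * ‖φ‖ ≤ ‖(U : E →L[ℂ] E) φ‖ := by
    intro φ
    have e1 : (U : E →L[ℂ] E) φ = (w - z) • φ - (D φ - z • φ) := by
      rw [hU]
      simp [Algebra.algebraMap_eq_smul_one, sub_smul]
    have h1 := hb φ
    have h2 : ‖D φ - z • φ‖ ≤ ‖(w - z) • φ‖ + ‖(U : E →L[ℂ] E) φ‖ := by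
      have : D φ - z • φ = (w - z) • φ - (U : E →L[ℂ] E) φ := by rw [e1]; abel
      rw [this]; exact norm_sub_le _ _
    rw [norm_smul] at h2
    nlinarith [norm_nonneg φ]
  have hUinv : ‖(↑U⁻¹ : E →L[ℂ] E)‖ ≤ (δ / 2)⁻¹ := by
    refine ContinuousLinearMap.opNorm_le_bound _ (by positivity) fun ψ => ?_
    have h1 := hUb ((↑U⁻¹ : E →L[ℂ] E) ψ)
    have h2 : (U : E →L[ℂ] E) ((↑U⁻¹ : E →L[ℂ] E) ψ) = ψ := by
      exact congrArg (fun T : E →L[ℂ] E => T ψ) U.mul_inv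
    rw [h2] at h1
    rw [inv_mul_eq_div, le_div_iff₀ (by positivity)]
    linarith
  have hunit : IsUnit (algebraMap ℂ (E →L[ℂ] E) z - D) := by
    have e : algebraMap ℂ (E →L[ℂ] E) z - D
        = ↑(U.add (algebraMap ℂ (E →L[ℂ] E) (z - w)) (by
          have hpos : 0 < ‖(↑U⁻¹ : E →L[ℂ] E)‖ := Units.norm_pos U⁻¹
          rw [norm_algebraMap', norm_sub_rev]
          refine hw2.trans_le ?_
          rw [le_inv_comm₀ (by positivity) hpos]
          exact hUinv)) := by
      rw [Units.val_add, hU, map_sub]; abel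
    rw [e]
    exact Units.isUnit _
  exact (spectrum.mem_iff.mp hz) hunit

/-- If the spectral radius is less than `r` then `D - z` is bounded below uniformly in
`|z| ≥ r`. -/
theorem bounded_below_of_spectralRadius_lt {E : Type*} [NormedAddCommGroup E] [NormedSpace ℂ E]
    [CompleteSpace E] (D : E →L[ℂ] E) (r : ℝ)
    (h : spectralRadius ℂ D < ENNReal.ofReal r) :
    ∃ δ > 0, ∀ z : ℂ, r ≤ ‖z‖ → ∀ φ, δ * ‖φ‖ ≤ ‖D φ - z • φ‖ := by
  have hres : ∀ z : ℂ, r ≤ ‖z‖ → z ∈ resolventSet ℂ D := by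
    intro z hz
    apply spectrum.mem_resolventSet_of_spectralRadius_lt
    refine h.trans_le ?_
    rw [← enorm_eq_nnnorm, ← ofReal_norm]
    exact ENNReal.ofReal_le_ofReal hz
  -- the resolvent is bounded on `r ≤ |z|`
  obtain ⟨C, hC⟩ : ∃ C, ∀ z : ℂ, r ≤ ‖z‖ → ‖z‖ ≤ ‖D‖ + 1 → ‖resolvent D z‖ ≤ C := by
    have hcomp : IsCompact {z : ℂ | r ≤ ‖z‖ ∧ ‖z‖ ≤ ‖D‖ + 1} := by
      refine (isCompact_closedBall (0 : ℂ) (‖D‖ + 1)).of_isClosed_subset ?_ ?_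
      · exact (isClosed_le continuous_const continuous_norm).inter
          (isClosed_le continuous_norm continuous_const)
      · intro z hz; simpa using hz.2
    have hcont : ContinuousOn (resolvent D) {z : ℂ | r ≤ ‖z‖ ∧ ‖z‖ ≤ ‖D‖ + 1} := by
      intro z hz
      exact (spectrum.hasDerivAt_resolvent_const_left (hres z hz.1)).continuousAt.continuousWithinAt
    obtain ⟨C, hC⟩ := hcomp.exists_bound_of_continuousOn hcont
    exact ⟨C, fun z h1 h2 => hC z ⟨h1, h2⟩⟩
  -- Compactness covers only |z| ≤ ‖D‖ + 1; further out the triangle inequality gives the constant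
  -- 1.
  refine ⟨min 1 (1 / (|C| + 1)), by positivity, fun z hz φ => ?_⟩
  rcases le_total ‖z‖ (‖D‖ + 1) with hz2 | hz2
  · have h1 : φ = resolvent D z (z • φ - D φ) := by
      have h2 : resolvent D z * (algebraMap ℂ (E →L[ℂ] E) z - D) = 1 :=
        Ring.inverse_mul_cancel _ (hres z hz)
      have := congrArg (fun T : E →L[ℂ] E => T φ) h2
      change resolvent D z ((algebraMap ℂ (E →L[ℂ] E) z - D) φ) = φ at this
      conv_lhs => rw [← this]
      simp [Algebra.algebraMap_eq_smul_one]
    have h3 : ‖φ‖ ≤ (|C| + 1) * ‖D φ - z • φ‖ := by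
      conv_lhs => rw [h1]
      refine (ContinuousLinearMap.le_opNorm _ _).trans ?_
      rw [norm_sub_rev]
      gcongr
      exact (hC z hz hz2).trans ((le_abs_self C).trans (by linarith))
    calc min 1 (1 / (|C| + 1)) * ‖φ‖ ≤ 1 / (|C| + 1) * ((|C| + 1) * ‖D φ - z • φ‖) := by
          gcongr; exact min_le_right _ _
      _ = ‖D φ - z • φ‖ := by field_simp
  · calc min 1 (1 / (|C| + 1)) * ‖φ‖ ≤ 1 * ‖φ‖ := by gcongr; exact min_le_left _ _
      _ ≤ ‖z • φ‖ - ‖D φ‖ := by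
          rw [norm_smul]
          nlinarith [D.le_opNorm φ, norm_nonneg φ]
      _ ≤ ‖D φ - z • φ‖ := by rw [norm_sub_rev]; exact norm_sub_norm_le _ _

/-! ### Parseval's identity and operators with Toeplitz block matrices -/

section Parseval
variable {H : Type*} [NormedAddCommGroup H] [InnerProductSpace ℂ H]

theorem norm_expI_smul (j : ℤ) (t : ℝ) (u : H) :
    ‖Complex.exp (Complex.I * (j : ℂ) * (t : ℂ)) • u‖ = ‖u‖ := by
  have : Complex.I * (j : ℂ) * (t : ℂ) = ((j * t : ℝ) : ℂ) * Complex.I := by push_cast; ring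
  rw [norm_smul, this, Complex.norm_exp_ofReal_mul_I, one_mul]

theorem norm_expI (j : ℤ) (t : ℝ) : ‖Complex.exp (Complex.I * (j : ℂ) * (t : ℂ))‖ = 1 := by
  simpa using norm_expI_smul j t (1 : ℂ)

theorem integral_expI (m : ℤ) :
    ∫ t in (-Real.pi)..Real.pi, Complex.exp (Complex.I * (m : ℂ) * (t : ℂ))
      = if m = 0 then ((2 * Real.pi : ℝ) : ℂ) else 0 := by
  split_ifs with h
  · subst h
    simp
    ring
  · rw [integral_exp_mul_complex (by simpa using h)]
    have : Complex.exp (Complex.I * (m : ℂ) * (Real.pi : ℂ))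
        = Complex.exp (Complex.I * (m : ℂ) * ((-Real.pi : ℝ) : ℂ)) := by
      rw [Complex.exp_eq_exp_iff_exists_int]
      exact ⟨m, by push_cast; ring⟩
    rw [this, sub_self, zero_div]

theorem integral_norm_sq_finset_sum (s : Finset ℤ) (a : ℤ → H) :
    ∫ t in (-Real.pi)..Real.pi, ‖∑ j ∈ s, Complex.exp (Complex.I * (j : ℂ) * (t : ℂ)) • a j‖ ^ 2
      = 2 * Real.pi * ∑ j ∈ s, ‖a j‖ ^ 2 := by
  have h1 : ∀ t : ℝ, ((‖∑ j ∈ s, Complex.exp (Complex.I * (j : ℂ) * (t : ℂ)) • a j‖ ^ 2 : ℝ) : ℂ)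
      = ∑ j ∈ s, ∑ k ∈ s, Complex.exp (Complex.I * ((k - j : ℤ) : ℂ) * (t : ℂ))
          * inner ℂ (a j) (a k) := by
    intro t
    rw [Complex.ofReal_pow]
    have hh : ∀ x : H, ((‖x‖ : ℝ) : ℂ) ^ 2 = inner ℂ x x :=
      fun x => (inner_self_eq_norm_sq_to_K x).symm
    rw [hh, sum_inner]
    refine Finset.sum_congr rfl fun j _ => ?_
    rw [inner_sum]
    refine Finset.sum_congr rfl fun k _ => ?_
    rw [inner_smul_left, inner_smul_right, ← mul_assoc]
    congr 1
    rw [← Complex.exp_conj, ← Complex.exp_add]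
    congr 1
    simp
    ring
  apply Complex.ofReal_injective
  rw [← intervalIntegral.integral_ofReal]
  simp_rw [h1]
  rw [intervalIntegral.integral_finsetSum (fun j _ => by
    apply Continuous.intervalIntegrable; fun_prop)]
  rw [Complex.ofReal_mul, Complex.ofReal_sum, Finset.mul_sum]
  refine Finset.sum_congr rfl fun j hj => ?_
  rw [intervalIntegral.integral_finsetSum (fun j _ => by
    apply Continuous.intervalIntegrable; fun_prop)]
  rw [Finset.sum_eq_single j]
  · rw [intervalIntegral.integral_mul_const, integral_expI, if_pos (sub_self j),
      inner_self_eq_norm_sq_to_K]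
    push_cast
    rfl
  · intro k _ hk
    rw [intervalIntegral.integral_mul_const, integral_expI, if_neg (sub_ne_zero.mpr hk), zero_mul]
  · exact fun h => absurd hj h

variable [CompleteSpace H]

theorem continuous_tsum_expI (a : ℤ → H) (ha : Summable fun j => ‖a j‖) :
    Continuous fun t : ℝ => ∑' j : ℤ, Complex.exp (Complex.I * (j : ℂ) * (t : ℂ)) • a j := by
  refine continuous_tsum (fun j => by fun_prop) ha (fun j t => ?_)
  rw [norm_expI_smul]

/-- Limit of the finite identity by dominated convergence. Summability of the norms is required as
well as square summability, so that the series converges at every t and has an integrable majorant.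
-/
theorem integral_norm_sq_tsum (a : ℤ → H) (ha : Summable fun j => ‖a j‖)
    (ha2 : Summable fun j => ‖a j‖ ^ 2) :
    ∫ t in (-Real.pi)..Real.pi, ‖∑' j : ℤ, Complex.exp (Complex.I * (j : ℂ) * (t : ℂ)) • a j‖ ^ 2
      = 2 * Real.pi * ∑' j, ‖a j‖ ^ 2 := by
  have h1 : Tendsto (fun s : Finset ℤ => ∫ t in (-Real.pi)..Real.pi,
      ‖∑ j ∈ s, Complex.exp (Complex.I * (j : ℂ) * (t : ℂ)) • a j‖ ^ 2) atTop
      (𝓝 (∫ t in (-Real.pi)..Real.pi,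
        ‖∑' j : ℤ, Complex.exp (Complex.I * (j : ℂ) * (t : ℂ)) • a j‖ ^ 2)) := by
    refine intervalIntegral.tendsto_integral_filter_of_dominated_convergence
      (fun _ => (∑' j, ‖a j‖) ^ 2) (Eventually.of_forall fun s => ?_)
      (Eventually.of_forall fun s => ?_) (by simp) ?_
    · exact Continuous.aestronglyMeasurable (by fun_prop)
    · refine Eventually.of_forall fun t _ => ?_
      rw [norm_pow, norm_norm]
      gcongr
      refine (norm_sum_le _ _).trans ?_
      simp_rw [norm_expI_smul]
      exact ha.sum_le_tsum s (fun _ _ => norm_nonneg _)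
    · refine Eventually.of_forall fun t _ => ?_
      have : Summable fun j : ℤ => Complex.exp (Complex.I * (j : ℂ) * (t : ℂ)) • a j := by
        apply Summable.of_norm
        simpa only [norm_expI_smul] using ha
      exact (this.hasSum.norm).pow 2
  simp_rw [integral_norm_sq_finset_sum] at h1
  have h2 : Tendsto (fun s : Finset ℤ => 2 * Real.pi * ∑ j ∈ s, ‖a j‖ ^ 2) atTop
      (𝓝 (2 * Real.pi * ∑' j, ‖a j‖ ^ 2)) := Tendsto.const_mul _ ha2.hasSum
  exact tendsto_nhds_unique h1 h2

end Parseval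

/-- The symbol `∑ e^{ijt} K_j` of a Toeplitz block matrix. -/
def symbol {H : Type*} [NormedAddCommGroup H] [InnerProductSpace ℂ H]
    (K : ℤ → H →L[ℂ] H) (t : ℝ) : H →L[ℂ] H :=
  ∑' j : ℤ, Complex.exp (Complex.I * (j : ℂ) * (t : ℂ)) • K j

/-! ### Lower bounds for a block Toeplitz operator and for its symbol -/

namespace BlockDecomposition

variable {E H : Type*} [NormedAddCommGroup E] [InnerProductSpace ℂ E]
  [NormedAddCommGroup H] [InnerProductSpace ℂ H] [CompleteSpace E] [CompleteSpace H]
  (B : BlockDecomposition E H) (D : E →L[ℂ] E) (K : ℤ → H →L[ℂ] H)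

omit [CompleteSpace E] in
theorem hasSum_symbol (hK : Summable fun j => ‖K j‖) (t : ℝ) (u : H) :
    HasSum (fun j : ℤ => Complex.exp (Complex.I * (j : ℂ) * (t : ℂ)) • K j u) (symbol K t u) := by
  have h1 : Summable fun j : ℤ => Complex.exp (Complex.I * (j : ℂ) * (t : ℂ)) • K j := by
    apply Summable.of_norm
    simp_rw [norm_smul, norm_expI, one_mul]
    exact hK
  exact h1.hasSum.mapL (ContinuousLinearMap.apply ℂ H u)

-- On finitely supported vectors the Fourier transform turns D − z into multiplication by symbol −
-- z. Squaring the pointwise bound and integrating over t gives the claim by Parseval. Finite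
-- support makes the coordinates of Dφ absolutely summable, so the transform exists at every t.
set_option maxHeartbeats 1000000 in
omit [CompleteSpace E] in
theorem bounded_below_finset (hK : Summable fun j => ‖K j‖)
    (hD : ∀ j k u, B.π k (D (B.ι j u)) = K (k - j) u) (z : ℂ) (δ : ℝ) (hδ : 0 ≤ δ)
    (h : ∀ t ∈ Set.Icc (-Real.pi) Real.pi, ∀ u, δ * ‖u‖ ≤ ‖symbol K t u - z • u‖)
    (s : Finset ℤ) (u : ℤ → H) :
    δ * ‖∑ j ∈ s, B.ι j (u j)‖ ≤ ‖D (∑ j ∈ s, B.ι j (u j)) - z • ∑ j ∈ s, B.ι j (u j)‖ := by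
  set φ := ∑ j ∈ s, B.ι j (u j) with hφ
  set a : ℤ → H := fun k => B.π k (D φ - z • φ) with ha
  set v : ℤ → H := fun k => if k ∈ s then u k else 0 with hv
  have hπφ : ∀ k, B.π k φ = v k := by
    intro k
    rw [hφ, map_sum]
    by_cases hk : k ∈ s
    · rw [Finset.sum_eq_single k (fun j _ hj => B.π_ι_of_ne j k hj.symm _) (fun h => absurd hk h),
        B.π_ι_self]
      simp [hv, hk]
    · rw [Finset.sum_eq_zero (fun j hj => B.π_ι_of_ne j k (by rintro rfl; exact hk hj) _)]
      simp [hv, hk]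
  have ha' : ∀ k, a k = (∑ j ∈ s, K (k - j) (u j)) - z • v k := by
    intro k
    simp only [ha, map_sub, map_smul, hπφ]
    congr 1
    rw [hφ, map_sum, map_sum]
    exact Finset.sum_congr rfl fun j _ => hD _ _ _
  have hshift : ∀ j, Summable fun k : ℤ => ‖K (k - j)‖ := fun j =>
    (Equiv.subRight j).summable_iff.mpr hK
  have hsum1 : ∀ j, Summable fun k : ℤ => ‖K (k - j) (u j)‖ := fun j =>
    Summable.of_nonneg_of_le (fun _ => norm_nonneg _) (fun k => (K (k - j)).le_opNorm (u j))
      ((hshift j).mul_right _)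
  have hvs : ∀ f : ℤ → ℝ, Summable fun k => if k ∈ s then f k else 0 := fun f =>
    summable_of_ne_finset_zero (s := s) (fun k hk => if_neg hk)
  have hasum : Summable fun k => ‖a k‖ := by
    refine Summable.of_nonneg_of_le (fun _ => norm_nonneg _) (fun k => ?_)
      ((summable_sum fun j (_ : j ∈ s) => hsum1 j).add
        ((hvs fun k => ‖z‖ * ‖u k‖)))
    rw [ha']
    refine (norm_sub_le _ _).trans (add_le_add (norm_sum_le _ _) ?_)
    simp only [hv]
    split_ifs <;> simp [norm_smul]
  have hadd := (B.hasSum_norm_sq (D φ - z • φ))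
  have hP := integral_norm_sq_tsum a hasum hadd.summable
  rw [hadd.tsum_eq] at hP
  have hQ := integral_norm_sq_finset_sum s u
  have hφn : ‖φ‖ ^ 2 = ∑ j ∈ s, ‖u j‖ ^ 2 := by
    refine (B.hasSum_norm_sq φ).unique ?_
    have := hasSum_sum_of_ne_finset_zero (L := .unconditional ℤ) (f := fun j => ‖B.π j φ‖ ^ 2)
      (s := s) (fun j hj => by simp [hπφ, hv, hj])
    rwa [Finset.sum_congr rfl (fun j hj => by rw [hπφ, hv]; simp [hj] :
      ∀ j ∈ s, ‖B.π j φ‖ ^ 2 = ‖u j‖ ^ 2)] at this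
  -- the Fourier transform intertwines
  have hF : ∀ t : ℝ, ∑' k : ℤ, Complex.exp (Complex.I * (k : ℂ) * (t : ℂ)) • a k
      = symbol K t (∑ j ∈ s, Complex.exp (Complex.I * (j : ℂ) * (t : ℂ)) • u j)
        - z • ∑ j ∈ s, Complex.exp (Complex.I * (j : ℂ) * (t : ℂ)) • u j := by
    intro t
    refine HasSum.tsum_eq ?_
    simp_rw [ha', smul_sub]
    refine HasSum.sub ?_ ?_
    · simp_rw [Finset.smul_sum, map_sum]
      refine hasSum_sum fun j _ => ?_
      have h1 := hasSum_symbol K hK t (Complex.exp (Complex.I * (j : ℂ) * (t : ℂ)) • u j)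
      have h2 := (Equiv.subRight j).hasSum_iff.mpr h1
      convert! h2 using 2 with k
      simp only [Function.comp_apply, Equiv.subRight_apply, map_smul, smul_smul]
      rw [← Complex.exp_add]
      congr 2
      push_cast; ring
    · have h2 := hasSum_sum_of_ne_finset_zero (L := .unconditional ℤ)
        (f := fun k : ℤ => Complex.exp (Complex.I * (k : ℂ) * (t : ℂ)) • z • v k)
        (s := s) (fun j hj => by simp [hv, hj])
      rw [Finset.smul_sum]
      rwa [Finset.sum_congr rfl (fun j hj => by rw [hv]; simp [hj]; rw [smul_comm] :
        ∀ j ∈ s, Complex.exp (Complex.I * (j : ℂ) * (t : ℂ)) • z • v j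
          = z • Complex.exp (Complex.I * (j : ℂ) * (t : ℂ)) • u j)] at h2
  have hmono : ∫ t in (-Real.pi)..Real.pi,
      δ ^ 2 * ‖∑ j ∈ s, Complex.exp (Complex.I * (j : ℂ) * (t : ℂ)) • u j‖ ^ 2
      ≤ ∫ t in (-Real.pi)..Real.pi,
        ‖∑' j : ℤ, Complex.exp (Complex.I * (j : ℂ) * (t : ℂ)) • a j‖ ^ 2 := by
    refine intervalIntegral.integral_mono_on (by linarith [Real.pi_pos]) ?_ ?_ ?_
    · exact Continuous.intervalIntegrable (by fun_prop) _ _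
    · exact Continuous.intervalIntegrable ((continuous_tsum_expI a hasum).norm.pow 2) _ _
    · intro t ht
      rw [hF, ← mul_pow]
      exact pow_le_pow_left₀ (by positivity) (h t ht _) 2
  rw [intervalIntegral.integral_const_mul, hQ, hP, ← hφn] at hmono
  have : (δ * ‖φ‖) ^ 2 ≤ ‖D φ - z • φ‖ ^ 2 := by
    have := Real.pi_pos
    rw [mul_pow]
    nlinarith
  exact (sq_le_sq₀ (by positivity) (norm_nonneg _)).mp this

omit [CompleteSpace E] in
/-- A uniform lower bound for the symbol is a lower bound for the operator. -/
theorem bounded_below_of_symbol (hK : Summable fun j => ‖K j‖)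
    (hD : ∀ j k u, B.π k (D (B.ι j u)) = K (k - j) u) (z : ℂ) (δ : ℝ) (hδ : 0 ≤ δ)
    (h : ∀ t ∈ Set.Icc (-Real.pi) Real.pi, ∀ u, δ * ‖u‖ ≤ ‖symbol K t u - z • u‖) (φ : E) :
    δ * ‖φ‖ ≤ ‖D φ - z • φ‖ := by
  have h1 := B.hasSum_ι_π φ
  have hc1 : Continuous fun ψ : E => δ * ‖ψ‖ := by fun_prop
  have hc2 : Continuous fun ψ : E => ‖D ψ - z • ψ‖ := by fun_prop
  exact le_of_tendsto_of_tendsto ((hc1.tendsto φ).comp h1) ((hc2.tendsto φ).comp h1)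
    (Eventually.of_forall fun s => B.bounded_below_finset D K hK hD z δ hδ h s
      fun j => B.π j φ)

theorem summable_geometric_natAbs {q : ℝ} (hq0 : 0 ≤ q) (hq1 : q < 1) :
    Summable fun j : ℤ => q ^ j.natAbs := by
  refine Summable.of_nat_of_neg ?_ ?_ <;>
  simpa using summable_geometric_of_lt_one hq0 hq1

omit [CompleteSpace E] [CompleteSpace H] in
theorem summable_norm_of_le_geometric {C q : ℝ} (hq0 : 0 ≤ q) (hq1 : q < 1)
    (hKq : ∀ j : ℤ, ‖K j‖ ≤ C * q ^ j.natAbs) : Summable fun j => ‖K j‖ :=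
  Summable.of_nonneg_of_le (fun _ => norm_nonneg _) hKq
    ((summable_geometric_natAbs hq0 hq1).mul_left C)

/-- Since ||k − m| − |k|| ≤ |m|, displacing the weight s^{−|k|} by m changes it by a relative amount
of at most s^{|m|} − 1, uniformly in k. This makes a damped plane wave an approximate generalised
eigenvector. -/
theorem abs_weight_sub_le {s : ℝ} (hs : 1 ≤ s) (k m : ℤ) :
    |(s ^ (k - m).natAbs)⁻¹ - (s ^ k.natAbs)⁻¹| ≤ (s ^ k.natAbs)⁻¹ * (s ^ m.natAbs - 1) := by
  have hs0 : 0 < s := by linarith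
  have h1 : s ^ k.natAbs ≤ s ^ (k - m).natAbs * s ^ m.natAbs := by
    rw [← pow_add]; exact pow_le_pow_right₀ hs (by omega)
  have h2 : s ^ (k - m).natAbs ≤ s ^ k.natAbs * s ^ m.natAbs := by
    rw [← pow_add]; exact pow_le_pow_right₀ hs (by omega)
  have ha : 1 ≤ s ^ k.natAbs := one_le_pow₀ hs
  have hb : 1 ≤ s ^ (k - m).natAbs := one_le_pow₀ hs
  have hc : 1 ≤ s ^ m.natAbs := one_le_pow₀ hs
  set a := s ^ k.natAbs
  set b := s ^ (k - m).natAbs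
  set c := s ^ m.natAbs
  have ha0 : 0 < a := by linarith
  have hb0 : 0 < b := by linarith
  rw [abs_le]
  constructor
  · have h3 : a⁻¹ * (2 - c) ≤ b⁻¹ := by
      rw [inv_mul_eq_div, div_le_iff₀ ha0, inv_mul_eq_div, le_div_iff₀ hb0]
      by_cases hc2 : c ≤ 2
      · nlinarith [mul_le_mul_of_nonneg_right h2 (by linarith : 0 ≤ 2 - c), sq_nonneg (c - 1)]
      · push Not at hc2
        nlinarith
    have e : a⁻¹ * (c - 1) = a⁻¹ - a⁻¹ * (2 - c) := by ring
    linarith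
  · have h3 : b⁻¹ ≤ a⁻¹ * c := by
      rw [inv_mul_eq_div, le_div_iff₀ ha0, inv_mul_eq_div, div_le_iff₀ hb0]
      linarith
    have e : a⁻¹ * (c - 1) = a⁻¹ * c - a⁻¹ := by ring
    linarith

/-- Dominated convergence as s decreases to 1: for s < q^{−1/2} the terms are at most C q^{|m|/2},
which is summable. -/
theorem tendsto_symbol_error {C q : ℝ} (hq0 : 0 < q) (hq1 : q < 1) (b : ℤ → ℝ)
    (hb0 : ∀ j, 0 ≤ b j) (hb : ∀ j : ℤ, b j ≤ C * q ^ j.natAbs) :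
    Tendsto (fun s : ℝ => ∑' m : ℤ, b m * (s ^ m.natAbs - 1)) (𝓝[>] 1) (𝓝 0) := by
  have hsq : √q < 1 := by rw [Real.sqrt_lt' one_pos]; simpa using hq1
  have hsq0 : 0 < √q := Real.sqrt_pos.mpr hq0
  have h0 : (0 : ℝ) = ∑' m : ℤ, b m * ((1 : ℝ) ^ m.natAbs - 1) := by simp
  rw [h0]
  refine tendsto_tsum_of_dominated_convergence (bound := fun m : ℤ => C * (√q) ^ m.natAbs)
    ((summable_geometric_natAbs hsq0.le hsq).mul_left C) (fun m => ?_) ?_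
  · exact Tendsto.const_mul _ (((continuous_pow _).tendsto' _ _ rfl).sub_const 1
      |>.mono_left nhdsWithin_le_nhds)
  · have h1 : ∀ᶠ s : ℝ in 𝓝[>] 1, s < (√q)⁻¹ :=
      nhdsWithin_le_nhds (Iio_mem_nhds ((one_lt_inv₀ hsq0).mpr hsq))
    filter_upwards [h1, self_mem_nhdsWithin] with s hs1 hs2 m
    have hs2' : (1 : ℝ) < s := hs2
    have h3 : 1 ≤ s ^ m.natAbs := one_le_pow₀ hs2'.le
    rw [Real.norm_of_nonneg (mul_nonneg (hb0 m) (by linarith))]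
    calc b m * (s ^ m.natAbs - 1) ≤ b m * s ^ m.natAbs :=
          mul_le_mul_of_nonneg_left (by linarith) (hb0 m)
      _ ≤ (C * q ^ m.natAbs) * ((√q)⁻¹) ^ m.natAbs := by
          gcongr
          · exact (hb0 m).trans (hb m)
          · exact hb m
      _ = C * (√q) ^ m.natAbs := by
          rw [mul_assoc, ← mul_pow]
          congr 2
          field_simp
          exact (Real.sq_sqrt hq0.le).symm

set_option maxHeartbeats 1000000 in
/-- A lower bound for the operator is a lower bound for its symbol. -/
theorem symbol_bounded_below {C q : ℝ} (hq0 : 0 < q) (hq1 : q < 1)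
    (hKq : ∀ j : ℤ, ‖K j‖ ≤ C * q ^ j.natAbs)
    (hD : ∀ j k u, B.π k (D (B.ι j u)) = K (k - j) u) (z : ℂ) (δ : ℝ) (hδ : 0 ≤ δ)
    (h : ∀ φ, δ * ‖φ‖ ≤ ‖D φ - z • φ‖) (t : ℝ) (u : H) :
    δ * ‖u‖ ≤ ‖symbol K t u - z • u‖ := by
  have hK := summable_norm_of_le_geometric K hq0.le hq1 hKq
  have hsq : √q < 1 := by rw [Real.sqrt_lt' one_pos]; simpa using hq1
  have hsq0 : 0 < √q := Real.sqrt_pos.mpr hq0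
  have main : ∀ s : ℝ, 1 < s → s < (√q)⁻¹ →
      δ * ‖u‖ ≤ ‖symbol K t u - z • u‖ + (∑' m : ℤ, ‖K m‖ * (s ^ m.natAbs - 1)) * ‖u‖ := by
    intro s hs hsq'
    have hs0 : 0 < s := by linarith
    have hw1 : Summable fun k : ℤ => (s ^ k.natAbs)⁻¹ := by
      simpa only [inv_pow] using
        summable_geometric_natAbs (inv_nonneg.mpr hs0.le) (inv_lt_one_of_one_lt₀ hs)
    have hw2 : Summable fun k : ℤ => ((s ^ k.natAbs)⁻¹) ^ 2 := by
      refine Summable.of_nonneg_of_le (fun _ => by positivity) (fun k => ?_) hw1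
      have : (s ^ k.natAbs)⁻¹ ≤ 1 := inv_le_one_of_one_le₀ (one_le_pow₀ hs.le)
      have h0 : 0 ≤ (s ^ k.natAbs)⁻¹ := by positivity
      nlinarith
    have herr : Summable fun m : ℤ => ‖K m‖ * (s ^ m.natAbs - 1) := by
      refine Summable.of_nonneg_of_le (fun m => mul_nonneg (norm_nonneg _)
        (by linarith [one_le_pow₀ (n := m.natAbs) hs.le])) (fun m => ?_)
        ((summable_geometric_natAbs (q := √q) hsq0.le hsq).mul_left C)
      calc ‖K m‖ * (s ^ m.natAbs - 1) ≤ ‖K m‖ * s ^ m.natAbs :=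
            mul_le_mul_of_nonneg_left (by linarith) (norm_nonneg _)
        _ ≤ (C * q ^ m.natAbs) * ((√q)⁻¹) ^ m.natAbs := by
            gcongr
            · exact (norm_nonneg _).trans (hKq m)
            · exact hKq m
        _ = C * (√q) ^ m.natAbs := by
            rw [mul_assoc, ← mul_pow]
            congr 2
            field_simp
            exact (Real.sq_sqrt hq0.le).symm
    set e : ℤ → ℂ := fun k => Complex.exp (Complex.I * (k : ℂ) * (t : ℂ)) with he
    have hen : ∀ k, ‖e k‖ = 1 := fun k => norm_expI k t
    have hemul : ∀ k m, e (k + m) = e k * e m := fun k m => by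
      simp only [he]; rw [← Complex.exp_add]; congr 1; push_cast; ring
    -- The plane wave e^{−ikt}u is carried by D exactly to the wave with u replaced by `symbol K t
    -- u`, but it is not square summable. The damping s^{−|k|} repairs this at the cost of an error
    -- that vanishes as s → 1.
    set a : ℤ → H := fun k => (((s ^ k.natAbs)⁻¹ : ℝ) : ℂ) • e (-k) • u with ha
    have han : ∀ k, ‖a k‖ = (s ^ k.natAbs)⁻¹ * ‖u‖ := by
      intro k
      simp only [ha]
      rw [norm_smul, norm_smul, hen, one_mul, Complex.norm_real,
        Real.norm_of_nonneg (by positivity)]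
    have hιa : Summable fun j => B.ι j (a j) := by
      apply Summable.of_norm
      simp_rw [B.norm_ι, han]
      exact hw1.mul_right _
    obtain ⟨φ, hφ⟩ := hιa
    have hπφ : ∀ k, B.π k φ = a k := by
      intro k
      have h1 := hφ.mapL (B.π k)
      refine h1.unique ?_
      have := hasSum_single (f := fun j => B.π k (B.ι j (a j))) k
        (fun j hj => B.π_ι_of_ne j k hj.symm _)
      rwa [B.π_ι_self] at this
    have hKu : ∀ m, ‖e m • K m u‖ ≤ ‖K m‖ * ‖u‖ := fun m => by
      rw [norm_smul, hen, one_mul]; exact (K m).le_opNorm u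
    have hπD : ∀ k, ‖B.π k (D φ - z • φ)‖ ≤ (s ^ k.natAbs)⁻¹ *
        (‖symbol K t u - z • u‖ + (∑' m : ℤ, ‖K m‖ * (s ^ m.natAbs - 1)) * ‖u‖) := by
      intro k
      have h1 : HasSum (fun j => K (k - j) (a j)) (B.π k (D φ)) := by
        have := hφ.mapL ((B.π k).comp D)
        simpa only [ContinuousLinearMap.comp_apply, hD] using this
      have h2 : HasSum (fun m : ℤ => (((s ^ (k - m).natAbs)⁻¹ : ℝ) : ℂ) • e (-k) • e m • K m u)
          (B.π k (D φ)) := by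
        have := (Equiv.subLeft k).hasSum_iff.mpr h1
        convert! this using 2 with m
        simp only [Function.comp_apply, Equiv.subLeft_apply, sub_sub_cancel, ha, map_smul]
        congr 1
        rw [smul_smul, ← hemul]
        congr 2; ring
      have h3 : HasSum (fun m : ℤ => (((s ^ k.natAbs)⁻¹ : ℝ) : ℂ) • e (-k) • e m • K m u)
          ((((s ^ k.natAbs)⁻¹ : ℝ) : ℂ) • e (-k) • symbol K t u) :=
        ((hasSum_symbol K hK t u).const_smul _).const_smul _
      have h4 := h2.sub h3
      have h5 : ‖B.π k (D φ) - (((s ^ k.natAbs)⁻¹ : ℝ) : ℂ) • e (-k) • symbol K t u‖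
          ≤ (s ^ k.natAbs)⁻¹ * ((∑' m : ℤ, ‖K m‖ * (s ^ m.natAbs - 1)) * ‖u‖) := by
        rw [← h4.tsum_eq, ← tsum_mul_right, ← tsum_mul_left]
        refine tsum_of_norm_bounded ((herr.mul_right _).mul_left _).hasSum fun m => ?_
        rw [← sub_smul, ← Complex.ofReal_sub, norm_smul, norm_smul, hen, one_mul,
          Complex.norm_real, Real.norm_eq_abs]
        calc _ ≤ ((s ^ k.natAbs)⁻¹ * (s ^ m.natAbs - 1)) * (‖K m‖ * ‖u‖) := by
              gcongr
              · exact mul_nonneg (by positivity) (by linarith [one_le_pow₀ (n := m.natAbs) hs.le])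
              · exact abs_weight_sub_le hs.le k m
              · exact hKu m
          _ = _ := by ring
      have h6 : B.π k (D φ - z • φ)
          = (B.π k (D φ) - (((s ^ k.natAbs)⁻¹ : ℝ) : ℂ) • e (-k) • symbol K t u)
            + (((s ^ k.natAbs)⁻¹ : ℝ) : ℂ) • e (-k) • (symbol K t u - z • u) := by
        rw [map_sub, map_smul, hπφ]
        simp only [ha, smul_sub]
        rw [smul_comm z, smul_comm z]
        abel
      rw [h6]
      refine (norm_add_le _ _).trans ?_
      rw [norm_smul, norm_smul, hen, one_mul, Complex.norm_real,
        Real.norm_of_nonneg (by positivity)]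
      linarith
    -- W is the common factor of ‖φ‖² and of the bound for ‖Dφ − zφ‖². It is unbounded as s → 1 but
    -- cancels.
    set W := ∑' k : ℤ, ((s ^ k.natAbs)⁻¹) ^ 2 with hW
    have hWpos : 0 < W := hw2.tsum_pos (fun _ => by positivity) 0 (by simp)
    set R := ‖symbol K t u - z • u‖ + (∑' m : ℤ, ‖K m‖ * (s ^ m.natAbs - 1)) * ‖u‖ with hR
    have hR0 : 0 ≤ R := by
      have : 0 ≤ ∑' m : ℤ, ‖K m‖ * (s ^ m.natAbs - 1) := tsum_nonneg fun m =>
        mul_nonneg (norm_nonneg _) (by linarith [one_le_pow₀ (n := m.natAbs) hs.le])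
      positivity
    have hφn : ‖φ‖ ^ 2 = W * ‖u‖ ^ 2 := by
      refine (B.hasSum_norm_sq φ).unique ?_
      simp_rw [hπφ, han, mul_pow]
      exact hw2.hasSum.mul_right _
    have hDn : ‖D φ - z • φ‖ ^ 2 ≤ W * R ^ 2 := by
      refine hasSum_le (fun k => ?_) (B.hasSum_norm_sq (D φ - z • φ)) (hw2.hasSum.mul_right _)
      rw [← mul_pow]
      exact pow_le_pow_left₀ (norm_nonneg _) (hπD k) 2
    have h7 : (δ * ‖φ‖) ^ 2 ≤ ‖D φ - z • φ‖ ^ 2 :=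
      pow_le_pow_left₀ (by positivity) (h φ) 2
    have h8 : (δ * ‖u‖) ^ 2 ≤ R ^ 2 := by
      rw [mul_pow, hφn] at h7
      rw [mul_pow]
      refine le_of_mul_le_mul_left ?_ hWpos
      linarith
    exact (sq_le_sq₀ (by positivity) hR0).mp h8
  have hlim := ((tendsto_symbol_error hq0 hq1 (fun m => ‖K m‖) (fun _ => norm_nonneg _)
    hKq).mul_const ‖u‖).const_add ‖symbol K t u - z • u‖
  rw [zero_mul, add_zero] at hlim
  refine ge_of_tendsto hlim ?_
  have h1 : ∀ᶠ s : ℝ in 𝓝[>] 1, s < (√q)⁻¹ :=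
    nhdsWithin_le_nhds (Iio_mem_nhds ((one_lt_inv₀ hsq0).mpr hsq))
  filter_upwards [h1, self_mem_nhdsWithin] with s hs1 hs2
  exact main s hs2 hs1

end BlockDecomposition

/-! ### Integral operators and the Schur test -/

section Schur
variable {Y : Type*} [MeasurableSpace Y] {ν : Measure Y} [SFinite ν]

-- Cauchy–Schwarz applied to kφ = (kh)^{1/2} · (kφ²/h)^{1/2}.
omit [SFinite ν] in
theorem sq_lintegral_mul_le {k φ h : Y → ENNReal} (hk : Measurable k) (hφ : Measurable φ)
    (hh : Measurable h) (h0 : ∀ y, h y ≠ 0) (ht : ∀ y, h y ≠ ⊤) :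
    (∫⁻ y, k y * φ y ∂ν) ^ 2 ≤ (∫⁻ y, k y * h y ∂ν) * ∫⁻ y, k y * (φ y ^ 2 * (h y)⁻¹) ∂ν := by
  have hpq : (2 : ℝ).HolderConjugate 2 := Real.HolderConjugate.two_two
  have h1 := ENNReal.lintegral_mul_le_Lp_mul_Lq ν hpq
    (f := fun y => (k y * h y) ^ (1 / 2 : ℝ))
    (g := fun y => (k y * (φ y ^ 2 * (h y)⁻¹)) ^ (1 / 2 : ℝ)) (by fun_prop) (by fun_prop)
  have e1 : ∀ a : ENNReal, (a ^ (1 / 2 : ℝ)) ^ (2 : ℝ) = a := fun a => by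
    rw [← ENNReal.rpow_mul]; norm_num
  have e2 : ∀ y, (fun y => (k y * h y) ^ (1 / 2 : ℝ)) y
      * (fun y => (k y * (φ y ^ 2 * (h y)⁻¹)) ^ (1 / 2 : ℝ)) y = k y * φ y := by
    intro y
    simp only
    rw [← ENNReal.mul_rpow_of_nonneg _ _ (by norm_num)]
    have : k y * h y * (k y * (φ y ^ 2 * (h y)⁻¹)) = (k y * φ y) ^ 2 := by
      calc _ = (h y * (h y)⁻¹) * (k y * φ y) ^ 2 := by ring
        _ = _ := by rw [ENNReal.mul_inv_cancel (h0 y) (ht y), one_mul]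
    rw [this, ← ENNReal.rpow_natCast, ← ENNReal.rpow_mul]
    norm_num
  simp only [Pi.mul_apply, e1] at h1
  rw [lintegral_congr (fun y => e2 y)] at h1
  calc (∫⁻ y, k y * φ y ∂ν) ^ 2
      ≤ ((∫⁻ y, k y * h y ∂ν) ^ (1 / 2 : ℝ)
        * (∫⁻ y, k y * (φ y ^ 2 * (h y)⁻¹) ∂ν) ^ (1 / 2 : ℝ)) ^ 2 := by gcongr
    _ = _ := by
      rw [mul_pow, ← ENNReal.rpow_natCast, ← ENNReal.rpow_natCast, ← ENNReal.rpow_mul,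
        ← ENNReal.rpow_mul]
      norm_num

/-- Schur's test with the same weight h for rows and columns: the row bound absorbs one factor of
Cauchy–Schwarz, and after Tonelli the column bound absorbs the other. -/
theorem lintegral_sq_schur {k : Y → Y → ENNReal} (hk : Measurable (Function.uncurry k))
    {φ h : Y → ENNReal} (hφ : Measurable φ) (hh : Measurable h) (h0 : ∀ y, h y ≠ 0)
    (ht : ∀ y, h y ≠ ⊤) (C : ENNReal)
    (h1 : ∀ᵐ x ∂ν, ∫⁻ y, k x y * h y ∂ν ≤ C * h x)
    (h2 : ∀ᵐ y ∂ν, ∫⁻ x, k x y * h x ∂ν ≤ C * h y) :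
    ∫⁻ x, (∫⁻ y, k x y * φ y ∂ν) ^ 2 ∂ν ≤ C ^ 2 * ∫⁻ y, φ y ^ 2 ∂ν := by
  have hkx : ∀ x, Measurable (k x) := fun x => hk.of_uncurry_left
  calc ∫⁻ x, (∫⁻ y, k x y * φ y ∂ν) ^ 2 ∂ν
      ≤ ∫⁻ x, C * ∫⁻ y, k x y * h x * (φ y ^ 2 * (h y)⁻¹) ∂ν ∂ν := by
        refine lintegral_mono_ae ?_
        filter_upwards [h1] with x hx
        refine (sq_lintegral_mul_le (hkx x) hφ hh h0 ht).trans ?_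
        calc _ ≤ C * h x * ∫⁻ y, k x y * (φ y ^ 2 * (h y)⁻¹) ∂ν := by gcongr
          _ = C * ∫⁻ y, k x y * h x * (φ y ^ 2 * (h y)⁻¹) ∂ν := by
            rw [mul_assoc, ← lintegral_const_mul]
            · congr 2; funext y; ring
            · exact (hkx x).mul (by fun_prop)
    _ = C * ∫⁻ y, ∫⁻ x, k x y * h x * (φ y ^ 2 * (h y)⁻¹) ∂ν ∂ν := by
        have hm : Measurable (Function.uncurry fun x y => k x y * h x * (φ y ^ 2 * (h y)⁻¹)) := by
          refine Measurable.mul (hk.mul (hh.comp measurable_fst)) ?_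
          exact ((hφ.comp measurable_snd).pow_const 2).mul (hh.comp measurable_snd).inv
        rw [lintegral_lintegral_swap (f := fun x y => k x y * h x * (φ y ^ 2 * (h y)⁻¹))
          hm.aemeasurable |>.symm, ← lintegral_const_mul]
        exact Measurable.lintegral_prod_right' (f := Function.uncurry fun x y => k x y * h x * (φ y ^ 2 * (h y)⁻¹)) hm
    _ ≤ C * ∫⁻ y, C * φ y ^ 2 ∂ν := by
        gcongr 1
        refine lintegral_mono_ae ?_
        filter_upwards [h2] with y hy
        have hky : Measurable fun x => k x y * h x :=
          (hk.comp (measurable_id.prodMk measurable_const)).mul hh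
        rw [lintegral_mul_const _ hky]
        calc _ ≤ C * h y * (φ y ^ 2 * (h y)⁻¹) := by gcongr
          _ = C * φ y ^ 2 * (h y * (h y)⁻¹) := by ring
          _ = _ := by rw [ENNReal.mul_inv_cancel (h0 y) (ht y), mul_one]
    _ = _ := by
        rw [lintegral_const_mul _ (hφ.pow_const 2)]; ring

/-- Schur's test for |k| and |φ| gives the operator norm and also absolute convergence of the
integral at almost every x. The latter is later what removes the principal value. -/
theorem exists_integralOperator {k : Y → Y → ℂ} (hk : Measurable (Function.uncurry k))
    {h : Y → ENNReal} (hh : Measurable h) (h0 : ∀ y, h y ≠ 0)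
    (ht : ∀ y, h y ≠ ⊤) (C : ENNReal) (hC : C ≠ ⊤)
    (h1 : ∀ᵐ x ∂ν, ∫⁻ y, ‖k x y‖ₑ * h y ∂ν ≤ C * h x)
    (h2 : ∀ᵐ y ∂ν, ∫⁻ x, ‖k x y‖ₑ * h x ∂ν ≤ C * h y) :
    ∃ D : Lp ℂ 2 ν →L[ℂ] Lp ℂ 2 ν, ‖D‖ ≤ C.toReal ∧ ∀ φ : Lp ℂ 2 ν, ∀ᵐ x ∂ν,
      Integrable (fun y => k x y * φ y) ν ∧ D φ x = ∫ y, k x y * φ y ∂ν := by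
  have hke : Measurable (Function.uncurry fun x y => ‖k x y‖ₑ) := hk.enorm
  have hφm : ∀ φ : Lp ℂ 2 ν, Measurable φ := fun φ => (Lp.stronglyMeasurable φ).measurable
  have hnorm : ∀ g : Y → ℂ, eLpNorm g 2 ν ^ 2 = ∫⁻ y, ‖g y‖ₑ ^ 2 ∂ν := fun g => by
    rw [eLpNorm_eq_lintegral_rpow_enorm_toReal two_ne_zero ENNReal.ofNat_ne_top,
      ← ENNReal.rpow_natCast, ← ENNReal.rpow_mul]
    norm_num
  have hA : ∀ φ : Lp ℂ 2 ν, ∫⁻ x, (∫⁻ y, ‖k x y‖ₑ * ‖φ y‖ₑ ∂ν) ^ 2 ∂ν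
      ≤ C ^ 2 * eLpNorm φ 2 ν ^ 2 := by
    intro φ
    rw [hnorm]
    exact lintegral_sq_schur hke (hφm φ).enorm hh h0 ht C h1 h2
  have hAm : ∀ φ : Lp ℂ 2 ν, Measurable fun x => ∫⁻ y, ‖k x y‖ₑ * ‖φ y‖ₑ ∂ν := fun φ => by
    refine Measurable.lintegral_prod_right' (f := fun p : Y × Y => ‖k p.1 p.2‖ₑ * ‖φ p.2‖ₑ) ?_
    exact hke.mul ((hφm φ).comp measurable_snd).enorm
  have hint : ∀ φ : Lp ℂ 2 ν, ∀ᵐ x ∂ν, Integrable (fun y => k x y * φ y) ν := by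
    intro φ
    have hfin : ∫⁻ x, (∫⁻ y, ‖k x y‖ₑ * ‖φ y‖ₑ ∂ν) ^ 2 ∂ν ≠ ⊤ :=
      ne_top_of_le_ne_top (ENNReal.mul_ne_top (ENNReal.pow_ne_top hC)
        (ENNReal.pow_ne_top (Lp.eLpNorm_ne_top φ))) (hA φ)
    filter_upwards [ae_lt_top ((hAm φ).pow_const 2) hfin] with x hx
    refine ⟨((hk.of_uncurry_left).mul (hφm φ)).aestronglyMeasurable, ?_⟩
    rw [hasFiniteIntegral_iff_enorm]
    simp_rw [enorm_mul]
    by_contra hcon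
    rw [not_lt, top_le_iff] at hcon
    rw [hcon] at hx
    simp at hx
  have hmeas : ∀ φ : Lp ℂ 2 ν, AEStronglyMeasurable (fun x => ∫ y, k x y * φ y ∂ν) ν := by
    intro φ
    have : StronglyMeasurable (fun p : Y × Y => k p.1 p.2 * φ p.2) :=
      (hk.mul ((hφm φ).comp measurable_snd)).stronglyMeasurable
    exact this.integral_prod_right'.aestronglyMeasurable
  have hbound : ∀ φ : Lp ℂ 2 ν, eLpNorm (fun x => ∫ y, k x y * φ y ∂ν) 2 ν
      ≤ C * eLpNorm φ 2 ν := by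
    intro φ
    have : eLpNorm (fun x => ∫ y, k x y * φ y ∂ν) 2 ν ^ 2 ≤ (C * eLpNorm φ 2 ν) ^ 2 := by
      rw [hnorm, mul_pow]
      refine (lintegral_mono fun x => ?_).trans (hA φ)
      gcongr
      refine (enorm_integral_le_lintegral_enorm _).trans_eq ?_
      simp_rw [enorm_mul]
    exact (ENNReal.pow_le_pow_left_iff two_ne_zero).mp this
  have hmem : ∀ φ : Lp ℂ 2 ν, MemLp (fun x => ∫ y, k x y * φ y ∂ν) 2 ν := fun φ =>
    ⟨hmeas φ, (hbound φ).trans_lt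
      (ENNReal.mul_lt_top hC.lt_top (Lp.eLpNorm_lt_top φ))⟩
  let L : Lp ℂ 2 ν →ₗ[ℂ] Lp ℂ 2 ν :=
    { toFun := fun φ => (hmem φ).toLp _
      map_add' := by
        intro φ ψ
        rw [← MemLp.toLp_add, MemLp.toLp_eq_toLp_iff]
        filter_upwards [hint φ, hint ψ] with x hx1 hx2
        simp only [Pi.add_apply]
        rw [← integral_add hx1 hx2]
        refine integral_congr_ae ?_
        filter_upwards [Lp.coeFn_add φ ψ] with y hy
        rw [hy, Pi.add_apply, mul_add]
      map_smul' := by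
        intro c φ
        rw [RingHom.id_apply, ← MemLp.toLp_const_smul, MemLp.toLp_eq_toLp_iff]
        refine Eventually.of_forall fun x => ?_
        simp only [Pi.smul_apply]
        rw [← integral_smul]
        refine integral_congr_ae ?_
        filter_upwards [Lp.coeFn_smul c φ] with y hy
        rw [hy, Pi.smul_apply, smul_eq_mul, smul_eq_mul]; ring }
  have hL : ∀ φ, ‖L φ‖ ≤ C.toReal * ‖φ‖ := by
    intro φ
    change ‖(hmem φ).toLp _‖ ≤ _
    rw [Lp.norm_toLp, Lp.norm_def, ← ENNReal.toReal_mul]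
    exact ENNReal.toReal_mono (ENNReal.mul_ne_top hC (Lp.eLpNorm_ne_top φ)) (hbound φ)
  refine ⟨L.mkContinuous C.toReal hL, L.mkContinuous_norm_le ENNReal.toReal_nonneg hL,
    fun φ => ?_⟩
  filter_upwards [hint φ, (hmem φ).coeFn_toLp] with x hx1 hx2
  exact ⟨hx1, hx2⟩

end Schur

/-! ### The midpoint rule for periodic functions analytic in a strip -/

section Quadrature

variable {c M : ℝ} {h : ℂ → ℂ}

/-- Cauchy's theorem on a rectangle of width one; its vertical sides cancel by periodicity. -/
theorem integral_shift_im (hd : DifferentiableOn ℂ h {z | |z.im| < c})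
    (hper : ∀ z : ℂ, |z.im| < c → h (z + 1) = h z) (y : ℝ) (hy : |y| < c) :
    ∫ x in (0 : ℝ)..1, h x = ∫ x in (0 : ℝ)..1, h (x + y * Complex.I) := by
  have h1 := Complex.integral_boundary_rect_eq_zero_of_differentiableOn h 0 (1 + y * Complex.I)
    (hd.mono (by
      intro z hz
      rw [Complex.mem_reProdIm] at hz
      have := hz.2
      simp only [Complex.zero_im, Complex.add_im, Complex.one_im, Complex.mul_im,
        Complex.ofReal_re, Complex.I_im, mul_one, Complex.ofReal_im, Complex.I_re, mul_zero,
        add_zero, zero_add] at this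
      have h2 := Set.abs_sub_left_of_mem_uIcc this
      simp only [sub_zero] at h2
      exact lt_of_le_of_lt h2 hy))
  simp only [Complex.zero_re, Complex.add_re, Complex.one_re, Complex.mul_re, Complex.ofReal_re,
    Complex.I_re, mul_zero, Complex.ofReal_im, Complex.I_im, mul_one, sub_self, add_zero,
    Complex.zero_im, Complex.ofReal_zero, zero_mul, Complex.add_im, Complex.one_im,
    Complex.mul_im, zero_add, Complex.ofReal_one] at h1
  have h2 : ∫ (x : ℝ) in (0 : ℝ)..y, h (1 + x * Complex.I)
      = ∫ (x : ℝ) in (0 : ℝ)..y, h (x * Complex.I) := by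
    refine intervalIntegral.integral_congr fun x hx => ?_
    have h2 := Set.abs_sub_left_of_mem_uIcc hx
    rw [add_comm, hper]
    rw [sub_zero, sub_zero] at h2
    simpa using lt_of_le_of_lt h2 hy
  rw [h2, add_sub_cancel_right, sub_eq_zero] at h1
  exact h1

/-- Moving the line of integration to height −b for n ≥ 0 and +b for n ≤ 0 gives the exponential the
modulus e^{−2πb|n|}. -/
theorem norm_fourier_integral_le (hd : DifferentiableOn ℂ h {z | |z.im| < c})
    (hper : ∀ z : ℂ, |z.im| < c → h (z + 1) = h z) (hM : ∀ z : ℂ, |z.im| < c → ‖h z‖ ≤ M)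
    (b : ℝ) (hb0 : 0 ≤ b) (hb : b < c) (n : ℤ) :
    ‖∫ x in (0 : ℝ)..1, Complex.exp (-(2 * Real.pi * Complex.I * n * x)) * h x‖
      ≤ M * Real.exp (-(2 * Real.pi * b)) ^ n.natAbs := by
  obtain ⟨y, hy, hny⟩ : ∃ y : ℝ, |y| < c ∧ (n : ℝ) * y = - (b * n.natAbs) := by
    rcases le_total 0 n with hn | hn
    · refine ⟨-b, by rwa [abs_neg, abs_of_nonneg hb0], ?_⟩
      have : ((n.natAbs : ℤ) : ℝ) = (n : ℝ) := by rw [Int.natAbs_of_nonneg hn]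
      rw [Int.cast_natCast] at this
      rw [this]; ring
    · refine ⟨b, by rwa [abs_of_nonneg hb0], ?_⟩
      have : ((n.natAbs : ℤ) : ℝ) = -(n : ℝ) := by
        rw [Int.ofNat_natAbs_of_nonpos hn]; push_cast; rfl
      rw [Int.cast_natCast] at this
      rw [this]; ring
  have h1 := integral_shift_im (h := fun z => Complex.exp (-(2 * Real.pi * Complex.I * n * z)) * h z)
    (c := c) (DifferentiableOn.mul (by fun_prop) hd) (fun z hz => by
      rw [hper z hz]
      refine congrArg (· * h z) ?_
      rw [Complex.exp_eq_exp_iff_exists_int]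
      exact ⟨-n, by push_cast; ring⟩) y hy
  rw [h1]
  refine (intervalIntegral.norm_integral_le_of_norm_le_const
    (C := M * Real.exp (-(2 * Real.pi * b)) ^ n.natAbs) fun x _ => ?_).trans (by simp)
  rw [norm_mul, mul_comm]
  have h2 : ‖h (x + y * Complex.I)‖ ≤ M := hM _ (by simpa using hy)
  have h3 : ‖Complex.exp (-(2 * Real.pi * Complex.I * n * (x + y * Complex.I)))‖
      = Real.exp (-(2 * Real.pi * b)) ^ n.natAbs := by
    rw [Complex.norm_exp, ← Real.exp_nat_mul]
    congr 1
    have : (-(2 * (Real.pi : ℂ) * Complex.I * n * (x + y * Complex.I)))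
        = ((2 * Real.pi * (n * y) : ℝ) : ℂ) + ((-(2 * Real.pi * n * x) : ℝ) : ℂ) * Complex.I := by
      push_cast
      linear_combination (-(2 * (Real.pi : ℂ) * n * y)) * Complex.I_sq
    rw [this, hny]
    simp
    ring
  rw [h3]
  gcongr

/-- A geometric sum whose ratio is an N-th root of unity different from 1. -/
theorem midpoint_sum_exp (N : ℕ) (hN : 1 ≤ N) (n : ℤ) :
    (¬ (N : ℤ) ∣ n → ∑ q : Fin N, Complex.exp (2 * Real.pi * Complex.I * n * (node N q : ℝ)) = 0) := by
  intro hn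
  have hN0 : (N : ℂ) ≠ 0 := by exact_mod_cast (by omega : N ≠ 0)
  set ζ := Complex.exp (2 * Real.pi * Complex.I * n / N) with hζ
  have h1 : ∀ q : Fin N, Complex.exp (2 * Real.pi * Complex.I * n * (node N q : ℝ))
      = Complex.exp (Real.pi * Complex.I * n / N) * ζ ^ (q : ℕ) := by
    intro q
    rw [hζ, ← Complex.exp_nat_mul, ← Complex.exp_add]
    congr 1
    rw [node]
    push_cast
    field_simp
    ring
  simp_rw [h1]
  rw [← Finset.mul_sum, Fin.sum_univ_eq_sum_range (fun q => ζ ^ q)]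
  have hζ1 : ζ ≠ 1 := by
    intro h
    rw [hζ, Complex.exp_eq_one_iff] at h
    obtain ⟨m, hm⟩ := h
    apply hn
    refine ⟨m, ?_⟩
    have hpi : (Real.pi : ℂ) ≠ 0 := by exact_mod_cast Real.pi_ne_zero
    have hI := Complex.I_ne_zero
    have h2 : (n : ℂ) = N * m := by
      field_simp at hm
      exact hm
    exact_mod_cast h2
  have hζN : ζ ^ N = 1 := by
    rw [hζ, ← Complex.exp_nat_mul, Complex.exp_eq_one_iff]
    exact ⟨n, by field_simp⟩
  rw [geom_sum_eq hζ1, hζN, sub_self, zero_div, mul_zero]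

theorem hasSum_two_sided_geometric {x : ℝ} (hx0 : 0 ≤ x) (hx1 : x < 1) (M : ℝ) :
    HasSum (fun m : ℤ => if m = 0 then 0 else M * x ^ m.natAbs) (2 * M * (x / (1 - x))) := by
  have h1 : HasSum (fun n : ℕ => M * x ^ (n + 1)) (M * (x / (1 - x))) := by
    have h := ((hasSum_geometric_of_lt_one hx0 hx1).mul_left x).mul_left M
    have e : (fun n : ℕ => M * (x * x ^ n)) = fun n => M * x ^ (n + 1) := by
      funext n; rw [pow_succ']
    rw [e] at h
    exact h
  have h2 : HasSum (fun n : ℕ => if (n : ℤ) = 0 then 0 else M * x ^ (n : ℤ).natAbs)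
      (M * (x / (1 - x))) := by
    rw [← hasSum_nat_add_iff' 1]
    have e : (fun n : ℕ => if ((n + 1 : ℕ) : ℤ) = 0 then 0 else M * x ^ ((n + 1 : ℕ) : ℤ).natAbs)
        = fun n => M * x ^ (n + 1) := by
      funext n
      rw [if_neg (by omega), Int.natAbs_natCast]
    rw [e]
    simpa using h1
  have h3 : HasSum (fun n : ℕ => if (-((n : ℤ) + 1)) = 0 then 0 else M * x ^ (-((n : ℤ) + 1)).natAbs)
      (M * (x / (1 - x))) := by
    have e : (fun n : ℕ => if (-((n : ℤ) + 1)) = 0 then 0 else M * x ^ (-((n : ℤ) + 1)).natAbs)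
        = fun n => M * x ^ (n + 1) := by
      funext n
      rw [if_neg (by omega), Int.natAbs_neg]
      rfl
    rw [e]
    exact h1
  have h4 := HasSum.of_nat_of_neg_add_one
    (f := fun m : ℤ => if m = 0 then 0 else M * x ^ m.natAbs) h2 h3
  have e : 2 * M * (x / (1 - x)) = M * (x / (1 - x)) + M * (x / (1 - x)) := by ring
  rw [e]
  exact h4

/-- On Fourier modes the midpoint rule errs only at the nonzero multiples of N, where it returns a
unimodular multiple of the coefficient. Summing the bounds M e^{−2πb|n|} over those n gives the
estimate. Taking b < c keeps the shifted contour inside the open strip; b → c follows afterwards. -/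
theorem midpoint_error_aux (hd : DifferentiableOn ℂ h {z | |z.im| < c})
    (hper : ∀ z : ℂ, |z.im| < c → h (z + 1) = h z) (hM : ∀ z : ℂ, |z.im| < c → ‖h z‖ ≤ M)
    (b : ℝ) (hb0 : 0 < b) (hb : b < c) (N : ℕ) (hN : 1 ≤ N) :
    ‖(∫ x in (0 : ℝ)..1, h x) - 1 / (N : ℂ) * ∑ q : Fin N, h (node N q : ℝ)‖
      ≤ 2 * M / (Real.exp (2 * Real.pi * N * b) - 1) := by
  have hM0 : 0 ≤ M := (norm_nonneg _).trans (hM 0 (by simp; linarith))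
  have hN0 : (N : ℂ) ≠ 0 := by exact_mod_cast (by omega : N ≠ 0)
  have hpi := Real.pi_pos
  set x := Real.exp (-(2 * Real.pi * b)) with hx
  have hx0 : 0 < x := Real.exp_pos _
  have hx1 : x < 1 := by rw [hx, Real.exp_lt_one_iff]; have := mul_pos hpi hb0; linarith
  have hcont : Continuous fun x : ℝ => h x := by
    rw [continuous_iff_continuousAt]
    intro t
    have : DifferentiableAt ℂ h (t : ℂ) := (hd t (by simp; linarith)).differentiableAt
      ((isOpen_lt (by fun_prop) continuous_const).mem_nhds (by simp; linarith))
    exact this.continuousAt.comp Complex.continuous_ofReal.continuousAt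
  have hperR : Function.Periodic (fun x : ℝ => h x) 1 := fun t => by
    simpa using hper t (by simp; linarith)
  have : Fact ((0 : ℝ) < 1) := ⟨one_pos⟩
  let F : C(AddCircle (1 : ℝ), ℂ) := ⟨hperR.lift, continuous_coinduced_dom.mpr hcont⟩
  have hF : ∀ t : ℝ, F (t : AddCircle (1 : ℝ)) = h t := fun t => rfl
  have hcoeff : ∀ n : ℤ, fourierCoeff F n
      = ∫ x in (0 : ℝ)..1, Complex.exp (-(2 * Real.pi * Complex.I * n * x)) * h x := by
    intro n
    rw [fourierCoeff_eq_intervalIntegral F n 0]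
    simp only [zero_add, div_one, one_smul]
    refine intervalIntegral.integral_congr fun t _ => ?_
    simp only [hF, fourier_coe_apply, smul_eq_mul]
    congr 2
    push_cast; ring
  have hcb : ∀ n, ‖fourierCoeff F n‖ ≤ M * x ^ n.natAbs := fun n => by
    rw [hcoeff]; exact norm_fourier_integral_le hd hper hM b hb0.le hb n
  have hsum : Summable (fourierCoeff F) := by
    apply Summable.of_norm_bounded (g := fun n : ℤ => M * x ^ n.natAbs) _ hcb
    apply Summable.mul_left
    refine Summable.of_nat_of_neg ?_ ?_ <;>
    simpa using summable_geometric_of_lt_one hx0.le hx1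
  have hpt : ∀ t : ℝ, HasSum (fun n : ℤ => fourierCoeff F n
      * Complex.exp (2 * Real.pi * Complex.I * n * t)) (h t) := by
    intro t
    have := has_pointwise_sum_fourier_series_of_summable hsum (t : AddCircle (1 : ℝ))
    rw [hF] at this
    simpa only [fourier_coe_apply, smul_eq_mul, Complex.ofReal_one, div_one] using this
  have hQ : HasSum (fun n : ℤ => 1 / (N : ℂ) * ∑ q : Fin N, fourierCoeff F n
      * Complex.exp (2 * Real.pi * Complex.I * n * (node N q : ℝ)))
      (1 / (N : ℂ) * ∑ q : Fin N, h (node N q : ℝ)) :=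
    (hasSum_sum fun q _ => hpt (node N q)).mul_left _
  have hI : HasSum (fun n : ℤ => if n = 0 then fourierCoeff F 0 else 0)
      (∫ x in (0 : ℝ)..1, h x) := by
    have e : ∫ x in (0 : ℝ)..1, h x = fourierCoeff F 0 := by rw [hcoeff]; simp
    rw [e]
    exact hasSum_ite_eq 0 _
  have hdiff := hI.sub hQ
  -- the error only sees the multiples of `N`
  have hterm : ∀ n : ℤ, ‖(if n = 0 then fourierCoeff F 0 else 0) - 1 / (N : ℂ) * ∑ q : Fin N,
      fourierCoeff F n * Complex.exp (2 * Real.pi * Complex.I * n * (node N q : ℝ))‖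
      ≤ if (N : ℤ) ∣ n ∧ n ≠ 0 then M * x ^ n.natAbs else 0 := by
    intro n
    rw [← Finset.mul_sum]
    by_cases hn0 : n = 0
    · subst hn0
      simp
      field_simp
      simp
    · rw [if_neg hn0, zero_sub, norm_neg]
      by_cases hdv : (N : ℤ) ∣ n
      · rw [if_pos ⟨hdv, hn0⟩]
        rw [norm_mul, norm_mul, mul_left_comm]
        refine mul_le_of_le_one_right (norm_nonneg _) ?_ |>.trans (hcb n)
        have hle : ‖∑ q : Fin N, Complex.exp (2 * Real.pi * Complex.I * n * (node N q : ℝ))‖ ≤ N := by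
          refine (norm_sum_le _ _).trans ?_
          have : ∀ q : Fin N, ‖Complex.exp (2 * Real.pi * Complex.I * n * (node N q : ℝ))‖ = 1 := by
            intro q
            have e : 2 * (Real.pi : ℂ) * Complex.I * n * (node N q : ℝ)
              = ((2 * Real.pi * n * node N q : ℝ) : ℂ) * Complex.I := by push_cast; ring
            rw [e, Complex.norm_exp_ofReal_mul_I]
          simp [this]
        rw [norm_div, norm_one, Complex.norm_natCast]
        rw [one_div, inv_mul_le_iff₀ (by exact_mod_cast hN)]
        simpa using hle
      · rw [if_neg (fun h => hdv h.1), midpoint_sum_exp N hN n hdv]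
        simp
  have hgeo : HasSum (fun n : ℤ => if (N : ℤ) ∣ n ∧ n ≠ 0 then M * x ^ n.natAbs else 0)
      (2 * M * (x ^ N / (1 - x ^ N))) := by
    have hinj : Function.Injective fun m : ℤ => (N : ℤ) * m :=
      mul_right_injective₀ (by exact_mod_cast (by omega : N ≠ 0))
    rw [← hinj.hasSum_iff]
    · have := hasSum_two_sided_geometric (x := x ^ N) (by positivity)
        (pow_lt_one₀ hx0.le hx1 (by omega)) M
      convert! this using 2 with m
      simp only [Function.comp_apply]
      by_cases hm : m = 0
      · simp [hm]
      · rw [if_pos ⟨dvd_mul_right _ _, mul_ne_zero (by exact_mod_cast (by omega : N ≠ 0)) hm⟩,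
          if_neg hm, Int.natAbs_mul, Int.natAbs_natCast, pow_mul]
    · intro n hn
      rw [if_neg]
      rintro ⟨⟨m, rfl⟩, _⟩
      exact hn ⟨m, rfl⟩
  have h1 : ‖(∫ x in (0 : ℝ)..1, h x) - 1 / (N : ℂ) * ∑ q : Fin N, h (node N q : ℝ)‖
      ≤ 2 * M * (x ^ N / (1 - x ^ N)) := by
    rw [← hdiff.tsum_eq]
    exact tsum_of_norm_bounded hgeo hterm
  have h2 : x ^ N = (Real.exp (2 * Real.pi * N * b))⁻¹ := by
    rw [hx, ← Real.exp_nat_mul, ← Real.exp_neg]; congr 1; ring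
  have hX : 1 < Real.exp (2 * Real.pi * N * b) := by
    rw [Real.one_lt_exp_iff]
    have : (0 : ℝ) < N := by exact_mod_cast hN
    positivity
  refine h1.trans_eq ?_
  rw [h2]
  set X := Real.exp (2 * Real.pi * N * b)
  have hX0 : X ≠ 0 := by positivity
  have hX1 : X - 1 ≠ 0 := by linarith
  have : 1 - X⁻¹ = (X - 1) / X := by field_simp
  rw [this]
  field_simp

/-- The midpoint rule converges exponentially for periodic functions analytic in a strip. -/
theorem midpoint_error (hc : 0 < c) (hd : DifferentiableOn ℂ h {z | |z.im| < c})
    (hper : ∀ z : ℂ, |z.im| < c → h (z + 1) = h z) (hM : ∀ z : ℂ, |z.im| < c → ‖h z‖ ≤ M)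
    (N : ℕ) (hN : 1 ≤ N) :
    ‖(∫ x in (0 : ℝ)..1, h x) - 1 / (N : ℂ) * ∑ q : Fin N, h (node N q : ℝ)‖
      ≤ 2 * M / (Real.exp (2 * Real.pi * N * c) - 1) := by
  have hN' : (0 : ℝ) < N := by exact_mod_cast hN
  have hX : 1 < Real.exp (2 * Real.pi * N * c) := by
    rw [Real.one_lt_exp_iff]
    positivity
  have hlim : Tendsto (fun b : ℝ => 2 * M / (Real.exp (2 * Real.pi * N * b) - 1)) (𝓝[<] c)
      (𝓝 (2 * M / (Real.exp (2 * Real.pi * N * c) - 1))) := by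
    refine Tendsto.mono_left ?_ nhdsWithin_le_nhds
    refine Tendsto.div tendsto_const_nhds ?_ (by linarith)
    exact Continuous.tendsto (by fun_prop) c
  refine ge_of_tendsto hlim ?_
  filter_upwards [Ioo_mem_nhdsLT hc] with b hb
  exact midpoint_error_aux hd hper hM b hb.1 hb.2 N hN

end Quadrature

/-! ### Majorants of the kernel terms and their sums -/

theorem summable_and_tsum_le_of_telescope {h Φ : ℕ → ℝ} (h0 : ∀ n, 0 ≤ h n) (hΦ : ∀ n, 0 ≤ Φ n)
    (hle : ∀ n, h n ≤ Φ n - Φ (n + 1)) : Summable h ∧ ∑' n, h n ≤ Φ 0 := by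
  have hb : ∀ n, ∑ i ∈ Finset.range n, h i ≤ Φ 0 := by
    intro n
    have h1 : ∑ i ∈ Finset.range n, h i ≤ ∑ i ∈ Finset.range n, (Φ i - Φ (i + 1)) :=
      Finset.sum_le_sum fun i _ => hle i
    rw [Finset.sum_range_sub'] at h1
    linarith [hΦ n]
  have hs := summable_of_sum_range_le h0 hb
  exact ⟨hs, hs.tsum_le_of_sum_range_le hb⟩

theorem hasSum_natAbs {F : ℕ → ℝ} {S : ℝ} (h : HasSum (fun n => F (n + 1)) S) :
    HasSum (fun j : ℤ => F j.natAbs) (F 0 + 2 * S) := by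
  have h1 : HasSum (fun n : ℕ => F (n : ℤ).natAbs) (F 0 + S) := by
    simp only [Int.natAbs_natCast]
    rw [← hasSum_nat_add_iff' 1]
    simpa using h
  have h2 : HasSum (fun n : ℕ => F (-((n : ℤ) + 1)).natAbs) S := by
    have e : (fun n : ℕ => F (-((n : ℤ) + 1)).natAbs) = fun n => F (n + 1) := by
      funext n; rw [Int.natAbs_neg]; rfl
    rw [e]; exact h
  have h3 := HasSum.of_nat_of_neg_add_one (f := fun j : ℤ => F j.natAbs) h1 h2
  have e : F 0 + 2 * S = F 0 + S + S := by ring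
  rw [e]; exact h3

/-- `1 / (2 sinh(λ u / 2))` with `λ = |log α|`. -/
def invSinh (α u : ℝ) : ℝ := (2 * Real.sinh (|Real.log α| * u / 2))⁻¹

/-- `1 / (2 cosh(λ u / 2))` with `λ = |log α|`. -/
def invCosh (α u : ℝ) : ℝ := (2 * Real.cosh (|Real.log α| * u / 2))⁻¹

section
variable {α : ℝ} (hα0 : 0 < α) (hα1 : α < 1)

include hα0 hα1 in
theorem abs_log_pos : 0 < |Real.log α| := abs_pos.mpr (Real.log_neg hα0 hα1).ne

include hα0 hα1 in
theorem abs_log_eq : |Real.log α| = -Real.log α := abs_of_neg (Real.log_neg hα0 hα1)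

include hα0 hα1 in
theorem exp_abs_log_mul (u : ℝ) : Real.exp (|Real.log α| * u) = α ^ (-u) := by
  rw [abs_log_eq hα0 hα1, Real.rpow_def_of_pos hα0]; congr 1; ring

include hα0 hα1 in
theorem invSinh_eq (u : ℝ) : invSinh α u = (α ^ (-u / 2) - α ^ (u / 2))⁻¹ := by
  have h1 := exp_abs_log_mul hα0 hα1 (u / 2)
  have h2 := exp_abs_log_mul hα0 hα1 (-(u / 2))
  rw [invSinh, Real.sinh_eq]
  congr 1
  rw [mul_div_assoc, h1, ← mul_neg, h2, neg_neg, neg_div]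
  ring

include hα0 hα1 in
theorem invCosh_eq (u : ℝ) : invCosh α u = (α ^ (-u / 2) + α ^ (u / 2))⁻¹ := by
  have h1 := exp_abs_log_mul hα0 hα1 (u / 2)
  have h2 := exp_abs_log_mul hα0 hα1 (-(u / 2))
  rw [invCosh, Real.cosh_eq]
  congr 1
  rw [mul_div_assoc, h1, ← mul_neg, h2, neg_neg, neg_div]
  ring

include hα0 hα1 in
theorem sinh_half_pos {u : ℝ} (hu : 0 < u) : 0 < Real.sinh (|Real.log α| * u / 2) := by
  rw [Real.sinh_pos_iff]
  have := abs_log_pos hα0 hα1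
  positivity

include hα0 hα1 in
theorem invSinh_pos {u : ℝ} (hu : 0 < u) : 0 < invSinh α u := by
  have := sinh_half_pos hα0 hα1 hu
  rw [invSinh]; positivity

theorem invCosh_pos (u : ℝ) : 0 < invCosh α u := by
  have := Real.cosh_pos (|Real.log α| * u / 2)
  rw [invCosh]; positivity

include hα0 hα1 in
theorem invSinh_anti {u v : ℝ} (hu : 0 < u) (huv : u ≤ v) : invSinh α v ≤ invSinh α u := by
  have h0 := abs_log_pos hα0 hα1
  have h1 := sinh_half_pos hα0 hα1 hu
  rw [invSinh, invSinh]
  gcongr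
  rw [Real.sinh_le_sinh]
  gcongr

theorem invCosh_anti {u v : ℝ} (hu : 0 ≤ u) (huv : u ≤ v) : invCosh α v ≤ invCosh α u := by
  have h1 := Real.cosh_pos (|Real.log α| * u / 2)
  rw [invCosh, invCosh]
  gcongr
  have h2 : |Real.log α| * u / 2 ≤ |Real.log α| * v / 2 := by gcongr
  have h3 : 0 ≤ |Real.log α| * u / 2 := by positivity
  rwa [Real.cosh_le_cosh, abs_of_nonneg h3, abs_of_nonneg (h3.trans h2)]

/-- An antiderivative of `-invSinh`. -/
def primSinh (α u : ℝ) : ℝ := -(Real.log (Real.tanh (|Real.log α| * u / 4)) / |Real.log α|)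

/-- An antiderivative of `-invCosh`. -/
def primCosh (α u : ℝ) : ℝ := 2 / |Real.log α| * Real.arctan (α ^ (u / 2))

include hα0 hα1 in
theorem primSinh_nonneg {u : ℝ} (hu : 0 < u) : 0 ≤ primSinh α u := by
  have h0 := abs_log_pos hα0 hα1
  have h1 : 0 < Real.tanh (|Real.log α| * u / 4) := by
    rw [Real.tanh_eq_sinh_div_cosh]
    have := Real.cosh_pos (|Real.log α| * u / 4)
    have : 0 < Real.sinh (|Real.log α| * u / 4) := Real.sinh_pos_iff.mpr (by positivity)
    positivity
  have h2 := (Real.tanh_lt_one (|Real.log α| * u / 4)).le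
  have := Real.log_nonpos h1.le h2
  rw [primSinh, neg_nonneg]
  exact div_nonpos_of_nonpos_of_nonneg this h0.le

include hα0 hα1 in
theorem primCosh_nonneg (u : ℝ) : 0 ≤ primCosh α u := by
  have h0 := abs_log_pos hα0 hα1
  have := Real.arctan_nonneg.mpr (Real.rpow_nonneg hα0.le (u / 2))
  rw [primCosh]; positivity

include hα0 hα1 in
theorem hasDerivAt_primSinh {u : ℝ} (hu : 0 < u) :
    HasDerivAt (primSinh α) (-invSinh α u) u := by
  have h0 := abs_log_pos hα0 hα1
  set l := |Real.log α| with hl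
  have hs : ∀ v, 0 < v → 0 < Real.sinh (l * v / 4) := fun v hv =>
    Real.sinh_pos_iff.mpr (by positivity)
  have hlin : HasDerivAt (fun v => l * v / 4) (l / 4) u := by
    simpa using ((hasDerivAt_id u).const_mul l).div_const 4
  have h1 : HasDerivAt (fun v => -((Real.log (Real.sinh (l * v / 4))
      - Real.log (Real.cosh (l * v / 4))) / l))
      (-((Real.cosh (l * u / 4) * (l / 4) / Real.sinh (l * u / 4)
        - Real.sinh (l * u / 4) * (l / 4) / Real.cosh (l * u / 4)) / l)) u :=
    (((hlin.sinh.log (hs u hu).ne').sub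
      (hlin.cosh.log (Real.cosh_pos _).ne')).div_const l).neg
  have e : -((Real.cosh (l * u / 4) * (l / 4) / Real.sinh (l * u / 4)
        - Real.sinh (l * u / 4) * (l / 4) / Real.cosh (l * u / 4)) / l) = -invSinh α u := by
    rw [invSinh, ← hl]
    have h2 : l * u / 2 = 2 * (l * u / 4) := by ring
    rw [h2, Real.sinh_two_mul]
    have hs' := (hs u hu).ne'
    have hc' := (Real.cosh_pos (l * u / 4)).ne'
    have hcs := Real.cosh_sq_sub_sinh_sq (l * u / 4)
    field_simp
    linear_combination (-4) * hcs
  rw [← e]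
  refine h1.congr_of_eventuallyEq ?_
  filter_upwards [Ioi_mem_nhds hu] with v hv
  rw [primSinh, Real.tanh_eq_sinh_div_cosh, Real.log_div (hs v hv).ne' (Real.cosh_pos _).ne']

include hα0 hα1 in
theorem hasDerivAt_primCosh (u : ℝ) : HasDerivAt (primCosh α) (-invCosh α u) u := by
  have h0 := abs_log_pos hα0 hα1
  have hlin : HasDerivAt (fun v : ℝ => v / 2) (1 / 2) u := (hasDerivAt_id u).div_const 2
  have h1 : HasDerivAt (fun v => 2 / |Real.log α| * Real.arctan (α ^ (v / 2))) _ u :=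
    ((hlin.const_rpow hα0).arctan.const_mul (2 / |Real.log α|))
  convert! h1 using 1
  rw [invCosh_eq hα0 hα1, abs_log_eq hα0 hα1]
  have hp : 0 < α ^ (u / 2) := Real.rpow_pos_of_pos hα0 _
  have e : α ^ (-u / 2) = (α ^ (u / 2))⁻¹ := by rw [neg_div, Real.rpow_neg hα0.le]
  have hl := (Real.log_neg hα0 hα1).ne
  rw [e]
  field_simp

-- The mean value theorem yields a point of (u, u + 1) at which `invSinh` equals the difference of
-- the primitive, and `invSinh` decreases: the integral test in telescoping form.
include hα0 hα1 in
theorem invSinh_le_primSinh {u : ℝ} (hu : 0 < u) :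
    invSinh α (u + 1) ≤ primSinh α u - primSinh α (u + 1) := by
  obtain ⟨v, hv, he⟩ := exists_hasDerivAt_eq_slope (primSinh α) (fun v => -invSinh α v)
    (by linarith : u < u + 1)
    (fun v hv => (hasDerivAt_primSinh hα0 hα1 (by linarith [hv.1])).continuousAt.continuousWithinAt)
    (fun v hv => hasDerivAt_primSinh hα0 hα1 (by linarith [hv.1]))
  have := invSinh_anti hα0 hα1 (by linarith [hv.1]) hv.2.le
  have e2 : u + 1 - u = 1 := by ring
  rw [e2, div_one] at he
  linarith

include hα0 hα1 in
theorem invCosh_le_primCosh {u : ℝ} (hu : 0 ≤ u) :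
    invCosh α (u + 1) ≤ primCosh α u - primCosh α (u + 1) := by
  obtain ⟨v, hv, he⟩ := exists_hasDerivAt_eq_slope (primCosh α) (fun v => -invCosh α v)
    (by linarith : u < u + 1)
    (fun v hv => (hasDerivAt_primCosh hα0 hα1 v).continuousAt.continuousWithinAt)
    (fun v hv => hasDerivAt_primCosh hα0 hα1 v)
  have := invCosh_anti (α := α) (by linarith [hv.1] : 0 ≤ v) hv.2.le
  have e2 : u + 1 - u = 1 := by ring
  rw [e2, div_one] at he
  linarith

include hα0 hα1 in
theorem tail_invSinh (n : ℕ) (hn : 1 ≤ n) :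
    Summable (fun i : ℕ => invSinh α ((i + n + 1 : ℕ) : ℝ)) ∧
      ∑' i : ℕ, invSinh α ((i + n + 1 : ℕ) : ℝ) ≤ primSinh α n := by
  have hpos : ∀ i : ℕ, (0 : ℝ) < ((i + n : ℕ) : ℝ) := fun i => by
    exact_mod_cast (by omega : 0 < i + n)
  have := summable_and_tsum_le_of_telescope (h := fun i : ℕ => invSinh α ((i + n + 1 : ℕ) : ℝ))
    (Φ := fun i : ℕ => primSinh α ((i + n : ℕ) : ℝ))
    (fun i => (invSinh_pos hα0 hα1 (by exact_mod_cast Nat.succ_pos _)).le)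
    (fun i => primSinh_nonneg hα0 hα1 (hpos i)) (fun i => by
      have := invSinh_le_primSinh hα0 hα1 (hpos i)
      have e : i + 1 + n = i + n + 1 := by ring
      simp only [e]
      push_cast at this ⊢
      exact this)
  simpa using this

include hα0 hα1 in
theorem tail_invCosh (n : ℕ) :
    Summable (fun i : ℕ => invCosh α ((i + n + 1 : ℕ) : ℝ)) ∧
      ∑' i : ℕ, invCosh α ((i + n + 1 : ℕ) : ℝ) ≤ primCosh α n := by
  have := summable_and_tsum_le_of_telescope (h := fun i : ℕ => invCosh α ((i + n + 1 : ℕ) : ℝ))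
    (Φ := fun i : ℕ => primCosh α ((i + n : ℕ) : ℝ))
    (fun i => (invCosh_pos _).le)
    (fun i => primCosh_nonneg hα0 hα1 _) (fun i => by
      have := invCosh_le_primCosh hα0 hα1 (Nat.cast_nonneg (α := ℝ) (i + n))
      have e : i + 1 + n = i + n + 1 := by ring
      simp only [e]
      push_cast at this ⊢
      exact this)
  simpa using this

-- `calB α (n + 2)` is the primitive at n + 1 divided by α^{1/2} ≤ 1, so the inequality gives away a
-- factor α^{−1/2}.
include hα0 hα1 in
theorem primSinh_le_calB (n : ℕ) : primSinh α (n + 1 : ℕ) ≤ calB α (n + 2) := by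
  have h0 := abs_log_pos hα0 hα1
  have h1 := primSinh_nonneg hα0 hα1 (u := (n + 1 : ℕ)) (by exact_mod_cast Nat.succ_pos n)
  have hr : 0 < α ^ (1 / 2 : ℝ) := Real.rpow_pos_of_pos hα0 _
  have hr1 : α ^ (1 / 2 : ℝ) ≤ 1 := Real.rpow_le_one hα0.le hα1.le (by norm_num)
  have e : calB α (n + 2) = primSinh α (n + 1 : ℕ) / α ^ (1 / 2 : ℝ) := by
    rw [calB, primSinh, abs_log_eq hα0 hα1]
    have hl := (Real.log_neg hα0 hα1).ne
    have e1 : (((n + 2 : ℕ) : ℝ) - 1) * -Real.log α / 4 = -Real.log α * ((n + 1 : ℕ) : ℝ) / 4 := by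
      push_cast; ring
    rw [e1]
    field_simp
  rw [e, le_div_iff₀ hr]
  nlinarith

include hα0 hα1 in
theorem primCosh_eq_calC (n : ℕ) : primCosh α n = α ^ 2 * calC α n := by
  have h0 := (abs_log_pos hα0 hα1).ne'
  rw [primCosh, calC]
  field_simp

-- The right-hand side equals α^{−1/2} times the left, the same factor that `calB` gives away.
include hα0 hα1 in
theorem invSinh_le_term (j : ℕ) (hj : 2 ≤ j) :
    invSinh α ((j - 1 : ℕ) : ℝ) ≤ α ^ ((j : ℝ) / 2) / (α - α ^ j) := by
  have hlt : α ^ j < α := pow_lt_self_of_lt_one₀ hα0 hα1 (by omega)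
  have e1 : ((j - 1 : ℕ) : ℝ) = (j : ℝ) - 1 := by
    rw [Nat.cast_sub (by omega)]; simp
  rw [invSinh_eq hα0 hα1, e1]
  have hp : 0 < α ^ ((j : ℝ) / 2) := Real.rpow_pos_of_pos hα0 _
  have h2 : α ^ (-((j : ℝ) - 1) / 2) - α ^ (((j : ℝ) - 1) / 2)
      = (α - α ^ j) / α ^ ((j : ℝ) / 2) * α ^ (-(1 / 2) : ℝ) := by
    have a1 : α ^ (-((j : ℝ) - 1) / 2) = α ^ (1 : ℝ) * (α ^ ((j : ℝ) / 2))⁻¹ * α ^ (-(1 / 2) : ℝ) := by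
      rw [← Real.rpow_neg hα0.le, ← Real.rpow_add hα0, ← Real.rpow_add hα0]
      congr 1; ring
    have a2 : α ^ (((j : ℝ) - 1) / 2) = α ^ (j : ℝ) * (α ^ ((j : ℝ) / 2))⁻¹ * α ^ (-(1 / 2) : ℝ) := by
      rw [← Real.rpow_neg hα0.le, ← Real.rpow_add hα0, ← Real.rpow_add hα0]
      congr 1; ring
    rw [a1, a2, Real.rpow_one, Real.rpow_natCast]
    field_simp
  have hge : 1 ≤ α ^ (-(1 / 2) : ℝ) :=
    Real.one_le_rpow_of_pos_of_le_one_of_nonpos hα0 hα1.le (by norm_num)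
  have hq : 0 < (α - α ^ j) / α ^ ((j : ℝ) / 2) := div_pos (by linarith) hp
  have h3 : (α - α ^ j) / α ^ ((j : ℝ) / 2)
      ≤ α ^ (-((j : ℝ) - 1) / 2) - α ^ (((j : ℝ) - 1) / 2) := by
    rw [h2]; exact le_mul_of_one_le_right hq.le hge
  calc _ ≤ ((α - α ^ j) / α ^ ((j : ℝ) / 2))⁻¹ := inv_anti₀ hq h3
    _ = _ := by rw [inv_div]

include hα0 hα1 in
theorem summable_invSinh : Summable (fun i : ℕ => invSinh α ((i + 1 : ℕ) : ℝ)) := by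
  have := (tail_invSinh hα0 hα1 1 le_rfl).1
  exact (summable_nat_add_iff (f := fun i : ℕ => invSinh α ((i + 1 : ℕ) : ℝ)) 1).mp this

include hα0 hα1 in
theorem tsum_invSinh_le : ∑' i : ℕ, invSinh α ((i + 1 : ℕ) : ℝ) ≤ calBStar α 10 := by
  have hs := summable_invSinh hα0 hα1
  -- The values at 1, …, 9 are matched with the summands j = 2, …, 10 of `calBStar`. The tail
  -- starting at 10 is bounded by the primitive at 9, hence by `calB α 10`.
  rw [← hs.sum_add_tsum_nat_add 9]
  have h1 := (tail_invSinh hα0 hα1 9 (by norm_num)).2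
  have h2 := primSinh_le_calB hα0 hα1 8
  rw [calBStar]
  refine add_le_add ?_ (h1.trans h2)
  have e : ∑ j ∈ Finset.Icc (2 : ℕ) 10, α ^ ((j : ℝ) / 2) / (α - α ^ j)
      = ∑ i ∈ Finset.range 9, α ^ (((i + 2 : ℕ) : ℝ) / 2) / (α - α ^ (i + 2)) := by
    have e0 : (Finset.Icc 2 10 : Finset ℕ) = Finset.Ico 2 11 := rfl
    rw [e0, Finset.sum_Ico_eq_sum_range]
    refine Finset.sum_congr rfl fun i _ => ?_
    rw [add_comm 2 i]
  rw [e]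
  refine Finset.sum_le_sum fun i _ => ?_
  exact invSinh_le_term hα0 hα1 (i + 2) (by omega)

include hα0 hα1 in
theorem summable_invCosh : Summable (fun i : ℕ => invCosh α ((i + 1 : ℕ) : ℝ)) :=
  (tail_invCosh hα0 hα1 0).1

include hα0 hα1 in
theorem tsum_invCosh_le :
    1 / 2 + 2 * ∑' i : ℕ, invCosh α ((i + 1 : ℕ) : ℝ) ≤ α ^ 2 * calCStar α 10 := by
  have hs := summable_invCosh hα0 hα1
  rw [← hs.sum_add_tsum_nat_add 10]
  have h1 := (tail_invCosh hα0 hα1 10).2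
  rw [primCosh_eq_calC hα0 hα1] at h1
  have e : ∑ j ∈ Finset.Icc (1 : ℕ) 10, (α ^ ((j : ℝ) / 2) + α ^ (-((j : ℝ) / 2)))⁻¹
      = ∑ i ∈ Finset.range 10, invCosh α ((i + 1 : ℕ) : ℝ) := by
    have e0 : (Finset.Icc 1 10 : Finset ℕ) = Finset.Ico 1 11 := rfl
    rw [e0, Finset.sum_Ico_eq_sum_range]
    refine Finset.sum_congr rfl fun i _ => ?_
    rw [add_comm 1 i, invCosh_eq hα0 hα1, add_comm, neg_div]
  rw [calCStar, e]
  have e2 : α ^ 2 * (1 / (2 * α ^ 2) + 2 / α ^ 2 * ∑ i ∈ Finset.range 10, invCosh α ((i + 1 : ℕ) : ℝ)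
      + 2 * calC α 10) = 1 / 2 + 2 * ∑ i ∈ Finset.range 10, invCosh α ((i + 1 : ℕ) : ℝ)
      + 2 * (α ^ 2 * calC α 10) := by
    field_simp
  rw [e2]
  linarith

/-- The majorant of the terms of the diagonal blocks. -/
def majSame (α a b : ℝ) : ℕ → ℝ
  | 0 => a * α ^ (-(3 / 2) : ℝ)
  | 1 => a * α ^ (-2 : ℝ)
  | n + 2 => b * invSinh α ((n + 1 : ℕ) : ℝ)

/-- The majorant of the terms of the off-diagonal blocks. -/
def majCross (α b : ℝ) (n : ℕ) : ℝ := b * (α ^ 2)⁻¹ * invCosh α n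

include hα0 hα1 in
theorem majSame_nonneg {a b : ℝ} (ha : 0 ≤ a) (hb : 0 ≤ b) (n : ℕ) : 0 ≤ majSame α a b n := by
  match n with
  | 0 => exact mul_nonneg ha (Real.rpow_nonneg hα0.le _)
  | 1 => exact mul_nonneg ha (Real.rpow_nonneg hα0.le _)
  | n + 2 => exact mul_nonneg hb (invSinh_pos hα0 hα1 (by exact_mod_cast Nat.succ_pos n)).le

include hα0 in
theorem majCross_nonneg {b : ℝ} (hb : 0 ≤ b) (n : ℕ) : 0 ≤ majCross α b n :=
  mul_nonneg (by positivity) (invCosh_pos _).le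

include hα0 hα1 in
theorem summable_majSame_succ (a b : ℝ) : Summable fun n => majSame α a b (n + 1) := by
  refine (summable_nat_add_iff (f := fun n => majSame α a b (n + 1)) 1).mp ?_
  exact (summable_invSinh hα0 hα1).mul_left b

include hα0 hα1 in
theorem summable_majSame (a b : ℝ) : Summable fun j : ℤ => majSame α a b j.natAbs :=
  (hasSum_natAbs (summable_majSame_succ hα0 hα1 a b).hasSum).summable

include hα0 hα1 in
theorem tsum_majSame_le {a b : ℝ} (ha : 0 ≤ a) (hb : 0 ≤ b) :
    ∑' j : ℤ, majSame α a b j.natAbs ≤ 2 * a * calR α + 2 * b * calBStar α 10 := by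
  rw [(hasSum_natAbs (summable_majSame_succ hα0 hα1 a b).hasSum).tsum_eq]
  rw [(summable_majSame_succ hα0 hα1 a b).tsum_eq_zero_add]
  have h1 : ∑' n : ℕ, majSame α a b (n + 1 + 1) = b * ∑' i : ℕ, invSinh α ((i + 1 : ℕ) : ℝ) := by
    rw [← tsum_mul_left]; rfl
  rw [h1]
  have h2 := mul_le_mul_of_nonneg_left (tsum_invSinh_le hα0 hα1) hb
  -- 2ℜ = α^{−2} + α^{−3/2} + α^{−5/2}, so one of the two copies of α^{−2} is enlarged to α^{−5/2}.
  have h3 : α ^ (-(3 / 2) : ℝ) + 2 * α ^ (-2 : ℝ) ≤ 2 * calR α := by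
    have e1 : α ^ (1 / 2 : ℝ) / α ^ 2 = α ^ (-(3 / 2) : ℝ) := by
      rw [← Real.rpow_natCast, ← Real.rpow_sub hα0]; norm_num
    have e2 : α ^ (-(1 / 2) : ℝ) / α ^ 2 = α ^ (-(5 / 2) : ℝ) := by
      rw [← Real.rpow_natCast, ← Real.rpow_sub hα0]; norm_num
    have e3 : 1 / α ^ 2 = α ^ (-2 : ℝ) := by
      rw [Real.rpow_neg hα0.le, one_div]; norm_num
    have e4 : 2 * calR α = α ^ (-2 : ℝ) + α ^ (-(3 / 2) : ℝ) + α ^ (-(5 / 2) : ℝ) := by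
      rw [← e1, ← e2, ← e3, calR]; field_simp
    have h5 : α ^ (-2 : ℝ) ≤ α ^ (-(5 / 2) : ℝ) :=
      Real.rpow_le_rpow_of_exponent_ge hα0 hα1.le (by norm_num)
    linarith
  have h4 := mul_le_mul_of_nonneg_left h3 ha
  simp only [majSame]
  linarith

include hα0 hα1 in
theorem summable_majCross (b : ℝ) : Summable fun j : ℤ => majCross α b j.natAbs :=
  (hasSum_natAbs (F := majCross α b) ((summable_invCosh hα0 hα1).mul_left _).hasSum).summable

include hα0 hα1 in
theorem tsum_majCross_le {b : ℝ} (hb : 0 ≤ b) :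
    ∑' j : ℤ, majCross α b j.natAbs ≤ b * calCStar α 10 := by
  have hs := (summable_invCosh hα0 hα1).mul_left (b * (α ^ 2)⁻¹)
  rw [(hasSum_natAbs (F := majCross α b) hs.hasSum).tsum_eq, tsum_mul_left, majCross]
  have h1 := tsum_invCosh_le hα0 hα1
  have h2 : invCosh α (0 : ℕ) = 1 / 2 := by simp [invCosh]
  rw [h2]
  have h3 : 0 ≤ b * (α ^ 2)⁻¹ := by positivity
  have h4 := mul_le_mul_of_nonneg_left h1 h3
  have e : b * (α ^ 2)⁻¹ * (α ^ 2 * calCStar α 10) = b * calCStar α 10 := by field_simp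
  linarith

theorem tsum_tail_eq {F : ℕ → ℝ} (M : ℕ) (hs : Summable fun i : ℕ => F (i + M + 1)) :
    ∑' j : ℤ, (if j ∈ Finset.Icc (-(M : ℤ)) M then 0 else F j.natAbs)
      = 2 * ∑' i : ℕ, F (i + M + 1) := by
  set G : ℕ → ℝ := fun n => if n ≤ M then 0 else F n with hG
  have e : (fun j : ℤ => if j ∈ Finset.Icc (-(M : ℤ)) M then 0 else F j.natAbs)
      = fun j : ℤ => G j.natAbs := by
    funext j
    simp only [hG, Finset.mem_Icc]
    congr 1
    rw [eq_iff_iff]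
    omega
  have h1 : HasSum (fun n => G (n + 1)) (∑' i : ℕ, F (i + M + 1)) := by
    have h0 : ∑ i ∈ Finset.range M, G (i + 1) = 0 := by
      refine Finset.sum_eq_zero fun i hi => ?_
      simp only [hG]
      rw [if_pos (by have := Finset.mem_range.mp hi; omega)]
    rw [← hasSum_nat_add_iff' M, h0, sub_zero]
    have e2 : (fun n => G (n + M + 1)) = fun i => F (i + M + 1) := by
      funext i
      simp only [hG]
      rw [if_neg (by omega)]
    rw [e2]
    exact hs.hasSum
  rw [e, (hasSum_natAbs h1).tsum_eq]
  simp [hG]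

include hα0 hα1 in
theorem tsum_tail_majSame_le {a b : ℝ} (hb : 0 ≤ b) (M : ℕ) (hM : 2 ≤ M) :
    ∑' j : ℤ, (if j ∈ Finset.Icc (-(M : ℤ)) M then 0 else majSame α a b j.natAbs)
      ≤ 2 * b * calB α M := by
  -- M ≥ 2 keeps the argument of the hyperbolic tangent in `calB` positive; at M = 1 its logarithm
  -- would take the default value 0.
  obtain ⟨n, rfl⟩ : ∃ n, M = n + 2 := ⟨M - 2, by omega⟩
  have h1 := tail_invSinh hα0 hα1 (n + 1) (by omega)
  have e : (fun i : ℕ => majSame α a b (i + (n + 2) + 1))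
      = fun i : ℕ => b * invSinh α ((i + (n + 1) + 1 : ℕ) : ℝ) := by
    funext i; rfl
  rw [tsum_tail_eq _ (by rw [e]; exact h1.1.mul_left b)]
  rw [e, tsum_mul_left]
  have := mul_le_mul_of_nonneg_left (h1.2.trans (primSinh_le_calB hα0 hα1 n)) hb
  linarith

include hα0 hα1 in
theorem tsum_tail_majCross_le {b : ℝ} (hb : 0 ≤ b) (M : ℕ) :
    ∑' j : ℤ, (if j ∈ Finset.Icc (-(M : ℤ)) M then 0 else majCross α b j.natAbs)
      ≤ 2 * b * calC α M := by
  have h1 := tail_invCosh hα0 hα1 M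
  rw [tsum_tail_eq (F := majCross α b) _ (h1.1.mul_left _)]
  have e : (fun i : ℕ => majCross α b (i + M + 1))
      = fun i : ℕ => b * (α ^ 2)⁻¹ * invCosh α ((i + M + 1 : ℕ) : ℝ) := rfl
  rw [e, tsum_mul_left]
  have h3 : 0 ≤ b * (α ^ 2)⁻¹ := by positivity
  have h2 := h1.2
  rw [primCosh_eq_calC hα0 hα1] at h2
  have := mul_le_mul_of_nonneg_left h2 h3
  have e2 : b * (α ^ 2)⁻¹ * (α ^ 2 * calC α M) = b * calC α M := by field_simp
  linarith

include hα0 hα1 in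
theorem invCosh_le_geometric (n : ℕ) : invCosh α n ≤ (√α) ^ n := by
  have hq : 0 < √α := Real.sqrt_pos.mpr hα0
  have e : α ^ (-(n : ℝ) / 2) = ((√α) ^ n)⁻¹ := by
    rw [Real.sqrt_eq_rpow, ← Real.rpow_natCast, ← Real.rpow_mul hα0.le, ← Real.rpow_neg hα0.le]
    congr 1; ring
  rw [invCosh_eq hα0 hα1, e]
  have h1 : 0 < (√α) ^ n := by positivity
  have h2 : 0 < α ^ ((n : ℝ) / 2) := Real.rpow_pos_of_pos hα0 _
  calc _ ≤ (((√α) ^ n)⁻¹)⁻¹ := inv_anti₀ (by positivity) (by linarith)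
    _ = _ := inv_inv _

include hα0 hα1 in
theorem invSinh_le_geometric (n : ℕ) :
    invSinh α ((n + 1 : ℕ) : ℝ) ≤ (1 - α)⁻¹ * (√α) ^ (n + 1) := by
  have hq : 0 < √α := Real.sqrt_pos.mpr hα0
  have hq1 : √α ≤ 1 := Real.sqrt_le_one.mpr hα1.le
  have e : α ^ (-((n + 1 : ℕ) : ℝ) / 2) = ((√α) ^ (n + 1))⁻¹ := by
    rw [Real.sqrt_eq_rpow, ← Real.rpow_natCast, ← Real.rpow_mul hα0.le, ← Real.rpow_neg hα0.le]
    congr 1; ring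
  have e2 : α ^ (((n + 1 : ℕ) : ℝ) / 2) = (√α) ^ (n + 1) := by
    rw [Real.sqrt_eq_rpow, ← Real.rpow_natCast, ← Real.rpow_mul hα0.le]
    congr 1; ring
  rw [invSinh_eq hα0 hα1, e, e2]
  have h1 : 0 < (√α) ^ (n + 1) := by positivity
  have h2 : ((√α) ^ (n + 1)) ^ 2 ≤ α := by
    calc ((√α) ^ (n + 1)) ^ 2 = α ^ (n + 1) := by
          rw [← pow_mul, mul_comm, pow_mul, Real.sq_sqrt hα0.le]
      _ ≤ α ^ 1 := pow_le_pow_of_le_one hα0.le hα1.le (by omega)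
      _ = α := pow_one _
  have h3 : (1 - α) * ((√α) ^ (n + 1))⁻¹ ≤ ((√α) ^ (n + 1))⁻¹ - (√α) ^ (n + 1) := by
    set x := (√α) ^ (n + 1)
    have e3 : x⁻¹ - x = (1 - x ^ 2) * x⁻¹ := by field_simp
    rw [e3]
    gcongr
  have h4 : 0 < (1 - α) * ((√α) ^ (n + 1))⁻¹ := mul_pos (by linarith) (by positivity)
  calc _ ≤ ((1 - α) * ((√α) ^ (n + 1))⁻¹)⁻¹ := inv_anti₀ h4 h3
    _ = _ := by rw [mul_inv, inv_inv]

include hα0 hα1 in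
theorem majSame_le_geometric {a b : ℝ} (ha : 0 ≤ a) (hb : 0 ≤ b) :
    ∃ C, 0 ≤ C ∧ ∀ n, majSame α a b n ≤ C * (√α) ^ n := by
  have hq : 0 < √α := Real.sqrt_pos.mpr hα0
  have hα' : 0 < 1 - α := by linarith
  have p1 : 0 ≤ α ^ (-(3 / 2) : ℝ) := Real.rpow_nonneg hα0.le _
  have p2 : 0 ≤ α ^ (-2 : ℝ) := Real.rpow_nonneg hα0.le _
  refine ⟨a * α ^ (-(3 / 2) : ℝ) + a * α ^ (-2 : ℝ) * (√α)⁻¹ + b * ((1 - α)⁻¹ * (√α)⁻¹),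
    by positivity, fun n => ?_⟩
  match n with
  | 0 =>
    rw [pow_zero, mul_one, majSame]
    have : 0 ≤ a * α ^ (-2 : ℝ) * (√α)⁻¹ + b * ((1 - α)⁻¹ * (√α)⁻¹) := by positivity
    linarith
  | 1 =>
    rw [pow_one, majSame]
    have : 0 ≤ (a * α ^ (-(3 / 2) : ℝ) + b * ((1 - α)⁻¹ * (√α)⁻¹)) * √α := by positivity
    have e : a * α ^ (-2 : ℝ) * (√α)⁻¹ * √α = a * α ^ (-2 : ℝ) := by field_simp
    nlinarith
  | n + 2 =>
    rw [majSame]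
    have h1 := mul_le_mul_of_nonneg_left (invSinh_le_geometric hα0 hα1 n) hb
    have : 0 ≤ (a * α ^ (-(3 / 2) : ℝ) + a * α ^ (-2 : ℝ) * (√α)⁻¹) * (√α) ^ (n + 2) := by
      positivity
    have e : b * ((1 - α)⁻¹ * (√α)⁻¹) * (√α) ^ (n + 2) = b * ((1 - α)⁻¹ * (√α) ^ (n + 1)) := by
      rw [pow_succ (√α) (n + 1)]
      field_simp
    linarith

include hα0 hα1 in
theorem majCross_le_geometric {b : ℝ} (hb : 0 ≤ b) :
    ∃ C, 0 ≤ C ∧ ∀ n, majCross α b n ≤ C * (√α) ^ n :=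
  ⟨b * (α ^ 2)⁻¹, by positivity, fun n =>
    mul_le_mul_of_nonneg_left (invCosh_le_geometric hα0 hα1 n) (by positivity)⟩

include hα0 hα1 in
theorem tendsto_calC : Tendsto (calC α) atTop (𝓝 0) := by
  have h1 : Tendsto (fun n : ℕ => α ^ ((n : ℝ) / 2)) atTop (𝓝 0) := by
    have := tendsto_pow_atTop_nhds_zero_of_lt_one (Real.sqrt_nonneg α)
      (by rw [Real.sqrt_lt' one_pos]; simpa using hα1)
    refine this.congr fun n => ?_
    rw [Real.sqrt_eq_rpow, ← Real.rpow_natCast, ← Real.rpow_mul hα0.le]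
    congr 1; ring
  have h2 := ((Real.continuous_arctan.tendsto 0).comp h1).const_mul 2
    |>.div_const (α ^ 2 * |Real.log α|)
  simp only [Real.arctan_zero, mul_zero, zero_div] at h2
  exact h2

include hα0 hα1 in
theorem tendsto_calB : Tendsto (calB α) atTop (𝓝 0) := by
  have h0 := abs_log_pos hα0 hα1
  have h1 : Tendsto (fun n : ℕ => ((n : ℝ) - 1) * |Real.log α| / 4) atTop atTop := by
    refine Tendsto.atTop_div_const (by norm_num) ?_
    refine Tendsto.atTop_mul_const h0 ?_
    exact tendsto_atTop_add_const_right _ _ tendsto_natCast_atTop_atTop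
  have h2 : Tendsto Real.tanh atTop (𝓝 1) := by
    have e : ∀ x : ℝ, Real.tanh x = 1 - 2 * Real.exp (-(2 * x)) / (1 + Real.exp (-(2 * x))) := by
      intro x
      rw [Real.tanh_eq_sinh_div_cosh, Real.sinh_eq, Real.cosh_eq]
      have : Real.exp (-(2 * x)) = Real.exp (-x) * Real.exp (-x) := by
        rw [← Real.exp_add]; congr 1; ring
      rw [this]
      have h3 : Real.exp x * Real.exp (-x) = 1 := by rw [← Real.exp_add]; simp
      have p1 := Real.exp_pos x
      have p2 := Real.exp_pos (-x)
      have p3 : 1 + Real.exp (-x) * Real.exp (-x) ≠ 0 := by positivity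
      field_simp
      linear_combination (2 * Real.exp (-x)) * h3
    have h3 : Tendsto (fun x : ℝ => Real.exp (-(2 * x))) atTop (𝓝 0) := by
      refine Real.tendsto_exp_neg_atTop_nhds_zero.comp ?_
      exact Tendsto.const_mul_atTop (by norm_num) tendsto_id
    have h4 := ((h3.const_mul 2).div (h3.const_add 1) (by norm_num)).const_sub 1
    simp only [mul_zero, add_zero, zero_div, sub_zero] at h4
    exact h4.congr fun x => (e x).symm
  have h3 := ((Real.continuousAt_log one_ne_zero).tendsto.comp (h2.comp h1)).div_const
    (α ^ (1 / 2 : ℝ) * Real.log α)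
  rw [Real.log_one, zero_div] at h3
  exact h3

end

/-! ### Resolvents of matrices in the infinity norm -/

section MatrixNorm
open scoped Matrix.Norms.Operator

variable {ι : Type*} [Fintype ι] [DecidableEq ι]

theorem norm_mulVec_le_matInfNorm (A : Matrix ι ι ℂ) (v : ι → ℂ) :
    ‖A.mulVec v‖ ≤ matInfNorm A * ‖v‖ := Matrix.linfty_opNorm_mulVec A v

theorem sum_norm_row_le {𝕜 : Type*} [RCLike 𝕜] (A : Matrix ι ι 𝕜) (i : ι) :
    ∑ j, ‖A i j‖ ≤ matInfNorm A := by
  have h : ∑ j, ‖A i j‖₊ ≤ ‖A‖₊ := by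
    rw [Matrix.linfty_opNNNorm_def]
    exact Finset.le_sup (f := fun i => ∑ j, ‖A i j‖₊) (Finset.mem_univ i)
  have h2 := NNReal.coe_le_coe.mpr h
  rw [NNReal.coe_sum] at h2
  exact h2

theorem matInfNorm_le {𝕜 : Type*} [RCLike 𝕜] (A : Matrix ι ι 𝕜) {C : ℝ} (hC : 0 ≤ C)
    (h : ∀ i, ∑ j, ‖A i j‖ ≤ C) : matInfNorm A ≤ C := by
  have : ‖A‖₊ ≤ ⟨C, hC⟩ := by
    rw [Matrix.linfty_opNNNorm_def]
    refine Finset.sup_le fun i _ => ?_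
    have h2 := h i
    refine NNReal.coe_le_coe.mp ?_
    rw [NNReal.coe_sum]
    exact h2
  exact NNReal.coe_le_coe.mpr this

theorem norm_mulVec_le_of_row (A : Matrix ι ι ℂ) {C : ℝ} (hC : 0 ≤ C)
    (h : ∀ i, ∑ j, ‖A i j‖ ≤ C) (v : ι → ℂ) : ‖A.mulVec v‖ ≤ C * ‖v‖ :=
  (norm_mulVec_le_matInfNorm A v).trans
    (mul_le_mul_of_nonneg_right (matInfNorm_le A hC h) (norm_nonneg _))

theorem matInfNorm_nonneg {𝕜 : Type*} [RCLike 𝕜] (A : Matrix ι ι 𝕜) : 0 ≤ matInfNorm A :=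
  norm_nonneg A

theorem sub_smul_mulVec (A : Matrix ι ι ℂ) (z : ℂ) (v : ι → ℂ) :
    (A - z • (1 : Matrix ι ι ℂ)).mulVec v = A.mulVec v - z • v := by
  rw [Matrix.sub_mulVec, Matrix.smul_mulVec, Matrix.one_mulVec]

theorem lowerNorm_mul_norm_le (A : Matrix ι ι ℂ) (z : ℂ)
    (h : IsUnit (A - z • (1 : Matrix ι ι ℂ))) (v : ι → ℂ) :
    lowerNorm A z * ‖v‖ ≤ ‖A.mulVec v - z • v‖ := by
  have hdet := (Matrix.isUnit_iff_isUnit_det _).mp h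
  have h1 : v = (A - z • (1 : Matrix ι ι ℂ))⁻¹.mulVec (A.mulVec v - z • v) := by
    rw [← sub_smul_mulVec, Matrix.mulVec_mulVec, Matrix.nonsing_inv_mul _ hdet, Matrix.one_mulVec]
  have h2 := norm_mulVec_le_matInfNorm (A - z • (1 : Matrix ι ι ℂ))⁻¹ (A.mulVec v - z • v)
  rw [← h1] at h2
  rw [lowerNorm]
  rcases (matInfNorm_nonneg (A - z • (1 : Matrix ι ι ℂ))⁻¹).eq_or_lt with h0 | h0
  · rw [← h0]; simp
  · rw [inv_mul_le_iff₀ h0]; exact h2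

theorem isUnit_of_bounded_below (A : Matrix ι ι ℂ) (z : ℂ) {δ : ℝ} (hδ : 0 < δ)
    (h : ∀ v : ι → ℂ, δ * ‖v‖ ≤ ‖A.mulVec v - z • v‖) : IsUnit (A - z • (1 : Matrix ι ι ℂ)) := by
  rw [← Matrix.mulVec_injective_iff_isUnit]
  intro v w hvw
  have h1 := h (v - w)
  rw [← sub_smul_mulVec, Matrix.mulVec_sub, hvw, sub_self, norm_zero] at h1
  have h2 : ‖v - w‖ ≤ 0 := by
    by_contra hcon
    push Not at hcon
    have := mul_pos hδ hcon
    linarith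
  exact sub_eq_zero.mp (norm_le_zero_iff.mp h2)

/-- The row-sum norm is the operator norm for the supremum norm, so a lower bound for A − z bounds
the norm of the inverse. With an empty index type that norm is 0, and `lowerNorm` would take the
default value 0⁻¹ = 0. -/
theorem le_lowerNorm [Nonempty ι] (A : Matrix ι ι ℂ) (z : ℂ) {δ : ℝ} (hδ : 0 < δ)
    (h : ∀ v : ι → ℂ, δ * ‖v‖ ≤ ‖A.mulVec v - z • v‖) : δ ≤ lowerNorm A z := by
  have hu := isUnit_of_bounded_below A z hδ h
  have hdet := (Matrix.isUnit_iff_isUnit_det _).mp hu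
  have hne : (A - z • (1 : Matrix ι ι ℂ))⁻¹ ≠ 0 := by
    intro h0
    have := Matrix.nonsing_inv_mul _ hdet
    rw [h0, zero_mul] at this
    exact zero_ne_one this
  have hpos : 0 < matInfNorm (A - z • (1 : Matrix ι ι ℂ))⁻¹ := norm_pos_iff.mpr hne
  rw [lowerNorm, le_inv_comm₀ hδ hpos]
  have e : matInfNorm (A - z • (1 : Matrix ι ι ℂ))⁻¹
      = ‖ContinuousLinearMap.mk (Matrix.mulVecLin (A - z • (1 : Matrix ι ι ℂ))⁻¹)‖ :=
    Matrix.linfty_opNorm_eq_opNorm _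
  rw [e]
  refine ContinuousLinearMap.opNorm_le_bound _ (by positivity) fun w => ?_
  have h1 := h ((A - z • (1 : Matrix ι ι ℂ))⁻¹.mulVec w)
  rw [← sub_smul_mulVec, Matrix.mulVec_mulVec, Matrix.mul_nonsing_inv _ hdet,
    Matrix.one_mulVec] at h1
  rw [inv_mul_eq_div, le_div_iff₀ hδ, mul_comm]
  exact h1

theorem isUnit_sub_smul_of_spectralRadius_lt (A : Matrix ι ι ℂ) {r : ℝ}
    (h : spectralRadius ℂ A < ENNReal.ofReal r) {z : ℂ} (hz : r ≤ ‖z‖) :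
    IsUnit (A - z • (1 : Matrix ι ι ℂ)) := by
  by_contra hcon
  have hm : z ∈ spectrum ℂ A := by
    rw [spectrum.mem_iff]
    rw [Algebra.algebraMap_eq_smul_one, ← IsUnit.neg_iff, neg_sub]
    exact hcon
  have h1 : (‖z‖₊ : ENNReal) ≤ spectralRadius ℂ A := le_iSup₂ (α := ENNReal) z hm
  have h2 := h1.trans_lt h
  rw [← enorm_eq_nnnorm, ← ofReal_norm] at h2
  exact absurd (ENNReal.ofReal_le_ofReal hz) (not_le.mpr h2)

theorem matrix_inv_neg (B : Matrix ι ι ℂ) : (-B)⁻¹ = -B⁻¹ := by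
  by_cases h : IsUnit B.det
  · refine Matrix.inv_eq_left_inv ?_
    rw [neg_mul_neg, Matrix.nonsing_inv_mul _ h]
  · have h2 : ¬ IsUnit (-B).det := by
      rw [← Matrix.isUnit_iff_isUnit_det, IsUnit.neg_iff, Matrix.isUnit_iff_isUnit_det]
      exact h
    rw [Matrix.nonsing_inv_apply_not_isUnit _ h, Matrix.nonsing_inv_apply_not_isUnit _ h2, neg_zero]

theorem matInfNorm_inv_eq_resolvent (A : Matrix ι ι ℂ) (z : ℂ) :
    matInfNorm (A - z • (1 : Matrix ι ι ℂ))⁻¹ = ‖resolvent A z‖ := by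
  have e : resolvent A z = -(A - z • (1 : Matrix ι ι ℂ))⁻¹ := by
    rw [resolvent, ← Matrix.nonsing_inv_eq_ringInverse, ← matrix_inv_neg, neg_sub,
      Algebra.algebraMap_eq_smul_one]
  rw [e, norm_neg]
  rfl

/-- The resolvent is continuous on the compact circle. The uniform δ ensures that the adaptive
sequence goes round the circle in finitely many steps. -/
theorem exists_pos_le_lowerNorm [Nonempty ι] (A : Matrix ι ι ℂ) {r : ℝ}
    (h : spectralRadius ℂ A < ENNReal.ofReal r) :
    ∃ δ > 0, ∀ z : ℂ, ‖z‖ = r → δ ≤ lowerNorm A z := by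
  have hres : ∀ z : ℂ, ‖z‖ = r → z ∈ resolventSet ℂ A := by
    intro z hz
    have := isUnit_sub_smul_of_spectralRadius_lt A h hz.ge
    rw [← IsUnit.neg_iff, neg_sub, ← Algebra.algebraMap_eq_smul_one] at this
    exact this
  have hcont : ContinuousOn (resolvent A) (Metric.sphere (0 : ℂ) r) := fun z hz =>
    (spectrum.hasDerivAt_resolvent_const_left (hres z (by simpa using hz))).continuousAt.continuousWithinAt
  obtain ⟨C, hC⟩ := (isCompact_sphere (0 : ℂ) r).exists_bound_of_continuousOn hcont
  refine ⟨(|C| + 1)⁻¹, by positivity, fun z hz => ?_⟩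
  have hdet := (Matrix.isUnit_iff_isUnit_det _).mp
    (isUnit_sub_smul_of_spectralRadius_lt A h hz.ge)
  have hne : (A - z • (1 : Matrix ι ι ℂ))⁻¹ ≠ 0 := by
    intro h0
    have := Matrix.nonsing_inv_mul _ hdet
    rw [h0, zero_mul] at this
    exact zero_ne_one this
  have hpos : 0 < matInfNorm (A - z • (1 : Matrix ι ι ℂ))⁻¹ := norm_pos_iff.mpr hne
  rw [lowerNorm]
  refine inv_anti₀ hpos ?_
  rw [matInfNorm_inv_eq_resolvent]
  exact (hC z (by simpa using hz)).trans ((le_abs_self C).trans (by linarith))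

/-- The maximum principle for the resolvent outside of a disc. -/
theorem norm_resolvent_le_of_sphere (A : Matrix ι ι ℂ) {r : ℝ} (hr : 0 < r)
    (h : spectralRadius ℂ A < ENNReal.ofReal r) {C : ℝ}
    (hC : ∀ z : ℂ, ‖z‖ = r → ‖resolvent A z‖ ≤ C) {z : ℂ} (hz : r ≤ ‖z‖) :
    ‖resolvent A z‖ ≤ C := by
  -- Inversion: g(w) = w(1 − wA)⁻¹ is the resolvent at 1/w and is analytic on the closed disc of
  -- radius 1/r, also at w = 0. The maximum modulus principle on this disc is the one for the
  -- exterior of the circle.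
  set g : ℂ → Matrix ι ι ℂ := fun w => w • Ring.inverse (1 - w • A) with hg
  have hgr : ∀ w : ℂ, w ≠ 0 → g w = resolvent A w⁻¹ := by
    intro w hw
    have e := spectrum.units_smul_resolvent_self (R := ℂ) (r := (Units.mk0 w hw)⁻¹) (a := A)
    rw [inv_inv, Units.smul_def, Units.smul_def, Units.val_inv_eq_inv_val, Units.val_mk0] at e
    have e2 : resolvent (w • A) (1 : ℂ) = Ring.inverse (1 - w • A) := by
      rw [resolvent, map_one]
    rw [e2] at e
    simp only [hg]
    rw [← e, smul_smul, mul_inv_cancel₀ hw, one_smul]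
  have hdiff : DifferentiableOn ℂ g (Metric.closedBall 0 r⁻¹) := by
    have h1 : ((Real.toNNReal r⁻¹ : NNReal) : ENNReal) < (spectralRadius ℂ A)⁻¹ := by
      rw [ENNReal.lt_inv_iff_lt_inv]
      refine h.trans_le ?_
      change _ ≤ (ENNReal.ofReal r⁻¹)⁻¹
      rw [ENNReal.ofReal_inv_of_pos hr, inv_inv]
    have h2 := spectrum.differentiableOn_inverse_one_sub_smul (𝕜 := ℂ) (a := A) h1
    rw [Real.coe_toNNReal _ (by positivity)] at h2
    exact differentiableOn_id.smul h2
  have hdc : DiffContOnCl ℂ g (Metric.ball 0 r⁻¹) := by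
    refine ⟨hdiff.mono Metric.ball_subset_closedBall, ?_⟩
    rw [closure_ball _ (by positivity)]
    exact hdiff.continuousOn
  have hz0 : z ≠ 0 := by rintro rfl; rw [norm_zero] at hz; linarith
  have h1 := Complex.norm_le_of_forall_mem_frontier_norm_le (Metric.isBounded_ball) hdc (C := C)
    (fun w hw => by
      rw [frontier_ball _ (by positivity)] at hw
      have hw' : ‖w‖ = r⁻¹ := by simpa using hw
      have hw0 : w ≠ 0 := by
        rintro rfl
        rw [norm_zero] at hw'
        have : 0 < r⁻¹ := by positivity
        linarith
      rw [hgr w hw0]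
      exact hC _ (by rw [norm_inv, hw', inv_inv])) (z := z⁻¹) (by
      rw [closure_ball _ (by positivity)]
      rw [mem_closedBall_zero_iff, norm_inv]
      exact inv_anti₀ hr hz)
  rwa [hgr _ (inv_ne_zero hz0), inv_inv] at h1

theorem bounded_below_of_circle [Nonempty ι] (A : Matrix ι ι ℂ) {r : ℝ} (hr : 0 < r)
    (h : spectralRadius ℂ A < ENNReal.ofReal r) {R : ℝ} (hR : 0 < R)
    (hb : ∀ z : ℂ, ‖z‖ = r → ∀ v : ι → ℂ, R * ‖v‖ ≤ ‖A.mulVec v - z • v‖) (z : ℂ) (hz : r ≤ ‖z‖)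
    (v : ι → ℂ) : R * ‖v‖ ≤ ‖A.mulVec v - z • v‖ := by
  have h1 : ∀ z : ℂ, ‖z‖ = r → ‖resolvent A z‖ ≤ R⁻¹ := by
    intro z hz
    have h2 := le_lowerNorm A z hR (hb z hz)
    rw [← matInfNorm_inv_eq_resolvent]
    rw [lowerNorm] at h2
    rw [le_inv_comm₀ _ hR]
    · exact h2
    · by_contra hcon
      push Not at hcon
      have := inv_nonpos.mpr hcon
      linarith
  have h3 := norm_resolvent_le_of_sphere A hr h h1 hz
  have hu := isUnit_sub_smul_of_spectralRadius_lt A h hz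
  refine le_trans ?_ (lowerNorm_mul_norm_le A z hu v)
  gcongr
  have hdet := (Matrix.isUnit_iff_isUnit_det _).mp hu
  have hne : (A - z • (1 : Matrix ι ι ℂ))⁻¹ ≠ 0 := by
    intro h0
    have := Matrix.nonsing_inv_mul _ hdet
    rw [h0, zero_mul] at this
    exact zero_ne_one this
  have hpos : 0 < matInfNorm (A - z • (1 : Matrix ι ι ℂ))⁻¹ := norm_pos_iff.mpr hne
  rw [lowerNorm, le_inv_comm₀ hR hpos, matInfNorm_inv_eq_resolvent]
  exact h3

end MatrixNorm

/-! ### Covering the circle by discs with controlled resolvents -/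

section Covering

variable {ι : Type*} [Fintype ι] [DecidableEq ι]

theorem muSeq_eq (A : Matrix ι ι ℂ) (r : ℝ) (l : ℕ) :
    muSeq A r l = r * Complex.exp (Complex.I *
      ((∑ i ∈ Finset.range l, nuSeq A r i / (2 * r) : ℝ) : ℂ)) := by
  induction l with
  | zero => simp [muSeq]
  | succ l ih =>
    have e : muSeq A r (l + 1) = muSeq A r l *
      Complex.exp (Complex.I * ((nuSeq A r l / (2 * r) : ℝ) : ℂ)) := by rw [muSeq, nuSeq]
    rw [e, Finset.sum_range_succ, Complex.ofReal_add, mul_add, Complex.exp_add, ← mul_assoc, ih]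

theorem norm_muSeq (A : Matrix ι ι ℂ) {r : ℝ} (hr : 0 < r) (l : ℕ) : ‖muSeq A r l‖ = r := by
  rw [muSeq_eq, norm_mul, mul_comm Complex.I, Complex.norm_exp_ofReal_mul_I, Complex.norm_real,
    Real.norm_of_nonneg hr.le, mul_one]

theorem norm_exp_I_sub_le (r a b : ℝ) (hr : 0 ≤ r) :
    ‖(r : ℂ) * Complex.exp (Complex.I * (a : ℂ)) - r * Complex.exp (Complex.I * (b : ℂ))‖
      ≤ r * |a - b| := by
  rw [← mul_sub, norm_mul, Complex.norm_real, Real.norm_of_nonneg hr]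
  gcongr
  have e : Complex.exp (Complex.I * (a : ℂ)) - Complex.exp (Complex.I * (b : ℂ))
      = Complex.exp (Complex.I * (b : ℂ)) * (Complex.exp (Complex.I * ((a - b : ℝ) : ℂ)) - 1) := by
    rw [mul_sub, ← Complex.exp_add, mul_one]
    congr 2
    push_cast; ring
  rw [e, norm_mul, mul_comm Complex.I, Complex.norm_exp_ofReal_mul_I, one_mul]
  exact Real.norm_exp_I_mul_ofReal_sub_one_le

/-- The lower bound δ makes the set in the definition of `numSteps` nonempty; the infimum of the
empty set would be 0. -/
theorem numSteps_spec (A : Matrix ι ι ℂ) {r δ : ℝ} (hδ : 0 < δ)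
    (h : ∀ l, δ ≤ nuSeq A r l) :
    4 * Real.pi * r ≤ ∑ l ∈ Finset.range (numSteps A r), nuSeq A r l := by
  have hne : {n : ℕ | 4 * Real.pi * r ≤ ∑ l ∈ Finset.range n, nuSeq A r l}.Nonempty := by
    obtain ⟨n, hn⟩ := exists_nat_ge (4 * Real.pi * r / δ)
    refine ⟨n, ?_⟩
    rw [div_le_iff₀ hδ] at hn
    refine hn.trans ?_
    have := Finset.card_nsmul_le_sum (Finset.range n) (nuSeq A r) δ (fun l _ => h l)
    simpa using this
  exact Nat.sInf_mem hne

theorem numSteps_pos (A : Matrix ι ι ℂ) {r δ : ℝ} (hr : 0 < r) (hδ : 0 < δ)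
    (h : ∀ l, δ ≤ nuSeq A r l) : 0 < numSteps A r := by
  by_contra h0
  have h1 := numSteps_spec A hδ h
  have e : numSteps A r = 0 := by omega
  rw [e, Finset.sum_range_zero] at h1
  have := Real.pi_pos
  have : 0 < 4 * Real.pi * r := by positivity
  linarith

variable [Nonempty ι]

/-- The discs around the points `μ_ℓ` cover the circle. -/
theorem bounded_below_of_covering (A : Matrix ι ι ℂ) {r R : ℝ} (hr : 0 < r)
    (h : spectralRadius ℂ A < ENNReal.ofReal r)
    (hR : ∀ l < numSteps A r, R ≤ nuSeq A r l / 4 + nuSeq A r (l + 1) / 2)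
    (z : ℂ) (hz : ‖z‖ = r) (v : ι → ℂ) : R * ‖v‖ ≤ ‖A.mulVec v - z • v‖ := by
  obtain ⟨δ, hδ, hb⟩ := exists_pos_le_lowerNorm A h
  have hν : ∀ l, δ ≤ nuSeq A r l := fun l => hb _ (norm_muSeq A hr l)
  have hn := numSteps_spec A hδ hν
  set θ : ℕ → ℝ := fun l => ∑ i ∈ Finset.range l, nuSeq A r i / (2 * r) with hθ
  have hμ : ∀ l, muSeq A r l = r * Complex.exp (Complex.I * (θ l : ℂ)) := muSeq_eq A r
  -- Step ℓ turns by the angle ν_ℓ/(2r), so a total of 4πr for the ν_ℓ is one full revolution.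
  have hθn : 2 * Real.pi ≤ θ (numSteps A r) := by
    simp only [hθ]
    rw [← Finset.sum_div, le_div_iff₀ (by positivity)]
    linarith
  -- the argument of `z` in `[0, 2π)`
  obtain ⟨t, ht0, ht1, hzt⟩ : ∃ t : ℝ, 0 ≤ t ∧ t < 2 * Real.pi ∧
      z = r * Complex.exp (Complex.I * (t : ℂ)) := by
    have hzarg : z = r * Complex.exp (Complex.I * (Complex.arg z : ℂ)) := by
      conv_lhs => rw [← Complex.norm_mul_exp_arg_mul_I z, hz, mul_comm (Complex.arg z : ℂ)]
    rcases le_or_gt 0 (Complex.arg z) with h0 | h0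
    · exact ⟨Complex.arg z, h0, by linarith [Complex.arg_le_pi z, Real.pi_pos], hzarg⟩
    · refine ⟨Complex.arg z + 2 * Real.pi, by linarith [Complex.neg_pi_lt_arg z, Real.pi_pos],
        by linarith, ?_⟩
      rw [hzarg]
      congr 1
      rw [← hzarg, Complex.exp_eq_exp_iff_exists_int]
      exact ⟨-1, by push_cast; ring⟩
  obtain ⟨l, hl, hl1, hl2⟩ : ∃ l < numSteps A r, θ l ≤ t ∧ t ≤ θ (l + 1) := by
    have hex : ∃ n, t < θ n := ⟨_, ht1.trans_le hθn⟩
    classical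
    have hm := Nat.find_spec hex
    have hpos : Nat.find hex ≠ 0 := by
      intro h0
      rw [h0] at hm
      simp [hθ] at hm
      linarith
    obtain ⟨l, hl⟩ := Nat.exists_eq_succ_of_ne_zero hpos
    have hle : Nat.find hex ≤ numSteps A r := Nat.find_min' hex (ht1.trans_le hθn)
    refine ⟨l, by omega, ?_, ?_⟩
    · have := Nat.find_min hex (m := l) (by omega)
      push Not at this
      exact this
    · rw [hl] at hm; exact hm.le
  have hstep : θ (l + 1) - θ l = nuSeq A r l / (2 * r) := by
    simp only [hθ]; rw [Finset.sum_range_succ]; ring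
  have hunit : ∀ l, IsUnit (A - muSeq A r l • (1 : Matrix ι ι ℂ)) := fun l =>
    isUnit_sub_smul_of_spectralRadius_lt A h (norm_muSeq A hr l).ge
  have hlow : ∀ l, (nuSeq A r l - ‖z - muSeq A r l‖) * ‖v‖ ≤ ‖A.mulVec v - z • v‖ := by
    intro l
    have h1 := lowerNorm_mul_norm_le A (muSeq A r l) (hunit l) v
    have h2 : A.mulVec v - muSeq A r l • v
        = (A.mulVec v - z • v) + (z - muSeq A r l) • v := by
      rw [sub_smul]; abel
    rw [h2] at h1
    have h3 := norm_add_le (A.mulVec v - z • v) ((z - muSeq A r l) • v)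
    rw [norm_smul] at h3
    rw [sub_mul]
    have : nuSeq A r l = lowerNorm A (muSeq A r l) := rfl
    rw [this]
    linarith
  have hd1 : ‖z - muSeq A r l‖ ≤ r * (t - θ l) := by
    rw [hzt, hμ]
    refine (norm_exp_I_sub_le r t (θ l) hr.le).trans_eq ?_
    rw [abs_of_nonneg (by linarith)]
  have hd2 : ‖z - muSeq A r (l + 1)‖ ≤ r * (θ (l + 1) - t) := by
    rw [hzt, hμ]
    refine (norm_exp_I_sub_le r t (θ (l + 1)) hr.le).trans_eq ?_
    rw [abs_sub_comm, abs_of_nonneg (by linarith)]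
  -- The arc from μ_ℓ to μ_{ℓ+1} has length ν_ℓ/2. The two distances from z therefore add up to at
  -- most ν_ℓ/2, and averaging the perturbation bounds at both end points leaves ν_ℓ/4 + ν_{ℓ+1}/2.
  have hsum : r * (t - θ l) + r * (θ (l + 1) - t) = nuSeq A r l / 2 := by
    rw [← mul_add]
    have : t - θ l + (θ (l + 1) - t) = nuSeq A r l / (2 * r) := by linarith
    rw [this]; field_simp
  have h1 := hlow l
  have h2 := hlow (l + 1)
  have h3 := hR l hl
  have hv := norm_nonneg v
  calc R * ‖v‖ ≤ (nuSeq A r l / 4 + nuSeq A r (l + 1) / 2) * ‖v‖ := by gcongr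
    _ ≤ ((nuSeq A r l - ‖z - muSeq A r l‖)
        + (nuSeq A r (l + 1) - ‖z - muSeq A r (l + 1)‖)) / 2 * ‖v‖ := by
        gcongr; linarith
    _ ≤ ‖A.mulVec v - z • v‖ := by nlinarith

theorem spectralRadius_matrix_lt (A : Matrix ι ι ℂ) {r δ : ℝ} (hr : 0 < r) (hδ : 0 < δ)
    (h : ∀ z : ℂ, r ≤ ‖z‖ → ∀ v : ι → ℂ, δ * ‖v‖ ≤ ‖A.mulVec v - z • v‖) :
    spectralRadius ℂ A < ENNReal.ofReal r := by
  open scoped Matrix.Norms.Operator in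
  have := spectrum.spectralRadius_lt_of_forall_lt A (r := Real.toNNReal r) (fun z hz => by
    by_contra hcon
    push Not at hcon
    have hz2 : r ≤ ‖z‖ := by
      have := NNReal.coe_le_coe.mpr hcon
      rwa [Real.coe_toNNReal _ hr.le] at this
    have hu := isUnit_of_bounded_below A z hδ (h z hz2)
    rw [← IsUnit.neg_iff, neg_sub, ← Algebra.algebraMap_eq_smul_one] at hu
    exact (spectrum.mem_iff.mp hz) hu)
  exact this

theorem le_nuSeq (A : Matrix ι ι ℂ) {r δ : ℝ} (hr : 0 < r) (hδ : 0 < δ)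
    (h : ∀ z : ℂ, r ≤ ‖z‖ → ∀ v : ι → ℂ, δ * ‖v‖ ≤ ‖A.mulVec v - z • v‖) (l : ℕ) :
    δ ≤ nuSeq A r l :=
  le_lowerNorm A _ hδ (h _ (norm_muSeq A hr l).ge)

end Covering

theorem resolventMin_le (α : ℝ) (f : ℝ → ℝ) (r : ℝ) (m M N : ℕ) (k : Fin m) (l : ℕ)
    (hl : l < numSteps (nystromMatrix α f (sampleT m k) M N) r) :
    resolventMin α f r m M N ≤ nuSeq (nystromMatrix α f (sampleT m k) M N) r l / 4
      + nuSeq (nystromMatrix α f (sampleT m k) M N) r (l + 1) / 2 := by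
  rw [resolventMin]
  refine (ciInf_le (Set.finite_range _).bddBelow k).trans ?_
  exact ciInf_le (Set.finite_range _).bddBelow (⟨l, hl⟩ : Fin _)

/-- 3/4 = 1/4 + 1/2. Both infima run over nonempty types, since `numSteps` is positive, so no
default value enters. -/
theorem le_resolventMin (α : ℝ) (f : ℝ → ℝ) {r δ : ℝ} (hr : 0 < r) (hδ : 0 < δ) (m M N : ℕ)
    (hm : 1 ≤ m) (hN : 1 ≤ N)
    (h : ∀ k : Fin m, ∀ l, δ ≤ nuSeq (nystromMatrix α f (sampleT m k) M N) r l) :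
    3 / 4 * δ ≤ resolventMin α f r m M N := by
  have : Nonempty (Fin m) := ⟨⟨0, hm⟩⟩
  have : Nonempty (Fin N ⊕ Fin N) := ⟨Sum.inl ⟨0, hN⟩⟩
  refine le_ciInf fun k => ?_
  have : Nonempty (Fin (numSteps (nystromMatrix α f (sampleT m k) M N) r)) :=
    ⟨⟨0, numSteps_pos _ hr hδ (h k)⟩⟩
  refine le_ciInf fun l => ?_
  linarith [h k l, h k (l + 1)]

/-! ### Divided differences of analytic functions -/

/-- The first divided difference `f[r, s]`, where `f1 = f'`. -/
def divDiff (f f1 : ℂ → ℂ) (r s : ℂ) : ℂ := if r = s then f1 s else (f r - f s) / (r - s)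

/-- The divided difference `f[r, s, s]`, where `f1 = f'` and `f2 = f''`. -/
def divDiff2 (f f1 f2 : ℂ → ℂ) (r s : ℂ) : ℂ :=
  if r = s then f2 s / 2 else ((s - r) * f1 s + f r - f s) / (r - s) ^ 2

section DivDiff

variable {f f1 f2 : ℂ → ℂ} {U : Set ℂ}

theorem divDiff_comm (r s : ℂ) : divDiff f f1 r s = divDiff f f1 s r := by
  unfold divDiff
  by_cases h : r = s
  · subst h; rfl
  · rw [if_neg h, if_neg (Ne.symm h), ← neg_sub (f s), ← neg_sub s, neg_div_neg_eq]

theorem divDiff_eq_dslope (hf : ∀ w ∈ U, HasDerivAt f (f1 w) w) {s : ℂ} (hs : s ∈ U) (r : ℂ) :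
    divDiff f f1 r s = dslope f s r := by
  unfold divDiff
  split_ifs with h
  · subst h; rw [dslope_same, (hf r hs).deriv]
  · rw [dslope_of_ne _ h, slope_def_field]

theorem differentiableOn_divDiff (hU : IsOpen U) (hf : ∀ w ∈ U, HasDerivAt f (f1 w) w) {s : ℂ}
    (hs : s ∈ U) : DifferentiableOn ℂ (fun r => divDiff f f1 r s) U := by
  have h1 : DifferentiableOn ℂ f U := fun w hw => (hf w hw).differentiableAt.differentiableWithinAt
  have h2 := (Complex.differentiableOn_dslope (hU.mem_nhds hs)).mpr h1
  exact h2.congr fun r _ => divDiff_eq_dslope hf hs r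

theorem differentiableOn_divDiff_right (hU : IsOpen U) (hf : ∀ w ∈ U, HasDerivAt f (f1 w) w) {r : ℂ}
    (hr : r ∈ U) : DifferentiableOn ℂ (fun s => divDiff f f1 r s) U := by
  simp_rw [divDiff_comm r]
  exact differentiableOn_divDiff hU hf hr

/-- With D = f[·, s], differentiate f(w) = f(s) + (w − s)D(w) twice at s: f″(s) = 2D′(s). -/
theorem deriv_divDiff_self (hU : IsOpen U) (hf : ∀ w ∈ U, HasDerivAt f (f1 w) w)
    (hf1 : ∀ w ∈ U, HasDerivAt f1 (f2 w) w) {s : ℂ} (hs : s ∈ U) :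
    deriv (fun r => divDiff f f1 r s) s = f2 s / 2 := by
  set D := fun r => divDiff f f1 r s with hD
  have hDd := differentiableOn_divDiff hU hf hs
  have hDan : AnalyticOnNhd ℂ D U := hDd.analyticOnNhd hU
  have hfac : ∀ w, f w = f s + (w - s) * D w := by
    intro w
    simp only [hD, divDiff]
    split_ifs with h
    · subst h; ring
    · have : w - s ≠ 0 := sub_ne_zero.mpr h
      field_simp
      ring
  have h1 : ∀ w ∈ U, f1 w = D w + (w - s) * deriv D w := by
    intro w hw
    have h2 : HasDerivAt (fun w => f s + (w - s) * D w) (1 * D w + (w - s) * deriv D w) w :=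
      ((((hasDerivAt_id w).sub_const s).mul (hDan w hw).differentiableAt.hasDerivAt).const_add (f s))
    have h3 := (hf w hw).unique (h2.congr_of_eventuallyEq (Eventually.of_forall hfac))
    rw [h3, one_mul]
  have h4 : HasDerivAt (fun w => D w + (w - s) * deriv D w)
      (deriv D s + (1 * deriv D s + (s - s) * deriv (deriv D) s)) s :=
    (hDan s hs).differentiableAt.hasDerivAt.add
      (((hasDerivAt_id s).sub_const s).mul (hDan.deriv s hs).differentiableAt.hasDerivAt)
  have h5 := (hf1 s hs).unique (h4.congr_of_eventuallyEq
    (Filter.eventually_of_mem (hU.mem_nhds hs) h1))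
  rw [h5]; ring

/-- In its first variable f[r, s, s] is the slope at s of the analytic function f[·, s], so the
singularity at r = s is removable. -/
theorem differentiableOn_divDiff2 (hU : IsOpen U) (hf : ∀ w ∈ U, HasDerivAt f (f1 w) w)
    (hf1 : ∀ w ∈ U, HasDerivAt f1 (f2 w) w) {s : ℂ} (hs : s ∈ U) :
    DifferentiableOn ℂ (fun r => divDiff2 f f1 f2 r s) U := by
  have h1 := differentiableOn_divDiff hU hf hs
  have h2 := (Complex.differentiableOn_dslope (hU.mem_nhds hs)).mpr h1
  refine h2.congr fun r hr => ?_
  unfold divDiff2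
  split_ifs with h
  · subst h; rw [dslope_same, deriv_divDiff_self hU hf hf1 hs]
  · rw [dslope_of_ne _ h, slope_def_field]
    simp only [divDiff, if_neg h, if_true]
    have : r - s ≠ 0 := sub_ne_zero.mpr h
    field_simp
    ring

/-- In its second variable f[r, s, s] is minus the slope at r of s ↦ f[r, s] − f′(s). That function
vanishes at s = r with derivative −f″(r)/2, so here too the singularity is removable. -/
theorem differentiableOn_divDiff2_right (hU : IsOpen U) (hf : ∀ w ∈ U, HasDerivAt f (f1 w) w)
    (hf1 : ∀ w ∈ U, HasDerivAt f1 (f2 w) w) {r : ℂ} (hr : r ∈ U) :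
    DifferentiableOn ℂ (fun s => divDiff2 f f1 f2 r s) U := by
  have h1 := differentiableOn_divDiff_right hU hf hr
  have hd1 : DifferentiableOn ℂ f1 U := fun w hw => (hf1 w hw).differentiableAt.differentiableWithinAt
  have h1' := h1.sub hd1
  have h2 := ((Complex.differentiableOn_dslope (hU.mem_nhds hr)).mpr h1').neg
  refine h2.congr fun s hs => ?_
  simp only [Pi.neg_apply]
  unfold divDiff2
  split_ifs with h
  · subst h
    rw [dslope_same]
    have h3 : HasDerivAt (fun s => divDiff f f1 r s) (f2 r / 2) r := by
      have h4 := (h1 r hr).differentiableAt (hU.mem_nhds hr) |>.hasDerivAt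
      simp_rw [divDiff_comm r] at h4 ⊢
      rwa [deriv_divDiff_self hU hf hf1 hr] at h4
    have h4 := (h3.sub (hf1 r hr)).deriv
    rw [h4]
    ring
  · rw [dslope_of_ne _ (Ne.symm h), slope_def_field]
    simp only [Pi.sub_apply, divDiff, if_neg h, if_true]
    have : r - s ≠ 0 := sub_ne_zero.mpr h
    have : s - r ≠ 0 := sub_ne_zero.mpr (Ne.symm h)
    have e : s - r = -(r - s) := by ring
    rw [e]
    field_simp
    ring

theorem segment_mem {S : Set ℂ} (hS : Convex ℝ S) {r s : ℂ} (hr : r ∈ S) (hs : s ∈ S) {t : ℝ}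
    (ht : t ∈ Set.Icc (0 : ℝ) 1) : s + (t : ℂ) * (r - s) ∈ S := by
  have := hS.add_smul_sub_mem hs hr ht
  simpa using this

theorem hasDerivAt_segment {g : ℂ → ℂ} {g' : ℂ} {r s : ℂ} {t : ℝ}
    (h : HasDerivAt g g' (s + (t : ℂ) * (r - s))) :
    HasDerivAt (fun t : ℝ => g (s + (t : ℂ) * (r - s))) ((r - s) * g') t := by
  have h1 : HasDerivAt (fun t : ℝ => s + (t : ℂ) * (r - s)) (1 * (r - s)) t :=
    ((Complex.ofRealCLM.hasDerivAt).mul_const (r - s)).const_add s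
  have := HasDerivAt.scomp t h h1
  rw [one_mul, smul_eq_mul] at this
  exact this

variable {S : Set ℂ} (hS : Convex ℝ S) (hf : ∀ w ∈ S, HasDerivAt f (f1 w) w)

include hS hf in
theorem norm_divDiff_le {F : ℝ} (hF : ∀ w ∈ S, ‖f1 w‖ ≤ F) {r s : ℂ} (hr : r ∈ S) (hs : s ∈ S) :
    ‖divDiff f f1 r s‖ ≤ F := by
  unfold divDiff
  split_ifs with h
  · exact hF s hs
  · have h1 := hS.norm_image_sub_le_of_norm_hasDerivWithin_le
      (fun w hw => (hf w hw).hasDerivWithinAt) hF hs hr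
    rw [norm_div, div_le_iff₀ (norm_pos_iff.mpr (sub_ne_zero.mpr h))]
    exact h1

-- f[r, s] is the mean of f′ over the segment, so bounds for Im f′ carry over. The mean is expressed
-- by the mean value inequality for the imaginary part of f/(r − s) along the segment.
include hS hf in
theorem abs_im_divDiff_le {I : ℝ} (hI : ∀ w ∈ S, |(f1 w).im| ≤ I) {r s : ℂ} (hr : r ∈ S)
    (hs : s ∈ S) : |(divDiff f f1 r s).im| ≤ I := by
  unfold divDiff
  split_ifs with h
  · exact hI s hs
  · have hne : r - s ≠ 0 := sub_ne_zero.mpr h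
    have hd : ∀ t ∈ Set.Icc (0 : ℝ) 1, HasDerivAt
        (fun t : ℝ => (f (s + (t : ℂ) * (r - s)) / (r - s)).im)
        (f1 (s + (t : ℂ) * (r - s))).im t := by
      intro t ht
      have h1 := (hasDerivAt_segment (hf _ (segment_mem hS hr hs ht))).div_const (r - s)
      have h2 := (Complex.imCLM.hasFDerivAt.comp_hasDerivAt t h1)
      rw [mul_div_cancel_left₀ _ hne] at h2
      exact h2
    have h3 := norm_image_sub_le_of_norm_deriv_le_segment_01'
      (fun t ht => (hd t ht).hasDerivWithinAt)
      (fun t ht => hI _ (segment_mem hS hr hs ⟨ht.1, ht.2.le⟩))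
    simp only [Complex.ofReal_one, one_mul, add_sub_cancel, Complex.ofReal_zero, zero_mul,
      add_zero] at h3
    rw [← Complex.sub_im, ← sub_div] at h3
    exact h3

-- Taylor's formula of second order: the bound for f″ is integrated twice along the segment, which
-- gives 1/2. It is asked for on the segment only, because the bound for f″ on a sector behaves like
-- 1/|w|.
include hS hf in
theorem norm_divDiff2_le (hf1 : ∀ w ∈ S, HasDerivAt f1 (f2 w) w) {C : ℝ} {r s : ℂ} (hr : r ∈ S)
    (hs : s ∈ S) (hC : ∀ t ∈ Set.Icc (0 : ℝ) 1, ‖f2 (s + (t : ℂ) * (r - s))‖ ≤ C) :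
    ‖divDiff2 f f1 f2 r s‖ ≤ C / 2 := by
  have hfs : ‖f2 s‖ ≤ C := by simpa using hC 0 (by simp)
  have hC0 : 0 ≤ C := (norm_nonneg _).trans hfs
  unfold divDiff2
  split_ifs with h
  · rw [norm_div, Complex.norm_ofNat]
    gcongr
  · have hpos : 0 < ‖r - s‖ := norm_pos_iff.mpr (sub_ne_zero.mpr h)
    -- first order estimate for `f1`
    have h1 : ∀ t ∈ Set.Icc (0 : ℝ) 1, ‖f1 (s + (t : ℂ) * (r - s)) - f1 s‖ ≤ ‖r - s‖ * C * t := by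
      intro t ht
      have := norm_image_sub_le_of_norm_deriv_le_segment'
        (f := fun t : ℝ => f1 (s + (t : ℂ) * (r - s))) (a := 0) (b := 1) (C := ‖r - s‖ * C)
        (f' := fun t => (r - s) * f2 (s + (t : ℂ) * (r - s)))
        (fun t ht => (hasDerivAt_segment (hf1 _ (segment_mem hS hr hs ht))).hasDerivWithinAt)
        (fun t ht => by
          rw [norm_mul]
          exact mul_le_mul_of_nonneg_left (hC t ⟨ht.1, ht.2.le⟩) (norm_nonneg _)) t ht
      simpa using this
    have hd : ∀ t ∈ Set.Icc (0 : ℝ) 1, HasDerivAt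
        (fun t : ℝ => f (s + (t : ℂ) * (r - s)) - f s - (t : ℂ) * ((r - s) * f1 s))
        ((r - s) * (f1 (s + (t : ℂ) * (r - s)) - f1 s)) t := by
      intro t ht
      have h2 := (hasDerivAt_segment (hf _ (segment_mem hS hr hs ht))).sub_const (f s)
      have h3 : HasDerivAt (fun t : ℝ => (t : ℂ) * ((r - s) * f1 s)) (1 * ((r - s) * f1 s)) t :=
        (Complex.ofRealCLM.hasDerivAt).mul_const _
      have := h2.sub h3
      rw [one_mul, ← mul_sub] at this
      exact this
    have h4 := image_norm_le_of_norm_deriv_right_le_deriv_boundary (a := 0) (b := 1)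
      (f := fun t : ℝ => f (s + (t : ℂ) * (r - s)) - f s - (t : ℂ) * ((r - s) * f1 s))
      (f' := fun t => (r - s) * (f1 (s + (t : ℂ) * (r - s)) - f1 s))
      (B := fun t => ‖r - s‖ ^ 2 * C * (t ^ 2 / 2)) (B' := fun t => ‖r - s‖ ^ 2 * C * t)
      (fun t ht => (hd t ht).continuousAt.continuousWithinAt)
      (fun t ht => (hd t ⟨ht.1, ht.2.le⟩).hasDerivWithinAt)
      (by simp)
      (fun t => by
        have := ((hasDerivAt_pow 2 t).div_const 2).const_mul (‖r - s‖ ^ 2 * C)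
        convert! this using 1
        simp)
      (fun t ht => by
        rw [norm_mul]
        have := mul_le_mul_of_nonneg_left (h1 t ⟨ht.1, ht.2.le⟩) (norm_nonneg (r - s))
        nlinarith)
    have h5 := h4 (x := 1) (by simp)
    simp only [Complex.ofReal_one, one_mul, add_sub_cancel, one_pow] at h5
    rw [norm_div, norm_pow, div_le_iff₀ (by positivity)]
    have e : (s - r) * f1 s + f r - f s = f r - f s - (r - s) * f1 s := by ring
    rw [e]
    linarith

/-- Away from the diagonal f[r, s, s] = (f[r, s] − f′(s))/(r − s), and no second derivative is
needed. -/
theorem norm_divDiff2_le_of_ne {F1 F2 : ℝ} {r s : ℂ} (h : r ≠ s)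
    (hq : ‖divDiff f f1 r s‖ ≤ F1) (hs : ‖f1 s‖ ≤ F2) :
    ‖divDiff2 f f1 f2 r s‖ ≤ (F1 + F2) / ‖r - s‖ := by
  have hne : r - s ≠ 0 := sub_ne_zero.mpr h
  have e : divDiff2 f f1 f2 r s = (divDiff f f1 r s - f1 s) / (r - s) := by
    simp only [divDiff2, divDiff, if_neg h]
    field_simp
    ring
  rw [e, norm_div]
  gcongr
  exact (norm_sub_le _ _).trans (add_le_add hq hs)

end DivDiff

/-! ### Strips, sectors and the continuation of a branch -/

theorem strip_mono {d c : ℝ} (h : d ≤ c) : strip d ⊆ strip c :=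
  fun _ hz => hz.imp id fun h' => h'.trans_le h

theorem ofReal_mem_strip (d x : ℝ) : (x : ℂ) ∈ strip d := Or.inl (Complex.ofReal_im x)

theorem strip_eq {c : ℝ} (hc : 0 < c) : strip c = {z : ℂ | |z.im| < c} := by
  ext z
  refine ⟨fun h => h.elim (fun h' => ?_) id, Or.inr⟩
  simpa [h'] using hc

theorem mem_strip_zero {z : ℂ} : z ∈ strip 0 ↔ z.im = 0 :=
  ⟨fun h => h.elim id fun h' => absurd h' (abs_nonneg _).not_gt, Or.inl⟩

theorem eq_ofReal_of_mem_strip_zero {z : ℂ} (hz : z ∈ strip 0) : z = (z.re : ℂ) :=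
  Complex.ext rfl (by simpa using mem_strip_zero.mp hz)

theorem isOpen_strip {c : ℝ} (hc : 0 < c) : IsOpen (strip c) := by
  rw [strip_eq hc]
  exact isOpen_lt (Complex.continuous_im.abs) continuous_const

theorem convex_strip {c : ℝ} (hc : 0 < c) : Convex ℝ (strip c) := by
  have : strip c = Complex.imLm ⁻¹' Set.Ioo (-c) c := by
    rw [strip_eq hc]
    ext z
    simp [abs_lt]
  rw [this]
  exact (convex_Ioo _ _).linear_preimage _

theorem add_mem_strip {c : ℝ} {z : ℂ} (hz : z ∈ strip c) (x : ℝ) : z + x ∈ strip c := by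
  simpa [strip] using hz

theorem add_intCast_mem_strip {c : ℝ} {z : ℂ} (hz : z ∈ strip c) (j : ℤ) : z + j ∈ strip c := by
  simpa [strip] using hz

theorem nonempty_strip (d : ℝ) : Nonempty (strip d) := ⟨⟨((0 : ℝ) : ℂ), ofReal_mem_strip d 0⟩⟩

theorem le_stripNorm {d : ℝ} {h : ℂ → ℂ} (hb : ∃ C, ∀ z ∈ strip d, ‖h z‖ ≤ C) {z : ℂ}
    (hz : z ∈ strip d) : ‖h z‖ ≤ stripNorm d h := by
  obtain ⟨C, hC⟩ := hb
  exact le_ciSup (f := fun z : strip d => ‖h z‖) ⟨C, by rintro _ ⟨z, rfl⟩; exact hC _ z.2⟩ ⟨z, hz⟩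

theorem stripNorm_nonneg (d : ℝ) (h : ℂ → ℂ) : 0 ≤ stripNorm d h :=
  Real.iSup_nonneg fun _ => norm_nonneg _

theorem stripImNorm_nonneg (d : ℝ) (h : ℂ → ℂ) : 0 ≤ stripImNorm d h :=
  Real.iSup_nonneg fun _ => abs_nonneg _

theorem le_stripImNorm {d : ℝ} {h : ℂ → ℂ} (hb : ∃ C, ∀ z ∈ strip d, ‖h z‖ ≤ C) {z : ℂ}
    (hz : z ∈ strip d) : |(h z).im| ≤ stripImNorm d h := by
  obtain ⟨C, hC⟩ := hb
  exact le_ciSup (f := fun z : strip d => |(h z).im|)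
    ⟨C, by rintro _ ⟨z, rfl⟩; exact (Complex.abs_im_le_norm _).trans (hC _ z.2)⟩ ⟨z, hz⟩

theorem quantF_nonneg (α d : ℝ) (g : ℂ → ℂ) : 0 ≤ quantF α d g :=
  add_nonneg (stripNorm_nonneg _ _) (div_nonneg (stripNorm_nonneg _ _) (abs_nonneg _))

theorem quantG_nonneg (α d : ℝ) (g : ℂ → ℂ) : 0 ≤ quantG α d g :=
  add_nonneg (stripNorm_nonneg _ _) (div_nonneg (stripNorm_nonneg _ _) (abs_nonneg _))

theorem quantI_nonneg (α d : ℝ) (g : ℂ → ℂ) : 0 ≤ quantI α d g :=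
  add_nonneg (stripImNorm_nonneg _ _) (div_nonneg (stripImNorm_nonneg _ _) (abs_nonneg _))

theorem quantK_nonneg {α : ℝ} (hα : 0 < α) (d : ℝ) (g h : ℂ → ℂ) : 0 ≤ quantK α d g h :=
  mul_nonneg (by positivity) ((stripNorm_nonneg _ _).trans (le_max_left _ _))

/-- The convex cone of opening `2 |log α| d` about the positive half-line. -/
def sector (α d : ℝ) : Set ℂ :=
  {w | 0 < w.re ∧ (w.im = 0 ∨ |w.im| < Real.tan (|Real.log α| * d) * w.re)}

/-- `αᶻ`. -/
def powC (α : ℝ) (z : ℂ) : ℂ := Complex.exp ((Real.log α : ℝ) * z)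

theorem powC_add (α : ℝ) (z w : ℂ) : powC α (z + w) = powC α z * powC α w := by
  rw [powC, mul_add, Complex.exp_add]; rfl

theorem powC_ofReal {α : ℝ} (hα : 0 < α) (x : ℝ) : powC α x = ((α ^ x : ℝ) : ℂ) := by
  rw [powC, ← Complex.ofReal_mul, ← Complex.ofReal_exp, Real.rpow_def_of_pos hα]

theorem powC_one {α : ℝ} (hα : 0 < α) : powC α 1 = α := by
  simpa using powC_ofReal hα 1

theorem norm_powC {α : ℝ} (hα : 0 < α) (z : ℂ) : ‖powC α z‖ = α ^ z.re := by
  rw [powC, Complex.norm_exp, Real.rpow_def_of_pos hα, Complex.re_ofReal_mul]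

theorem powC_re {α : ℝ} (hα : 0 < α) (z : ℂ) :
    (powC α z).re = α ^ z.re * Real.cos (Real.log α * z.im) := by
  rw [powC, Complex.exp_re, Complex.re_ofReal_mul, Complex.im_ofReal_mul, Real.rpow_def_of_pos hα]

theorem powC_im {α : ℝ} (hα : 0 < α) (z : ℂ) :
    (powC α z).im = α ^ z.re * Real.sin (Real.log α * z.im) := by
  rw [powC, Complex.exp_im, Complex.re_ofReal_mul, Complex.im_ofReal_mul, Real.rpow_def_of_pos hα]

theorem differentiable_powC (α : ℝ) : Differentiable ℂ (powC α) := by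
  unfold powC; fun_prop

theorem convex_sector (α d : ℝ) : Convex ℝ (sector α d) := by
  rw [convex_iff_forall_pos]
  rintro z ⟨hz, hz'⟩ w ⟨hw, hw'⟩ a b ha hb -
  have h1 : 0 < a * z.re := mul_pos ha hz
  have h2 : 0 < b * w.re := mul_pos hb hw
  refine ⟨by simpa using add_pos h1 h2, ?_⟩
  set T := Real.tan (|Real.log α| * d) with hT
  have e1 : (a • z + b • w).im = a * z.im + b * w.im := by simp
  have e2 : (a • z + b • w).re = a * z.re + b * w.re := by simp
  rw [e1, e2]
  have h3 : |a * z.im + b * w.im| ≤ a * |z.im| + b * |w.im| := by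
    refine (abs_add_le _ _).trans ?_
    rw [abs_mul, abs_mul, abs_of_pos ha, abs_of_pos hb]
  rcases hz' with hz' | hz' <;> rcases hw' with hw' | hw'
  · left; simp [hz', hw']
  · right
    have hT0 : 0 < T := pos_of_mul_pos_left ((abs_nonneg _).trans_lt hw') hw.le
    rw [hz'] at h3 ⊢
    simp only [abs_zero] at h3
    nlinarith [mul_lt_mul_of_pos_left hw' hb, mul_pos hT0 h1]
  · right
    have hT0 : 0 < T := pos_of_mul_pos_left ((abs_nonneg _).trans_lt hz') hz.le
    rw [hw'] at h3 ⊢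
    simp only [abs_zero] at h3
    nlinarith [mul_lt_mul_of_pos_left hz' ha, mul_pos hT0 h2]
  · right
    nlinarith [mul_lt_mul_of_pos_left hz' ha, mul_lt_mul_of_pos_left hw' hb]

/-- A branch `φ` of a dilation invariant function, with `φ(αx) = αφ(x)`, together with a
continuation `G` of its logarithmic profile to an admissible strip. -/
structure Branch (α c : ℝ) (φ : ℝ → ℝ) (G : ℂ → ℂ) : Prop where
  pos : 0 < α
  lt_one : α < 1
  c_pos : 0 < c
  c_le : c ≤ Real.arccos α / |Real.log α|
  dil : ∀ x, 0 < x → φ (α * x) = α * φ x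
  cont : IsStripContinuation c (logProfile α φ) G
  quantI_lt : quantI α c G < 1

/-- The imaginary part is constant along the real axis near s, so the complex derivative is real
there. This identifies derivatives of continuations with real `deriv`. -/
theorem hasDerivAt_ofReal_eq {f : ℂ → ℂ} {f' : ℂ} {φ : ℝ → ℝ} {s : ℝ} (h : HasDerivAt f f' (s : ℂ))
    (he : ∀ᶠ t : ℝ in 𝓝 s, f t = (φ t : ℝ)) : HasDerivAt φ f'.re s ∧ f' = ((deriv φ s : ℝ) : ℂ) := by
  have h1 : HasDerivAt (fun t : ℝ => f t) f' s := h.comp_ofReal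
  have hre : HasDerivAt (fun t : ℝ => (f t).re) f'.re s := Complex.reCLM.hasFDerivAt.comp_hasDerivAt s h1
  have him : HasDerivAt (fun t : ℝ => (f t).im) f'.im s := Complex.imCLM.hasFDerivAt.comp_hasDerivAt s h1
  have h2 : HasDerivAt φ f'.re s := hre.congr_of_eventuallyEq (he.mono fun t ht => by simp [ht])
  have h3 : HasDerivAt (fun _ : ℝ => (0 : ℝ)) f'.im s :=
    him.congr_of_eventuallyEq (he.mono fun t ht => by simp [ht])
  refine ⟨h2, Complex.ext (by simp [h2.deriv]) ?_⟩
  simpa using h3.unique (hasDerivAt_const s 0)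

namespace Branch

variable {α c : ℝ} {φ : ℝ → ℝ} {G : ℂ → ℂ} (B : Branch α c φ G)
include B

theorem lam_pos : 0 < |Real.log α| := abs_log_pos B.pos B.lt_one

theorem log_ne_zero : Real.log α ≠ 0 := abs_pos.mp B.lam_pos

theorem lam_mul_c_le : |Real.log α| * c ≤ Real.arccos α := by
  have := (le_div_iff₀ B.lam_pos).mp B.c_le
  linarith

theorem arccos_lt : Real.arccos α < Real.pi / 2 := by
  rw [Real.arccos_lt_pi_div_two]; exact B.pos

theorem lam_mul_c_lt : |Real.log α| * c < Real.pi / 2 := B.lam_mul_c_le.trans_lt B.arccos_lt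

theorem abs_log_mul_im_le {z : ℂ} (hz : z ∈ strip c) : |Real.log α * z.im| ≤ |Real.log α| * c := by
  rw [strip_eq B.c_pos] at hz
  rw [abs_mul]
  exact mul_le_mul_of_nonneg_left (le_of_lt hz) (abs_nonneg _)

/-- The source of the condition c ≤ arccos α/|log α|: the argument of αᶻ is at most arccos α in
modulus, so passing from |αᶻ| to its real part loses at most a factor α. -/
theorem le_cos {z : ℂ} (hz : z ∈ strip c) : α ≤ Real.cos (Real.log α * z.im) := by
  have h1 := (B.abs_log_mul_im_le hz).trans B.lam_mul_c_le
  have h2 := Real.cos_le_cos_of_nonneg_of_le_pi (abs_nonneg _) (Real.arccos_le_pi _) h1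
  rwa [Real.cos_abs, Real.cos_arccos (by linarith [B.pos] : -1 ≤ α) B.lt_one.le] at h2

theorem le_powC_re {z : ℂ} (hz : z ∈ strip c) : α * α ^ z.re ≤ (powC α z).re := by
  rw [powC_re B.pos, mul_comm]
  exact mul_le_mul_of_nonneg_left (B.le_cos hz) (Real.rpow_nonneg B.pos.le _)

theorem powC_mem_sector {d : ℝ} (hdc : d ≤ c) {z : ℂ} (hz : z ∈ strip d) :
    powC α z ∈ sector α d := by
  have hp := Real.rpow_pos_of_pos B.pos z.re
  have h0 := B.le_powC_re (strip_mono hdc hz)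
  refine ⟨(mul_pos B.pos hp).trans_le h0, hz.imp (fun h => ?_) fun h => ?_⟩
  · rw [powC_im B.pos, h]; simp
  · have hl := B.lam_pos
    have hcos : 0 < Real.cos (Real.log α * z.im) := B.pos.trans_le (B.le_cos (strip_mono hdc hz))
    rw [powC_im B.pos, powC_re B.pos, abs_mul, abs_of_pos hp]
    have h1 : |Real.log α * z.im| < |Real.log α| * d := by
      rw [abs_mul]; exact mul_lt_mul_of_pos_left h hl
    have h2 : |Real.log α| * d < Real.pi / 2 :=
      (mul_le_mul_of_nonneg_left hdc hl.le).trans_lt B.lam_mul_c_lt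
    have h3 : Real.tan |Real.log α * z.im| < Real.tan (|Real.log α| * d) :=
      Real.tan_lt_tan_of_lt_of_lt_pi_div_two
        (by linarith [abs_nonneg (Real.log α * z.im), Real.pi_pos]) h2 h1
    have h4 : |Real.sin (Real.log α * z.im)|
        = Real.tan |Real.log α * z.im| * Real.cos (Real.log α * z.im) := by
      rw [Real.tan_eq_sin_div_cos, Real.cos_abs, div_mul_cancel₀ _ hcos.ne', Real.abs_sin_eq_sin_abs_of_abs_le_pi]
      linarith [Real.pi_pos]
    rw [h4]
    calc α ^ z.re * (Real.tan |Real.log α * z.im| * Real.cos (Real.log α * z.im))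
        = Real.tan |Real.log α * z.im| * (α ^ z.re * Real.cos (Real.log α * z.im)) := by ring
      _ < _ := mul_lt_mul_of_pos_right h3 (mul_pos hp hcos)

theorem isOpen_sector : IsOpen (sector α c) := by
  have hT : 0 < Real.tan (|Real.log α| * c) :=
    Real.tan_pos_of_pos_of_lt_pi_div_two (mul_pos B.lam_pos B.c_pos) B.lam_mul_c_lt
  have : sector α c = {w : ℂ | 0 < w.re} ∩ {w | |w.im| < Real.tan (|Real.log α| * c) * w.re} := by
    ext w
    refine ⟨fun ⟨h1, h2⟩ => ⟨h1, h2.elim (fun h => ?_) id⟩, fun ⟨h1, h2⟩ => ⟨h1, Or.inr h2⟩⟩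
    simpa [h] using mul_pos hT h1
  rw [this]
  exact (isOpen_lt continuous_const Complex.continuous_re).inter
    (isOpen_lt Complex.continuous_im.abs (Complex.continuous_re.const_mul _))

/-- Inverse of z ↦ αᶻ from the strip to the sector. The half-angle |log α| d is below π/2, where the
tangent is monotone and the principal logarithm applies. -/
theorem log_div_mem_strip {d : ℝ} (hd : 0 ≤ d) (hdc : d ≤ c) {w : ℂ} (hw : w ∈ sector α d) :
    Complex.log w / (Real.log α : ℝ) ∈ strip d := by
  obtain ⟨h0, h1⟩ := hw
  have e : (Complex.log w / (Real.log α : ℝ)).im = w.arg / Real.log α := by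
    rw [Complex.div_ofReal_im, Complex.log_im]
  refine h1.imp (fun h => ?_) fun h => ?_
  · rw [e, Complex.arg_eq_zero_iff.mpr ⟨h0.le, h⟩, zero_div]
  · rw [e, abs_div, div_lt_iff₀ B.lam_pos, mul_comm]
    have h2 : |Real.log α| * d < Real.pi / 2 :=
      (mul_le_mul_of_nonneg_left hdc B.lam_pos.le).trans_lt B.lam_mul_c_lt
    have h3 : |w.arg| < Real.pi / 2 := Complex.abs_arg_lt_pi_div_two_iff.mpr (Or.inl h0)
    have hT : 0 < Real.tan (|Real.log α| * d) := pos_of_mul_pos_left ((abs_nonneg _).trans_lt h) h0.le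
    by_contra! hcon
    have h4 : Real.tan (|Real.log α| * d) ≤ Real.tan |w.arg| :=
      Real.strictMonoOn_tan.monotoneOn
        ⟨by linarith [mul_nonneg B.lam_pos.le hd, Real.pi_pos], h2⟩
        ⟨by linarith [abs_nonneg w.arg, Real.pi_pos], h3⟩ hcon
    have h5 : Real.tan |w.arg| ≤ |w.im| / w.re := by
      rw [← abs_of_pos h0, ← abs_div, ← Complex.tan_arg]
      rcases abs_choice w.arg with ha | ha
      · rw [ha]; exact le_abs_self _
      · rw [ha, Real.tan_neg]; exact neg_le_abs _
    replace h4 := h4.trans h5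
    rw [le_div_iff₀ h0] at h4
    linarith

end Branch

set_option linter.unusedSectionVars false

/-- The continuation `w ↦ w G(log w / log α)` of a branch to a sector. -/
def conic (α : ℝ) (G : ℂ → ℂ) (w : ℂ) : ℂ := w * G (Complex.log w / (Real.log α : ℝ))

/-- `G + G' / log α`. -/
def slopeC (α : ℝ) (G : ℂ → ℂ) (z : ℂ) : ℂ := G z + deriv G z / (Real.log α : ℝ)

/-- The derivative of `conic`. -/
def conic1 (α : ℝ) (G : ℂ → ℂ) (w : ℂ) : ℂ := slopeC α G (Complex.log w / (Real.log α : ℝ))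

/-- The second derivative of `conic`. -/
def conic2 (α : ℝ) (G : ℂ → ℂ) (w : ℂ) : ℂ :=
  (deriv G (Complex.log w / (Real.log α : ℝ))
    + deriv (deriv G) (Complex.log w / (Real.log α : ℝ)) / (Real.log α : ℝ)) /
    ((Real.log α : ℝ) * w)

namespace Branch

variable {α c : ℝ} {φ : ℝ → ℝ} {G : ℂ → ℂ} (B : Branch α c φ G)
include B

theorem log_powC {z : ℂ} (hz : z ∈ strip c) :
    Complex.log (powC α z) / (Real.log α : ℝ) = z := by
  have h1 := (B.abs_log_mul_im_le hz).trans_lt (B.lam_mul_c_lt)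
  have h2 : |((Real.log α : ℝ) * z : ℂ).im| < Real.pi := by
    rw [Complex.im_ofReal_mul]; linarith [Real.pi_pos]
  rw [powC, Complex.log_exp (abs_lt.mp h2).1 (abs_lt.mp h2).2.le]
  exact mul_div_cancel_left₀ _ (Complex.ofReal_ne_zero.mpr B.log_ne_zero)

theorem conic_powC {z : ℂ} (hz : z ∈ strip c) : conic α G (powC α z) = powC α z * G z := by
  rw [conic, B.log_powC hz]

theorem conic1_powC {z : ℂ} (hz : z ∈ strip c) : conic1 α G (powC α z) = slopeC α G z := by
  rw [conic1, B.log_powC hz]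

theorem analyticOnNhd : AnalyticOnNhd ℂ G (strip c) :=
  B.cont.differentiableOn.analyticOnNhd (isOpen_strip B.c_pos)

theorem logProfile_add_one (x : ℝ) : logProfile α φ (x + 1) = logProfile α φ x := by
  have hx := Real.rpow_pos_of_pos B.pos x
  have e : α ^ (x + 1) = α * α ^ x := by rw [Real.rpow_add B.pos, Real.rpow_one, mul_comm]
  have hα := B.pos.ne'
  rw [logProfile, logProfile, e, B.dil _ hx, neg_add, Real.rpow_add B.pos, Real.rpow_neg_one]
  field_simp

/-- Periodicity on the real line comes from the dilation law; the identity theorem extends it to the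
strip. -/
theorem add_one {z : ℂ} (hz : z ∈ strip c) : G (z + 1) = G z := by
  have hsh : ∀ w ∈ strip c, w + 1 ∈ strip c := fun w hw => by simpa using add_mem_strip hw 1
  have h1 : AnalyticOnNhd ℂ (fun w => G (w + 1)) (strip c) := 
    (B.cont.differentiableOn.comp (by fun_prop) hsh).analyticOnNhd (isOpen_strip B.c_pos)
  refine h1.eqOn_of_preconnected_of_frequently_eq B.analyticOnNhd (convex_strip B.c_pos).isPreconnected
    (z₀ := ((0 : ℝ) : ℂ)) (ofReal_mem_strip c 0) ?_ hz
  have h2 : Tendsto (fun x : ℝ => (x : ℂ)) (𝓝[≠] 0) (𝓝[≠] ((0 : ℝ) : ℂ)) := by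
    refine tendsto_nhdsWithin_iff.mpr ⟨?_, ?_⟩
    · exact Complex.continuous_ofReal.continuousAt.tendsto.mono_left nhdsWithin_le_nhds
    · filter_upwards [self_mem_nhdsWithin] with x hx
      simpa using hx
  refine h2.frequently (Eventually.frequently (Eventually.of_forall fun x => ?_))
  have := B.cont.eq_on_real (x + 1)
  push_cast at this
  rw [this, B.cont.eq_on_real, B.logProfile_add_one]

theorem deriv_add_one {z : ℂ} (hz : z ∈ strip c) : deriv G (z + 1) = deriv G z := by
  rw [← deriv_comp_add_const G 1 z]
  exact Filter.EventuallyEq.deriv_eq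
    (eventually_of_mem ((isOpen_strip B.c_pos).mem_nhds hz) fun w hw => B.add_one hw)

theorem slopeC_add_one {z : ℂ} (hz : z ∈ strip c) : slopeC α G (z + 1) = slopeC α G z := by
  rw [slopeC, slopeC, B.add_one hz, B.deriv_add_one hz]

theorem differentiableOn_slopeC : DifferentiableOn ℂ (slopeC α G) (strip c) :=
  B.cont.differentiableOn.add
    ((B.analyticOnNhd.deriv.differentiableOn).div_const _)

theorem hasDerivAt_log_div {w : ℂ} (hw : w ∈ sector α c) :
    HasDerivAt (fun w => Complex.log w / (Real.log α : ℝ)) (w⁻¹ / (Real.log α : ℝ)) w :=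
  (Complex.hasDerivAt_log (Or.inl hw.1)).div_const _

theorem hasDerivAt_conic {w : ℂ} (hw : w ∈ sector α c) :
    HasDerivAt (conic α G) (conic1 α G w) w := by
  have hw0 : w ≠ 0 := fun h => by simpa [h] using hw.1
  have hz := B.log_div_mem_strip B.c_pos.le le_rfl hw
  have h1 := (B.analyticOnNhd _ hz).differentiableAt.hasDerivAt.comp w (B.hasDerivAt_log_div hw)
  have h2 := (hasDerivAt_id w).mul h1
  refine h2.congr_deriv ?_
  simp only [conic1, slopeC, Function.comp, id]
  field_simp

theorem hasDerivAt_conic1 {w : ℂ} (hw : w ∈ sector α c) :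
    HasDerivAt (conic1 α G) (conic2 α G w) w := by
  have hw0 : w ≠ 0 := fun h => by simpa [h] using hw.1
  have hz := B.log_div_mem_strip B.c_pos.le le_rfl hw
  have h0 := (B.analyticOnNhd _ hz).differentiableAt.hasDerivAt.add
    ((B.analyticOnNhd.deriv _ hz).differentiableAt.hasDerivAt.div_const ((Real.log α : ℝ) : ℂ))
  have h1 := h0.comp w (B.hasDerivAt_log_div hw)
  refine h1.congr_deriv ?_
  have := Complex.ofReal_ne_zero.mpr B.log_ne_zero
  simp only [conic2]
  field_simp

theorem ofReal_mem_sector {s : ℝ} (hs : 0 < s) (d : ℝ) : (s : ℂ) ∈ sector α d :=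
  ⟨by simpa using hs, Or.inl (Complex.ofReal_im s)⟩

theorem conic_ofReal {s : ℝ} (hs : 0 < s) : conic α G s = (φ s : ℝ) := by
  have e : Complex.log (s : ℂ) / (Real.log α : ℝ) = ((Real.log s / Real.log α : ℝ) : ℂ) := by
    rw [← Complex.ofReal_log hs.le]; push_cast; rfl
  rw [conic, e, B.cont.eq_on_real, logProfile]
  have e2 : α ^ (Real.log s / Real.log α) = s := by
    rw [Real.rpow_def_of_pos B.pos, mul_div_cancel₀ _ B.log_ne_zero, Real.exp_log hs]
  rw [Real.rpow_neg B.pos.le, e2]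
  have : (s : ℂ) ≠ 0 := Complex.ofReal_ne_zero.mpr hs.ne'
  push_cast
  field_simp

theorem conic1_ofReal {s : ℝ} (hs : 0 < s) : conic1 α G s = (deriv φ s : ℝ) :=
  (hasDerivAt_ofReal_eq (B.hasDerivAt_conic (B.ofReal_mem_sector hs c))
    (eventually_of_mem (Ioi_mem_nhds hs) fun _ ht => B.conic_ofReal ht)).2

theorem conic2_ofReal {s : ℝ} (hs : 0 < s) : conic2 α G s = (deriv (deriv φ) s : ℝ) :=
  (hasDerivAt_ofReal_eq (B.hasDerivAt_conic1 (B.ofReal_mem_sector hs c))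
    (eventually_of_mem (Ioi_mem_nhds hs) fun _ ht => B.conic1_ofReal ht)).2

theorem slopeC_ofReal (x : ℝ) : slopeC α G x = (deriv φ (α ^ x) : ℝ) := by
  rw [← B.conic1_powC (ofReal_mem_strip c x), powC_ofReal B.pos,
    B.conic1_ofReal (Real.rpow_pos_of_pos B.pos x)]

section bounds

variable {d : ℝ} (hdc : d ≤ c)
include hdc

theorem norm_le {z : ℂ} (hz : z ∈ strip d) : ‖G z‖ ≤ stripNorm d G :=
  le_stripNorm (B.cont.bounded.imp fun _ h z hz => h z (strip_mono hdc hz)) hz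

theorem norm_deriv_le {z : ℂ} (hz : z ∈ strip d) : ‖deriv G z‖ ≤ stripNorm d (deriv G) :=
  le_stripNorm (B.cont.bounded_deriv.imp fun _ h z hz => h z (strip_mono hdc hz)) hz

theorem norm_deriv_deriv_le {z : ℂ} (hz : z ∈ strip d) :
    ‖deriv (deriv G) z‖ ≤ stripNorm d (deriv (deriv G)) :=
  le_stripNorm (B.cont.bounded_deriv_deriv.imp fun _ h z hz => h z (strip_mono hdc hz)) hz

theorem abs_im_le {z : ℂ} (hz : z ∈ strip d) : |(G z).im| ≤ stripImNorm d G :=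
  le_stripImNorm (B.cont.bounded.imp fun _ h z hz => h z (strip_mono hdc hz)) hz

theorem abs_im_deriv_le {z : ℂ} (hz : z ∈ strip d) : |(deriv G z).im| ≤ stripImNorm d (deriv G) :=
  le_stripImNorm (B.cont.bounded_deriv.imp fun _ h z hz => h z (strip_mono hdc hz)) hz

theorem norm_slopeC_le {z : ℂ} (hz : z ∈ strip d) : ‖slopeC α G z‖ ≤ quantF α d G := by
  refine (norm_add_le _ _).trans (add_le_add (B.norm_le hdc hz) ?_)
  rw [norm_div, Complex.norm_real, Real.norm_eq_abs]
  exact div_le_div_of_nonneg_right (B.norm_deriv_le hdc hz) (abs_nonneg _)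

theorem abs_im_slopeC_le {z : ℂ} (hz : z ∈ strip d) : |(slopeC α G z).im| ≤ quantI α d G := by
  rw [slopeC, Complex.add_im, Complex.div_ofReal_im]
  refine (abs_add_le _ _).trans (add_le_add (B.abs_im_le hdc hz) ?_)
  rw [abs_div]
  exact div_le_div_of_nonneg_right (B.abs_im_deriv_le hdc hz) (abs_nonneg _)

variable (hd : 0 ≤ d)
include hd

theorem norm_conic1_le {w : ℂ} (hw : w ∈ sector α d) : ‖conic1 α G w‖ ≤ quantF α d G :=
  B.norm_slopeC_le hdc (B.log_div_mem_strip hd hdc hw)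

theorem abs_im_conic1_le {w : ℂ} (hw : w ∈ sector α d) : |(conic1 α G w).im| ≤ quantI α d G :=
  B.abs_im_slopeC_le hdc (B.log_div_mem_strip hd hdc hw)

theorem norm_conic2_le {w : ℂ} (hw : w ∈ sector α d) :
    ‖conic2 α G w‖ ≤ quantG α d G / (|Real.log α| * ‖w‖) := by
  have hz := B.log_div_mem_strip hd hdc hw
  rw [conic2, norm_div, norm_mul, Complex.norm_real, Real.norm_eq_abs]
  refine div_le_div_of_nonneg_right ((norm_add_le _ _).trans
    (add_le_add (B.norm_deriv_le hdc hz) ?_)) (by positivity)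
  rw [norm_div, Complex.norm_real, Real.norm_eq_abs]
  exact div_le_div_of_nonneg_right (B.norm_deriv_deriv_le hdc hz) (abs_nonneg _)

end bounds

/-- G and G′ are real on the real axis. At width zero the denominators 1 − ℑ² are therefore 1. -/
theorem quantI_zero : quantI α 0 G = 0 := by
  have h1 : ∀ z ∈ strip 0, (G z).im = 0 := fun z hz => by
    rw [eq_ofReal_of_mem_strip_zero hz, B.cont.eq_on_real]; simp
  have h2 : ∀ z ∈ strip 0, (deriv G z).im = 0 := fun z hz => by
    rw [eq_ofReal_of_mem_strip_zero hz]
    rw [(hasDerivAt_ofReal_eq (B.analyticOnNhd _ (ofReal_mem_strip c z.re)).differentiableAt.hasDerivAt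
      (Eventually.of_forall B.cont.eq_on_real)).2]
    simp
  have key : ∀ h : ℂ → ℂ, (∀ z ∈ strip 0, (h z).im = 0) → stripImNorm 0 h = 0 := by
    intro h hh
    have : ∀ z : strip 0, |(h z).im| = 0 := fun z => by rw [hh z z.2, abs_zero]
    simp [stripImNorm, this]
  rw [quantI, key _ h1, key _ h2]; simp

theorem quantI_lt_of_le {d : ℝ} (hdc : d ≤ c) : quantI α d G < 1 := by
  have := nonempty_strip d
  refine lt_of_le_of_lt (add_le_add ?_ (div_le_div_of_nonneg_right ?_ (abs_nonneg _))) B.quantI_lt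
  · exact ciSup_le fun z => B.abs_im_le le_rfl (strip_mono hdc z.2)
  · exact ciSup_le fun z => B.abs_im_deriv_le le_rfl (strip_mono hdc z.2)

end Branch

/-! ### The complexified kernels -/

/-- The continuation of `kernelWeight`. -/
def weightC (α : ℝ) (G H : ℂ → ℂ) (x y : ℂ) : ℂ :=
  (1 + slopeC α G x ^ 2) ^ (1 / 4 : ℂ) / (1 + slopeC α H y ^ 2) ^ (1 / 4 : ℂ) *
    powC α ((x + y) / 2) * (|Real.log α| : ℝ)

/-- The continuation of `qSame`. -/
def qSameC (α : ℝ) (G : ℂ → ℂ) (x y : ℂ) : ℂ := divDiff (conic α G) (conic1 α G) (powC α x) (powC α y)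

/-- The continuation of `pSame`. -/
def pSameC (α : ℝ) (G : ℂ → ℂ) (x y : ℂ) : ℂ :=
  divDiff2 (conic α G) (conic1 α G) (conic2 α G) (powC α x) (powC α y)

/-- The continuation of `qCross`. -/
def qCrossC (α : ℝ) (G H : ℂ → ℂ) (x y : ℂ) : ℂ :=
  (conic α G (powC α x) - conic α H (powC α y)) / (powC α x + powC α y)

/-- The continuation of `pCross`. -/
def pCrossC (α : ℝ) (G H : ℂ → ℂ) (x y : ℂ) : ℂ :=
  ((powC α y + powC α x) * conic1 α H (powC α y) + conic α G (powC α x) - conic α H (powC α y)) /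
    (powC α x + powC α y) ^ 2

/-- The continuation of `termSame`, as a function of `x + j` and `y`. -/
def termSameC (α : ℝ) (G : ℂ → ℂ) (x y : ℂ) : ℂ :=
  pSameC α G x y / (1 + qSameC α G x y ^ 2) * weightC α G G x y

/-- The continuation of `termCross`, as a function of `x + j` and `y`. -/
def termCrossC (α : ℝ) (G H : ℂ → ℂ) (x y : ℂ) : ℂ :=
  pCrossC α G H x y / (1 + qCrossC α G H x y ^ 2) * weightC α G H x y

/-- Re(1 + q²) = 1 + (Re q)² − (Im q)². For |Im q| < 1 this keeps 1 + q² away from zero and off the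
branch cut of the fourth root. -/
theorem one_sub_sq_le_re {q : ℂ} {κ : ℝ} (h : |q.im| ≤ κ) : 1 - κ ^ 2 ≤ (1 + q ^ 2).re := by
  have : q.im ^ 2 ≤ κ ^ 2 := sq_le_sq' (by linarith [neg_abs_le q.im]) ((le_abs_self _).trans h)
  simp only [sq, Complex.add_re, Complex.one_re, Complex.mul_re] at *
  nlinarith [mul_self_nonneg q.re]

theorem one_sub_sq_le_norm {q : ℂ} {κ : ℝ} (h : |q.im| ≤ κ) : 1 - κ ^ 2 ≤ ‖1 + q ^ 2‖ :=
  (one_sub_sq_le_re h).trans (Complex.re_le_norm _)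

theorem one_add_sq_ne_zero {q : ℂ} (h : |q.im| < 1) : 1 + q ^ 2 ≠ 0 := by
  intro h0
  have := one_sub_sq_le_re (le_refl |q.im|)
  rw [h0] at this
  have h1 := abs_nonneg q.im
  simp at this
  nlinarith [sq_abs q.im]

theorem one_add_sq_mem_slitPlane {q : ℂ} (h : |q.im| < 1) : 1 + q ^ 2 ∈ Complex.slitPlane := by
  left
  have := one_sub_sq_le_re (le_refl |q.im|)
  have h1 := abs_nonneg q.im
  nlinarith

theorem norm_cpow_quarter (w : ℂ) : ‖w ^ (1 / 4 : ℂ)‖ = ‖w‖ ^ (1 / 4 : ℝ) := by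
  have : (1 / 4 : ℂ) = ((1 / 4 : ℝ) : ℂ) := by push_cast; rfl
  rw [this, Complex.norm_cpow_real]

theorem norm_one_add_sq_le {q : ℂ} {F : ℝ} (h : ‖q‖ ≤ F) : ‖1 + q ^ 2‖ ≤ 1 + F ^ 2 := by
  refine (norm_add_le _ _).trans ?_
  rw [norm_one, norm_pow]
  gcongr

theorem cpow_quarter_ofReal {x : ℝ} (hx : 0 ≤ x) :
    (x : ℂ) ^ (1 / 4 : ℂ) = ((x ^ (1 / 4 : ℝ) : ℝ) : ℂ) := by
  rw [Complex.ofReal_cpow hx]; push_cast; rfl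

/-! ### The complexified terms at real arguments -/

section real

variable {α c : ℝ} {φ ψ : ℝ → ℝ} {G H : ℂ → ℂ} (B : Branch α c φ G) (B' : Branch α c ψ H)

include B in
theorem Branch.slopeC_add_intCast (x : ℝ) (j : ℤ) : slopeC α G (x + j) = slopeC α G x := by
  have hs : ∀ (x : ℝ), slopeC α G (x + 1) = slopeC α G x := fun x =>
    B.slopeC_add_one (ofReal_mem_strip c x)
  induction j with
  | zero => simp
  | succ n ih =>
    have := hs (x + n)
    push_cast at this ih ⊢
    rw [← add_assoc, this, ih]
  | pred n ih =>
    have := hs (x + (-n - 1))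
    push_cast at this ih ⊢
    rw [← this, ← ih]; congr 1; ring

-- The continuation has the slope at x + j where `kernelWeight` has it at x; the slope has period
-- one.
include B B' in
theorem weightC_ofReal (j : ℤ) (x y : ℝ) :
    weightC α G H (x + j) y = (kernelWeight α φ ψ j x y : ℝ) := by
  have e1 : ((x : ℂ) + j + y) / 2 = (((x + y + j) / 2 : ℝ) : ℂ) := by push_cast; ring
  rw [weightC, B.slopeC_add_intCast, B.slopeC_ofReal, B'.slopeC_ofReal, e1, powC_ofReal B.pos,
    kernelWeight, Real.div_rpow (by positivity) (by positivity)]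
  push_cast
  rw [← cpow_quarter_ofReal (by positivity), ← cpow_quarter_ofReal (by positivity)]
  push_cast
  rfl

include B in
theorem termSameC_ofReal (j : ℤ) (x y : ℝ) :
    termSameC α G (x + j) y = (termSame α φ j x y : ℝ) := by
  have e1 : (x : ℂ) + j = ((x + j : ℝ) : ℂ) := by push_cast; ring
  have hr := Real.rpow_pos_of_pos B.pos (x + j)
  have hs := Real.rpow_pos_of_pos B.pos y
  have hiff : (((α ^ (x + j) : ℝ) : ℂ) = ((α ^ y : ℝ) : ℂ)) ↔ x + j = y := by
    rw [Complex.ofReal_inj]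
    exact Real.rpow_right_inj B.pos B.lt_one.ne
  have hq : qSameC α G (x + j) y = (qSame α φ j x y : ℝ) := by
    rw [qSameC, e1, powC_ofReal B.pos, powC_ofReal B.pos, divDiff, qSame]
    by_cases h : x + j = y
    · rw [if_pos (hiff.mpr h), if_pos h, B.conic1_ofReal hs]
    · rw [if_neg (hiff.not.mpr h), if_neg h, B.conic_ofReal hs, B.conic_ofReal hr]
      push_cast; rfl
  have hp : pSameC α G (x + j) y = (pSame α φ j x y : ℝ) := by
    rw [pSameC, e1, powC_ofReal B.pos, powC_ofReal B.pos, divDiff2, pSame]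
    by_cases h : x + j = y
    · rw [if_pos (hiff.mpr h), if_pos h, B.conic2_ofReal hs]
      push_cast; rfl
    · rw [if_neg (hiff.not.mpr h), if_neg h, B.conic_ofReal hs, B.conic_ofReal hr,
        B.conic1_ofReal hs]
      push_cast; rfl
  rw [termSameC, hq, hp, weightC_ofReal B B, termSame]
  push_cast; rfl

include B B' in
theorem termCrossC_ofReal (j : ℤ) (x y : ℝ) :
    termCrossC α G H (x + j) y = (termCross α φ ψ j x y : ℝ) := by
  have e1 : (x : ℂ) + j = ((x + j : ℝ) : ℂ) := by push_cast; ring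
  have hr := Real.rpow_pos_of_pos B.pos (x + j)
  have hs := Real.rpow_pos_of_pos B.pos y
  rw [termCrossC, weightC_ofReal B B', pCrossC, qCrossC, e1, powC_ofReal B.pos, powC_ofReal B.pos,
    B'.conic_ofReal hs, B.conic_ofReal hr, B'.conic1_ofReal hs, termCross, pCross, qCross]
  push_cast; rfl

end real

/-! ### Bound for the weight -/

section weight

variable {α c : ℝ} {φ ψ : ℝ → ℝ} {G H : ℂ → ℂ} (B : Branch α c φ G) (B' : Branch α c ψ H)
  {d₁ d₂ : ℝ} (h₁ : d₁ ≤ c) (h₂ : d₂ ≤ c)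

include B B' h₁ h₂ in
theorem norm_weightC_le {x y : ℂ} (hx : x ∈ strip d₁) (hy : y ∈ strip d₂) :
    ‖weightC α G H x y‖ ≤ ((1 + quantF α d₁ G ^ 2) / (1 - quantI α d₂ H ^ 2)) ^ (1 / 4 : ℝ) *
      (α ^ ((x.re + y.re) / 2) * |Real.log α|) := by
  have hI := B'.quantI_lt_of_le h₂
  have hI0 := quantI_nonneg α d₂ H
  have hpos : 0 < 1 - quantI α d₂ H ^ 2 := by nlinarith
  have hl := one_sub_sq_le_norm (B'.abs_im_slopeC_le h₂ hy)
  have hu := norm_one_add_sq_le (B.norm_slopeC_le h₁ hx)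
  rw [weightC, norm_mul, norm_mul, norm_div, norm_cpow_quarter, norm_cpow_quarter,
    norm_powC B.pos, Complex.norm_real, Real.norm_eq_abs, abs_abs, mul_assoc]
  have e : ((x + y) / 2).re = (x.re + y.re) / 2 := by simp
  rw [e]
  have := Real.rpow_nonneg B.pos.le ((x.re + y.re) / 2)
  refine mul_le_mul_of_nonneg_right ?_ (by positivity)
  rw [← Real.div_rpow (norm_nonneg _) (norm_nonneg _)]
  exact Real.rpow_le_rpow (by positivity) (div_le_div₀ (by positivity) hu hpos hl) (by norm_num)

end weight

/-! ### Bounds for the terms of the diagonal blocks -/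

section same

variable {α c : ℝ} {φ : ℝ → ℝ} {G : ℂ → ℂ} (B : Branch α c φ G)
  {d d₁ d₂ : ℝ} (hd : 0 ≤ d) (hdc : d ≤ c)

/-- After division by the distance |αᵃ − αᵇ| the factor α^{(a+b)/2} depends only on a − b. This is
the origin of the hyperbolic sine in ℬ. -/
theorem rpow_half_eq_invSinh {α : ℝ} (hα0 : 0 < α) (hα1 : α < 1) {a b : ℝ} (h : a ≠ b) :
    α ^ ((a + b) / 2) = |α ^ a - α ^ b| * invSinh α |a - b| := by
  wlog hab : a < b generalizing a b
  · rw [add_comm, abs_sub_comm, abs_sub_comm a b]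
    exact this h.symm (lt_of_le_of_ne (not_lt.mp hab) h.symm)
  have h1 : α ^ b < α ^ a := Real.rpow_lt_rpow_of_exponent_gt hα0 hα1 hab
  rw [abs_of_pos (by linarith), abs_of_neg (by linarith), invSinh_eq hα0 hα1]
  have e1 : α ^ a = α ^ ((a + b) / 2) * α ^ (-(-(a - b)) / 2) := by
    rw [← Real.rpow_add hα0]; congr 1; ring
  have e2 : α ^ b = α ^ ((a + b) / 2) * α ^ (-(a - b) / 2) := by
    rw [← Real.rpow_add hα0]; congr 1; ring
  have hp := Real.rpow_pos_of_pos hα0 ((a + b) / 2)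
  have h3 : α ^ a - α ^ b = α ^ ((a + b) / 2) * (α ^ (-(-(a - b)) / 2) - α ^ (-(a - b) / 2)) := by
    rw [mul_sub, ← e1, ← e2]
  rw [h3, mul_assoc, mul_inv_cancel₀, mul_one]
  intro h0
  rw [h0, mul_zero] at h3
  linarith

include B hd hdc in
theorem sector_subset : sector α d ⊆ sector α c := by
  rintro w hw
  have h1 := B.powC_mem_sector le_rfl (strip_mono hdc (B.log_div_mem_strip hd hdc hw))
  rwa [powC, mul_div_cancel₀ _ (Complex.ofReal_ne_zero.mpr B.log_ne_zero),
    Complex.exp_log (fun h => by simpa [h] using hw.1)] at h1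

-- Near the diagonal f[r, s, s] is bounded through f″, with |f″(w)| ≤ 𝔊/(λ|w|). On the segment Re w
-- ≥ α·αᵐ with m = max(Re x, Re y), which costs one power of α. The remaining exponent (Re x + Re
-- y)/2 − m = −|Re x − Re y|/2 is at least −k/2.
include B hd hdc in
theorem norm_pSameC_le_near {x y : ℂ} (hx : x ∈ strip d) (hy : y ∈ strip d) {k : ℝ}
    (hk : |x.re - y.re| ≤ k) :
    ‖pSameC α G x y‖ * (α ^ ((x.re + y.re) / 2) * |Real.log α|) ≤
      quantG α d G / 2 * α ^ (-(1 + k / 2)) := by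
  have hl := B.lam_pos
  set m := max x.re y.re with hm
  have hG := quantG_nonneg α d G
  have hpm := Real.rpow_pos_of_pos B.pos m
  have hr := B.powC_mem_sector hdc hx
  have hs := B.powC_mem_sector hdc hy
  have hrre : α * α ^ m ≤ (powC α x).re :=
    (mul_le_mul_of_nonneg_left (Real.rpow_le_rpow_of_exponent_ge B.pos B.lt_one.le (le_max_left _ _))
      B.pos.le).trans (B.le_powC_re (strip_mono hdc hx))
  have hsre : α * α ^ m ≤ (powC α y).re :=
    (mul_le_mul_of_nonneg_left (Real.rpow_le_rpow_of_exponent_ge B.pos B.lt_one.le (le_max_right _ _))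
      B.pos.le).trans (B.le_powC_re (strip_mono hdc hy))
  have hsub := sector_subset B hd hdc
  have hp : ‖pSameC α G x y‖ ≤ quantG α d G / (|Real.log α| * (α * α ^ m)) / 2 := by
    refine norm_divDiff2_le (convex_sector α d) (fun w hw => B.hasDerivAt_conic (hsub hw))
      (fun w hw => B.hasDerivAt_conic1 (hsub hw)) hr hs fun t ht => ?_
    refine (B.norm_conic2_le hdc hd (segment_mem (convex_sector α d) hr hs ht)).trans ?_
    have hα := B.pos
    gcongr
    refine le_trans ?_ (Complex.re_le_norm _)
    have e : (powC α y + (t : ℂ) * (powC α x - powC α y)).re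
        = (1 - t) * (powC α y).re + t * (powC α x).re := by
      simp; ring
    rw [e]
    nlinarith [mul_le_mul_of_nonneg_left hsre (by linarith [ht.2] : 0 ≤ 1 - t),
      mul_le_mul_of_nonneg_left hrre ht.1]
  have hE := Real.rpow_pos_of_pos B.pos ((x.re + y.re) / 2)
  refine (mul_le_mul_of_nonneg_right hp (by positivity)).trans ?_
  have e1 : quantG α d G / (|Real.log α| * (α * α ^ m)) / 2 * (α ^ ((x.re + y.re) / 2) * |Real.log α|)
      = quantG α d G / 2 * (α ^ ((x.re + y.re) / 2) / (α * α ^ m)) := by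
    have := B.pos
    field_simp
  have e2 : α ^ ((x.re + y.re) / 2) / (α * α ^ m) = α ^ ((x.re + y.re) / 2 - (1 + m)) := by
    rw [Real.rpow_sub B.pos, Real.rpow_add B.pos, Real.rpow_one]
  rw [e1, e2]
  refine mul_le_mul_of_nonneg_left (Real.rpow_le_rpow_of_exponent_ge B.pos B.lt_one.le ?_)
    (by positivity)
  rw [hm]
  rcases abs_le.mp hk with ⟨h1, h2⟩
  rcases max_cases x.re y.re with ⟨h, _⟩ | ⟨h, _⟩ <;> rw [h] <;> linarith

-- Far from the diagonal only first derivatives enter: the divided difference f[r, s] sees the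
-- larger strip, f′(s) only the strip of the second variable, hence 𝔉_d + 𝔉_{d₂}. The distance |r −
-- s| is at least the difference of the moduli.
include B hd hdc in
theorem norm_pSameC_le_far (hd₂ : d₂ ≤ d) {x y : ℂ} (hx : x ∈ strip d) (hy : y ∈ strip d₂) {k : ℝ}
    (hk0 : 0 < k) (hk : k ≤ |x.re - y.re|) :
    ‖pSameC α G x y‖ * (α ^ ((x.re + y.re) / 2) * |Real.log α|) ≤
      |Real.log α| * (quantF α d G + quantF α d₂ G) * invSinh α k := by
  have hl := B.lam_pos
  have hne : x.re ≠ y.re := fun h => by simp [h] at hk; linarith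
  have hF := quantF_nonneg α d G
  have hF₂ := quantF_nonneg α d₂ G
  have hr := B.powC_mem_sector hdc hx
  have hs := B.powC_mem_sector hdc (strip_mono hd₂ hy)
  have hsub : ∀ w ∈ sector α d, HasDerivAt (conic α G) (conic1 α G w) w := fun w hw =>
    B.hasDerivAt_conic (sector_subset B hd hdc hw)
  have hdist : |α ^ x.re - α ^ y.re| ≤ ‖powC α x - powC α y‖ := by
    rw [← norm_powC B.pos, ← norm_powC B.pos]; exact abs_norm_sub_norm_le _ _
  have hpos : 0 < |α ^ x.re - α ^ y.re| := by
    rw [abs_pos, sub_ne_zero]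
    exact fun h => hne ((Real.rpow_right_inj B.pos B.lt_one.ne).mp h)
  have hrs : powC α x ≠ powC α y := fun h => by
    rw [h, sub_self, norm_zero] at hdist; linarith
  have hp : ‖pSameC α G x y‖ ≤ (quantF α d G + quantF α d₂ G) / ‖powC α x - powC α y‖ := by
    refine norm_divDiff2_le_of_ne hrs (norm_divDiff_le (convex_sector α d) hsub
      (fun w hw => B.norm_conic1_le hdc hd hw) hr hs) ?_
    rw [B.conic1_powC (strip_mono (hd₂.trans hdc) hy)]
    exact B.norm_slopeC_le (hd₂.trans hdc) hy
  have h3 : ‖pSameC α G x y‖ ≤ (quantF α d G + quantF α d₂ G) / |α ^ x.re - α ^ y.re| :=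
    hp.trans (by gcongr)
  have hi : 0 < invSinh α |x.re - y.re| := invSinh_pos B.pos B.lt_one (hk0.trans_le hk)
  rw [rpow_half_eq_invSinh B.pos B.lt_one hne]
  calc ‖pSameC α G x y‖ * (|α ^ x.re - α ^ y.re| * invSinh α |x.re - y.re| * |Real.log α|)
      ≤ (quantF α d G + quantF α d₂ G) / |α ^ x.re - α ^ y.re| *
        (|α ^ x.re - α ^ y.re| * invSinh α |x.re - y.re| * |Real.log α|) := by gcongr
    _ = |Real.log α| * (quantF α d G + quantF α d₂ G) * invSinh α |x.re - y.re| := by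
        field_simp
    _ ≤ _ := by
        have := invSinh_anti B.pos B.lt_one hk0 hk
        gcongr

include B hd hdc in
theorem abs_im_qSameC_le {x y : ℂ} (hx : x ∈ strip d) (hy : y ∈ strip d) :
    |(qSameC α G x y).im| ≤ quantI α d G := by
  exact abs_im_divDiff_le (convex_sector α d)
    (fun w hw => B.hasDerivAt_conic (sector_subset B hd hdc hw))
    (fun w hw => B.abs_im_conic1_le hdc hd hw) (B.powC_mem_sector hdc hx) (B.powC_mem_sector hdc hy)

theorem norm_quotient_mul_le {p q w : ℂ} {κ W E m : ℝ} (hκ : κ < 1) (hq : |q.im| ≤ κ)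
    (hw : ‖w‖ ≤ W * E) (hp : ‖p‖ * E ≤ m) (hW : 0 ≤ W) :
    ‖p / (1 + q ^ 2) * w‖ ≤ W / (1 - κ ^ 2) * m := by
  have hκ0 : 0 ≤ κ := (abs_nonneg _).trans hq
  have hpos : 0 < 1 - κ ^ 2 := by nlinarith
  have h1 := one_sub_sq_le_norm hq
  rw [norm_mul, norm_div]
  calc ‖p‖ / ‖1 + q ^ 2‖ * ‖w‖ ≤ ‖p‖ / (1 - κ ^ 2) * (W * E) := by gcongr
    _ = W / (1 - κ ^ 2) * (‖p‖ * E) := by ring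
    _ ≤ _ := by gcongr

-- For real parts in [0, 1] the distance |Re x + j − Re y| is at most 1 for j = 0, at most 2 for |j|
-- = 1 and at least |j| − 1 otherwise. These are the three cases of `majSame`; the near bound with k
-- = 1, 2 yields the exponents −3/2 and −2.
include B hd hdc in
theorem norm_termSameC_le (h₁ : d₁ ≤ d) (h₂ : d₂ ≤ d) {x y : ℂ} (hx : x ∈ strip d₁)
    (hy : y ∈ strip d₂) (hxr : x.re ∈ Set.Icc (0 : ℝ) 1) (hyr : y.re ∈ Set.Icc (0 : ℝ) 1) (j : ℤ) :
    ‖termSameC α G (x + j) y‖ ≤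
      ((1 + quantF α d₁ G ^ 2) / (1 - quantI α d₂ G ^ 2)) ^ (1 / 4 : ℝ) / (1 - quantI α d G ^ 2) *
        majSame α (quantG α d G / 2) (|Real.log α| * (quantF α d G + quantF α d₂ G)) j.natAbs := by
  have hx' := add_intCast_mem_strip hx j
  have hre : (x + j).re = x.re + j := by simp
  have hw := norm_weightC_le B B (h₁.trans hdc) (h₂.trans hdc) hx' hy
  have hI := B.quantI_lt_of_le (h₂.trans hdc)
  have hI0 := quantI_nonneg α d₂ G
  refine norm_quotient_mul_le (B.quantI_lt_of_le hdc)
    (abs_im_qSameC_le B hd hdc (strip_mono h₁ hx') (strip_mono h₂ hy)) hw ?_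
    (Real.rpow_nonneg (div_nonneg (by positivity) (by nlinarith)) _)
  obtain ⟨n, hn | hn⟩ := j.eq_nat_or_neg
  all_goals
    have hjn : j.natAbs = n := by omega
    rw [hjn]
    match n, hn, hjn with
    | 0, hn, _ =>
      refine (norm_pSameC_le_near B hd hdc (strip_mono h₁ hx') (strip_mono h₂ hy) (k := 1) ?_).trans
        (le_of_eq ?_)
      · rw [hre, hn]; push_cast
        exact abs_le.mpr ⟨by linarith [hxr.1, hyr.2], by linarith [hxr.2, hyr.1]⟩
      · rw [majSame]; norm_num
    | 1, hn, _ =>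
      refine (norm_pSameC_le_near B hd hdc (strip_mono h₁ hx') (strip_mono h₂ hy) (k := 2) ?_).trans
        (le_of_eq ?_)
      · rw [hre, hn]; push_cast
        exact abs_le.mpr ⟨by linarith [hxr.1, hyr.2], by linarith [hxr.2, hyr.1]⟩
      · rw [majSame]; norm_num
    | n + 2, hn, _ =>
      refine (norm_pSameC_le_far B hd hdc h₂ (strip_mono h₁ hx') hy (k := ((n + 1 : ℕ) : ℝ))
        (by positivity) ?_).trans (le_of_eq rfl)
      rw [hre, hn]; push_cast
      first
      | exact le_abs.mpr (Or.inl (by linarith [hxr.1, hyr.2]))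
      | exact le_abs.mpr (Or.inr (by linarith [hxr.2, hyr.1]))

end same

/-! ### Bounds for the terms of the off-diagonal blocks -/

section cross

variable {α c : ℝ} {φ ψ : ℝ → ℝ} {G H : ℂ → ℂ} (B : Branch α c φ G) (B' : Branch α c ψ H)
  {d₁ d₂ : ℝ}

theorem rpow_half_eq_invCosh {α : ℝ} (hα0 : 0 < α) (hα1 : α < 1) (a b : ℝ) :
    α ^ ((a + b) / 2) = (α ^ a + α ^ b) * invCosh α (a - b) := by
  rw [invCosh_eq hα0 hα1]
  have e1 : α ^ a = α ^ ((a + b) / 2) * α ^ ((a - b) / 2) := by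
    rw [← Real.rpow_add hα0]; congr 1; ring
  have e2 : α ^ b = α ^ ((a + b) / 2) * α ^ (-(a - b) / 2) := by
    rw [← Real.rpow_add hα0]; congr 1; ring
  have h1 := Real.rpow_pos_of_pos hα0 (-(a - b) / 2)
  have h2 := Real.rpow_pos_of_pos hα0 ((a - b) / 2)
  have h3 : α ^ a + α ^ b = α ^ ((a + b) / 2) * (α ^ (-(a - b) / 2) + α ^ ((a - b) / 2)) := by
    rw [mul_add, ← e1, ← e2, add_comm]
  rw [h3, mul_assoc, mul_inv_cancel₀ (by positivity), mul_one]

/-- Lowering |u| by at most one unit costs at most the factor α⁻¹. Such a unit is lost because both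
positions range over [0, 1]. -/
theorem invCosh_le {α : ℝ} (hα0 : 0 < α) (hα1 : α < 1) {u : ℝ} {n : ℕ} (h : (n : ℝ) ≤ |u| + 1) :
    invCosh α u ≤ α⁻¹ * invCosh α n := by
  have e : invCosh α u = invCosh α |u| := by
    rcases abs_choice u with h | h <;> rw [h]
    rw [invCosh, invCosh, mul_neg, neg_div, Real.cosh_neg]
  rw [e, invCosh_eq hα0 hα1, invCosh_eq hα0 hα1, ← mul_inv]
  have h1 := fun x => Real.rpow_pos_of_pos hα0 x
  have h2 : α * α ^ (-(n : ℝ) / 2) ≤ α ^ (-|u| / 2) := by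
    nth_rw 1 [← Real.rpow_one α]
    rw [← Real.rpow_add hα0]
    exact Real.rpow_le_rpow_of_exponent_ge hα0 hα1.le (by linarith)
  have hcosh : α * (α ^ (-(n : ℝ) / 2) + α ^ ((n : ℝ) / 2)) ≤ α ^ (-|u| / 2) + α ^ (|u| / 2) := by
    rcases le_or_gt |u| n with h3 | h3
    · have h4 : α ^ ((n : ℝ) / 2) ≤ α ^ (|u| / 2) :=
        Real.rpow_le_rpow_of_exponent_ge hα0 hα1.le (by linarith)
      nlinarith [h1 ((n : ℝ) / 2)]
    · have h5 := invCosh_anti (α := α) (Nat.cast_nonneg n) h3.le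
      rw [invCosh_eq hα0 hα1, invCosh_eq hα0 hα1,
        inv_le_inv₀ (add_pos (h1 _) (h1 _)) (add_pos (h1 _) (h1 _))] at h5
      have := add_pos (h1 (-(n : ℝ) / 2)) (h1 ((n : ℝ) / 2))
      nlinarith
  exact inv_anti₀ (mul_pos hα0 (add_pos (h1 _) (h1 _))) hcosh

include B in
theorem le_norm_powC_add {x y : ℂ} (hx : x ∈ strip c) (hy : y ∈ strip c) :
    α * (α ^ x.re + α ^ y.re) ≤ ‖powC α x + powC α y‖ := by
  refine le_trans ?_ (Complex.re_le_norm _)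
  rw [mul_add, Complex.add_re]
  exact add_le_add (B.le_powC_re hx) (B.le_powC_re hy)

-- Here p̃ = (h′ + (rG − sH)/(r + s))/(r + s), where r, s = αˣ, αʸ lie in the right half-plane and
-- cannot cancel: |r + s| ≥ α(|r| + |s|). One factor α⁻¹ comes from this bound for the outer
-- denominator and one from `invCosh_le`, together the α^{−2} of `majCross`; the inner quotient
-- contributes the α⁻¹ of 𝔎.
include B B' in
theorem norm_pCrossC_le (h₁ : d₁ ≤ c) (h₂ : d₂ ≤ c) {x y : ℂ} (hx : x ∈ strip d₁)
    (hy : y ∈ strip d₂) {m : ℝ} (hm₁ : stripNorm d₁ G ≤ m) (hm₂ : stripNorm d₂ H ≤ m) {n : ℕ}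
    (hn : (n : ℝ) ≤ |x.re - y.re| + 1) :
    ‖pCrossC α G H x y‖ * (α ^ ((x.re + y.re) / 2) * |Real.log α|) ≤
      majCross α (|Real.log α| * quantF α d₂ H + α⁻¹ * |Real.log α| * m) n := by
  have hl := B.lam_pos
  have hα := B.pos
  have hF := quantF_nonneg α d₂ H
  have hm0 := (stripNorm_nonneg d₁ G).trans hm₁
  have hR := Real.rpow_pos_of_pos hα x.re
  have hS := Real.rpow_pos_of_pos hα y.re
  have hx' := strip_mono h₁ hx
  have hy' := strip_mono h₂ hy
  have hsum := le_norm_powC_add B hx' hy'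
  have hpos : 0 < α * (α ^ x.re + α ^ y.re) := by positivity
  have hn0 : 0 < ‖powC α x + powC α y‖ := hpos.trans_le hsum
  have hne : powC α x + powC α y ≠ 0 := norm_pos_iff.mp hn0
  have e : pCrossC α G H x y = (slopeC α H y +
      (powC α x * G x - powC α y * H y) / (powC α x + powC α y)) / (powC α x + powC α y) := by
    rw [pCrossC, B.conic_powC hx', B'.conic_powC hy', B'.conic1_powC hy']
    field_simp
    ring
  have hfrac : ‖(powC α x * G x - powC α y * H y) / (powC α x + powC α y)‖ ≤ α⁻¹ * m := by
    rw [norm_div, div_le_iff₀ hn0]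
    calc ‖powC α x * G x - powC α y * H y‖ ≤ α ^ x.re * ‖G x‖ + α ^ y.re * ‖H y‖ := by
          refine (norm_sub_le _ _).trans (le_of_eq ?_)
          rw [norm_mul, norm_mul, norm_powC hα, norm_powC hα]
      _ ≤ α ^ x.re * m + α ^ y.re * m := by
          have := (B.norm_le h₁ hx).trans hm₁
          have := (B'.norm_le h₂ hy).trans hm₂
          gcongr
      _ = α⁻¹ * m * (α * (α ^ x.re + α ^ y.re)) := by field_simp
      _ ≤ _ := by gcongr
  have hp : ‖pCrossC α G H x y‖ ≤ (quantF α d₂ H + α⁻¹ * m) / (α * (α ^ x.re + α ^ y.re)) := by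
    rw [e, norm_div]
    refine div_le_div₀ (by positivity) ((norm_add_le _ _).trans
      (add_le_add (B'.norm_slopeC_le h₂ hy) hfrac)) hpos hsum
  have hic := invCosh_le hα B.lt_one hn
  have hi := invCosh_pos (α := α) (x.re - y.re)
  rw [rpow_half_eq_invCosh hα B.lt_one, majCross]
  calc ‖pCrossC α G H x y‖ * ((α ^ x.re + α ^ y.re) * invCosh α (x.re - y.re) * |Real.log α|)
      ≤ (quantF α d₂ H + α⁻¹ * m) / (α * (α ^ x.re + α ^ y.re)) *
        ((α ^ x.re + α ^ y.re) * invCosh α (x.re - y.re) * |Real.log α|) := by gcongr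
    _ = (|Real.log α| * quantF α d₂ H + α⁻¹ * |Real.log α| * m) * α⁻¹ * invCosh α (x.re - y.re) := by
        field_simp
    _ ≤ (|Real.log α| * quantF α d₂ H + α⁻¹ * |Real.log α| * m) * α⁻¹ * (α⁻¹ * invCosh α n) := by
        gcongr
    _ = _ := by rw [sq, mul_inv]; ring

/-- The estimate of the imaginary part of `(r g - s h) / (r + s)` for real `s` and `h`. -/
theorem abs_im_weighted_average_le {r g : ℂ} {s h R k I m : ℝ} (hα : 0 < α) (hs : 0 < s)
    (hR : ‖r‖ = R) (hR0 : 0 < R) (hre : α * R ≤ r.re) (him : |r.im| ≤ R * k) (hI : |g.im| ≤ I)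
    (hg : ‖g‖ ≤ m) (hh : |h| ≤ m) (hα1 : α < 1) :
    |((r * g - s * h) / (r + s)).im| ≤ (I + k * m) / α ^ 2 := by
  have hk : 0 ≤ k := by
    have := (abs_nonneg _).trans him
    exact nonneg_of_mul_nonneg_right this hR0
  have hI0 := (abs_nonneg _).trans hI
  have hm0 := (abs_nonneg _).trans hh
  have hnsq : Complex.normSq r = R ^ 2 := by rw [Complex.normSq_eq_norm_sq, hR]
  rw [Complex.normSq_apply] at hnsq
  have hD : Complex.normSq (r + s) = R ^ 2 + 2 * s * r.re + s ^ 2 := by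
    rw [Complex.normSq_apply, ← hnsq]; simp; ring
  have hDlow : α ^ 2 * (R + s) ^ 2 ≤ Complex.normSq (r + s) := by
    have h1 : α * (R + s) ≤ ‖r + s‖ := by
      refine le_trans ?_ (Complex.re_le_norm _)
      simp only [Complex.add_re, Complex.ofReal_re]
      nlinarith
    rw [Complex.normSq_eq_norm_sq, ← mul_pow]
    exact pow_le_pow_left₀ (by positivity) h1 2
  have hDpos : 0 < Complex.normSq (r + s) := lt_of_lt_of_le (by positivity) hDlow
  -- With s and h real, only the first summand contains Im g and only the second contains Im r. They
  -- contribute I and k m respectively, each with a factor at most (R + s)², against |r + s|² ≥ α²(R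
  -- + s)².
  have e : ((r * g - s * h) / (r + s)).im =
      ((R ^ 2 + s * r.re) * g.im + s * r.im * (g.re + h)) / Complex.normSq (r + s) := by
    rw [Complex.div_im, ← hnsq]
    simp
    ring
  rw [e, abs_div, abs_of_pos hDpos, div_le_div_iff₀ hDpos (by positivity)]
  have hre' : |r.re| ≤ R := hR ▸ Complex.abs_re_le_norm r
  have h1 : |(R ^ 2 + s * r.re) * g.im| ≤ (R ^ 2 + s * R) * I := by
    rw [abs_mul]
    refine mul_le_mul ((abs_add_le _ _).trans ?_) hI (abs_nonneg _) (by positivity)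
    rw [abs_of_nonneg (by positivity : 0 ≤ R ^ 2), abs_mul, abs_of_pos hs]
    gcongr
  have h2 : |s * r.im * (g.re + h)| ≤ s * (R * k) * (m + m) := by
    rw [abs_mul, abs_mul, abs_of_pos hs]
    refine mul_le_mul (by gcongr) ((abs_add_le _ _).trans
      (add_le_add ((Complex.abs_re_le_norm g).trans hg) hh)) (abs_nonneg _) (by positivity)
  have h3 : |(R ^ 2 + s * r.re) * g.im + s * r.im * (g.re + h)| ≤ (I + k * m) * (R + s) ^ 2 := by
    refine (abs_add_le _ _).trans ((add_le_add h1 h2).trans ?_)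
    have : 0 ≤ k * m := mul_nonneg hk hm0
    nlinarith [mul_pos hR0 hs, mul_nonneg hI0 (mul_pos hR0 hs).le, mul_nonneg hI0 (sq_nonneg s),
      mul_nonneg this (sq_nonneg R), mul_nonneg this (sq_nonneg s)]
  calc _ ≤ (I + k * m) * (R + s) ^ 2 * α ^ 2 := by gcongr
    _ = (I + k * m) * (α ^ 2 * (R + s) ^ 2) := by ring
    _ ≤ _ := by
      have : 0 ≤ I + k * m := by positivity
      gcongr

-- The weighted-average estimate with k = λc, a bound for |sin(log α · Im x)|. Since αc𝔎 =
-- λc·max(‖g‖_c, ‖h‖_0), the last condition on c says exactly that this bound is below 1.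
include B B' in
theorem abs_im_qCrossC_le_left {x : ℂ} (hx : x ∈ strip c) (y : ℝ) :
    |(qCrossC α G H x y).im| ≤ (stripImNorm c G + α * c * quantK α c G H) / α ^ 2 := by
  have hα := B.pos
  have hS := Real.rpow_pos_of_pos hα y
  have hle : (0 : ℝ) ≤ c := B.c_pos.le
  have hHy : H y = (((H y).re : ℝ) : ℂ) := by
    apply Complex.ext
    · simp
    · rw [B'.cont.eq_on_real]; simp
  rw [qCrossC, B.conic_powC hx, B'.conic_powC (ofReal_mem_strip c y), powC_ofReal hα, hHy]
  have e : α * c * quantK α c G H = (|Real.log α| * c) * max (stripNorm c G) (stripNorm 0 H) := by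
    rw [quantK]; field_simp
  rw [e]
  refine abs_im_weighted_average_le hα hS (norm_powC hα x) (Real.rpow_pos_of_pos hα _)
    (B.le_powC_re hx) ?_ (B.abs_im_le le_rfl hx) ((B.norm_le le_rfl hx).trans (le_max_left _ _))
    ((Complex.abs_re_le_norm _).trans ((B'.norm_le hle (ofReal_mem_strip 0 y)).trans
      (le_max_right _ _))) B.lt_one
  rw [powC_im hα, abs_mul, abs_of_pos (Real.rpow_pos_of_pos hα _)]
  refine mul_le_mul_of_nonneg_left ?_ (Real.rpow_nonneg hα.le _)
  exact (Real.abs_sin_le_abs).trans (B.abs_log_mul_im_le hx)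

theorem qCrossC_swap (x y : ℂ) : qCrossC α G H x y = -qCrossC α H G y x := by
  rw [qCrossC, qCrossC, ← neg_div, neg_sub, add_comm]

include B B' in
theorem abs_im_qCrossC_le_right {y : ℂ} (hy : y ∈ strip c) (x : ℝ) :
    |(qCrossC α G H x y).im| ≤ (stripImNorm c H + α * c * quantK α c H G) / α ^ 2 := by
  rw [qCrossC_swap, Complex.neg_im, abs_neg]
  exact abs_im_qCrossC_le_left B' B hy x

include B B' in
theorem norm_termCrossC_le (h₁ : d₁ ≤ c) (h₂ : d₂ ≤ c) {x y : ℂ} (hx : x ∈ strip d₁)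
    (hy : y ∈ strip d₂) (hxr : x.re ∈ Set.Icc (0 : ℝ) 1) (hyr : y.re ∈ Set.Icc (0 : ℝ) 1) (j : ℤ)
    {m κ : ℝ} (hm₁ : stripNorm d₁ G ≤ m) (hm₂ : stripNorm d₂ H ≤ m) (hκ : κ < 1)
    (hq : |(qCrossC α G H (x + j) y).im| ≤ κ) :
    ‖termCrossC α G H (x + j) y‖ ≤
      ((1 + quantF α d₁ G ^ 2) / (1 - quantI α d₂ H ^ 2)) ^ (1 / 4 : ℝ) / (1 - κ ^ 2) *
        majCross α (|Real.log α| * quantF α d₂ H + α⁻¹ * |Real.log α| * m) j.natAbs := by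
  have hx' := add_intCast_mem_strip hx j
  have hre : (x + j).re = x.re + j := by simp
  have hI := B'.quantI_lt_of_le h₂
  have hI0 := quantI_nonneg α d₂ H
  refine norm_quotient_mul_le hκ hq (norm_weightC_le B B' h₁ h₂ hx' hy)
    (norm_pCrossC_le B B' h₁ h₂ hx' hy hm₁ hm₂ ?_)
    (Real.rpow_nonneg (div_nonneg (by positivity) (by nlinarith)) _)
  rw [hre, Nat.cast_natAbs, Int.cast_abs]
  have h1 : |(j : ℝ)| ≤ |x.re + j - y.re| + |y.re - x.re| := by
    refine le_trans (le_of_eq ?_) (abs_add_le _ _)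
    congr 1; ring
  have h2 : |y.re - x.re| ≤ 1 :=
    abs_le.mpr ⟨by linarith [hxr.2, hyr.1], by linarith [hxr.1, hyr.2]⟩
  linarith

end cross

/-! ### Invariance under translation, and analyticity -/

section invariance

variable {α c : ℝ} {φ ψ : ℝ → ℝ} {G H : ℂ → ℂ} (B : Branch α c φ G) (B' : Branch α c ψ H)

theorem divDiff_smul {f f1 : ℂ → ℂ} {a r s : ℂ} (ha : a ≠ 0) (hr : f (a * r) = a * f r)
    (hs : f (a * s) = a * f s) (hs1 : f1 (a * s) = f1 s) :
    divDiff f f1 (a * r) (a * s) = divDiff f f1 r s := by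
  unfold divDiff
  simp only [mul_right_inj' ha, hr, hs, hs1, ← mul_sub]
  rw [mul_div_mul_left _ _ ha]

theorem divDiff2_smul {f f1 f2 : ℂ → ℂ} {a r s : ℂ} (ha : a ≠ 0) (hr : f (a * r) = a * f r)
    (hs : f (a * s) = a * f s) (hs1 : f1 (a * s) = f1 s) (hs2 : f2 (a * s) = a⁻¹ * f2 s) :
    divDiff2 f f1 f2 (a * r) (a * s) = a⁻¹ * divDiff2 f f1 f2 r s := by
  unfold divDiff2
  simp only [mul_right_inj' ha, hr, hs, hs1, hs2]
  split_ifs with h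
  · ring
  · have : r - s ≠ 0 := sub_ne_zero.mpr h
    rw [← mul_sub, ← mul_sub]
    field_simp

include B

theorem powC_add_one (z : ℂ) : powC α (z + 1) = α * powC α z := by
  rw [powC_add, powC_one B.pos, mul_comm]

theorem conic_mul_powC {z : ℂ} (hz : z ∈ strip c) :
    conic α G (α * powC α z) = α * conic α G (powC α z) := by
  have hz' : z + 1 ∈ strip c := by simpa using add_mem_strip hz 1
  rw [← powC_add_one B, B.conic_powC hz', B.conic_powC hz, B.add_one hz, powC_add_one B, mul_assoc]

theorem conic1_mul_powC {z : ℂ} (hz : z ∈ strip c) :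
    conic1 α G (α * powC α z) = conic1 α G (powC α z) := by
  have hz' : z + 1 ∈ strip c := by simpa using add_mem_strip hz 1
  rw [← powC_add_one B, B.conic1_powC hz', B.conic1_powC hz, B.slopeC_add_one hz]

theorem conic2_mul_powC {z : ℂ} (hz : z ∈ strip c) :
    conic2 α G (α * powC α z) = (α : ℂ)⁻¹ * conic2 α G (powC α z) := by
  have hz' : z + 1 ∈ strip c := by simpa using add_mem_strip hz 1
  have h2 : deriv (deriv G) (z + 1) = deriv (deriv G) z := by
    rw [← deriv_comp_add_const (deriv G) 1 z]
    exact Filter.EventuallyEq.deriv_eq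
      (eventually_of_mem ((isOpen_strip B.c_pos).mem_nhds hz) fun w hw => B.deriv_add_one hw)
  rw [← powC_add_one B, conic2, conic2, B.log_powC hz', B.log_powC hz, B.deriv_add_one hz, h2,
    powC_add_one B]
  simp only [div_eq_mul_inv, mul_inv]
  ring

include B'

theorem weightC_add_one {x y : ℂ} (hx : x ∈ strip c) (hy : y ∈ strip c) :
    weightC α G H (x + 1) (y + 1) = α * weightC α G H x y := by
  have e : (x + 1 + (y + 1)) / 2 = (x + y) / 2 + 1 := by ring
  rw [weightC, weightC, B.slopeC_add_one hx, B'.slopeC_add_one hy, e, powC_add_one B]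
  ring

-- Under a simultaneous unit translation p is multiplied by α⁻¹, the weight by α, and q is
-- unchanged.
omit B' in
theorem termSameC_add_one {x y : ℂ} (hx : x ∈ strip c) (hy : y ∈ strip c) :
    termSameC α G (x + 1) (y + 1) = termSameC α G x y := by
  have hα : (α : ℂ) ≠ 0 := Complex.ofReal_ne_zero.mpr B.pos.ne'
  have hp : pSameC α G (x + 1) (y + 1) = (α : ℂ)⁻¹ * pSameC α G x y := by
    rw [pSameC, powC_add_one B, powC_add_one B, divDiff2_smul hα (conic_mul_powC B hx)
      (conic_mul_powC B hy) (conic1_mul_powC B hy) (conic2_mul_powC B hy), pSameC]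
  have hq : qSameC α G (x + 1) (y + 1) = qSameC α G x y := by
    rw [qSameC, powC_add_one B, powC_add_one B, divDiff_smul hα (conic_mul_powC B hx)
      (conic_mul_powC B hy) (conic1_mul_powC B hy), qSameC]
  rw [termSameC, termSameC, hp, hq, weightC_add_one B B hx hy]
  field_simp

theorem termCrossC_add_one {x y : ℂ} (hx : x ∈ strip c) (hy : y ∈ strip c) :
    termCrossC α G H (x + 1) (y + 1) = termCrossC α G H x y := by
  have hα : (α : ℂ) ≠ 0 := Complex.ofReal_ne_zero.mpr B.pos.ne'
  have hp : pCrossC α G H (x + 1) (y + 1) = (α : ℂ)⁻¹ * pCrossC α G H x y := by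
    rw [pCrossC, powC_add_one B, powC_add_one B, conic_mul_powC B hx, conic_mul_powC B' hy,
      conic1_mul_powC B' hy, pCrossC]
    rw [← mul_add, ← mul_add, mul_pow]
    field_simp
  have hq : qCrossC α G H (x + 1) (y + 1) = qCrossC α G H x y := by
    rw [qCrossC, powC_add_one B, powC_add_one B, conic_mul_powC B hx, conic_mul_powC B' hy, qCrossC,
      ← mul_sub, ← mul_add, mul_div_mul_left _ _ hα]
  rw [termCrossC, termCrossC, hp, hq, weightC_add_one B B' hx hy]
  field_simp

omit B' in
theorem slopeC_mem_slitPlane {z : ℂ} (hz : z ∈ strip c) :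
    1 + slopeC α G z ^ 2 ∈ Complex.slitPlane :=
  one_add_sq_mem_slitPlane ((B.abs_im_slopeC_le le_rfl hz).trans_lt B.quantI_lt)

omit B' in
theorem differentiableOn_slope_cpow :
    DifferentiableOn ℂ (fun z => (1 + slopeC α G z ^ 2) ^ (1 / 4 : ℂ)) (strip c) := by
  refine DifferentiableOn.cpow ?_ (differentiableOn_const _) fun z hz => slopeC_mem_slitPlane B hz
  exact (B.differentiableOn_slopeC.pow 2).const_add 1

omit B' in
theorem slope_cpow_ne_zero {z : ℂ} (hz : z ∈ strip c) :
    (1 + slopeC α G z ^ 2) ^ (1 / 4 : ℂ) ≠ 0 := by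
  rw [Ne, Complex.cpow_eq_zero_iff]
  exact fun h => Complex.slitPlane_ne_zero (slopeC_mem_slitPlane B hz) h.1

omit B' in
theorem differentiableOn_weightC_left (y : ℂ) :
    DifferentiableOn ℂ (fun x => weightC α G H x y) (strip c) := by
  unfold weightC
  have h := (differentiable_powC α).comp (by fun_prop : Differentiable ℂ fun x : ℂ => (x + y) / 2)
  exact (((differentiableOn_slope_cpow B).div_const _).mul h.differentiableOn).mul_const _

omit B in
theorem differentiableOn_weightC_right (x : ℂ) :
    DifferentiableOn ℂ (fun y => weightC α G H x y) (strip c) := by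
  unfold weightC
  have h := (differentiable_powC α).comp (by fun_prop : Differentiable ℂ fun y : ℂ => (x + y) / 2)
  exact (((differentiableOn_const _).div (differentiableOn_slope_cpow B')
    fun z hz => slope_cpow_ne_zero B' hz).mul h.differentiableOn).mul_const _

omit B' in
theorem mapsTo_powC : Set.MapsTo (powC α) (strip c) (sector α c) :=
  fun _ hz => B.powC_mem_sector le_rfl hz

omit B' in
theorem one_add_qSameC_ne_zero {x y : ℂ} (hx : x ∈ strip c) (hy : y ∈ strip c) :
    1 + qSameC α G x y ^ 2 ≠ 0 :=
  one_add_sq_ne_zero ((abs_im_qSameC_le B B.c_pos.le le_rfl hx hy).trans_lt B.quantI_lt)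

omit B' in
theorem differentiableOn_termSameC_left {y : ℂ} (hy : y ∈ strip c) :
    DifferentiableOn ℂ (fun x => termSameC α G x y) (strip c) := by
  have hs := B.powC_mem_sector le_rfl hy
  have hp := (differentiableOn_divDiff2 B.isOpen_sector (fun w hw => B.hasDerivAt_conic hw)
    (fun w hw => B.hasDerivAt_conic1 hw) hs).comp (differentiable_powC α).differentiableOn (mapsTo_powC B)
  have hq := (differentiableOn_divDiff B.isOpen_sector (fun w hw => B.hasDerivAt_conic hw) hs).comp
    (differentiable_powC α).differentiableOn (mapsTo_powC B)
  exact (hp.div ((hq.pow 2).const_add 1) fun x hx => one_add_qSameC_ne_zero B hx hy).mul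
    (differentiableOn_weightC_left B y)

omit B' in
theorem differentiableOn_termSameC_right {x : ℂ} (hx : x ∈ strip c) :
    DifferentiableOn ℂ (fun y => termSameC α G x y) (strip c) := by
  have hr := B.powC_mem_sector le_rfl hx
  have hp := (differentiableOn_divDiff2_right B.isOpen_sector (fun w hw => B.hasDerivAt_conic hw)
    (fun w hw => B.hasDerivAt_conic1 hw) hr).comp (differentiable_powC α).differentiableOn (mapsTo_powC B)
  have hq := (differentiableOn_divDiff_right B.isOpen_sector (fun w hw => B.hasDerivAt_conic hw) hr).comp
    (differentiable_powC α).differentiableOn (mapsTo_powC B)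
  exact (hp.div ((hq.pow 2).const_add 1) fun y hy => one_add_qSameC_ne_zero B hx hy).mul
    (differentiableOn_weightC_right B x)

omit B' in
theorem differentiableOn_conic_powC :
    DifferentiableOn ℂ (fun x => conic α G (powC α x)) (strip c) :=
  DifferentiableOn.comp (fun _ hw => (B.hasDerivAt_conic hw).differentiableAt.differentiableWithinAt)
    (differentiable_powC α).differentiableOn (mapsTo_powC B)

omit B' in
theorem differentiableOn_conic1_powC :
    DifferentiableOn ℂ (fun x => conic1 α G (powC α x)) (strip c) :=
  DifferentiableOn.comp (g := conic1 α G)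
    (fun _ hw => (B.hasDerivAt_conic1 hw).differentiableAt.differentiableWithinAt)
    (differentiable_powC α).differentiableOn (mapsTo_powC B)

omit B' in
theorem powC_add_ne_zero {x y : ℂ} (hx : x ∈ strip c) (hy : y ∈ strip c) :
    powC α x + powC α y ≠ 0 := by
  have h := le_norm_powC_add B hx hy
  have h1 := Real.rpow_pos_of_pos B.pos x.re
  have h2 := Real.rpow_pos_of_pos B.pos y.re
  have := B.pos
  exact norm_pos_iff.mp (lt_of_lt_of_le (by positivity) h)

/-- The other variable is kept real, because the bound for Im q̃ that excludes zeros of 1 + q̃² is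
for one complex variable at a time. -/
theorem differentiableOn_termCrossC_left
    (hG : stripImNorm c G + α * c * quantK α c G H < α ^ 2) (y : ℝ) :
    DifferentiableOn ℂ (fun x => termCrossC α G H x y) (strip c) := by
  have hα := B.pos
  have hy := ofReal_mem_strip c y
  have h1 := differentiableOn_conic_powC B
  have h2 := (differentiable_powC α).differentiableOn (s := strip c)
  have hp : DifferentiableOn ℂ (fun x => pCrossC α G H x y) (strip c) := by
    unfold pCrossC
    refine DifferentiableOn.div ?_ ((h2.add_const _).pow 2) fun x hx =>
      pow_ne_zero 2 (powC_add_ne_zero B hx hy)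
    exact (((h2.const_add _).mul_const _).add h1).sub_const _
  have hq : DifferentiableOn ℂ (fun x => qCrossC α G H x y) (strip c) := by
    unfold qCrossC
    exact (h1.sub_const _).div (h2.add_const _) fun x hx => powC_add_ne_zero B hx hy
  refine (hp.div ((hq.pow 2).const_add 1) fun x hx => one_add_sq_ne_zero ?_).mul
    (differentiableOn_weightC_left B (y : ℂ))
  exact (abs_im_qCrossC_le_left B B' hx y).trans_lt ((div_lt_one (by positivity)).mpr hG)

theorem differentiableOn_termCrossC_right
    (hH : stripImNorm c H + α * c * quantK α c H G < α ^ 2) (x : ℝ) :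
    DifferentiableOn ℂ (fun y => termCrossC α G H x y) (strip c) := by
  have hα := B.pos
  have hx := ofReal_mem_strip c x
  have h1 := differentiableOn_conic_powC B'
  have h1' := differentiableOn_conic1_powC B'
  have h2 := (differentiable_powC α).differentiableOn (s := strip c)
  have hp : DifferentiableOn ℂ (fun y => pCrossC α G H x y) (strip c) := by
    unfold pCrossC
    refine DifferentiableOn.div ?_ ((h2.const_add _).pow 2) fun y hy =>
      pow_ne_zero 2 (powC_add_ne_zero B hx hy)
    exact (((h2.add_const _).mul h1').add_const _).sub h1
  have hq : DifferentiableOn ℂ (fun y => qCrossC α G H x y) (strip c) := by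
    unfold qCrossC
    exact (h1.const_sub _).div (h2.const_add _) fun y hy => powC_add_ne_zero B hx hy
  refine (hp.div ((hq.pow 2).const_add 1) fun y hy => one_add_sq_ne_zero ?_).mul
    (differentiableOn_weightC_right B' (x : ℂ))
  exact (abs_im_qCrossC_le_right B B' hy x).trans_lt ((div_lt_one (by positivity)).mpr hH)

end invariance

/-! ### Sums over integer translates -/

section translates

variable {c : ℝ} {T : ℤ → ℂ → ℂ} {σ : ℤ} {u : ℤ → ℝ}

theorem norm_expI_mul (t : ℝ) (j : ℤ) : ‖Complex.exp (Complex.I * j * t)‖ = 1 := by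
  have : Complex.I * j * t = ((j * t : ℝ) : ℂ) * Complex.I := by push_cast; ring
  rw [this, Complex.norm_exp_ofReal_mul_I]

theorem shift_int (hT : ∀ j, ∀ z ∈ strip c, T j (z + 1) = T (j + σ) z) (n : ℤ) (j : ℤ) {z : ℂ}
    (hz : z ∈ strip c) : T j (z + n) = T (j + σ * n) z := by
  have hs : ∀ j, ∀ m : ℤ, T j (z + m + 1) = T (j + σ) (z + m) := fun j m =>
    hT j _ (add_intCast_mem_strip hz m)
  induction n generalizing j with
  | zero => simp
  | succ n ih =>
    have := hs j n
    push_cast at this ih ⊢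
    rw [← add_assoc, this, ih]; congr 1; ring
  | pred n ih =>
    have := hs (j - σ) (-n - 1)
    have e : z + ((-n - 1 : ℤ) : ℂ) + 1 = z + ((-n : ℤ) : ℂ) := by push_cast; ring
    rw [e, ih, sub_add_cancel] at this
    rw [← this]; congr 1; ring

variable (hT : ∀ j, ∀ z ∈ strip c, T j (z + 1) = T (j + σ) z)
  (hb : ∀ j, ∀ z ∈ strip c, z.re ∈ Set.Icc (0 : ℝ) 1 → ‖T j z‖ ≤ u j) (hu : Summable u)
include hT hb

/-- Moving z into the fundamental interval shifts the index by σ⌊Re z⌋, so a majorant known for 0 ≤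
Re z ≤ 1 serves the whole strip. For the kernel σ is 1 in the first variable and −1 in the second.
-/
theorem norm_le_of_shift (j : ℤ) {z : ℂ} (hz : z ∈ strip c) : ‖T j z‖ ≤ u (j + σ * ⌊z.re⌋) := by
  have hz' := add_intCast_mem_strip hz (-⌊z.re⌋)
  have h1 := shift_int hT ⌊z.re⌋ j hz'
  have e : z + ((-⌊z.re⌋ : ℤ) : ℂ) + (⌊z.re⌋ : ℤ) = z := by push_cast; ring
  rw [e] at h1
  rw [h1]
  refine hb _ _ hz' ?_
  have h2 := Int.floor_le z.re
  have h3 := Int.lt_floor_add_one z.re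
  simp only [Int.cast_neg, Complex.add_re, Complex.neg_re, Complex.intCast_re]
  constructor <;> linarith

include hu

theorem norm_tsum_translates_le {z : ℂ} (hz : z ∈ strip c) (t : ℝ) :
    ‖∑' j : ℤ, Complex.exp (Complex.I * j * t) * T j z‖ ≤ ∑' j, u j := by
  have h1 : HasSum (fun j => u (j + σ * ⌊z.re⌋)) (∑' j, u j) :=
    ((Equiv.addRight (σ * ⌊z.re⌋)).hasSum_iff (f := u)).mpr hu.hasSum
  refine tsum_of_norm_bounded h1 fun j => ?_
  rw [norm_mul, norm_expI_mul, one_mul]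
  exact norm_le_of_shift hT hb j hz

-- Re-indexing the sum by σ leaves a phase, so the sum is quasi-periodic.
omit hu in
theorem tsum_translates_add_one {z : ℂ} (hz : z ∈ strip c) (t : ℝ) :
    ∑' j : ℤ, Complex.exp (Complex.I * j * t) * T j (z + 1) =
      Complex.exp (-(Complex.I * σ * t)) * ∑' j : ℤ, Complex.exp (Complex.I * j * t) * T j z := by
  rw [← tsum_mul_left, ← (Equiv.addRight σ).tsum_eq
    (fun j : ℤ => Complex.exp (-(Complex.I * σ * t)) * (Complex.exp (Complex.I * j * t) * T j z))]
  refine tsum_congr fun j => ?_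
  rw [hT j z hz, Equiv.coe_addRight, ← mul_assoc, ← Complex.exp_add]
  congr 2
  push_cast; ring

theorem differentiableOn_tsum_translates (hc : 0 < c)
    (hd : ∀ j, DifferentiableOn ℂ (T j) (strip c)) (t : ℝ) :
    DifferentiableOn ℂ (fun z => ∑' j : ℤ, Complex.exp (Complex.I * j * t) * T j z) (strip c) := by
  intro z₀ hz₀
  set m := ⌊z₀.re⌋ with hm
  -- On this window ⌊Re z⌋ takes only three values, so the sum of three translates of u is a common
  -- majorant.
  set U : Set ℂ := strip c ∩ {z | ((m - 1 : ℤ) : ℝ) < z.re ∧ z.re < ((m + 2 : ℤ) : ℝ)} with hU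
  have hUo : IsOpen U := (isOpen_strip hc).inter
    ((isOpen_lt continuous_const Complex.continuous_re).inter
      (isOpen_lt Complex.continuous_re continuous_const))
  have hz₀U : z₀ ∈ U := by
    refine ⟨hz₀, ?_, ?_⟩
    · push_cast; linarith [Int.floor_le z₀.re]
    · push_cast; linarith [Int.lt_floor_add_one z₀.re]
  have hsum : Summable fun j : ℤ => ∑ i ∈ Finset.Icc (m - 1) (m + 1), ‖u (j + σ * i)‖ :=
    summable_sum fun i _ => (hu.norm.comp_injective (add_left_injective (σ * i)))
  have := Complex.differentiableOn_tsum_of_summable_norm 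
    (F := fun (j : ℤ) (z : ℂ) => Complex.exp (Complex.I * j * t) * T j z)
    hsum (fun j => ((hd j).mono Set.inter_subset_left).const_mul _) hUo (fun j z hz => by
      rw [norm_mul, norm_expI_mul, one_mul]
      refine (norm_le_of_shift hT hb j hz.1).trans ((Real.le_norm_self _).trans ?_)
      refine Finset.single_le_sum (f := fun i => ‖u (j + σ * i)‖) (fun i _ => norm_nonneg _) ?_
      rw [Finset.mem_Icc]
      constructor
      · exact Int.le_floor.mpr hz.2.1.le
      · have := Int.floor_lt.mpr hz.2.2
        omega)
  exact ((this z₀ hz₀U).differentiableAt (hUo.mem_nhds hz₀U)).differentiableWithinAt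

end translates

/-! ### The kernel on the two branches -/

/-- The continuations of the two branches of a dilation invariant graph; `false` stands for `-`. -/
structure BranchPair (α c : ℝ) (φ : Bool → ℝ → ℝ) (G : Bool → ℂ → ℂ) : Prop where
  branch : ∀ σ, Branch α c (φ σ) (G σ)
  cross_lt : ∀ σ τ, σ ≠ τ → stripImNorm c (G σ) + α * c * quantK α c (G σ) (G τ) < α ^ 2

/-- The `j`-th term of the kernel, between the branches `σ` and `τ`. -/
def termR (α : ℝ) (φ : Bool → ℝ → ℝ) (σ τ : Bool) (j : ℤ) (x y : ℝ) : ℝ :=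
  if σ = τ then termSame α (φ σ) j x y else termCross α (φ σ) (φ τ) j x y

/-- The continuation of `termR`, as a function of `x + j` and `y`. -/
def termC (α : ℝ) (G : Bool → ℂ → ℂ) (σ τ : Bool) (x y : ℂ) : ℂ :=
  if σ = τ then termSameC α (G σ) x y else termCrossC α (G σ) (G τ) x y

/-- The kernel `(2π)⁻¹ ∑ⱼ e^{ijt} T_j(x, y)`. -/
def kerC (α : ℝ) (G : Bool → ℂ → ℂ) (t : ℝ) (σ τ : Bool) (x y : ℂ) : ℂ :=
  1 / (2 * (Real.pi : ℂ)) * ∑' j : ℤ, Complex.exp (Complex.I * j * t) * termC α G σ τ (x + j) y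

/-- The bound for the kernel when the first variable is complex. -/
def bndL (α c : ℝ) (G : Bool → ℂ → ℂ) (σ τ : Bool) : ℝ :=
  if σ = τ then boundKc0 α c (G σ) else boundLc0 α c (G σ) (G τ)

/-- The bound for the kernel when the second variable is complex. -/
def bndR (α c : ℝ) (G : Bool → ℂ → ℂ) (σ τ : Bool) : ℝ :=
  if σ = τ then boundK0c α c (G σ) else boundL0c α c (G σ) (G τ)

/-- The bound for the sum of the absolute values of the terms. -/
def bndS (α : ℝ) (G : Bool → ℂ → ℂ) (σ τ : Bool) : ℝ :=
  (1 + quantF α 0 (G σ) ^ 2) ^ (1 / 4 : ℝ) *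
    if σ = τ then quantG α 0 (G σ) * calR α + 4 * |Real.log α| * quantF α 0 (G σ) * calBStar α 10
    else (|Real.log α| * quantF α 0 (G τ) + quantK α 0 (G σ) (G τ)) * calCStar α 10

/-- The bound for the sum of the absolute values of the terms with `|j| > M`. -/
def bndT (α : ℝ) (G : Bool → ℂ → ℂ) (M : ℕ) (σ τ : Bool) : ℝ :=
  (1 + quantF α 0 (G σ) ^ 2) ^ (1 / 4 : ℝ) *
    if σ = τ then 4 * |Real.log α| * quantF α 0 (G σ) * calB α M
    else 2 * (|Real.log α| * quantF α 0 (G τ) + quantK α 0 (G σ) (G τ)) * calC α M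

section

variable {α c : ℝ} {φ : Bool → ℝ → ℝ} {G : Bool → ℂ → ℂ} (P : BranchPair α c φ G) (σ τ : Bool)
include P

namespace BranchPair

theorem pos : 0 < α := (P.branch true).pos
theorem lt_one : α < 1 := (P.branch true).lt_one
theorem c_pos : 0 < c := (P.branch true).c_pos

theorem termC_ofReal (j : ℤ) (x y : ℝ) : termC α G σ τ (x + j) y = (termR α φ σ τ j x y : ℝ) := by
  unfold termC termR
  split_ifs with h
  · exact termSameC_ofReal (P.branch σ) j x y
  · exact termCrossC_ofReal (P.branch σ) (P.branch τ) j x y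

theorem cross_div_lt (h : σ ≠ τ) :
    (stripImNorm c (G σ) + α * c * quantK α c (G σ) (G τ)) / α ^ 2 < 1 := by
  have := P.pos
  exact (div_lt_one (by positivity)).mpr (P.cross_lt σ τ h)

theorem cross_nonneg (σ τ : Bool) :
    0 ≤ (stripImNorm c (G σ) + α * c * quantK α c (G σ) (G τ)) / α ^ 2 := by
  have h0 := P.pos
  have h1 := P.c_pos
  have h2 := quantK_nonneg h0 c (G σ) (G τ)
  have h3 := stripImNorm_nonneg c (G σ)
  positivity

/-- Width c in the first variable and 0 in the second. The weight then has denominator 1, as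
`quantI` vanishes at width zero, and only 1/(1 + q²) contributes a factor above 1. -/
theorem exists_majorant_left : ∃ u : ℤ → ℝ, Summable u ∧ ∑' j, u j ≤ 2 * Real.pi * bndL α c G σ τ ∧
    ∀ (j : ℤ) (x : ℂ) (y : ℝ), x ∈ strip c → x.re ∈ Set.Icc (0 : ℝ) 1 → y ∈ Set.Icc (0 : ℝ) 1 →
      ‖termC α G σ τ (x + j) y‖ ≤ u j := by
  have hα0 := P.pos
  have hα1 := P.lt_one
  have hπ := Real.pi_pos
  have hc := P.c_pos
  have hl := abs_log_pos hα0 hα1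
  have hF := fun d σ => quantF_nonneg α d (G σ)
  have hI0 := (P.branch τ).quantI_zero
  have hIσ := (P.branch σ).quantI_lt
  have hIσ0 := quantI_nonneg α c (G σ)
  have hIpos : 0 < 1 - quantI α c (G σ) ^ 2 := by nlinarith
  by_cases h : σ = τ
  · subst h
    refine ⟨_, (summable_majSame hα0 hα1 (quantG α c (G σ) / 2)
      (|Real.log α| * (quantF α c (G σ) + quantF α 0 (G σ)))).mul_left
      (((1 + quantF α c (G σ) ^ 2) / (1 - quantI α 0 (G σ) ^ 2)) ^ (1 / 4 : ℝ) /
        (1 - quantI α c (G σ) ^ 2)), ?_, fun j x y hx hxr hyr => ?_⟩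
    · rw [tsum_mul_left]
      have h1 := tsum_majSame_le hα0 hα1 (a := quantG α c (G σ) / 2)
        (b := |Real.log α| * (quantF α c (G σ) + quantF α 0 (G σ)))
        (by have := quantG_nonneg α c (G σ); positivity)
        (by have := hF c σ; have := hF 0 σ; positivity)
      refine (mul_le_mul_of_nonneg_left h1 (by rw [hI0]; positivity)).trans (le_of_eq ?_)
      rw [bndL, if_pos rfl, boundKc0, hI0, calR]
      field_simp
      ring_nf
    · rw [termC, if_pos rfl]
      exact norm_termSameC_le (P.branch σ) hc.le le_rfl le_rfl hc.le hx (ofReal_mem_strip 0 y) hxr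
        (by simpa using hyr) j
  · have hκ := P.cross_div_lt σ τ h
    have hκ0 := P.cross_nonneg σ τ
    have hκp : 0 < 1 - ((stripImNorm c (G σ) + α * c * quantK α c (G σ) (G τ)) / α ^ 2) ^ 2 := by
      nlinarith
    have hm : |Real.log α| * quantF α 0 (G τ) + α⁻¹ * |Real.log α| *
        max (stripNorm c (G σ)) (stripNorm 0 (G τ))
        = |Real.log α| * quantF α 0 (G τ) + quantK α c (G σ) (G τ) := rfl
    refine ⟨_, (summable_majCross hα0 hα1
      (|Real.log α| * quantF α 0 (G τ) + quantK α c (G σ) (G τ))).mul_left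
      (((1 + quantF α c (G σ) ^ 2) / (1 - quantI α 0 (G τ) ^ 2)) ^ (1 / 4 : ℝ) /
        (1 - ((stripImNorm c (G σ) + α * c * quantK α c (G σ) (G τ)) / α ^ 2) ^ 2)), ?_,
        fun j x y hx hxr hyr => ?_⟩
    · rw [tsum_mul_left]
      have h1 := tsum_majCross_le hα0 hα1
        (b := |Real.log α| * quantF α 0 (G τ) + quantK α c (G σ) (G τ))
        (by have := hF 0 τ; have := quantK_nonneg hα0 c (G σ) (G τ); positivity)
      refine (mul_le_mul_of_nonneg_left h1 (by rw [hI0]; positivity)).trans (le_of_eq ?_)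
      have e : ((stripImNorm c (G σ) + α * c * quantK α c (G σ) (G τ)) / α ^ 2) ^ 2 =
        (stripImNorm c (G σ) + α * c * quantK α c (G σ) (G τ)) ^ 2 / α ^ 4 := by
        rw [div_pow]; ring
      rw [bndL, if_neg h, boundLc0, hI0, e]
      field_simp
      ring_nf
    · rw [termC, if_neg h, ← hm]
      refine norm_termCrossC_le (P.branch σ) (P.branch τ) le_rfl hc.le hx (ofReal_mem_strip 0 y) hxr
        (by simpa using hyr) j (le_max_left _ _) (le_max_right _ _) hκ ?_
      exact abs_im_qCrossC_le_left (P.branch σ) (P.branch τ) (add_intCast_mem_strip hx j) y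

theorem exists_majorant_right : ∃ u : ℤ → ℝ, Summable u ∧
    ∑' j, u j ≤ 2 * Real.pi * bndR α c G σ τ ∧
    ∀ (j : ℤ) (x : ℝ) (y : ℂ), x ∈ Set.Icc (0 : ℝ) 1 → y ∈ strip c → y.re ∈ Set.Icc (0 : ℝ) 1 →
      ‖termC α G σ τ (x + j) y‖ ≤ u j := by
  have hα0 := P.pos
  have hα1 := P.lt_one
  have hπ := Real.pi_pos
  have hc := P.c_pos
  have hl := abs_log_pos hα0 hα1
  have hF := fun d σ => quantF_nonneg α d (G σ)
  have hIτ := (P.branch τ).quantI_lt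
  have hIτ0 := quantI_nonneg α c (G τ)
  have hIpos : 0 < 1 - quantI α c (G τ) ^ 2 := by nlinarith
  by_cases h : σ = τ
  · subst h
    refine ⟨_, (summable_majSame hα0 hα1 (quantG α c (G σ) / 2)
      (|Real.log α| * (quantF α c (G σ) + quantF α c (G σ)))).mul_left
      (((1 + quantF α 0 (G σ) ^ 2) / (1 - quantI α c (G σ) ^ 2)) ^ (1 / 4 : ℝ) /
        (1 - quantI α c (G σ) ^ 2)), ?_, fun j x y hxr hy hyr => ?_⟩
    · rw [tsum_mul_left]
      have h1 := tsum_majSame_le hα0 hα1 (a := quantG α c (G σ) / 2)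
        (b := |Real.log α| * (quantF α c (G σ) + quantF α c (G σ)))
        (by have := quantG_nonneg α c (G σ); positivity)
        (by have := hF c σ; positivity)
      refine (mul_le_mul_of_nonneg_left h1 (by positivity)).trans (le_of_eq ?_)
      -- The exponent 5/4 is 1 from the denominator 1 + q² plus 1/4 from the weight, whose
      -- denominator now sees the complex variable.
      have e : (1 - quantI α c (G σ) ^ 2) ^ (5 / 4 : ℝ) =
          (1 - quantI α c (G σ) ^ 2) * (1 - quantI α c (G σ) ^ 2) ^ (1 / 4 : ℝ) := by
        nth_rw 2 [← Real.rpow_one (1 - quantI α c (G σ) ^ 2)]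
        rw [← Real.rpow_add hIpos]; norm_num
      have hq := Real.rpow_pos_of_pos hIpos (1 / 4 : ℝ)
      rw [bndR, if_pos rfl, boundK0c, e, calR, Real.div_rpow (by positivity) hIpos.le]
      field_simp
      ring_nf
    · rw [termC, if_pos rfl]
      exact norm_termSameC_le (P.branch σ) hc.le le_rfl hc.le le_rfl (ofReal_mem_strip 0 x) hy
        (by simpa using hxr) hyr j
  · have hκ := P.cross_div_lt τ σ (Ne.symm h)
    have hκ0 := P.cross_nonneg τ σ
    have hκp : 0 < 1 - ((stripImNorm c (G τ) + α * c * quantK α c (G τ) (G σ)) / α ^ 2) ^ 2 := by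
      nlinarith
    have hm : |Real.log α| * quantF α c (G τ) + α⁻¹ * |Real.log α| *
        max (stripNorm c (G τ)) (stripNorm 0 (G σ))
        = |Real.log α| * quantF α c (G τ) + quantK α c (G τ) (G σ) := rfl
    refine ⟨_, (summable_majCross hα0 hα1
      (|Real.log α| * quantF α c (G τ) + quantK α c (G τ) (G σ))).mul_left
      (((1 + quantF α 0 (G σ) ^ 2) / (1 - quantI α c (G τ) ^ 2)) ^ (1 / 4 : ℝ) /
        (1 - ((stripImNorm c (G τ) + α * c * quantK α c (G τ) (G σ)) / α ^ 2) ^ 2)), ?_,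
        fun j x y hxr hy hyr => ?_⟩
    · rw [tsum_mul_left]
      have h1 := tsum_majCross_le hα0 hα1
        (b := |Real.log α| * quantF α c (G τ) + quantK α c (G τ) (G σ))
        (by have := hF c τ; have := quantK_nonneg hα0 c (G τ) (G σ); positivity)
      refine (mul_le_mul_of_nonneg_left h1 (by positivity)).trans (le_of_eq ?_)
      have e : ((stripImNorm c (G τ) + α * c * quantK α c (G τ) (G σ)) / α ^ 2) ^ 2 =
        (stripImNorm c (G τ) + α * c * quantK α c (G τ) (G σ)) ^ 2 / α ^ 4 := by
        rw [div_pow]; ring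
      rw [bndR, if_neg h, boundL0c, e]
      field_simp
    · rw [termC, if_neg h, ← hm]
      refine norm_termCrossC_le (P.branch σ) (P.branch τ) hc.le le_rfl (ofReal_mem_strip 0 x) hy
        (by simpa using hxr) hyr j (le_max_right _ _) (le_max_left _ _) hκ ?_
      have := abs_im_qCrossC_le_right (P.branch σ) (P.branch τ) hy (x + j)
      push_cast at this
      exact this

/-- One majorant on the real square serves four purposes: geometric decay for the Toeplitz theory
and for the matrix B, its sum for C₃, and its tails for C₁(M). At real arguments q is real and every
width is zero. -/
theorem exists_majorant_real : ∃ u : ℕ → ℝ, (∀ n, 0 ≤ u n) ∧ (∃ C, 0 ≤ C ∧ ∀ n, u n ≤ C * √α ^ n) ∧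
    Summable (fun j : ℤ => u j.natAbs) ∧ ∑' j : ℤ, u j.natAbs ≤ bndS α G σ τ ∧
    (∀ M : ℕ, 2 ≤ M → ∑' j : ℤ, (if j ∈ Finset.Icc (-(M : ℤ)) M then 0 else u j.natAbs)
      ≤ bndT α G M σ τ) ∧
    ∀ (j : ℤ) (x y : ℝ), x ∈ Set.Icc (0 : ℝ) 1 → y ∈ Set.Icc (0 : ℝ) 1 →
      |termR α φ σ τ j x y| ≤ u j.natAbs := by
  have hα0 := P.pos
  have hα1 := P.lt_one
  have hc := P.c_pos
  have hl := abs_log_pos hα0 hα1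
  have hF := fun d σ => quantF_nonneg α d (G σ)
  have hI := fun σ => (P.branch σ).quantI_zero
  set W := (1 + quantF α 0 (G σ) ^ 2) ^ (1 / 4 : ℝ) with hW
  have hW0 : 0 ≤ W := by positivity
  have hWe : ((1 + quantF α 0 (G σ) ^ 2) / (1 - quantI α 0 (G τ) ^ 2)) ^ (1 / 4 : ℝ) = W := by
    rw [hI τ, hW]; norm_num
  have hite : ∀ (M : ℕ) (u : ℕ → ℝ),
      ∑' j : ℤ, (if j ∈ Finset.Icc (-(M : ℤ)) M then 0 else W * u j.natAbs)
      = W * ∑' j : ℤ, (if j ∈ Finset.Icc (-(M : ℤ)) M then 0 else u j.natAbs) := by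
    intro M u
    rw [← tsum_mul_left]
    exact tsum_congr fun j => by split_ifs <;> simp
  have hreal : ∀ (j : ℤ) (x y : ℝ), |termR α φ σ τ j x y| = ‖termC α G σ τ (x + j) y‖ := by
    intro j x y
    rw [P.termC_ofReal, Complex.norm_real, Real.norm_eq_abs]
  by_cases h : σ = τ
  · subst h
    have ha : 0 ≤ quantG α 0 (G σ) / 2 := by have := quantG_nonneg α 0 (G σ); positivity
    have hb : 0 ≤ |Real.log α| * (quantF α 0 (G σ) + quantF α 0 (G σ)) := by
      have := hF 0 σ; positivity
    obtain ⟨C, hC, hCu⟩ := majSame_le_geometric hα0 hα1 ha hb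
    refine ⟨fun n => W * majSame α (quantG α 0 (G σ) / 2)
      (|Real.log α| * (quantF α 0 (G σ) + quantF α 0 (G σ))) n,
      fun n => mul_nonneg hW0 (majSame_nonneg hα0 hα1 ha hb n),
      ⟨W * C, by positivity, fun n => by
        rw [mul_assoc]; exact mul_le_mul_of_nonneg_left (hCu n) hW0⟩,
      (summable_majSame hα0 hα1 _ _).mul_left _, ?_, fun M hM => ?_, fun j x y hx hy => ?_⟩
    · rw [tsum_mul_left, bndS, if_pos rfl]
      refine mul_le_mul_of_nonneg_left ((tsum_majSame_le hα0 hα1 ha hb).trans (le_of_eq ?_)) hW0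
      ring
    · rw [hite, bndT, if_pos rfl]
      refine mul_le_mul_of_nonneg_left
        ((tsum_tail_majSame_le hα0 hα1 hb M hM).trans (le_of_eq ?_)) hW0
      ring
    · rw [hreal, termC, if_pos rfl]
      have := norm_termSameC_le (P.branch σ) le_rfl hc.le le_rfl le_rfl (ofReal_mem_strip 0 x)
        (ofReal_mem_strip 0 y) (by simpa using hx) (by simpa using hy) j
      rw [hWe, hI σ] at this
      simpa using this
  · have hb : 0 ≤ |Real.log α| * quantF α 0 (G τ) + quantK α 0 (G σ) (G τ) := by
      have := hF 0 τ; have := quantK_nonneg hα0 0 (G σ) (G τ); positivity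
    obtain ⟨C, hC, hCu⟩ := majCross_le_geometric hα0 hα1 hb
    refine ⟨fun n => W * majCross α
      (|Real.log α| * quantF α 0 (G τ) + quantK α 0 (G σ) (G τ)) n,
      fun n => mul_nonneg hW0 (majCross_nonneg hα0 hb n),
      ⟨W * C, by positivity, fun n => by
        rw [mul_assoc]; exact mul_le_mul_of_nonneg_left (hCu n) hW0⟩,
      (summable_majCross hα0 hα1 _).mul_left _, ?_, fun M hM => ?_, fun j x y hx hy => ?_⟩
    · rw [tsum_mul_left, bndS, if_neg h]
      exact mul_le_mul_of_nonneg_left (tsum_majCross_le hα0 hα1 hb) hW0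
    · rw [hite, bndT, if_neg h]
      exact mul_le_mul_of_nonneg_left (tsum_tail_majCross_le hα0 hα1 hb M) hW0
    · rw [hreal, termC, if_neg h]
      have := norm_termCrossC_le (P.branch σ) (P.branch τ) hc.le hc.le (ofReal_mem_strip 0 x)
        (ofReal_mem_strip 0 y) (by simpa using hx) (by simpa using hy) j
        (m := max (stripNorm 0 (G σ)) (stripNorm 0 (G τ))) (le_max_left _ _) (le_max_right _ _)
        zero_lt_one (by
          have e : (x : ℂ) + j = ((x + j : ℝ) : ℂ) := by push_cast; ring
          rw [e, qCrossC, powC_ofReal hα0, powC_ofReal hα0,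
            (P.branch σ).conic_ofReal (Real.rpow_pos_of_pos hα0 _),
            (P.branch τ).conic_ofReal (Real.rpow_pos_of_pos hα0 _), ← Complex.ofReal_sub,
            ← Complex.ofReal_add, ← Complex.ofReal_div, Complex.ofReal_im, abs_zero])
      rw [hWe] at this
      simpa [quantK] using this

end BranchPair

end

/-! ### Analyticity, quasi-periodicity and size of the kernel -/

section

variable {α c : ℝ} {φ : Bool → ℝ → ℝ} {G : Bool → ℂ → ℂ} (P : BranchPair α c φ G) (σ τ : Bool)

/-- The kernel at real arguments. -/
def kerR (α : ℝ) (φ : Bool → ℝ → ℝ) (t : ℝ) (σ τ : Bool) (x y : ℝ) : ℂ :=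
  1 / (2 * (Real.pi : ℂ)) *
    ∑' j : ℤ, Complex.exp (Complex.I * j * t) * (termR α φ σ τ j x y : ℝ)

/-- The sum of the products of the bounds for the two factors of the iterated kernel. -/
def bndProd (α c : ℝ) (G : Bool → ℂ → ℂ) (σ τ : Bool) : ℝ := ∑ ρ, bndR α c G σ ρ * bndL α c G ρ τ

include P

namespace BranchPair

theorem kerC_ofReal (t x y : ℝ) : kerC α G t σ τ x y = kerR α φ t σ τ x y := by
  rw [kerC, kerR]
  simp_rw [P.termC_ofReal]

theorem termC_add_one {x y : ℂ} (hx : x ∈ strip c) (hy : y ∈ strip c) :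
    termC α G σ τ (x + 1) (y + 1) = termC α G σ τ x y := by
  unfold termC
  split_ifs with h
  · exact termSameC_add_one (P.branch σ) hx hy
  · exact termCrossC_add_one (P.branch σ) (P.branch τ) hx hy

theorem differentiableOn_termC_left (y : ℝ) :
    DifferentiableOn ℂ (fun x => termC α G σ τ x y) (strip c) := by
  unfold termC
  split_ifs with h
  · exact differentiableOn_termSameC_left (P.branch σ) (ofReal_mem_strip c y)
  · exact differentiableOn_termCrossC_left (P.branch σ) (P.branch τ) (P.cross_lt σ τ h) y

theorem differentiableOn_termC_right (x : ℝ) :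
    DifferentiableOn ℂ (fun y => termC α G σ τ x y) (strip c) := by
  unfold termC
  split_ifs with h
  · exact differentiableOn_termSameC_right (P.branch σ) (ofReal_mem_strip c x)
  · exact differentiableOn_termCrossC_right (P.branch σ) (P.branch τ) (P.cross_lt τ σ (Ne.symm h)) x

theorem norm_inv_two_pi : ‖(1 / (2 * (Real.pi : ℂ)) : ℂ)‖ = (2 * Real.pi)⁻¹ := by
  simp [abs_of_pos Real.pi_pos]

/-- Increasing x by one raises the index by one. Increasing y by one lowers it, by joint translation
invariance, so `kerC_right` has the inverse phase; in the iterated kernel the two phases cancel. -/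
theorem kerC_left (t : ℝ) {y : ℝ} (hy : y ∈ Set.Icc (0 : ℝ) 1) :
    DifferentiableOn ℂ (fun x => kerC α G t σ τ x y) (strip c) ∧
    (∀ x ∈ strip c, kerC α G t σ τ (x + 1) y = Complex.exp (-(Complex.I * t)) * kerC α G t σ τ x y) ∧
    ∀ x ∈ strip c, ‖kerC α G t σ τ x y‖ ≤ bndL α c G σ τ := by
  obtain ⟨u, hu, hs, hb⟩ := P.exists_majorant_left σ τ
  have hT : ∀ (j : ℤ), ∀ z ∈ strip c,
      termC α G σ τ (z + 1 + j) y = termC α G σ τ (z + (j + 1 : ℤ)) y := by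
    intro j z _; congr 1; push_cast; ring
  have hb' : ∀ (j : ℤ), ∀ z ∈ strip c, z.re ∈ Set.Icc (0 : ℝ) 1 →
      ‖termC α G σ τ (z + j) y‖ ≤ u j := fun j z hz hzr => hb j z y hz hzr hy
  refine ⟨?_, fun x hx => ?_, fun x hx => ?_⟩
  · refine DifferentiableOn.const_mul ?_ _
    refine differentiableOn_tsum_translates (T := fun j z => termC α G σ τ (z + j) y) hT hb' hu
      P.c_pos (fun j => ?_) t
    exact (P.differentiableOn_termC_left σ τ y).comp (by fun_prop)
      fun z hz => add_intCast_mem_strip hz j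
  · have := tsum_translates_add_one (T := fun j z => termC α G σ τ (z + j) y) hT hb' hx t
    rw [kerC, kerC, this, Int.cast_one, mul_one]
    ring
  · have := norm_tsum_translates_le (T := fun j z => termC α G σ τ (z + j) y) hT hb' hu hx t
    rw [kerC, norm_mul, P.norm_inv_two_pi, inv_mul_le_iff₀ (by positivity)]
    exact this.trans hs

theorem kerC_right (t : ℝ) {x : ℝ} (hx : x ∈ Set.Icc (0 : ℝ) 1) :
    DifferentiableOn ℂ (fun y => kerC α G t σ τ x y) (strip c) ∧
    (∀ y ∈ strip c, kerC α G t σ τ x (y + 1) = Complex.exp (Complex.I * t) * kerC α G t σ τ x y) ∧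
    ∀ y ∈ strip c, ‖kerC α G t σ τ x y‖ ≤ bndR α c G σ τ := by
  obtain ⟨u, hu, hs, hb⟩ := P.exists_majorant_right σ τ
  have hT : ∀ (j : ℤ), ∀ z ∈ strip c,
      termC α G σ τ (x + j) (z + 1) = termC α G σ τ (x + (j + -1 : ℤ)) z := by
    intro j z hz
    rw [← P.termC_add_one σ τ (add_intCast_mem_strip (ofReal_mem_strip c x) (j + -1)) hz]
    congr 1; push_cast; ring
  have hb' : ∀ (j : ℤ), ∀ z ∈ strip c, z.re ∈ Set.Icc (0 : ℝ) 1 →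
      ‖termC α G σ τ (x + j) z‖ ≤ u j := fun j z hz hzr => hb j x z hx hz hzr
  refine ⟨?_, fun y hy => ?_, fun y hy => ?_⟩
  · refine DifferentiableOn.const_mul ?_ _
    refine differentiableOn_tsum_translates (T := fun j z => termC α G σ τ (x + j) z) hT hb' hu
      P.c_pos (fun j => ?_) t
    have := P.differentiableOn_termC_right σ τ (x + j)
    push_cast at this
    exact this
  · have := tsum_translates_add_one (T := fun j z => termC α G σ τ (x + j) z) hT hb' hy t
    rw [kerC, kerC, this]
    have e : -(Complex.I * ((-1 : ℤ) : ℂ) * t) = Complex.I * t := by push_cast; ring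
    rw [e]
    ring
  · have := norm_tsum_translates_le (T := fun j z => termC α G σ τ (x + j) z) hT hb' hu hy t
    rw [kerC, norm_mul, P.norm_inv_two_pi, inv_mul_le_iff₀ (by positivity)]
    exact this.trans hs

theorem bndL_nonneg : 0 ≤ bndL α c G σ τ :=
  (norm_nonneg _).trans ((P.kerC_left σ τ 0 (y := 0) (by simp)).2.2 _ (ofReal_mem_strip c 0))

theorem bndR_nonneg : 0 ≤ bndR α c G σ τ :=
  (norm_nonneg _).trans ((P.kerC_right σ τ 0 (x := 0) (by simp)).2.2 _ (ofReal_mem_strip c 0))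

/-- The quadrature error of the midpoint rule for the iterated kernel. -/
theorem quadrature_error (t : ℝ) {x y : ℝ} (hx : x ∈ Set.Icc (0 : ℝ) 1) (hy : y ∈ Set.Icc (0 : ℝ) 1)
    (N : ℕ) (hN : 1 ≤ N) :
    ‖(∑ ρ, ∫ z in (0 : ℝ)..1, kerR α φ t σ ρ x z * kerR α φ t ρ τ z y) -
      ∑ ρ, 1 / (N : ℂ) * ∑ q : Fin N, kerR α φ t σ ρ x (node N q) * kerR α φ t ρ τ (node N q) y‖
      ≤ 2 * bndProd α c G σ τ / (Real.exp (2 * Real.pi * N * c) - 1) := by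
  rw [← Finset.sum_sub_distrib, bndProd, Finset.mul_sum, Finset.sum_div]
  refine (norm_sum_le _ _).trans (Finset.sum_le_sum fun ρ _ => ?_)
  obtain ⟨hr1, hr2, hr3⟩ := P.kerC_right σ ρ t hx
  obtain ⟨hl1, hl2, hl3⟩ := P.kerC_left ρ τ t hy
  have hs := strip_eq P.c_pos
  have := midpoint_error (h := fun z => kerC α G t σ ρ x z * kerC α G t ρ τ z y)
    (M := bndR α c G σ ρ * bndL α c G ρ τ) P.c_pos (hs ▸ hr1.mul hl1)
    (fun z hz => by
      have hz : z ∈ strip c := by rw [hs]; exact hz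
      rw [hr2 z hz, hl2 z hz, mul_mul_mul_comm, ← Complex.exp_add, add_neg_cancel, Complex.exp_zero,
        one_mul])
    (fun z hz => by
      have hz : z ∈ strip c := by rw [hs]; exact hz
      rw [norm_mul]
      exact mul_le_mul (hr3 z hz) (hl3 z hz) (norm_nonneg _) (P.bndR_nonneg σ ρ)) N hN
  simp only [P.kerC_ofReal] at this
  exact this

/-- For a fixed row σ the sum over τ and over the intermediate branch has four products, those
inside the maximum in `constC4`. The factor 2 comes from the midpoint rule, and e^{2πc} ≥ 1 is
slack. -/
theorem sum_bndProd_le : ∑ τ, 2 * bndProd α c G σ τ ≤ constC4 α c (G true) (G false) := by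
  have hexp : 1 ≤ Real.exp (2 * Real.pi * c) := by
    have := P.c_pos
    have := Real.pi_pos
    exact Real.one_le_exp (by positivity)
  have hnn : 0 ≤ ∑ τ, bndProd α c G σ τ := Finset.sum_nonneg fun τ _ => Finset.sum_nonneg fun ρ _ =>
    mul_nonneg (P.bndR_nonneg σ ρ) (P.bndL_nonneg ρ τ)
  rw [← Finset.mul_sum, constC4]
  have key : ∀ m, ∑ τ, bndProd α c G σ τ ≤ m →
      2 * ∑ τ, bndProd α c G σ τ ≤ 2 * Real.exp (2 * Real.pi * c) * m := by
    intro m hm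
    nlinarith
  refine key _ ?_
  cases σ
  · refine le_max_of_le_left (le_of_eq ?_)
    simp [bndProd, bndR, bndL]
    ring
  · refine le_max_of_le_right (le_of_eq ?_)
    simp [bndProd, bndR, bndL]
    ring

theorem sum_bndS_le : (2 * Real.pi)⁻¹ * ∑ τ, bndS α G σ τ ≤ constC3 α (G true) (G false) := by
  rw [constC3, one_div]
  refine mul_le_mul_of_nonneg_left ?_ (by have := Real.pi_pos; positivity)
  cases σ
  · refine le_max_of_le_right (le_of_eq ?_)
    simp [bndS, constC3Entry]
    ring
  · refine le_max_of_le_left (le_of_eq ?_)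
    simp [bndS, constC3Entry]
    ring

theorem sum_bndT_le (M : ℕ) :
    (2 * Real.pi)⁻¹ * ∑ τ, bndT α G M σ τ ≤ constC1 α M (G true) (G false) := by
  have hp : (2 * Real.pi)⁻¹ = 1 / Real.pi * (1 / 2) := by rw [mul_inv]; ring
  rw [constC1, hp, mul_assoc]
  refine mul_le_mul_of_nonneg_left ?_ (by have := Real.pi_pos; positivity)
  cases σ
  · refine le_max_of_le_right (le_of_eq ?_)
    simp [bndT, constC1Entry]
    ring
  · refine le_max_of_le_left (le_of_eq ?_)
    simp [bndT, constC1Entry]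
    ring

theorem summable_termR {x y : ℝ} (hx : x ∈ Set.Icc (0 : ℝ) 1) (hy : y ∈ Set.Icc (0 : ℝ) 1) :
    Summable fun j : ℤ => |termR α φ σ τ j x y| := by
  obtain ⟨u, -, -, hs, -, -, hb⟩ := P.exists_majorant_real σ τ
  exact Summable.of_nonneg_of_le (fun _ => abs_nonneg _) (fun j => hb j x y hx hy) hs

theorem norm_kerR_le (t : ℝ) {x y : ℝ} (hx : x ∈ Set.Icc (0 : ℝ) 1) (hy : y ∈ Set.Icc (0 : ℝ) 1) :
    ‖kerR α φ t σ τ x y‖ ≤ (2 * Real.pi)⁻¹ * bndS α G σ τ := by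
  obtain ⟨u, -, -, hs, hS, -, hb⟩ := P.exists_majorant_real σ τ
  rw [kerR, norm_mul, P.norm_inv_two_pi]
  refine mul_le_mul_of_nonneg_left ((tsum_of_norm_bounded hs.hasSum fun j => ?_).trans hS)
    (by positivity)
  rw [norm_mul, norm_expI_mul, one_mul, Complex.norm_real, Real.norm_eq_abs]
  exact hb j x y hx hy

/-- The kernel truncated to `|j| ≤ M`. -/
theorem norm_kerR_sub_le (t : ℝ) {x y : ℝ} (hx : x ∈ Set.Icc (0 : ℝ) 1)
    (hy : y ∈ Set.Icc (0 : ℝ) 1) (M : ℕ) (hM : 2 ≤ M) :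
    ‖kerR α φ t σ τ x y - 1 / (2 * (Real.pi : ℂ)) * ∑ j ∈ Finset.Icc (-(M : ℤ)) M,
      Complex.exp (Complex.I * j * t) * (termR α φ σ τ j x y : ℝ)‖
      ≤ (2 * Real.pi)⁻¹ * bndT α G M σ τ := by
  obtain ⟨u, hu0, -, hs, -, hT, hb⟩ := P.exists_majorant_real σ τ
  set a : ℤ → ℂ := fun j => Complex.exp (Complex.I * j * t) * (termR α φ σ τ j x y : ℝ) with ha
  have hna : ∀ j, ‖a j‖ ≤ u j.natAbs := fun j => by
    rw [ha]
    simp only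
    rw [norm_mul, norm_expI_mul, one_mul, Complex.norm_real, Real.norm_eq_abs]
    exact hb j x y hx hy
  have hsa : Summable a := Summable.of_norm_bounded hs hna
  have hfin : HasSum (fun j => if j ∈ Finset.Icc (-(M : ℤ)) M then a j else 0)
      (∑ j ∈ Finset.Icc (-(M : ℤ)) M, a j) := by
    have := hasSum_sum_of_ne_finset_zero (L := .unconditional ℤ) (s := Finset.Icc (-(M : ℤ)) M)
      (f := fun j => if j ∈ Finset.Icc (-(M : ℤ)) M then a j else 0)
      (fun j hj => if_neg hj)
    rwa [Finset.sum_congr rfl fun j hj => if_pos hj] at this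
  have htail := hsa.hasSum.sub hfin
  have hss : Summable fun j : ℤ => if j ∈ Finset.Icc (-(M : ℤ)) M then 0 else u j.natAbs := by
    refine Summable.of_nonneg_of_le (fun j => ?_) (fun j => ?_) hs
    · split_ifs; exacts [le_rfl, hu0 _]
    · split_ifs; exacts [hu0 _, le_rfl]
  rw [kerR, ← mul_sub, norm_mul, P.norm_inv_two_pi]
  refine mul_le_mul_of_nonneg_left ?_ (by positivity)
  rw [← htail.tsum_eq]
  refine (tsum_of_norm_bounded hss.hasSum fun j => ?_).trans (hT M hM)
  split_ifs with h
  · simp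
  · simpa using hna j

end BranchPair

end

/-! ### Nyström approximation of integral operators with bounded kernels -/

section nystrom

variable {X ι : Type*} [MeasurableSpace X] {μ : Measure X} [IsFiniteMeasure μ] [Fintype ι]

/-- The error in the iterated kernel caused by replacing integration by a quadrature rule. -/
def quadError (μ : Measure X) (ξ : ι → X) (w : ℝ) (k : X → X → ℂ) (x y : X) : ℂ :=
  (∫ z, k x z * k z y ∂μ) - ∑ i, (w : ℂ) * (k x (ξ i) * k (ξ i) y)

theorem integral_norm_le_norm_Lp (φ : Lp ℂ 2 μ) :
    ∫ x, ‖φ x‖ ∂μ ≤ √(μ.real Set.univ) * ‖φ‖ := by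
  have hm := Lp.memLp φ
  have h1 : Integrable φ μ := hm.integrable (by norm_num)
  have h2 := eLpNorm_le_eLpNorm_mul_rpow_measure_univ (μ := μ) (f := φ) (p := 1) (q := 2)
    (by norm_num) hm.1
  have e : (1 / (1 : ENNReal).toReal - 1 / (2 : ENNReal).toReal) = (1 / 2 : ℝ) := by norm_num
  rw [e, eLpNorm_one_eq_lintegral_enorm] at h2
  have h3 := ENNReal.toReal_mono (ENNReal.mul_ne_top hm.2.ne (ENNReal.rpow_ne_top_of_nonneg
    (by norm_num) (measure_ne_top μ _))) h2
  rw [← integral_norm_eq_lintegral_enorm h1.1, ENNReal.toReal_mul, ← ENNReal.toReal_rpow,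
    ← Real.sqrt_eq_rpow] at h3
  rw [mul_comm]
  exact h3

theorem norm_Lp_le_of_bound {φ : Lp ℂ 2 μ} {b : ℝ} (hb : 0 ≤ b) (h : ∀ᵐ x ∂μ, ‖φ x‖ ≤ b) :
    ‖φ‖ ≤ √(μ.real Set.univ) * b := by
  have := Lp.norm_le_of_ae_bound hb h
  convert this using 2
  rw [Real.sqrt_eq_rpow]
  norm_num [measureUnivNNReal, Measure.real, ENNReal.coe_toNNReal_eq_toReal]

variable {k : X → X → ℂ} (hk : Measurable (Function.uncurry k)) {C : ℝ} (hC : ∀ x y, ‖k x y‖ ≤ C)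
include hk hC

theorem integrable_kernel_mul (x : X) {g : X → ℂ} (hg : Integrable g μ) :
    Integrable (fun y => k x y * g y) μ :=
  hg.bdd_mul (hk.comp measurable_prodMk_left).aestronglyMeasurable (ae_of_all _ (hC x))

theorem norm_integral_kernel_le (x : X) {g : X → ℂ} (hg : Integrable g μ) :
    ‖∫ y, k x y * g y ∂μ‖ ≤ C * ∫ y, ‖g y‖ ∂μ := by
  rw [← integral_const_mul]
  refine norm_integral_le_of_norm_le (hg.norm.const_mul C) (ae_of_all _ fun y => ?_)
  rw [norm_mul]
  exact mul_le_mul_of_nonneg_right (hC x y) (norm_nonneg _)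

omit hC in
theorem measurable_iterated (x : X) :
    StronglyMeasurable fun y => ∫ z, k x z * k z y ∂μ := by
  have h : Measurable (Function.uncurry fun (y z : X) => k x z * k z y) :=
    (hk.comp (measurable_const.prodMk measurable_snd)).mul
      (hk.comp (measurable_snd.prodMk measurable_fst))
  exact h.stronglyMeasurable.integral_prod_right

omit hC in
theorem measurable_quadError (ξ : ι → X) (w : ℝ) (x : X) :
    Measurable fun y => quadError μ ξ w k x y :=
  (measurable_iterated hk x).measurable.sub (Finset.measurable_sum _ fun _ _ =>
    ((measurable_const.mul (hk.comp (measurable_const.prodMk measurable_id))).const_mul _))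

theorem measurable_integral_kernel {g : X → ℂ} (hg : Measurable g) :
    StronglyMeasurable fun x => ∫ y, k x y * g y ∂μ := by
  have h : Measurable (Function.uncurry fun (x y : X) => k x y * g y) :=
    hk.mul (hg.comp measurable_snd)
  exact h.stronglyMeasurable.integral_prod_right

theorem integral_iterated (x : X) {g : X → ℂ} (hg : Integrable g μ) :
    ∫ z, k x z * ∫ y, k z y * g y ∂μ ∂μ = ∫ y, (∫ z, k x z * k z y ∂μ) * g y ∂μ := by
  have h0 : 0 ≤ C ∨ IsEmpty X := by
    rcases isEmpty_or_nonempty X with h | ⟨⟨x⟩⟩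
    · exact Or.inr h
    · exact Or.inl ((norm_nonneg _).trans (hC x x))
  have h1 : Integrable (Function.uncurry fun (z y : X) => k x z * (k z y * g y)) (μ.prod μ) := by
    have hg2 : Integrable (fun p : X × X => g p.2) (μ.prod μ) := hg.comp_snd μ
    have h2 : Integrable (fun p : X × X => k p.1 p.2 * g p.2) (μ.prod μ) :=
      hg2.bdd_mul hk.aestronglyMeasurable (ae_of_all _ fun p => hC p.1 p.2)
    exact h2.bdd_mul (hk.comp (measurable_const.prodMk measurable_fst)).aestronglyMeasurable
      (ae_of_all _ fun p => hC x p.1)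
  calc ∫ z, k x z * ∫ y, k z y * g y ∂μ ∂μ = ∫ z, ∫ y, k x z * (k z y * g y) ∂μ ∂μ := by
        simp_rw [integral_const_mul]
    _ = ∫ y, ∫ z, k x z * (k z y * g y) ∂μ ∂μ := integral_integral_swap h1
    _ = _ := by
        refine integral_congr_ae (ae_of_all _ fun y => ?_)
        simp only [← mul_assoc]
        rw [integral_mul_const]

variable {ξ : ι → X} {w C₃ ε CE : ℝ}

-- The identity K²g − K_N K g = ∫ E(·, y) g(y) dy, where E is the quadrature error of the iterated
-- kernel. Quadrature is never applied to g itself, which need not be smooth.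
omit [Fintype ι] in
theorem iterated_sub_quadrature [Fintype ι] (x : X) {g : X → ℂ} (hg : Integrable g μ)
    (hCE : ∀ x y, ‖quadError μ ξ w k x y‖ ≤ CE) :
    (∫ z, k x z * ∫ y, k z y * g y ∂μ ∂μ) - ∑ i, (w : ℂ) * (k x (ξ i) * ∫ y, k (ξ i) y * g y ∂μ) =
      ∫ y, quadError μ ξ w k x y * g y ∂μ := by
  have hi : ∀ i, Integrable (fun y => (w : ℂ) * (k x (ξ i) * k (ξ i) y) * g y) μ := fun i => by
    have := ((integrable_kernel_mul hk hC (ξ i) hg).const_mul (k x (ξ i))).const_mul (w : ℂ)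
    refine this.congr (ae_of_all _ fun y => ?_)
    simp only; ring
  have hE : Integrable (fun y => quadError μ ξ w k x y * g y) μ :=
    hg.bdd_mul (measurable_quadError hk ξ w x).aestronglyMeasurable (ae_of_all _ (hCE x))
  have hs : Integrable (fun y => (∑ i, (w : ℂ) * (k x (ξ i) * k (ξ i) y)) * g y) μ := by
    simp_rw [Finset.sum_mul]
    exact integrable_finsetSum _ fun i _ => hi i
  have hadd := integral_add hE hs
  have e1 : ∫ y, (∑ i, (w : ℂ) * (k x (ξ i) * k (ξ i) y)) * g y ∂μ =
      ∑ i, (w : ℂ) * (k x (ξ i) * ∫ y, k (ξ i) y * g y ∂μ) := by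
    simp_rw [Finset.sum_mul]
    rw [integral_finsetSum _ fun i _ => hi i]
    refine Finset.sum_congr rfl fun i _ => ?_
    rw [← integral_const_mul, ← integral_const_mul]
    refine integral_congr_ae (ae_of_all _ fun y => ?_)
    simp only; ring
  rw [integral_iterated hk hC x hg, ← e1, sub_eq_iff_eq_add, ← hadd]
  refine integral_congr_ae (ae_of_all _ fun y => ?_)
  simp only [quadError]; ring

/-- Resolvent bounds for the Nyström matrix give resolvent bounds for the integral operator. -/
theorem norm_le_of_nystrom [Nonempty X] [Nonempty ι] [DecidableEq ι] (hw : 0 ≤ w)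
    (hCE : ∀ x y, ‖quadError μ ξ w k x y‖ ≤ CE) (hrow : ∀ x, ∑ i, w * ‖k x (ξ i)‖ ≤ C₃)
    (hε : ∀ x, ∫ y, ‖quadError μ ξ w k x y‖ ∂μ ≤ ε) {ρ₀ Δ : ℝ} (hρ : 0 < ρ₀) (hΔ : 0 < Δ) {z : ℂ}
    (hz : ρ₀ ≤ ‖z‖)
    (hA : ∀ v : ι → ℂ, Δ * ‖v‖ ≤
      ‖(Matrix.of fun i j => (w : ℂ) * k (ξ i) (ξ j)).mulVec v - z • v‖)
    (hθ : (1 + C₃ / Δ) * ε < ρ₀ ^ 2) {φ ω : Lp ℂ 2 μ}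
    (hω : ∀ᵐ x ∂μ, ω x = (∫ y, k x y * φ y ∂μ) - z * φ x) :
    ‖φ‖ ≤ ρ₀⁻¹ * (√(μ.real Set.univ) * ((1 + C₃ / Δ) * (C / ρ₀ + CE / ρ₀ ^ 2) *
      √(μ.real Set.univ) / (1 - (1 + C₃ / Δ) * ε / ρ₀ ^ 2)) + 1) * ‖ω‖ := by
  set m := √(μ.real Set.univ) with hm
  have hm0 : 0 ≤ m := Real.sqrt_nonneg _
  obtain ⟨x₀⟩ := ‹Nonempty X›
  have hC0 : 0 ≤ C := (norm_nonneg _).trans (hC x₀ x₀)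
  have hCE0 : 0 ≤ CE := (norm_nonneg _).trans (hCE x₀ x₀)
  have hε0 : 0 ≤ ε := (integral_nonneg fun _ => norm_nonneg _).trans (hε x₀)
  have hC₃0 : 0 ≤ C₃ := (Finset.sum_nonneg fun i _ => mul_nonneg hw (norm_nonneg _)).trans (hrow x₀)
  have ha : 0 < ‖z‖ := hρ.trans_le hz
  have hz0 : z ≠ 0 := norm_pos_iff.mp ha
  have hφi : Integrable φ μ := (Lp.memLp φ).integrable (by norm_num)
  have hωi : Integrable ω μ := (Lp.memLp ω).integrable (by norm_num)
  -- The class φ has no values at the nodes. Its image ψ = Kφ is bounded and defined at every point,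
  -- so the argument runs on ψ in the supremum norm.
  set ψ : X → ℂ := fun x => ∫ y, k x y * φ y ∂μ with hψ
  have hψb : ∀ x, ‖ψ x‖ ≤ C * ∫ y, ‖φ y‖ ∂μ := fun x => norm_integral_kernel_le hk hC x hφi
  have hbdd : BddAbove (Set.range fun x => ‖ψ x‖) :=
    ⟨_, by rintro _ ⟨x, rfl⟩; exact hψb x⟩
  set Ψ := ⨆ x, ‖ψ x‖ with hΨ
  have hψΨ : ∀ x, ‖ψ x‖ ≤ Ψ := fun x => le_ciSup hbdd x
  have hΨ0 : 0 ≤ Ψ := (norm_nonneg _).trans (hψΨ x₀)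
  have hψω : ∀ᵐ y ∂μ, ψ y = ω y + z * φ y := hω.mono fun y hy => by rw [hy]; ring
  have hφψ : ∀ᵐ y ∂μ, φ y = z⁻¹ * (ψ y - ω y) := hψω.mono fun y hy => by
    rw [hy]; field_simp; ring
  have hn : ∫ y, ‖ω y‖ ∂μ ≤ m * ‖ω‖ := integral_norm_le_norm_Lp ω
  set n := ‖ω‖ with hnn
  have hn0 : 0 ≤ n := norm_nonneg _
  -- the equation for `ψ`
  have hKψ : ∀ x, ∫ y, k x y * ψ y ∂μ = (∫ y, k x y * ω y ∂μ) + z * ψ x := by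
    intro x
    rw [hψ]
    simp only
    rw [← integral_const_mul, ← integral_add (integrable_kernel_mul hk hC x hωi)
      ((integrable_kernel_mul hk hC x hφi).const_mul z)]
    refine integral_congr_ae (hψω.mono fun y hy => ?_)
    simp only
    rw [show (∫ y', k y y' * φ y' ∂μ) = ψ y from rfl, hy]; ring
  -- ψ solves the Nyström equation (K_N − z)ψ = r with r = Kω − ∫ Eφ.
  set r : X → ℂ := fun x => (∫ y, k x y * ω y ∂μ) - ∫ y, quadError μ ξ w k x y * φ y ∂μ with hr
  have hNψ : ∀ x, ∑ i, (w : ℂ) * (k x (ξ i) * ψ (ξ i)) - z * ψ x = r x := by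
    intro x
    have h1 := iterated_sub_quadrature hk hC x hφi hCE
    have h2 := hKψ x
    rw [hr]
    simp only
    rw [← h1]
    rw [show (∫ z, k x z * ∫ y, k z y * φ y ∂μ ∂μ) = ∫ y, k x y * ψ y ∂μ from rfl, h2]
    ring
  -- In ∫ Eφ the density is replaced by φ = (ψ − ω)/z. The unknown Ψ then carries the small factor
  -- ε/|z|, and the rest is controlled by ω.
  set R := C * (m * n) + ‖z‖⁻¹ * (ε * Ψ + CE * (m * n)) with hR
  have hrR : ∀ x, ‖r x‖ ≤ R := by
    intro x
    refine (norm_sub_le _ _).trans (add_le_add ?_ ?_)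
    · exact (norm_integral_kernel_le hk hC x hωi).trans (mul_le_mul_of_nonneg_left hn hC0)
    · have hEm := (measurable_quadError (μ := μ) hk ξ w x).aestronglyMeasurable (μ := μ)
      have hEi : Integrable (fun y => ‖quadError μ ξ w k x y‖) μ :=
        (Integrable.of_bound hEm CE (ae_of_all _ (hCE x))).norm
      have h1 : ‖∫ y, quadError μ ξ w k x y * φ y ∂μ‖ ≤
          ∫ y, ‖z‖⁻¹ * (‖quadError μ ξ w k x y‖ * Ψ + CE * ‖ω y‖) ∂μ := by
        refine norm_integral_le_of_norm_le
          (((hEi.mul_const Ψ).add (hωi.norm.const_mul CE)).const_mul _) (hφψ.mono fun y hy => ?_)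
        rw [hy, norm_mul, norm_mul, norm_inv]
        calc ‖quadError μ ξ w k x y‖ * (‖z‖⁻¹ * ‖ψ y - ω y‖)
            = ‖z‖⁻¹ * (‖quadError μ ξ w k x y‖ * ‖ψ y - ω y‖) := by ring
          _ ≤ ‖z‖⁻¹ * (‖quadError μ ξ w k x y‖ * (‖ψ y‖ + ‖ω y‖)) := by
              gcongr; exact norm_sub_le _ _
          _ ≤ _ := by
              rw [mul_add]
              have := hψΨ y
              have := hCE x y
              gcongr
      refine h1.trans ?_
      rw [integral_const_mul, integral_add (hEi.mul_const Ψ) (hωi.norm.const_mul CE),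
        integral_mul_const, integral_const_mul]
      have := hε x
      gcongr
  have hR0 : 0 ≤ R := (norm_nonneg _).trans (hrR x₀)
  set v : ι → ℂ := fun i => ψ (ξ i) with hv
  have hvR : Δ * ‖v‖ ≤ R := by
    refine (hA v).trans ((pi_norm_le_iff_of_nonneg hR0).mpr fun i => ?_)
    have : ((Matrix.of fun i j => (w : ℂ) * k (ξ i) (ξ j)).mulVec v - z • v) i = r (ξ i) := by
      rw [← hNψ (ξ i)]
      simp [Matrix.mulVec, dotProduct, hv, mul_assoc]
    rw [this]
    exact hrR _
  -- The matrix bound controls ψ at the nodes; Nyström interpolation zψ(x) = Σ w k(x, ξ_i)ψ(ξ_i) −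
  -- r(x) propagates this to all x, whence 1 + C₃/Δ.
  have hpt : ∀ x, ‖z‖ * ‖ψ x‖ ≤ (1 + C₃ / Δ) * R := by
    intro x
    have h1 : z * ψ x = (∑ i, (w : ℂ) * (k x (ξ i) * ψ (ξ i))) - r x := by rw [← hNψ x]; ring
    rw [← norm_mul, h1]
    refine (norm_sub_le _ _).trans ?_
    have h2 : ‖∑ i, (w : ℂ) * (k x (ξ i) * ψ (ξ i))‖ ≤ C₃ * ‖v‖ := by
      refine (norm_sum_le _ _).trans ?_
      refine le_trans ?_ (mul_le_mul_of_nonneg_right (hrow x) (norm_nonneg _))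
      rw [Finset.sum_mul]
      refine Finset.sum_le_sum fun i _ => ?_
      rw [norm_mul, norm_mul, Complex.norm_real, Real.norm_eq_abs, abs_of_nonneg hw, mul_assoc]
      have := norm_le_pi_norm v i
      gcongr
    have h3 : ‖v‖ ≤ R / Δ := by rw [le_div_iff₀ hΔ, mul_comm]; exact hvR
    calc _ ≤ C₃ * (R / Δ) + R := add_le_add (h2.trans (by gcongr)) (hrR x)
      _ = _ := by field_simp; ring
  set κ := 1 + C₃ / Δ with hκ
  have hκ0 : 0 ≤ κ := by positivity
  have hΨle : ‖z‖ * Ψ ≤ κ * R := by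
    rw [mul_comm, ← le_div_iff₀ ha]
    have : Nonempty X := ⟨x₀⟩
    refine ciSup_le fun x => ?_
    rw [le_div_iff₀ ha, mul_comm]
    exact hpt x
  -- Ψ occurs on both sides, on the right with the coefficient κε/ρ₀². The hypothesis `hθ`, which is
  -- the inequality ℒ < ℛ of the criterion, makes it less than 1.
  have hΨfin : Ψ ≤ κ * (C / ρ₀ + CE / ρ₀ ^ 2) * m / (1 - κ * ε / ρ₀ ^ 2) * n := by
    have hpos : 0 < 1 - κ * ε / ρ₀ ^ 2 := by
      rw [sub_pos, div_lt_one (by positivity)]; exact hθ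
    have h1 : ‖z‖⁻¹ ≤ ρ₀⁻¹ := inv_anti₀ hρ hz
    have h2 : Ψ ≤ ‖z‖⁻¹ * (κ * R) := by
      rw [inv_mul_eq_div, le_div_iff₀ ha, mul_comm]; exact hΨle
    have h3 : R ≤ C * (m * n) + ρ₀⁻¹ * (ε * Ψ + CE * (m * n)) := by
      rw [hR]; gcongr
    have h4 : Ψ ≤ ρ₀⁻¹ * (κ * (C * (m * n) + ρ₀⁻¹ * (ε * Ψ + CE * (m * n)))) := by
      refine h2.trans ?_
      gcongr
    have h5 : Ψ * (1 - κ * ε / ρ₀ ^ 2) ≤ κ * (C / ρ₀ + CE / ρ₀ ^ 2) * m * n := by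
      have e : ρ₀⁻¹ * (κ * (C * (m * n) + ρ₀⁻¹ * (ε * Ψ + CE * (m * n)))) =
          κ * (C / ρ₀ + CE / ρ₀ ^ 2) * m * n + Ψ * (κ * ε / ρ₀ ^ 2) := by
        field_simp; ring
      rw [e] at h4
      linarith
    rw [div_mul_eq_mul_div, le_div_iff₀ hpos]
    exact h5
  -- the bound in `L²`
  have hψL : MemLp ψ 2 μ := by
    have hsm : AEStronglyMeasurable ψ μ := by
      have h1 : AEStronglyMeasurable (fun y => ω y + z * φ y) μ :=
        hωi.1.add (hφi.1.const_mul z)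
      exact h1.congr (hψω.mono fun y hy => hy.symm)
    exact MemLp.of_bound hsm Ψ (ae_of_all _ hψΨ)
  have hφe : φ = z⁻¹ • (hψL.toLp ψ - ω) := by
    refine Lp.ext ?_
    filter_upwards [hφψ, hψL.coeFn_toLp, Lp.coeFn_smul z⁻¹ (hψL.toLp ψ - ω),
      Lp.coeFn_sub (hψL.toLp ψ) ω] with y h1 h2 h3 h4
    rw [h3, Pi.smul_apply, h4, Pi.sub_apply, h2, smul_eq_mul, h1]
  have hψn : ‖hψL.toLp ψ‖ ≤ m * Ψ :=
    norm_Lp_le_of_bound hΨ0 (hψL.coeFn_toLp.mono fun y hy => by rw [hy]; exact hψΨ y)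
  calc ‖φ‖ = ‖z⁻¹ • (hψL.toLp ψ - ω)‖ := by rw [← hφe]
    _ ≤ ρ₀⁻¹ * (m * Ψ + n) := by
        rw [norm_smul, norm_inv]
        have := inv_anti₀ hρ hz
        have := (norm_sub_le (hψL.toLp ψ) ω).trans (add_le_add_left hψn ‖ω‖)
        gcongr
    _ ≤ ρ₀⁻¹ * (m * (κ * (C / ρ₀ + CE / ρ₀ ^ 2) * m / (1 - κ * ε / ρ₀ ^ 2) * n) + n) := by gcongr
    _ = _ := by ring

/-- Resolvent bounds for the integral operator give resolvent bounds for the Nyström matrix. -/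
theorem nystrom_bounded_below [Nonempty X] [DecidableEq ι] (hw : 0 ≤ w) (hrow : ∀ x, ∑ i, w * ‖k x (ξ i)‖ ≤ C₃)
    (hε : ∀ x, ∑ i, w * ‖quadError μ ξ w k x (ξ i)‖ ≤ ε) {ρ₀ δ : ℝ} (hρ : 0 < ρ₀) (hδ : 0 < δ) {z : ℂ}
    (hz : ρ₀ ≤ ‖z‖)
    (hK : ∀ φ ω : Lp ℂ 2 μ, (∀ᵐ x ∂μ, ω x = (∫ y, k x y * φ y ∂μ) - z * φ x) → δ * ‖φ‖ ≤ ‖ω‖)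
    (hsmall : (C * μ.real Set.univ / δ + 1) / ρ₀ ^ 2 * ε ≤ 1 / 2) (u : ι → ℂ) :
    ‖u‖ ≤ 2 * ((C * μ.real Set.univ / δ + 1) / ρ₀ ^ 2 * C₃ + ρ₀⁻¹) *
      ‖(Matrix.of fun i j => (w : ℂ) * k (ξ i) (ξ j)).mulVec u - z • u‖ := by
  set m := √(μ.real Set.univ) with hm
  have hm0 : 0 ≤ m := Real.sqrt_nonneg _
  have hmm : m * m = μ.real Set.univ := Real.mul_self_sqrt measureReal_nonneg
  obtain ⟨x₀⟩ := ‹Nonempty X›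
  have hC0 : 0 ≤ C := (norm_nonneg _).trans (hC x₀ x₀)
  have hε0 : 0 ≤ ε := (Finset.sum_nonneg fun i _ => mul_nonneg hw (norm_nonneg _)).trans (hε x₀)
  have hC₃0 : 0 ≤ C₃ := (Finset.sum_nonneg fun i _ => mul_nonneg hw (norm_nonneg _)).trans (hrow x₀)
  have ha : 0 < ‖z‖ := hρ.trans_le hz
  have hz0 : z ≠ 0 := norm_pos_iff.mp ha
  have hzi : ‖z‖⁻¹ ≤ ρ₀⁻¹ := inv_anti₀ hρ hz
  set ω₀ := (Matrix.of fun i j => (w : ℂ) * k (ξ i) (ξ j)).mulVec u - z • u with hω₀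
  set n := ‖ω₀‖ with hn
  have hω₀i : ∀ i, ∑ j, (w : ℂ) * (k (ξ i) (ξ j) * u j) = z * u i + ω₀ i := by
    intro i
    have : ω₀ i = ∑ j, (w : ℂ) * (k (ξ i) (ξ j) * u j) - z * u i := by
      simp [hω₀, Matrix.mulVec, dotProduct, mul_assoc]
    rw [this]; ring
  -- The Nyström interpolant of u: an approximate eigenfunction of K built from an approximate
  -- eigenvector of the matrix, equal to u at the nodes up to ω₀/z.
  set g : X → ℂ := fun x => z⁻¹ * ∑ j, (w : ℂ) * (k x (ξ j) * u j) with hg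
  have hkm : ∀ y, Measurable fun x => k x y := fun y => hk.comp (measurable_id.prodMk measurable_const)
  have hgm : Measurable g := (Finset.measurable_sum _ fun j _ =>
    ((hkm (ξ j)).mul_const (u j)).const_mul (w : ℂ)).const_mul _
  have hsumle : ∀ (a : X → X → ℂ) (D : ℝ) (v : ι → ℂ) (x : X), ∑ i, w * ‖a x (ξ i)‖ ≤ D →
      ‖∑ j, (w : ℂ) * (a x (ξ j) * v j)‖ ≤ D * ‖v‖ := by
    intro a D v x h
    refine (norm_sum_le _ _).trans (le_trans ?_ (mul_le_mul_of_nonneg_right h (norm_nonneg _)))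
    rw [Finset.sum_mul]
    refine Finset.sum_le_sum fun i _ => ?_
    rw [norm_mul, norm_mul, Complex.norm_real, Real.norm_eq_abs, abs_of_nonneg hw, mul_assoc]
    have := norm_le_pi_norm v i
    gcongr
  have hgb : ∀ x, ‖g x‖ ≤ ‖z‖⁻¹ * (C₃ * ‖u‖) := fun x => by
    rw [hg]; simp only
    rw [norm_mul, norm_inv]
    exact mul_le_mul_of_nonneg_left (hsumle k C₃ u x (hrow x)) (by positivity)
  have hgi : ∀ i, g (ξ i) = u i + z⁻¹ * ω₀ i := by
    intro i
    rw [hg]; simp only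
    rw [hω₀i]; field_simp
  have hkint : ∀ j, Integrable (fun y => k y (ξ j)) μ := fun j =>
    Integrable.of_bound (hkm (ξ j)).aestronglyMeasurable C (ae_of_all _ fun y => hC y _)
  have hKg : ∀ x, (∫ y, k x y * g y ∂μ) = z⁻¹ * ∑ j, (w : ℂ) * ((∫ y, k x y * k y (ξ j) ∂μ) * u j) := by
    intro x
    have hi : ∀ j ∈ Finset.univ, Integrable (fun y => (w : ℂ) * ((k x y * k y (ξ j)) * u j)) μ :=
      fun j _ => ((integrable_kernel_mul hk hC x (hkint j)).mul_const _).const_mul _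
    have : (fun y => k x y * g y) =
        fun y => z⁻¹ * ∑ j, (w : ℂ) * ((k x y * k y (ξ j)) * u j) := by
      funext y
      rw [hg]; simp only
      rw [mul_left_comm, Finset.mul_sum]
      congr 1
      refine Finset.sum_congr rfl fun j _ => ?_
      ring
    rw [this, integral_const_mul, integral_finsetSum _ hi]
    congr 1
    refine Finset.sum_congr rfl fun j _ => ?_
    rw [integral_const_mul, integral_mul_const]
  -- The residual of g consists of the quadrature error acting on u and the row sums acting on ω₀;
  -- it is divided by z, and again only the iterated kernel is involved.
  have hres : ∀ x, (∫ y, k x y * g y ∂μ) - z * g x =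
      z⁻¹ * (∑ j, (w : ℂ) * (quadError μ ξ w k x (ξ j) * u j) + ∑ i, (w : ℂ) * (k x (ξ i) * ω₀ i)) := by
    intro x
    have h1 : ∑ j, (w : ℂ) * (quadError μ ξ w k x (ξ j) * u j) =
        ∑ j, (w : ℂ) * ((∫ y, k x y * k y (ξ j) ∂μ) * u j) -
          ∑ i, (w : ℂ) * (k x (ξ i) * (z * u i + ω₀ i)) := by
      have h2 : ∑ i, (w : ℂ) * (k x (ξ i) * (z * u i + ω₀ i)) =
          ∑ j, (w : ℂ) * ((∑ i, (w : ℂ) * (k x (ξ i) * k (ξ i) (ξ j))) * u j) := by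
        simp_rw [← hω₀i, Finset.mul_sum, Finset.sum_mul, Finset.mul_sum]
        rw [Finset.sum_comm]
        refine Finset.sum_congr rfl fun i _ => Finset.sum_congr rfl fun j _ => ?_
        ring
      rw [h2, ← Finset.sum_sub_distrib]
      refine Finset.sum_congr rfl fun j _ => ?_
      rw [quadError]; ring
    have h3 : ∑ i, (w : ℂ) * (k x (ξ i) * (z * u i + ω₀ i)) =
        z * (z * g x) + ∑ i, (w : ℂ) * (k x (ξ i) * ω₀ i) := by
      rw [hg]; simp only
      rw [mul_inv_cancel_left₀ hz0, Finset.mul_sum, ← Finset.sum_add_distrib]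
      refine Finset.sum_congr rfl fun i _ => ?_
      ring
    rw [h1, h3, hKg]
    field_simp
    ring
  set b := ρ₀⁻¹ * (ε * ‖u‖ + C₃ * n) with hb
  have hb0 : 0 ≤ b := by positivity
  have hresb : ∀ x, ‖(∫ y, k x y * g y ∂μ) - z * g x‖ ≤ b := by
    intro x
    rw [hres, norm_mul, norm_inv, hb]
    have h1 := hsumle (quadError μ ξ w k) ε u x (hε x)
    have h2 := hsumle k C₃ ω₀ x (hrow x)
    have h3 := (norm_add_le _ _).trans (add_le_add h1 h2)
    gcongr
  have hgL : MemLp g 2 μ := MemLp.of_bound hgm.aestronglyMeasurable _ (ae_of_all _ hgb)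
  have hrL : MemLp (fun x => (∫ y, k x y * g y ∂μ) - z * g x) 2 μ :=
    MemLp.of_bound ((measurable_integral_kernel hk hC hgm).aestronglyMeasurable.sub
      (hgm.aestronglyMeasurable.const_mul z)) b (ae_of_all _ hresb)
  have hKφ : ∀ x, (∫ y, k x y * (hgL.toLp g) y ∂μ) = ∫ y, k x y * g y ∂μ := fun x =>
    integral_congr_ae (hgL.coeFn_toLp.mono fun y hy => by simp only; rw [hy])
  have h1 := hK (hgL.toLp g) (hrL.toLp _) (by
    filter_upwards [hgL.coeFn_toLp, hrL.coeFn_toLp] with x h1 h2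
    rw [h2, h1, hKφ])
  have h2 : ‖hrL.toLp _‖ ≤ m * b :=
    norm_Lp_le_of_bound hb0 (hrL.coeFn_toLp.mono fun x hx => by rw [hx]; exact hresb x)
  have h3 : ‖hgL.toLp g‖ ≤ m * b / δ := by
    rw [le_div_iff₀ hδ, mul_comm]; exact h1.trans h2
  have h4 : ∀ x, ‖g x‖ ≤ ρ₀⁻¹ * ((C * μ.real Set.univ / δ + 1) * b) := by
    intro x
    have h5 : ‖∫ y, k x y * g y ∂μ‖ ≤ C * (m * (m * b / δ)) := by
      rw [← hKφ]
      refine (norm_integral_kernel_le hk hC x ((Lp.memLp (hgL.toLp g)).integrable (by norm_num))).trans ?_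
      refine mul_le_mul_of_nonneg_left ?_ hC0
      exact (integral_norm_le_norm_Lp _).trans (mul_le_mul_of_nonneg_left h3 hm0)
    have h6 : ‖z * g x‖ ≤ C * (m * (m * b / δ)) + b := by
      have : z * g x = (∫ y, k x y * g y ∂μ) - ((∫ y, k x y * g y ∂μ) - z * g x) := by ring
      rw [this]
      exact (norm_sub_le _ _).trans (add_le_add h5 (hresb x))
    rw [norm_mul] at h6
    have h7 : ‖g x‖ ≤ ‖z‖⁻¹ * (C * (m * (m * b / δ)) + b) := by
      rw [inv_mul_eq_div, le_div_iff₀ ha, mul_comm]; exact h6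
    refine h7.trans ?_
    have e : C * (m * (m * b / δ)) + b = (C * μ.real Set.univ / δ + 1) * b := by
      rw [← hmm]; ring
    rw [e]
    have : 0 ≤ μ.real Set.univ := measureReal_nonneg
    gcongr
  set Q := (C * μ.real Set.univ / δ + 1) / ρ₀ ^ 2 with hQ
  have hu : ‖u‖ ≤ Q * (ε * ‖u‖ + C₃ * n) + ρ₀⁻¹ * n := by
    refine (pi_norm_le_iff_of_nonneg ?_).mpr fun i => ?_
    · have : 0 ≤ μ.real Set.univ := measureReal_nonneg
      positivity
    · have e : u i = g (ξ i) - z⁻¹ * ω₀ i := by rw [hgi]; ring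
      rw [e]
      refine (norm_sub_le _ _).trans (add_le_add ((h4 _).trans (le_of_eq ?_)) ?_)
      · rw [hb, hQ]; field_simp
      · rw [norm_mul, norm_inv]
        have := norm_le_pi_norm ω₀ i
        gcongr
  -- By `hsmall` the coefficient Qε of ‖u‖ on the right is at most 1/2 and is absorbed; this is the
  -- factor 2 in the conclusion.
  nlinarith [norm_nonneg u, norm_nonneg ω₀, mul_le_mul_of_nonneg_right hsmall (norm_nonneg u)]

end nystrom

/-! ### The fibre space and the kernels on it -/

/-- The measure on the fibre `{-, +} × (0, 1]`. -/
def fiberMeasure : Measure (Bool × ℝ) := Measure.count.prod (volume.restrict (Set.Ioc 0 1))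

instance : IsFiniteMeasure fiberMeasure := by
  unfold fiberMeasure; infer_instance

theorem fiberMeasure_univ : fiberMeasure.real Set.univ = 2 := by
  rw [fiberMeasure, Measure.real, ← Set.univ_prod_univ, Measure.prod_prod, Measure.count_univ]
  simp

theorem integral_fiber {g : Bool × ℝ → ℂ} (hg : Integrable g fiberMeasure) :
    ∫ p, g p ∂fiberMeasure = ∑ ρ, ∫ x in (0 : ℝ)..1, g (ρ, x) := by
  rw [fiberMeasure, integral_prod _ hg, integral_fintype (.of_finite)]
  simp [intervalIntegral.integral_of_le, Measure.real]

theorem integral_fiber_fst (g : Bool → ℝ) : ∫ p, g p.1 ∂fiberMeasure = ∑ ρ, g ρ := by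
  have hg : Integrable (fun p : Bool × ℝ => g p.1) fiberMeasure :=
    Integrable.of_bound ((measurable_of_finite g).comp measurable_fst).aestronglyMeasurable
      (∑ ρ, |g ρ|) (ae_of_all _ fun p =>
        Finset.single_le_sum (f := fun ρ => |g ρ|) (fun _ _ => abs_nonneg _) (Finset.mem_univ p.1))
  rw [fiberMeasure, integral_prod _ hg, integral_fintype (.of_finite)]
  simp [Measure.real]

/-- The nearest point of `[0, 1]`. -/
def clamp (x : ℝ) : ℝ := max 0 (min 1 x)

theorem clamp_mem (x : ℝ) : clamp x ∈ Set.Icc (0 : ℝ) 1 :=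
  ⟨le_max_left _ _, max_le zero_le_one (min_le_left _ _)⟩

theorem clamp_of_mem {x : ℝ} (hx : x ∈ Set.Icc (0 : ℝ) 1) : clamp x = x := by
  rw [clamp, min_eq_right hx.2, max_eq_right hx.1]

theorem measurable_clamp : Measurable clamp :=
  measurable_const.max (measurable_const.min measurable_id)

theorem ae_fiber_mem : ∀ᵐ p ∂fiberMeasure, p.2 ∈ Set.Ioc (0 : ℝ) 1 := by
  have h : ∀ᵐ x ∂(volume.restrict (Set.Ioc (0 : ℝ) 1)), x ∈ Set.Ioc (0 : ℝ) 1 :=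
    ae_restrict_mem measurableSet_Ioc
  exact Measure.quasiMeasurePreserving_snd.ae h

theorem node_mem (N : ℕ) (q : Fin N) : node N q ∈ Set.Icc (0 : ℝ) 1 := by
  have h1 : (q : ℝ) + 1 ≤ N := by exact_mod_cast q.2
  have h2 : (0 : ℝ) < N := by have := Nat.cast_nonneg (α := ℝ) (q : ℕ); linarith
  rw [node]
  constructor
  · positivity
  · rw [div_le_one h2]; linarith

/-- The quadrature nodes on the two copies of the interval. -/
def nodeF (N : ℕ) : Fin N ⊕ Fin N → Bool × ℝ :=
  Sum.elim (fun q => (false, node N q)) (fun q => (true, node N q))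

theorem nodeF_mem (N : ℕ) (i : Fin N ⊕ Fin N) : (nodeF N i).2 ∈ Set.Icc (0 : ℝ) 1 := by
  cases i <;> exact node_mem N _

/-- The kernel on the fibre. -/
def kerF (α : ℝ) (φ : Bool → ℝ → ℝ) (t : ℝ) (p q : Bool × ℝ) : ℂ :=
  kerR α φ t p.1 q.1 (clamp p.2) (clamp q.2)

theorem sum_nodeF (N : ℕ) (hN : 1 ≤ N) {a : Bool × ℝ → ℝ} {b : Bool → ℝ}
    (h : ∀ i, a (nodeF N i) ≤ b (nodeF N i).1) : ∑ i, 1 / (N : ℝ) * a (nodeF N i) ≤ ∑ τ, b τ := by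
  have hN0 : (0 : ℝ) < N := by exact_mod_cast hN
  refine (Finset.sum_le_sum fun i _ => mul_le_mul_of_nonneg_left (h i) (by positivity)).trans ?_
  rw [Fintype.sum_sum_type, Fintype.sum_bool]
  simp only [nodeF, Sum.elim_inl, Sum.elim_inr, Finset.sum_const, Finset.card_univ, Fintype.card_fin,
    nsmul_eq_mul]
  refine le_of_eq ?_
  field_simp
  ring

theorem measurable_termR {α : ℝ} {φ : Bool → ℝ → ℝ} (hφ : ∀ σ, Measurable (φ σ)) (σ τ : Bool) (j : ℤ) :
    Measurable (Function.uncurry (termR α φ σ τ j)) := by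
  have h1 : ∀ σ, Measurable (deriv (φ σ)) := fun σ => measurable_deriv _
  have h2 : ∀ σ, Measurable (deriv (deriv (φ σ))) := fun σ => measurable_deriv _
  have hpow : ∀ g : ℝ × ℝ → ℝ, Measurable g → Measurable fun p => α ^ g p := fun g hg =>
    measurable_const.pow hg
  have hx : Measurable fun p : ℝ × ℝ => α ^ (p.1 + j) := hpow _ (measurable_fst.add_const _)
  have hx0 : Measurable fun p : ℝ × ℝ => α ^ p.1 := hpow _ measurable_fst
  have hy : Measurable fun p : ℝ × ℝ => α ^ p.2 := hpow _ measurable_snd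
  have hset : MeasurableSet {p : ℝ × ℝ | p.1 + j = p.2} :=
    measurableSet_eq_fun (measurable_fst.add_const _) measurable_snd
  have hw : ∀ σ τ, Measurable fun p : ℝ × ℝ => kernelWeight α (φ σ) (φ τ) j p.1 p.2 := fun σ τ =>
    (((((((h1 σ).comp hx0).pow_const 2).const_add 1).div
      ((((h1 τ).comp hy).pow_const 2).const_add 1)).pow_const _).mul
      (hpow _ (((measurable_fst.add measurable_snd).add_const _).div_const _))).mul_const _
  by_cases h : σ = τ
  · have hp : Measurable fun p : ℝ × ℝ => pSame α (φ σ) j p.1 p.2 :=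
      Measurable.ite hset (((h2 σ).comp hy).div_const _)
        (((((hy.sub hx).mul ((h1 σ).comp hy)).add ((hφ σ).comp hx)).sub ((hφ σ).comp hy)).div
          ((hx.sub hy).pow_const 2))
    have hq : Measurable fun p : ℝ × ℝ => qSame α (φ σ) j p.1 p.2 :=
      Measurable.ite hset ((h1 σ).comp hy)
        ((((hφ σ).comp hx).sub ((hφ σ).comp hy)).div (hx.sub hy))
    have : Function.uncurry (termR α φ σ τ j) = fun p : ℝ × ℝ =>
        pSame α (φ σ) j p.1 p.2 / (1 + qSame α (φ σ) j p.1 p.2 ^ 2) *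
          kernelWeight α (φ σ) (φ σ) j p.1 p.2 := by
      funext p; simp [Function.uncurry, termR, h, termSame]
    rw [this]
    exact (hp.div ((hq.pow_const 2).const_add 1)).mul (hw σ σ)
  · have hp : Measurable fun p : ℝ × ℝ => pCross α (φ σ) (φ τ) j p.1 p.2 :=
      (((((hy.add hx).mul ((h1 τ).comp hy)).add ((hφ σ).comp hx)).sub ((hφ τ).comp hy)).div
        ((hx.add hy).pow_const 2))
    have hq : Measurable fun p : ℝ × ℝ => qCross α (φ σ) (φ τ) j p.1 p.2 :=
      ((((hφ σ).comp hx).sub ((hφ τ).comp hy)).div (hx.add hy))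
    have : Function.uncurry (termR α φ σ τ j) = fun p : ℝ × ℝ =>
        pCross α (φ σ) (φ τ) j p.1 p.2 / (1 + qCross α (φ σ) (φ τ) j p.1 p.2 ^ 2) *
          kernelWeight α (φ σ) (φ τ) j p.1 p.2 := by
      funext p; simp [Function.uncurry, termR, h, termCross]
    rw [this]
    exact (hp.div ((hq.pow_const 2).const_add 1)).mul (hw σ τ)

theorem measurable_fiber_kernel {a : Bool → Bool → ℝ → ℝ → ℂ}
    (ha : ∀ σ τ, Measurable (Function.uncurry (a σ τ))) :
    Measurable fun p : (Bool × ℝ) × (Bool × ℝ) => a p.1.1 p.2.1 p.1.2 p.2.2 := by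
  have : (fun p : (Bool × ℝ) × (Bool × ℝ) => a p.1.1 p.2.1 p.1.2 p.2.2) =
      fun p => ∑ σ, ∑ τ, Set.indicator {p : (Bool × ℝ) × (Bool × ℝ) | p.1.1 = σ ∧ p.2.1 = τ}
        (fun p => Function.uncurry (a σ τ) (p.1.2, p.2.2)) p := by
    funext ⟨⟨σ, x⟩, ⟨τ, y⟩⟩
    cases σ <;> cases τ <;> simp [Set.indicator]
  rw [this]
  refine Finset.measurable_sum _ fun σ _ => Finset.measurable_sum _ fun τ _ => ?_
  refine Measurable.indicator ((ha σ τ).comp ((measurable_snd.comp measurable_fst).prodMk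
    (measurable_snd.comp measurable_snd))) ?_
  exact ((measurable_fst.comp measurable_fst) (measurableSet_singleton σ)).inter
    ((measurable_fst.comp measurable_snd) (measurableSet_singleton τ))

theorem measurable_tsum_of_summable {X : Type*} [MeasurableSpace X] {a : ℤ → X → ℂ}
    (ha : ∀ j, Measurable (a j)) (hs : ∀ x, Summable fun j => a j x) :
    Measurable fun x => ∑' j, a j x :=
  measurable_of_tendsto_metrizable' (f := fun (s : Finset ℤ) x => ∑ j ∈ s, a j x) atTop
    (fun s => Finset.measurable_sum s fun j _ => ha j)
    (tendsto_pi_nhds.mpr fun x => (hs x).hasSum)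

/-- The pair of branches of `f`. -/
def branchFn (f : ℝ → ℝ) (σ : Bool) : ℝ → ℝ := bif σ then fPlus f else fMinus f

theorem nystromMatrix_apply (α : ℝ) (f : ℝ → ℝ) (t : ℝ) (M N : ℕ) (i j : Fin N ⊕ Fin N) :
    nystromMatrix α f t M N i j = 1 / (N : ℂ) * (1 / (2 * (Real.pi : ℂ)) *
      ∑ l ∈ Finset.Icc (-(M : ℤ)) M, Complex.exp (Complex.I * l * t) *
        (termR α (branchFn f) (nodeF N i).1 (nodeF N j).1 l (nodeF N i).2 (nodeF N j).2 : ℝ)) := by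
  cases i <;> cases j <;> rfl

theorem derivMatrix_apply (α : ℝ) (f : ℝ → ℝ) (M N : ℕ) (i j : Fin N ⊕ Fin N) :
    derivMatrix α f M N i j = 1 / (2 * Real.pi * N) *
      ∑ l ∈ Finset.Icc (-(M : ℤ)) M, |(l : ℝ)| *
        |termR α (branchFn f) (nodeF N i).1 (nodeF N j).1 l (nodeF N i).2 (nodeF N j).2| := by
  cases i <;> cases j <;> rfl

/-- The Nyström matrix of the kernel without truncation. -/
def nystromFull (α : ℝ) (φ : Bool → ℝ → ℝ) (t : ℝ) (N : ℕ) :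
    Matrix (Fin N ⊕ Fin N) (Fin N ⊕ Fin N) ℂ :=
  Matrix.of fun i j => ((1 / (N : ℝ) : ℝ) : ℂ) * kerF α φ t (nodeF N i) (nodeF N j)

/-! ### Bounds on the fibre: kernel, row sums and quadrature error -/

section

variable {α c : ℝ} {φ : Bool → ℝ → ℝ} {G : Bool → ℂ → ℂ} (P : BranchPair α c φ G)
include P

namespace BranchPair

theorem bndS_nonneg (σ τ : Bool) : 0 ≤ (2 * Real.pi)⁻¹ * bndS α G σ τ :=
  (norm_nonneg _).trans (P.norm_kerR_le σ τ 0 (x := 0) (y := 0) (by simp) (by simp))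

/-- Clamping positions to [0, 1] makes this hold at every point of the fibre space, as the Nyström
lemmas demand, while nothing changes almost everywhere or at the nodes. -/
theorem norm_kerF_le' (t : ℝ) (p q : Bool × ℝ) :
    ‖kerF α φ t p q‖ ≤ (2 * Real.pi)⁻¹ * bndS α G p.1 q.1 :=
  P.norm_kerR_le _ _ t (clamp_mem _) (clamp_mem _)

theorem norm_kerF_le (t : ℝ) (p q : Bool × ℝ) :
    ‖kerF α φ t p q‖ ≤ constC3 α (G true) (G false) := by
  refine (P.norm_kerF_le' t p q).trans (le_trans ?_ (P.sum_bndS_le p.1))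
  rw [Finset.mul_sum]
  exact Finset.single_le_sum (f := fun τ => (2 * Real.pi)⁻¹ * bndS α G p.1 τ)
    (fun τ _ => P.bndS_nonneg p.1 τ) (Finset.mem_univ q.1)

theorem measurable_kerF (hφ : ∀ σ, Measurable (φ σ)) (t : ℝ) :
    Measurable (Function.uncurry (kerF α φ t)) := by
  have h1 : ∀ σ τ, Measurable (Function.uncurry fun x y => kerR α φ t σ τ (clamp x) (clamp y)) := by
    intro σ τ
    refine Measurable.const_mul (measurable_tsum_of_summable (a := fun (j : ℤ) (p : ℝ × ℝ) =>
      Complex.exp (Complex.I * j * t) * (termR α φ σ τ j (clamp p.1) (clamp p.2) : ℝ))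
      (fun j => ?_) fun p => ?_) _
    · exact (Complex.measurable_ofReal.comp ((measurable_termR hφ σ τ j).comp
        ((measurable_clamp.comp measurable_fst).prodMk
          (measurable_clamp.comp measurable_snd)))).const_mul _
    · refine Summable.of_norm ((P.summable_termR σ τ (clamp_mem p.1) (clamp_mem p.2)).congr
        fun j => ?_)
      rw [norm_mul, norm_expI_mul, one_mul, Complex.norm_real, Real.norm_eq_abs]
  exact measurable_fiber_kernel (a := fun σ τ x y => kerR α φ t σ τ (clamp x) (clamp y)) h1

theorem sum_kerF_le (t : ℝ) (N : ℕ) (hN : 1 ≤ N) (p : Bool × ℝ) :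
    ∑ i, 1 / (N : ℝ) * ‖kerF α φ t p (nodeF N i)‖ ≤ constC3 α (G true) (G false) := by
  refine le_trans ?_ (P.sum_bndS_le p.1)
  rw [Finset.mul_sum]
  exact sum_nodeF N hN (a := fun q => ‖kerF α φ t p q‖)
    (b := fun τ => (2 * Real.pi)⁻¹ * bndS α G p.1 τ) fun i => P.norm_kerF_le' t p _

theorem norm_quadError_le' (hφ : ∀ σ, Measurable (φ σ)) (t : ℝ) (N : ℕ) (hN : 1 ≤ N)
    (p q : Bool × ℝ) :
    ‖quadError fiberMeasure (nodeF N) (1 / N) (kerF α φ t) p q‖ ≤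
      2 * bndProd α c G p.1 q.1 / (Real.exp (2 * Real.pi * N * c) - 1) := by
  have h := P.quadrature_error p.1 q.1 t (clamp_mem p.2) (clamp_mem q.2) N hN
  have hk := P.measurable_kerF hφ t
  have hint : Integrable (fun z => kerF α φ t p z * kerF α φ t z q) fiberMeasure :=
    integrable_kernel_mul hk (P.norm_kerF_le t) p (Integrable.of_bound
      (hk.comp (measurable_id.prodMk measurable_const)).aestronglyMeasurable _
      (ae_of_all _ fun z => P.norm_kerF_le t z q))
  have e1 : ∫ z, kerF α φ t p z * kerF α φ t z q ∂fiberMeasure =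
      ∑ ρ, ∫ z in (0 : ℝ)..1, kerR α φ t p.1 ρ (clamp p.2) z * kerR α φ t ρ q.1 z (clamp q.2) := by
    rw [integral_fiber hint]
    refine Finset.sum_congr rfl fun ρ _ => intervalIntegral.integral_congr fun z hz => ?_
    rw [Set.uIcc_of_le zero_le_one] at hz
    simp only [kerF, clamp_of_mem hz]
  have e2 : ∑ i, ((1 / (N : ℝ) : ℝ) : ℂ) * (kerF α φ t p (nodeF N i) * kerF α φ t (nodeF N i) q) =
      ∑ ρ, 1 / (N : ℂ) * ∑ l : Fin N, kerR α φ t p.1 ρ (clamp p.2) (node N l) *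
        kerR α φ t ρ q.1 (node N l) (clamp q.2) := by
    rw [Fintype.sum_sum_type, Fintype.sum_bool, Finset.mul_sum, Finset.mul_sum, add_comm]
    simp [nodeF, kerF, clamp_of_mem (node_mem N _)]
  rw [quadError, e1, e2]
  exact h

theorem exp_sub_one_pos (N : ℕ) (hN : 1 ≤ N) : 0 < Real.exp (2 * Real.pi * N * c) - 1 := by
  have h1 : (0 : ℝ) < N := by exact_mod_cast hN
  have := P.c_pos
  have := Real.pi_pos
  rw [sub_pos, Real.one_lt_exp_iff]
  positivity

theorem bndProd_nonneg (σ τ : Bool) : 0 ≤ bndProd α c G σ τ :=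
  Finset.sum_nonneg fun ρ _ => mul_nonneg (P.bndR_nonneg σ ρ) (P.bndL_nonneg ρ τ)

theorem sum_error_le (N : ℕ) (hN : 1 ≤ N) (σ : Bool) :
    ∑ τ, 2 * bndProd α c G σ τ / (Real.exp (2 * Real.pi * N * c) - 1) ≤
      lhsL α c (G true) (G false) N := by
  rw [← Finset.sum_div, lhsL]
  exact div_le_div_of_nonneg_right (P.sum_bndProd_le σ) (P.exp_sub_one_pos N hN).le

theorem norm_quadError_le (hφ : ∀ σ, Measurable (φ σ)) (t : ℝ) (N : ℕ) (hN : 1 ≤ N)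
    (p q : Bool × ℝ) :
    ‖quadError fiberMeasure (nodeF N) (1 / N) (kerF α φ t) p q‖ ≤
      lhsL α c (G true) (G false) N := by
  have h0 := P.exp_sub_one_pos N hN
  refine (P.norm_quadError_le' hφ t N hN p q).trans (le_trans ?_ (P.sum_error_le N hN p.1))
  exact Finset.single_le_sum
    (f := fun τ => 2 * bndProd α c G p.1 τ / (Real.exp (2 * Real.pi * N * c) - 1))
    (fun τ _ => by have := P.bndProd_nonneg p.1 τ; positivity) (Finset.mem_univ q.1)

theorem integral_quadError_le (hφ : ∀ σ, Measurable (φ σ)) (t : ℝ) (N : ℕ) (hN : 1 ≤ N)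
    (p : Bool × ℝ) :
    ∫ q, ‖quadError fiberMeasure (nodeF N) (1 / N) (kerF α φ t) p q‖ ∂fiberMeasure ≤
      lhsL α c (G true) (G false) N := by
  refine le_trans ?_ (P.sum_error_le N hN p.1)
  rw [← integral_fiber_fst]
  have hm := measurable_quadError (μ := fiberMeasure) (P.measurable_kerF hφ t) (nodeF N) (1 / N) p
  refine integral_mono_ae ?_ ?_ (ae_of_all _ fun q => P.norm_quadError_le' hφ t N hN p q)
  · exact (Integrable.of_bound hm.aestronglyMeasurable _
      (ae_of_all _ (P.norm_quadError_le hφ t N hN p))).norm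
  · exact Integrable.of_bound ((measurable_of_finite fun τ =>
      2 * bndProd α c G p.1 τ / (Real.exp (2 * Real.pi * N * c) - 1)).comp
        measurable_fst).aestronglyMeasurable (lhsL α c (G true) (G false) N) (ae_of_all _ fun q => by
      have h0 := P.exp_sub_one_pos N hN
      have hb := P.bndProd_nonneg p.1
      rw [Real.norm_eq_abs, abs_of_nonneg (div_nonneg (mul_nonneg zero_le_two (hb q.1)) h0.le)]
      refine le_trans ?_ (P.sum_error_le N hN p.1)
      exact Finset.single_le_sum
        (f := fun τ => 2 * bndProd α c G p.1 τ / (Real.exp (2 * Real.pi * N * c) - 1))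
        (fun τ _ => by have := hb τ; positivity) (Finset.mem_univ q.1))

theorem sum_quadError_le (hφ : ∀ σ, Measurable (φ σ)) (t : ℝ) (N : ℕ) (hN : 1 ≤ N)
    (p : Bool × ℝ) :
    ∑ i, 1 / (N : ℝ) * ‖quadError fiberMeasure (nodeF N) (1 / N) (kerF α φ t) p (nodeF N i)‖ ≤
      lhsL α c (G true) (G false) N :=
  le_trans (sum_nodeF N hN
    (a := fun q => ‖quadError fiberMeasure (nodeF N) (1 / N) (kerF α φ t) p q‖)
    (b := fun τ => 2 * bndProd α c G p.1 τ / (Real.exp (2 * Real.pi * N * c) - 1))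
    fun _ => P.norm_quadError_le' hφ t N hN p _) (P.sum_error_le N hN p.1)

end BranchPair

end

/-! ### Sufficiency of the criterion: truncation, sampling in t, and the resolvent bound -/

section

variable {α c : ℝ} {f : ℝ → ℝ} {G : Bool → ℂ → ℂ} (P : BranchPair α c (branchFn f) G)

theorem norm_expI_sub_le (j : ℤ) (t s : ℝ) :
    ‖Complex.exp (Complex.I * j * t) - Complex.exp (Complex.I * j * s)‖ ≤ |(j : ℝ)| * |t - s| := by
  have e : Complex.exp (Complex.I * j * t) - Complex.exp (Complex.I * j * s) =
      Complex.exp (Complex.I * j * s) * (Complex.exp (Complex.I * ((j * (t - s) : ℝ) : ℂ)) - 1) := by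
    rw [mul_sub, ← Complex.exp_add, mul_one]
    congr 2
    push_cast; ring
  rw [e, norm_mul, norm_expI_mul, one_mul, ← abs_mul, ← Real.norm_eq_abs]
  exact Real.norm_exp_I_mul_ofReal_sub_one_le

/-- |e^{ijt} − e^{ijs}| ≤ |j||t − s|, so B majorises the t-derivative of the matrix entry by entry.
-/
theorem norm_nystrom_sub_le (α : ℝ) (f : ℝ → ℝ) (t s : ℝ) (M N : ℕ) (v : Fin N ⊕ Fin N → ℂ) :
    ‖(nystromMatrix α f t M N).mulVec v - (nystromMatrix α f s M N).mulVec v‖ ≤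
      |t - s| * matInfNorm (derivMatrix α f M N) * ‖v‖ := by
  rw [← Matrix.sub_mulVec]
  refine norm_mulVec_le_of_row _ (mul_nonneg (abs_nonneg _) (matInfNorm_nonneg _)) (fun i => ?_) v
  refine le_trans ?_ (mul_le_mul_of_nonneg_left (sum_norm_row_le (derivMatrix α f M N) i)
    (abs_nonneg _))
  rw [Finset.mul_sum]
  refine Finset.sum_le_sum fun j _ => ?_
  have h0 : 0 ≤ derivMatrix α f M N i j := by
    rw [derivMatrix_apply]
    have := Real.pi_pos
    positivity
  rw [Real.norm_eq_abs, abs_of_nonneg h0, Matrix.sub_apply, nystromMatrix_apply,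
    nystromMatrix_apply, derivMatrix_apply, ← mul_sub, ← mul_sub, ← Finset.sum_sub_distrib, norm_mul,
    norm_mul]
  have e1 : ‖(1 / (N : ℂ))‖ = 1 / (N : ℝ) := by simp
  have e2 : ‖(1 / (2 * (Real.pi : ℂ)) : ℂ)‖ = 1 / (2 * Real.pi) := by
    simp [abs_of_pos Real.pi_pos]
  rw [e1, e2]
  have h1 : ∀ l : ℤ, ‖Complex.exp (Complex.I * l * t) *
        (termR α (branchFn f) (nodeF N i).1 (nodeF N j).1 l (nodeF N i).2 (nodeF N j).2 : ℂ) -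
      Complex.exp (Complex.I * l * s) *
        (termR α (branchFn f) (nodeF N i).1 (nodeF N j).1 l (nodeF N i).2 (nodeF N j).2 : ℂ)‖ ≤
      |t - s| * (|(l : ℝ)| *
        |termR α (branchFn f) (nodeF N i).1 (nodeF N j).1 l (nodeF N i).2 (nodeF N j).2|) := by
    intro l
    rw [← sub_mul, norm_mul, Complex.norm_real, Real.norm_eq_abs]
    refine (mul_le_mul_of_nonneg_right (norm_expI_sub_le l t s) (abs_nonneg _)).trans (le_of_eq ?_)
    ring
  have h2 := (norm_sum_le (Finset.Icc (-(M : ℤ)) M) _).trans (Finset.sum_le_sum fun l _ => h1 l)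
  rw [← Finset.mul_sum] at h2
  have hπ := Real.pi_pos
  refine (mul_le_mul_of_nonneg_left (mul_le_mul_of_nonneg_left h2 (by positivity))
    (by positivity)).trans (le_of_eq ?_)
  field_simp

include P

namespace BranchPair

theorem constC1_nonneg (M : ℕ) (hM : 2 ≤ M) : 0 ≤ constC1 α M (G true) (G false) :=
  ((mul_nonneg (by have := Real.pi_pos; positivity) (Finset.sum_nonneg fun τ _ => by
    obtain ⟨u, hu, -, -, -, hT, -⟩ := P.exists_majorant_real true τ
    refine le_trans (tsum_nonneg fun j => ?_) (hT M hM)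
    split_ifs
    exacts [le_rfl, hu _])).trans (P.sum_bndT_le true M))

theorem constC3_nonneg : 0 ≤ constC3 α (G true) (G false) :=
  (norm_nonneg _).trans (P.norm_kerF_le 0 (true, 0) (true, 0))

theorem norm_full_sub_le (t : ℝ) (M N : ℕ) (hM : 2 ≤ M) (hN : 1 ≤ N) (v : Fin N ⊕ Fin N → ℂ) :
    ‖(nystromFull α (branchFn f) t N).mulVec v - (nystromMatrix α f t M N).mulVec v‖ ≤
      constC1 α M (G true) (G false) * ‖v‖ := by
  rw [← Matrix.sub_mulVec]
  refine norm_mulVec_le_of_row _ (P.constC1_nonneg M hM) (fun i => ?_) v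
  refine le_trans ?_ (P.sum_bndT_le (nodeF N i).1 M)
  rw [Finset.mul_sum]
  refine le_trans (le_of_eq (Finset.sum_congr rfl fun j _ => ?_)) (sum_nodeF N hN
    (a := fun q => ‖kerF α (branchFn f) t (nodeF N i) q - 1 / (2 * (Real.pi : ℂ)) *
      ∑ l ∈ Finset.Icc (-(M : ℤ)) M, Complex.exp (Complex.I * l * t) *
        (termR α (branchFn f) (nodeF N i).1 q.1 l (nodeF N i).2 q.2 : ℝ)‖)
    (b := fun τ => (2 * Real.pi)⁻¹ * bndT α G M (nodeF N i).1 τ) fun j => ?_)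
  · rw [Matrix.sub_apply, nystromMatrix_apply, nystromFull, Matrix.of_apply]
    have e : ((1 / (N : ℝ) : ℝ) : ℂ) = 1 / (N : ℂ) := by push_cast; rfl
    rw [e, ← mul_sub, norm_mul]
    congr 1
    simp
  · rw [kerF, clamp_of_mem (nodeF_mem N i), clamp_of_mem (nodeF_mem N j)]
    exact P.norm_kerR_sub_le _ _ t (nodeF_mem N i) (nodeF_mem N j) M hM

-- The terms of the kernel are real, so changing the sign of t is complex conjugation. This reduces
-- t ∈ [−π, π] to the sampled half [0, π].
omit P in
theorem kerF_neg (φ : Bool → ℝ → ℝ) (t : ℝ) (p q : Bool × ℝ) :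
    kerF α φ (-t) p q = (starRingEnd ℂ) (kerF α φ t p q) := by
  rw [kerF, kerF, kerR, kerR, map_mul, Complex.conj_tsum]
  congr 1
  · simp [map_ofNat (starRingEnd ℂ) 2]
  · refine tsum_congr fun j => ?_
    rw [map_mul, ← Complex.exp_conj, Complex.conj_ofReal]
    congr 2
    simp

omit P in
theorem norm_full_neg (φ : Bool → ℝ → ℝ) (t : ℝ) (N : ℕ) (z : ℂ) (v : Fin N ⊕ Fin N → ℂ) :
    ‖(nystromFull α φ (-t) N).mulVec v - z • v‖ =
      ‖(nystromFull α φ t N).mulVec (star v) - (starRingEnd ℂ) z • star v‖ := by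
  rw [← norm_star]
  congr 1
  funext i
  simp [nystromFull, Matrix.mulVec, dotProduct, kerF_neg]

/-- The lower bound for the resolvents of the Nyström matrices of the full kernel. -/
theorem full_bounded_below {ρ₀ : ℝ} (hρ : 0 < ρ₀) {m M N : ℕ} (hm : 1 ≤ m) (hM : 2 ≤ M) (hN : 1 ≤ N)
    (hs : ∀ k : Fin m, spectralRadius ℂ (nystromMatrix α f (sampleT m k) M N) < ENNReal.ofReal ρ₀)
    (hΔ : 0 < resolventGap α f (G true) (G false) ρ₀ m M N) :
    ∀ t ∈ Set.Icc (-Real.pi) Real.pi, ∀ z : ℂ, ρ₀ ≤ ‖z‖ → ∀ v : Fin N ⊕ Fin N → ℂ,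
      resolventGap α f (G true) (G false) ρ₀ m M N * ‖v‖ ≤
        ‖(nystromFull α (branchFn f) t N).mulVec v - z • v‖ := by
  have hne : Nonempty (Fin N ⊕ Fin N) := ⟨Sum.inl ⟨0, hN⟩⟩
  have hm0 : (0 : ℝ) < m := by exact_mod_cast hm
  have hπ := Real.pi_pos
  have hpos : ∀ t ∈ Set.Icc 0 Real.pi, ∀ z : ℂ, ρ₀ ≤ ‖z‖ → ∀ v : Fin N ⊕ Fin N → ℂ,
      resolventGap α f (G true) (G false) ρ₀ m M N * ‖v‖ ≤
        ‖(nystromFull α (branchFn f) t N).mulVec v - z • v‖ := by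
    intro t ht z hz v
    -- The t_k are midpoints of m equal subintervals of [0, π], so some t_k is within π/(2m) of t.
    obtain ⟨k, hk⟩ : ∃ k : Fin m, |t - sampleT m k| ≤ Real.pi / (2 * m) := by
      set a := t * m / Real.pi with ha
      have ha0 : 0 ≤ a := by have := ht.1; positivity
      have ham : a ≤ m := by rw [ha, div_le_iff₀ hπ]; nlinarith [ht.2]
      have hta : t = a * Real.pi / m := by rw [ha]; field_simp
      obtain ⟨n, hn, h1, h2⟩ : ∃ n : ℕ, n < m ∧ (n : ℝ) ≤ a ∧ a ≤ n + 1 := by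
        rcases lt_or_ge ⌊a⌋₊ m with h | h
        · exact ⟨⌊a⌋₊, h, Nat.floor_le ha0, (Nat.lt_floor_add_one a).le⟩
        -- Only t = π arises here; it belongs to the last subinterval, of index m − 1.
        · have h3 : (m : ℝ) ≤ a := (Nat.cast_le.mpr h).trans (Nat.floor_le ha0)
          refine ⟨m - 1, by omega, ?_, ?_⟩ <;> rw [Nat.cast_sub hm] <;> push_cast <;> linarith
      refine ⟨⟨n, hn⟩, ?_⟩
      have e : t - sampleT m ⟨n, hn⟩ = (a - (n + 1 / 2)) * (Real.pi / m) := by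
        rw [sampleT, hta]; ring
      have h3 : |a - (n + 1 / 2)| ≤ 1 / 2 := abs_le.mpr ⟨by linarith, by linarith⟩
      rw [e, abs_mul, abs_of_pos (by positivity : 0 < Real.pi / m)]
      calc _ ≤ 1 / 2 * (Real.pi / m) := by gcongr
        _ = _ := by ring
    set A := nystromMatrix α f (sampleT m k) M N with hA
    set Bn := matInfNorm (derivMatrix α f M N) with hB
    have hB0 : 0 ≤ Bn := matInfNorm_nonneg _
    have hC1 := P.constC1_nonneg M hM
    set Rm := resolventMin α f ρ₀ m M N with hRm
    have hgap : resolventGap α f (G true) (G false) ρ₀ m M N =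
        Rm - constC1 α M (G true) (G false) - Real.pi / (2 * m) * Bn := rfl
    have hR : 0 < Rm := by
      have : 0 ≤ Real.pi / (2 * m) * Bn := by positivity
      rw [hgap] at hΔ
      linarith
    -- The covering gives the bound `Rm` on the circle, and the maximum principle carries it to all
    -- |z| ≥ ρ₀. Truncation and the displacement of t are then subtracted.
    have h1 := bounded_below_of_circle A hρ (hs k) hR (fun z hz v =>
      bounded_below_of_covering A hρ (hs k) (fun l hl => resolventMin_le α f ρ₀ m M N k l hl) z hz v)
      z hz v
    have h2 := P.norm_full_sub_le t M N hM hN v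
    have h3 := norm_nystrom_sub_le α f t (sampleT m k) M N v
    have h4 : |t - sampleT m k| * Bn * ‖v‖ ≤ Real.pi / (2 * m) * Bn * ‖v‖ := by gcongr
    have h5 : ‖A.mulVec v - z • v‖ ≤ ‖(nystromFull α (branchFn f) t N).mulVec v - z • v‖ +
        ‖(nystromFull α (branchFn f) t N).mulVec v - (nystromMatrix α f t M N).mulVec v‖ +
        ‖(nystromMatrix α f t M N).mulVec v - A.mulVec v‖ := by
      have e : A.mulVec v - z • v = ((nystromFull α (branchFn f) t N).mulVec v - z • v) -
        ((nystromFull α (branchFn f) t N).mulVec v - (nystromMatrix α f t M N).mulVec v) -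
        ((nystromMatrix α f t M N).mulVec v - A.mulVec v) := by abel
      rw [e]
      exact (norm_sub_le _ _).trans (add_le_add_left (norm_sub_le _ _) _)
    rw [hgap, sub_mul, sub_mul]
    linarith
  intro t ht z hz v
  rcases le_total 0 t with h0 | h0
  · exact hpos t ⟨h0, ht.2⟩ z hz v
  · have h1 := hpos (-t) ⟨by linarith, by linarith [ht.1]⟩ ((starRingEnd ℂ) z)
      (by rwa [RCLike.norm_conj]) (star v)
    have h2 := norm_full_neg (α := α) (branchFn f) (-t) N z v
    rw [neg_neg] at h2
    rw [h2]
    rwa [norm_star] at h1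

theorem lhsL_nonneg (N : ℕ) (hN : 1 ≤ N) (hφ : ∀ σ, Measurable (branchFn f σ)) :
    0 ≤ lhsL α c (G true) (G false) N :=
  (norm_nonneg _).trans (P.norm_quadError_le hφ 0 N hN (true, 0) (true, 0))

/-- The criterion bounds the resolvents of the fibre operators. -/
theorem fiber_bounded_below (hφ : ∀ σ, Measurable (branchFn f σ)) {ρ₀ : ℝ} (hρ : 0 < ρ₀)
    {m M N : ℕ} (hm : 1 ≤ m) (hM : 2 ≤ M) (hN : 1 ≤ N)
    (hs : ∀ k : Fin m, spectralRadius ℂ (nystromMatrix α f (sampleT m k) M N) < ENNReal.ofReal ρ₀)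
    (hΔ : 0 < resolventGap α f (G true) (G false) ρ₀ m M N)
    (hcrit : lhsL α c (G true) (G false) N < rhsR α f (G true) (G false) ρ₀ m M N) :
    ∃ δ > 0, ∀ t ∈ Set.Icc (-Real.pi) Real.pi, ∀ z : ℂ, ρ₀ ≤ ‖z‖ → ∀ φ ω : Lp ℂ 2 fiberMeasure,
      (∀ᵐ x ∂fiberMeasure, ω x = (∫ y, kerF α (branchFn f) t x y * φ y ∂fiberMeasure) - z * φ x) →
      δ * ‖φ‖ ≤ ‖ω‖ := by
  set Δ := resolventGap α f (G true) (G false) ρ₀ m M N with hΔd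
  set C := constC3 α (G true) (G false) with hC
  set ε := lhsL α c (G true) (G false) N with hεd
  have hC0 : 0 ≤ C := P.constC3_nonneg
  have hε0 : 0 ≤ ε := P.lhsL_nonneg N hN hφ
  have hne : Nonempty (Fin N ⊕ Fin N) := ⟨Sum.inl ⟨0, hN⟩⟩
  -- The inequality ℒ < ℛ after clearing the denominator.
  have hθ : (1 + C / Δ) * ε < ρ₀ ^ 2 := by
    rw [rhsR, ← hΔd, ← hC, ← div_eq_mul_inv, ← div_eq_mul_inv, lt_div_iff₀ (by positivity)] at hcrit
    linarith
  have key := fun (t : ℝ) (ht : t ∈ Set.Icc (-Real.pi) Real.pi) (z : ℂ) (hz : ρ₀ ≤ ‖z‖)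
      (φ ω : Lp ℂ 2 fiberMeasure) => norm_le_of_nystrom (μ := fiberMeasure) (ξ := nodeF N)
    (w := 1 / (N : ℝ)) (φ := φ) (ω := ω)
    (P.measurable_kerF hφ t) (P.norm_kerF_le t) (by positivity) (P.norm_quadError_le hφ t N hN)
    (P.sum_kerF_le t N hN) (P.integral_quadError_le hφ t N hN) hρ hΔ hz
    (P.full_bounded_below hρ hm hM hN hs hΔ t ht z hz) hθ
  set K := ρ₀⁻¹ * (√(fiberMeasure.real Set.univ) * ((1 + C / Δ) * (C / ρ₀ + ε / ρ₀ ^ 2) *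
      √(fiberMeasure.real Set.univ) / (1 - (1 + C / Δ) * ε / ρ₀ ^ 2)) + 1) with hK
  have hpos : 0 < 1 - (1 + C / Δ) * ε / ρ₀ ^ 2 := by
    rw [sub_pos, div_lt_one (by positivity)]; exact hθ
  have hK0 : 0 < K := by positivity
  refine ⟨K⁻¹, by positivity, fun t ht z hz φ ω h => ?_⟩
  rw [inv_mul_le_iff₀ hK0]
  exact key t ht z hz φ ω h

end BranchPair

end

/-! ### Necessity of the criterion for large m, M and N -/

section

variable {α c : ℝ} {f : ℝ → ℝ} {G : Bool → ℂ → ℂ} (P : BranchPair α c (branchFn f) G)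
include P

namespace BranchPair

theorem tendsto_constC1 : Tendsto (fun M => constC1 α M (G true) (G false)) atTop (𝓝 0) := by
  have hB := tendsto_calB P.pos P.lt_one
  have hC := tendsto_calC P.pos P.lt_one
  have key : ∀ g h : ℂ → ℂ, Tendsto (fun M => constC1Entry α M g h) atTop (𝓝 0) := by
    intro g h
    have := ((hB.const_mul (2 * |Real.log α| * quantF α 0 g)).add
      (hC.const_mul (|Real.log α| * quantF α 0 h + quantK α 0 g h))).const_mul
      ((1 + quantF α 0 g ^ 2) ^ (1 / 4 : ℝ))
    simpa [constC1Entry] using this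
  have := ((key (G true) (G false)).max (key (G false) (G true))).const_mul (1 / Real.pi)
  simpa [constC1] using this

theorem tendsto_lhsL : Tendsto (fun N => lhsL α c (G true) (G false) N) atTop (𝓝 0) := by
  have hc := P.c_pos
  have hπ := Real.pi_pos
  have h1 : Tendsto (fun N : ℕ => 2 * Real.pi * N * c) atTop atTop := by
    have : (fun N : ℕ => 2 * Real.pi * N * c) = fun N : ℕ => (2 * Real.pi * c) * (N : ℝ) := by
      funext N; ring
    rw [this]
    exact tendsto_natCast_atTop_atTop.const_mul_atTop (by positivity)
  have h2 : Tendsto (fun N : ℕ => Real.exp (2 * Real.pi * N * c) - 1) atTop atTop :=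
    tendsto_atTop_add_const_right _ (-1) (Real.tendsto_exp_atTop.comp h1)
  exact h2.const_div_atTop _

/-- The terms decay like α^{|j|/2}, so Σ |j| α^{|j|/2} bounds all the matrices B at once. Hence the
cost of sampling in t tends to zero as m → ∞, uniformly in M and N. -/
theorem exists_matInfNorm_deriv_le :
    ∃ K, 0 ≤ K ∧ ∀ M N : ℕ, 1 ≤ N → matInfNorm (derivMatrix α f M N) ≤ K := by
  have hα0 := P.pos
  have hα1 := P.lt_one
  have hπ := Real.pi_pos
  set q := √α with hq
  have hq0 : 0 ≤ q := Real.sqrt_nonneg _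
  have hq1 : q < 1 := by rw [hq, Real.sqrt_lt' one_pos]; simpa using hα1
  have hs : Summable fun j : ℤ => |(j : ℝ)| * q ^ j.natAbs := by
    have h1 : Summable fun n : ℕ => ((n : ℝ) ^ 1 * q ^ n : ℝ) :=
      summable_pow_mul_geometric_of_norm_lt_one 1 (by rwa [Real.norm_of_nonneg hq0])
    have h2 := hasSum_natAbs (F := fun n : ℕ => ((n : ℝ) ^ 1 * q ^ n : ℝ))
      ((summable_nat_add_iff 1).mpr h1).hasSum
    refine h2.summable.congr fun j => ?_
    rw [pow_one, Nat.cast_natAbs, Int.cast_abs]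
  set S := ∑' j : ℤ, |(j : ℝ)| * q ^ j.natAbs with hS
  have hS0 : 0 ≤ S := tsum_nonneg fun j => by positivity
  have hu : ∀ σ τ, ∃ C, 0 ≤ C ∧ ∀ (j : ℤ) (x y : ℝ), x ∈ Set.Icc (0 : ℝ) 1 → y ∈ Set.Icc (0 : ℝ) 1 →
      |termR α (branchFn f) σ τ j x y| ≤ C * q ^ j.natAbs := by
    intro σ τ
    obtain ⟨u, -, ⟨C, hC, hCu⟩, -, -, -, hb⟩ := P.exists_majorant_real σ τ
    exact ⟨C, hC, fun j x y hx hy => (hb j x y hx hy).trans (hCu _)⟩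
  choose C hC hCu using hu
  have hnn : ∀ σ τ, 0 ≤ 1 / (2 * Real.pi) * (C σ τ * S) := fun σ τ => by
    have := hC σ τ; positivity
  refine ⟨∑ σ, ∑ τ, 1 / (2 * Real.pi) * (C σ τ * S), Finset.sum_nonneg fun σ _ =>
    Finset.sum_nonneg fun τ _ => hnn σ τ, fun M N hN => ?_⟩
  refine matInfNorm_le _ (Finset.sum_nonneg fun σ _ => Finset.sum_nonneg fun τ _ => hnn σ τ)
    fun i => ?_
  refine le_trans ?_ (Finset.single_le_sum (f := fun σ => ∑ τ, 1 / (2 * Real.pi) * (C σ τ * S))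
    (fun σ _ => Finset.sum_nonneg fun τ _ => hnn σ τ) (Finset.mem_univ (nodeF N i).1))
  refine le_trans (le_of_eq (Finset.sum_congr rfl fun j _ => ?_)) (sum_nodeF N hN
    (a := fun p => 1 / (2 * Real.pi) * ∑ l ∈ Finset.Icc (-(M : ℤ)) M, |(l : ℝ)| *
      |termR α (branchFn f) (nodeF N i).1 p.1 l (nodeF N i).2 p.2|)
    (b := fun τ => 1 / (2 * Real.pi) * (C (nodeF N i).1 τ * S)) fun j => ?_)
  · rw [derivMatrix_apply, Real.norm_eq_abs, abs_of_nonneg (by positivity)]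
    field_simp
  · refine mul_le_mul_of_nonneg_left ?_ (by positivity)
    rw [hS, ← tsum_mul_left]
    refine le_trans (Finset.sum_le_sum fun l _ => ?_) ((hs.mul_left _).sum_le_tsum _
      fun l _ => by have := hC (nodeF N i).1 (nodeF N j).1; positivity)
    refine (mul_le_mul_of_nonneg_left (hCu _ _ l _ _ (nodeF_mem N i) (nodeF_mem N j))
      (abs_nonneg _)).trans (le_of_eq ?_)
    ring

/-- Resolvent bounds for the fibre operators imply the criterion, for large `m`, `M` and `N`. -/
theorem criterion_of_fiber_bounded_below (hφ : ∀ σ, Measurable (branchFn f σ)) {ρ₀ δ : ℝ}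
    (hρ : 0 < ρ₀) (hδ : 0 < δ)
    (hK : ∀ (t : ℝ) (z : ℂ), ρ₀ ≤ ‖z‖ → ∀ φ ω : Lp ℂ 2 fiberMeasure,
      (∀ᵐ x ∂fiberMeasure, ω x = (∫ y, kerF α (branchFn f) t x y * φ y ∂fiberMeasure) - z * φ x) →
      δ * ‖φ‖ ≤ ‖ω‖) :
    ∃ m₀ M₀ N₀ : ℕ, ∀ m M N : ℕ, m₀ ≤ m → M₀ ≤ M → N₀ ≤ N →
      (∀ t ∈ Set.Icc 0 Real.pi,
        spectralRadius ℂ (nystromMatrix α f t M N) < ENNReal.ofReal ρ₀) ∧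
      0 < resolventGap α f (G true) (G false) ρ₀ m M N ∧
      lhsL α c (G true) (G false) N < rhsR α f (G true) (G false) ρ₀ m M N := by
  set C := constC3 α (G true) (G false) with hC
  have hC0 : 0 ≤ C := P.constC3_nonneg
  set Q := (C * fiberMeasure.real Set.univ / δ + 1) / ρ₀ ^ 2 with hQ
  have hQ0 : 0 ≤ Q := by
    have : 0 ≤ fiberMeasure.real Set.univ := measureReal_nonneg
    positivity
  set K := 2 * (Q * C + ρ₀⁻¹) with hKd
  have hK0 : 0 < K := by positivity
  set δ₁ := K⁻¹ with hδ₁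
  have hδ₁0 : 0 < δ₁ := by positivity
  obtain ⟨KB, hKB0, hKB⟩ := P.exists_matInfNorm_deriv_le
  have hπ := Real.pi_pos
  -- The value of ℛ when the gap is δ₁/4. Since ℛ increases with the gap, ℒ < r will suffice.
  set r := ρ₀ ^ 2 * (1 + C * (δ₁ / 4)⁻¹)⁻¹ with hr
  have hr0 : 0 < r := by positivity
  have hN1 : ∀ᶠ N : ℕ in atTop, 1 ≤ N ∧ Q * lhsL α c (G true) (G false) N ≤ 1 / 2 ∧
      lhsL α c (G true) (G false) N < r := by
    have h1 := P.tendsto_lhsL.const_mul Q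
    rw [mul_zero] at h1
    filter_upwards [eventually_ge_atTop 1, h1.eventually_le_const (by norm_num : (0 : ℝ) < 1 / 2),
      P.tendsto_lhsL.eventually_lt_const hr0] with N h1 h2 h3
    exact ⟨h1, h2, h3⟩
  have hM1 : ∀ᶠ M : ℕ in atTop, 2 ≤ M ∧ constC1 α M (G true) (G false) ≤ δ₁ / 4 := by
    filter_upwards [eventually_ge_atTop 2, P.tendsto_constC1.eventually_le_const
      (by positivity : (0 : ℝ) < δ₁ / 4)] with M h1 h2
    exact ⟨h1, h2⟩
  have hm1 : ∀ᶠ m : ℕ in atTop, 1 ≤ m ∧ Real.pi / (2 * m) * KB ≤ δ₁ / 16 := by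
    have h1 : Tendsto (fun m : ℕ => Real.pi / (2 * m) * KB) atTop (𝓝 0) := by
      have h2 : Tendsto (fun m : ℕ => (2 * m : ℝ)) atTop atTop :=
        tendsto_natCast_atTop_atTop.const_mul_atTop two_pos
      simpa using (h2.const_div_atTop Real.pi).mul_const KB
    filter_upwards [eventually_ge_atTop 1, h1.eventually_le_const
      (by positivity : (0 : ℝ) < δ₁ / 16)] with M h1 h2
    exact ⟨h1, h2⟩
  obtain ⟨N₀, hN₀⟩ := eventually_atTop.mp hN1
  obtain ⟨M₀, hM₀⟩ := eventually_atTop.mp hM1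
  obtain ⟨m₀, hm₀⟩ := eventually_atTop.mp hm1
  refine ⟨m₀, M₀, N₀, fun m M N hm hM hN => ?_⟩
  obtain ⟨hN1, hNQ, hNr⟩ := hN₀ N hN
  obtain ⟨hM2, hMC⟩ := hM₀ M hM
  obtain ⟨hm1, hmB⟩ := hm₀ m hm
  have hne : Nonempty (Fin N ⊕ Fin N) := ⟨Sum.inl ⟨0, hN1⟩⟩
  have hA : ∀ (t : ℝ) (z : ℂ), ρ₀ ≤ ‖z‖ → ∀ v : Fin N ⊕ Fin N → ℂ,
      3 / 4 * δ₁ * ‖v‖ ≤ ‖(nystromMatrix α f t M N).mulVec v - z • v‖ := by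
    intro t z hz v
    have h1 := nystrom_bounded_below (μ := fiberMeasure) (ξ := nodeF N) (w := 1 / (N : ℝ))
      (P.measurable_kerF hφ t) (P.norm_kerF_le t) (by positivity) (P.sum_kerF_le t N hN1)
      (P.sum_quadError_le hφ t N hN1) hρ hδ hz (hK t z hz) hNQ v
    have h2 : δ₁ * ‖v‖ ≤ ‖(nystromFull α (branchFn f) t N).mulVec v - z • v‖ := by
      rw [hδ₁, inv_mul_le_iff₀ hK0]; exact h1
    have h3 := P.norm_full_sub_le t M N hM2 hN1 v
    have h4 : constC1 α M (G true) (G false) * ‖v‖ ≤ δ₁ / 4 * ‖v‖ :=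
      mul_le_mul_of_nonneg_right hMC (norm_nonneg _)
    have h5 : ‖(nystromFull α (branchFn f) t N).mulVec v - z • v‖ ≤
        ‖(nystromFull α (branchFn f) t N).mulVec v - (nystromMatrix α f t M N).mulVec v‖ +
        ‖(nystromMatrix α f t M N).mulVec v - z • v‖ := by
      refine le_trans (le_of_eq ?_) (norm_add_le _ _)
      congr 1; abel
    linarith
  have hδ₂ : 0 < 3 / 4 * δ₁ := by positivity
  -- The truncated matrices satisfy the bound ¾δ₁, so the minimum of ν_ℓ/4 + ν_{ℓ+1}/2 is at least
  -- 9δ₁/16. Subtracting δ₁/4 for C₁(M) and δ₁/16 for the sampling leaves δ₁/4.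
  have hgap : δ₁ / 4 ≤ resolventGap α f (G true) (G false) ρ₀ m M N := by
    have h1 := le_resolventMin α f hρ hδ₂ m M N hm1 hN1 fun k l =>
      le_nuSeq (nystromMatrix α f (sampleT m k) M N) hρ hδ₂ (fun z hz v => hA _ z hz.ge v) l
    have h2 : Real.pi / (2 * m) * matInfNorm (derivMatrix α f M N) ≤ Real.pi / (2 * m) * KB :=
      mul_le_mul_of_nonneg_left (hKB M N hN1) (by positivity)
    rw [resolventGap]
    linarith
  have hgap0 : 0 < resolventGap α f (G true) (G false) ρ₀ m M N := by linarith
  refine ⟨fun t _ => spectralRadius_matrix_lt _ hρ hδ₂ (hA t), hgap0, hNr.trans_le ?_⟩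
  rw [rhsR, hr]
  have h4 : (resolventGap α f (G true) (G false) ρ₀ m M N)⁻¹ ≤ (δ₁ / 4)⁻¹ :=
    inv_anti₀ (by positivity) hgap
  gcongr

end BranchPair

end

/-! ### Existence of the continuations -/

/-- `F` continues `g` analytically to the disc of radius `r` about `y`. -/
def IsLocalContinuation (g : ℝ → ℝ) (y r : ℝ) (F : ℂ → ℂ) : Prop :=
  DifferentiableOn ℂ F (Metric.ball (y : ℂ) r) ∧ ∀ t : ℝ, |t - y| < r → F t = g t

/-- The real Taylor series is read with a complex variable; on half of a radius of convergence its
terms are dominated by a geometric series. -/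
theorem AnalyticAt.exists_isLocalContinuation {g : ℝ → ℝ} {x : ℝ} (hg : AnalyticAt ℝ g x) :
    ∃ r > 0, ∃ F, IsLocalContinuation g x r F := by
  obtain ⟨p, ρ, hp⟩ := hg
  obtain ⟨R, hR0, hRρ⟩ := ENNReal.lt_iff_exists_nnreal_btwn.mp hp.r_pos
  have hR0' : (0 : ℝ) < R := by exact_mod_cast hR0
  obtain ⟨C, hC0, hC⟩ := p.norm_mul_pow_le_of_lt_radius (hRρ.trans_le hp.r_le)
  have hcoef : ∀ n, |p.coeff n| * (R : ℝ) ^ n ≤ C := fun n => by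
    have := hC n
    rwa [FormalMultilinearSeries.norm_apply_eq_norm_coef] at this
  have hterm : ∀ (n : ℕ) (w : ℂ), ‖w‖ < R / 2 → ‖(p.coeff n : ℂ) * w ^ n‖ ≤ C * (1 / 2) ^ n := by
    intro n w hw
    rw [norm_mul, norm_pow, Complex.norm_real, Real.norm_eq_abs]
    calc |p.coeff n| * ‖w‖ ^ n ≤ |p.coeff n| * (R / 2) ^ n := by gcongr
      _ = |p.coeff n| * (R : ℝ) ^ n * (1 / 2) ^ n := by rw [div_pow, div_pow, one_pow]; ring
      _ ≤ _ := by gcongr; exact hcoef n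
  have hsum : Summable fun n : ℕ => C * (1 / 2 : ℝ) ^ n :=
    (summable_geometric_of_lt_one (by norm_num) (by norm_num)).mul_left C
  refine ⟨R / 2, by positivity, fun z => ∑' n, (p.coeff n : ℂ) * (z - x) ^ n, ?_, fun t ht => ?_⟩
  · refine Complex.differentiableOn_tsum_of_summable_norm hsum (fun n => ?_) Metric.isOpen_ball
      fun n w hw => hterm n _ (by simpa [dist_eq_norm] using hw)
    exact (((differentiable_id.sub_const (x : ℂ)).pow n).const_mul _).differentiableOn
  · have h1 : HasSum (fun n => p n fun _ => t - x) (g (x + (t - x))) := by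
      refine hp.hasSum ?_
      rw [Metric.mem_eball, edist_zero_right]
      refine lt_trans ?_ hRρ
      rw [enorm_eq_nnnorm]
      refine ENNReal.coe_lt_coe.mpr (NNReal.coe_lt_coe.mp ?_)
      rw [coe_nnnorm, Real.norm_eq_abs]
      linarith
    simp only [FormalMultilinearSeries.apply_eq_pow_smul_coeff, add_sub_cancel, smul_eq_mul] at h1
    have h2 := (Complex.hasSum_ofReal.mpr h1).tsum_eq
    rw [← h2]
    refine tsum_congr fun n => ?_
    push_cast; ring

theorem IsLocalContinuation.mono {g : ℝ → ℝ} {y y' r r' : ℝ} {F : ℂ → ℂ}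
    (h : IsLocalContinuation g y r F) (hr : |y' - y| + r' ≤ r) : IsLocalContinuation g y' r' F := by
  refine ⟨h.1.mono (Metric.ball_subset_ball' ?_), fun t ht => h.2 t ?_⟩
  · rw [dist_eq_norm, ← Complex.ofReal_sub, Complex.norm_real, Real.norm_eq_abs]; linarith
  · have := abs_sub_le t y' y
    linarith

/-- Two discs of the same radius centred on the real axis that both contain z also contain Re z.
Their convex intersection therefore meets the real axis, and the identity theorem applies. -/
theorem IsLocalContinuation.eqOn {g : ℝ → ℝ} {y y' r : ℝ} {F F' : ℂ → ℂ}
    (h : IsLocalContinuation g y r F) (h' : IsLocalContinuation g y' r F') {z : ℂ}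
    (hz : z ∈ Metric.ball (y : ℂ) r) (hz' : z ∈ Metric.ball (y' : ℂ) r) : F z = F' z := by
  set U := Metric.ball (y : ℂ) r ∩ Metric.ball (y' : ℂ) r with hU
  have hUo : IsOpen U := Metric.isOpen_ball.inter Metric.isOpen_ball
  have hUc : Convex ℝ U := (convex_ball _ _).inter (convex_ball _ _)
  have hF := (h.1.mono Set.inter_subset_left).analyticOnNhd hUo
  have hF' := (h'.1.mono Set.inter_subset_right).analyticOnNhd hUo
  have hmem : ∀ a : ℝ, z ∈ Metric.ball (a : ℂ) r → |z.re - a| < r := fun a ha => by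
    rw [Metric.mem_ball, dist_eq_norm] at ha
    have := (Complex.abs_re_le_norm (z - a)).trans_lt ha
    simpa using this
  have hball : ∀ a t : ℝ, |t - a| < r → (t : ℂ) ∈ Metric.ball (a : ℂ) r := fun a t ht => by
    rw [Metric.mem_ball, dist_eq_norm, ← Complex.ofReal_sub, Complex.norm_real, Real.norm_eq_abs]
    exact ht
  refine hF.eqOn_of_preconnected_of_frequently_eq hF' hUc.isPreconnected (z₀ := (z.re : ℂ))
    ⟨hball _ _ (hmem y hz), hball _ _ (hmem y' hz')⟩ ?_ ⟨hz, hz'⟩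
  have h2 : Tendsto (fun x : ℝ => (x : ℂ)) (𝓝[≠] z.re) (𝓝[≠] (z.re : ℂ)) := by
    refine tendsto_nhdsWithin_iff.mpr ⟨?_, ?_⟩
    · exact Complex.continuous_ofReal.continuousAt.tendsto.mono_left nhdsWithin_le_nhds
    · filter_upwards [self_mem_nhdsWithin] with x hx
      simpa using hx
  refine h2.frequently (Eventually.frequently ?_)
  have h3 : ∀ᶠ t in 𝓝 z.re, |t - y| < r ∧ |t - y'| < r :=
    ((continuous_id.sub continuous_const).abs.continuousAt.eventually_lt continuousAt_const
      (hmem y hz)).and ((continuous_id.sub continuous_const).abs.continuousAt.eventually_lt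
      continuousAt_const (hmem y' hz'))
  filter_upwards [h3.filter_mono nhdsWithin_le_nhds] with t ht
  rw [h.2 t ht.1, h'.2 t ht.2]

/-- Compactness of a period gives a common radius, and periodicity carries it to the whole line. -/
theorem exists_uniform_localContinuation {g : ℝ → ℝ} (hg : ∀ x, AnalyticAt ℝ g x)
    (hper : ∀ x, g (x + 1) = g x) : ∃ r > 0, ∀ y, ∃ F, IsLocalContinuation g y r F := by
  have h1 : ∃ r > 0, ∀ y ∈ Set.Icc (0 : ℝ) 1, ∃ F, IsLocalContinuation g y r F := by
    refine isCompact_Icc.induction_on (p := fun s => ∃ r > 0, ∀ y ∈ s, ∃ F, IsLocalContinuation g y r F)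
      ⟨1, one_pos, fun y hy => absurd hy (Set.notMem_empty y)⟩
      (fun s t hst ⟨r, hr, h⟩ => ⟨r, hr, fun y hy => h y (hst hy)⟩)
      (fun s t ⟨r, hr, h⟩ ⟨r', hr', h'⟩ => ⟨min r r', lt_min hr hr', fun y hy => ?_⟩)
      fun x _ => ?_
    · rcases hy with hy | hy
      · exact (h y hy).imp fun F hF => hF.mono (by simp)
      · exact (h' y hy).imp fun F hF => hF.mono (by simp)
    · obtain ⟨r, hr, F, hF⟩ := AnalyticAt.exists_isLocalContinuation (hg x)
      refine ⟨Metric.ball x (r / 2), mem_nhdsWithin_of_mem_nhds (Metric.ball_mem_nhds x (by positivity)),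
        r / 2, by positivity, fun y hy => ⟨F, hF.mono ?_⟩⟩
      rw [Metric.mem_ball, Real.dist_eq] at hy
      linarith
  obtain ⟨r, hr, h⟩ := h1
  refine ⟨r, hr, fun y => ?_⟩
  have hper' : Function.Periodic g 1 := hper
  obtain ⟨F, hF⟩ := h (Int.fract y) ⟨Int.fract_nonneg y, (Int.fract_lt_one y).le⟩
  have e : y = Int.fract y + ⌊y⌋ := (Int.fract_add_floor y).symm
  refine ⟨fun z => F (z - (⌊y⌋ : ℤ)), ?_, fun t ht => ?_⟩
  · refine hF.1.comp (by fun_prop) fun z hz => ?_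
    rw [Metric.mem_ball, dist_eq_norm] at hz ⊢
    have e2 : z - (⌊y⌋ : ℤ) - (Int.fract y : ℝ) = z - y := by
      rw [Int.fract]; push_cast; ring
    rwa [e2]
  · have h2 := hF.2 (t - ⌊y⌋) (by
      have : t - ⌊y⌋ - Int.fract y = t - y := by rw [Int.fract]; ring
      rwa [this])
    push_cast at h2
    refine h2.trans ?_
    have := hper'.sub_int_mul_eq (x := t) ⌊y⌋
    rw [mul_one] at this
    rw [this]

/-- Up to integer translation the strip of half the width lies in a compact rectangle inside the
full strip. -/
theorem exists_bound_of_periodic {r : ℝ} (hr : 0 < r) {h : ℂ → ℂ} (hh : ContinuousOn h (strip r))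
    (hper : ∀ z ∈ strip r, h (z + 1) = h z) : ∃ C, ∀ z ∈ strip (r / 2), ‖h z‖ ≤ C := by
  set K : Set ℂ := Set.Icc (0 : ℝ) 1 ×ℂ Set.Icc (-(r / 2)) (r / 2) with hK
  have hKc : IsCompact K := isCompact_Icc.reProdIm isCompact_Icc
  have hKs : K ⊆ strip r := fun z hz => by
    rw [strip_eq hr]
    have := abs_le.mpr hz.2
    exact this.trans_lt (by linarith)
  obtain ⟨C, hC⟩ := hKc.exists_bound_of_continuousOn (hh.mono hKs)
  refine ⟨C, fun z hz => ?_⟩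
  have hz' : z ∈ strip r := strip_mono (by linarith) hz
  have hn : ∀ n : ℕ, ∀ z ∈ strip r, h (z + n) = h z := by
    intro n
    induction n with
    | zero => simp
    | succ n ih =>
      intro z hz
      have h1 : z + n ∈ strip r := by simpa using add_intCast_mem_strip hz n
      rw [Nat.cast_add, Nat.cast_one, ← add_assoc, hper _ h1, ih z hz]
  have hint : ∀ n : ℤ, ∀ z ∈ strip r, h (z + n) = h z := by
    intro n z hz
    obtain ⟨m, rfl | rfl⟩ := n.eq_nat_or_neg
    · simpa using hn m z hz
    · have h1 := hn m (z + ((-(m : ℤ) : ℤ) : ℂ)) (add_intCast_mem_strip hz _)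
      rw [← h1]; congr 1; push_cast; ring
  rw [← hint (-⌊z.re⌋) z hz']
  refine hC _ ⟨?_, ?_⟩
  · have h2 := Int.floor_le z.re
    have h3 := Int.lt_floor_add_one z.re
    simp only [Set.mem_preimage, Int.cast_neg, Complex.add_re, Complex.neg_re, Complex.intCast_re]
    constructor <;> linarith
  · rw [strip_eq (by positivity)] at hz
    have := abs_lt.mp (show |z.im| < r / 2 from hz)
    simp only [Set.mem_preimage, Int.cast_neg, Complex.add_im, Complex.neg_im, Complex.intCast_im]
    constructor <;> linarith [this.1, this.2]

theorem exists_isStripContinuation {g : ℝ → ℝ} (hg : ∀ x, AnalyticAt ℝ g x)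
    (hper : ∀ x, g (x + 1) = g x) : ∃ r > 0, ∃ G, IsStripContinuation r g G := by
  obtain ⟨r, hr, h⟩ := exists_uniform_localContinuation hg hper
  choose F hF using h
  -- Gluing: at z the local continuation centred at Re z is used. Near any point it agrees with a
  -- single local continuation by `IsLocalContinuation.eqOn`.
  set G : ℂ → ℂ := fun z => F z.re z with hG
  have hball : ∀ z ∈ strip r, z ∈ Metric.ball (z.re : ℂ) r := fun z hz => by
    rw [Metric.mem_ball, dist_eq_norm]
    have e : z - (z.re : ℂ) = (z.im : ℂ) * Complex.I := by
      nth_rw 1 [← Complex.re_add_im z]; ring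
    rw [e, norm_mul, Complex.norm_I, mul_one, Complex.norm_real]
    rw [strip_eq hr] at hz
    exact hz
  have hGd : DifferentiableOn ℂ G (strip r) := by
    intro z hz
    have hev : ∀ᶠ w in 𝓝 z, G w = F z.re w := by
      filter_upwards [(isOpen_strip hr).mem_nhds hz, Metric.isOpen_ball.mem_nhds (hball z hz)]
        with w hw hw'
      exact (hF w.re).eqOn (hF z.re) (hball w hw) hw'
    exact (((hF z.re).1.differentiableAt (Metric.isOpen_ball.mem_nhds (hball z hz))).congr_of_eventuallyEq
      hev).differentiableWithinAt
  have hGan := hGd.analyticOnNhd (isOpen_strip hr)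
  have hGper : ∀ z ∈ strip r, G (z + 1) = G z := by
    intro z hz
    have h1 : IsLocalContinuation g z.re r (fun w => F (z + 1).re (w + 1)) := by
      have h2 := hF (z + 1).re
      have e : (((z + 1).re : ℝ) : ℂ) = z.re + 1 := by simp
      refine ⟨h2.1.comp (by fun_prop) fun w hw => ?_, fun t ht => ?_⟩
      · rw [Metric.mem_ball, dist_eq_norm] at hw ⊢
        rwa [e, add_sub_add_right_eq_sub]
      · have := h2.2 (t + 1) (by simpa using ht)
        push_cast at this
        exact this.trans (by rw [hper])
    exact h1.eqOn (hF z.re) (hball z hz) (hball z hz)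
  have hG'per : ∀ z ∈ strip r, deriv G (z + 1) = deriv G z := by
    intro z hz
    rw [← deriv_comp_add_const G 1 z]
    exact Filter.EventuallyEq.deriv_eq
      (eventually_of_mem ((isOpen_strip hr).mem_nhds hz) fun w hw => hGper w hw)
  have hG''per : ∀ z ∈ strip r, deriv (deriv G) (z + 1) = deriv (deriv G) z := by
    intro z hz
    rw [← deriv_comp_add_const (deriv G) 1 z]
    exact Filter.EventuallyEq.deriv_eq
      (eventually_of_mem ((isOpen_strip hr).mem_nhds hz) fun w hw => hG'per w hw)
  refine ⟨r / 2, by positivity, G, hGd.mono (strip_mono (by linarith)), fun x => ?_,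
    exists_bound_of_periodic hr hGd.continuousOn hGper,
    exists_bound_of_periodic hr hGan.deriv.continuousOn hG'per,
    exists_bound_of_periodic hr hGan.deriv.deriv.continuousOn hG''per⟩
  have := (hF x).2 x (by simpa using hr)
  simpa [hG] using this

theorem IsStripContinuation.mono {g : ℝ → ℝ} {G : ℂ → ℂ} {r c : ℝ} (h : IsStripContinuation r g G)
    (hc : c ≤ r) : IsStripContinuation c g G :=
  ⟨h.differentiableOn.mono (strip_mono hc), h.eq_on_real,
    h.bounded.imp fun _ h z hz => h z (strip_mono hc hz),
    h.bounded_deriv.imp fun _ h z hz => h z (strip_mono hc hz),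
    h.bounded_deriv_deriv.imp fun _ h z hz => h z (strip_mono hc hz)⟩

/-- Im h vanishes on the real axis, and every point of the strip is within c of its real part, so
the mean value inequality gives O(c). -/
theorem stripImNorm_le_mul {r c C : ℝ} {h : ℂ → ℂ} (hr : 0 < r) (hc : 0 < c) (hcr : c ≤ r)
    (hd : DifferentiableOn ℂ h (strip r)) (hC : ∀ z ∈ strip r, ‖deriv h z‖ ≤ C)
    (hreal : ∀ x : ℝ, (h x).im = 0) : stripImNorm c h ≤ c * C := by
  have := nonempty_strip c
  have hC0 : 0 ≤ C := (norm_nonneg _).trans (hC ((0 : ℝ) : ℂ) (ofReal_mem_strip r 0))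
  refine ciSup_le fun ⟨z, hz⟩ => ?_
  have hz' := strip_mono hcr hz
  have h1 := (convex_strip hr).norm_image_sub_le_of_norm_deriv_le
    (fun w hw => hd.differentiableAt ((isOpen_strip hr).mem_nhds hw)) hC (ofReal_mem_strip r z.re) hz'
  have e : z - (z.re : ℂ) = (z.im : ℂ) * Complex.I := by
    nth_rw 1 [← Complex.re_add_im z]; ring
  rw [e, norm_mul, Complex.norm_I, mul_one, Complex.norm_real, Real.norm_eq_abs] at h1
  have h2 := (Complex.abs_im_le_norm (h z - h z.re)).trans h1
  rw [Complex.sub_im, hreal, sub_zero] at h2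
  rw [strip_eq hc] at hz
  calc |(h z).im| ≤ C * |z.im| := h2
    _ ≤ C * c := mul_le_mul_of_nonneg_left (le_of_lt hz) hC0
    _ = c * C := mul_comm _ _

theorem exists_admissible {α : ℝ} (hα0 : 0 < α) (hα1 : α < 1) {gp gm : ℝ → ℝ}
    (hp : ∀ x, AnalyticAt ℝ gp x) (hp1 : ∀ x, gp (x + 1) = gp x)
    (hm : ∀ x, AnalyticAt ℝ gm x) (hm1 : ∀ x, gm (x + 1) = gm x) :
    ∃ c₀ : ℝ, 0 < c₀ ∧ ∀ c : ℝ, 0 < c → c ≤ c₀ → ∃ Gp Gm : ℂ → ℂ,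
      IsStripContinuation c gp Gp ∧ IsStripContinuation c gm Gm ∧ AdmissibleWidth α c Gp Gm := by
  have hl := abs_log_pos hα0 hα1
  obtain ⟨rp, hrp, Gp, hGp⟩ := exists_isStripContinuation hp hp1
  obtain ⟨rm, hrm, Gm, hGm⟩ := exists_isStripContinuation hm hm1
  have key : ∀ {g : ℝ → ℝ} {G : ℂ → ℂ} {r : ℝ}, 0 < r → IsStripContinuation r g G →
      ∃ C, 0 ≤ C ∧ ∀ c, 0 < c → c ≤ r → stripImNorm c G ≤ c * C ∧ quantI α c G ≤ c * C ∧
        stripNorm c G ≤ C ∧ stripNorm 0 G ≤ C := by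
    intro g G r hr hG
    obtain ⟨C0, hC0⟩ := hG.bounded
    obtain ⟨C1, hC1⟩ := hG.bounded_deriv
    obtain ⟨C2, hC2⟩ := hG.bounded_deriv_deriv
    have h00 : 0 ≤ C0 := (norm_nonneg _).trans (hC0 ((0 : ℝ) : ℂ) (ofReal_mem_strip r 0))
    have h10 : 0 ≤ C1 := (norm_nonneg _).trans (hC1 ((0 : ℝ) : ℂ) (ofReal_mem_strip r 0))
    have h20 : 0 ≤ C2 := (norm_nonneg _).trans (hC2 ((0 : ℝ) : ℂ) (ofReal_mem_strip r 0))
    have hdiv : 0 ≤ C2 / |Real.log α| := by positivity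
    have han := hG.differentiableOn.analyticOnNhd (isOpen_strip hr)
    refine ⟨C0 + C1 + C2 / |Real.log α|, by positivity, fun c hc hcr => ?_⟩
    have h1 := stripImNorm_le_mul hr hc hcr hG.differentiableOn hC1 (fun x => by
      rw [hG.eq_on_real]; simp)
    have h2 := stripImNorm_le_mul hr hc hcr han.deriv.differentiableOn hC2 (fun x => by
      rw [(hasDerivAt_ofReal_eq (han _ (ofReal_mem_strip r x)).differentiableAt.hasDerivAt
        (Eventually.of_forall hG.eq_on_real)).2]
      simp)
    have hne := nonempty_strip c
    have hne0 := nonempty_strip 0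
    refine ⟨h1.trans (by nlinarith), ?_, ?_, ?_⟩
    · have h3 : stripImNorm c (deriv G) / |Real.log α| ≤ c * C2 / |Real.log α| := by gcongr
      have h4 : c * C2 / |Real.log α| = c * (C2 / |Real.log α|) := by ring
      rw [quantI]
      nlinarith
    · refine ciSup_le fun z => (hC0 z (strip_mono hcr z.2)).trans (by linarith)
    · refine ciSup_le fun z => (hC0 z (strip_mono hr.le z.2)).trans (by linarith)
  obtain ⟨A, hA0, hA⟩ := key hrp hGp
  obtain ⟨B, hB0, hB⟩ := key hrm hGm
  set K := α⁻¹ * |Real.log α| * (A + B) with hK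
  have hK0 : 0 ≤ K := by positivity
  -- Every quantity to be made small is at most c times a summand of S or a sum of distinct
  -- summands, so the one inequality cS ≤ α²/2 < 1 settles all four.
  set S := A + B + α * K + 1 with hS
  have hαK : 0 ≤ α * K := by positivity
  have hS0 : 0 < S := by positivity
  have harc : 0 < Real.arccos α / |Real.log α| := div_pos (Real.arccos_pos.mpr hα1) hl
  refine ⟨min (min rp rm) (min (Real.arccos α / |Real.log α|) (α ^ 2 / (2 * S))), by positivity,
    fun c hc hc0 => ?_⟩
  have hcp : c ≤ rp := hc0.trans ((min_le_left _ _).trans (min_le_left _ _))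
  have hcm : c ≤ rm := hc0.trans ((min_le_left _ _).trans (min_le_right _ _))
  have hca : c ≤ Real.arccos α / |Real.log α| := hc0.trans ((min_le_right _ _).trans (min_le_left _ _))
  have hcS : c * S ≤ α ^ 2 / 2 := by
    have : c ≤ α ^ 2 / (2 * S) := hc0.trans ((min_le_right _ _).trans (min_le_right _ _))
    rw [le_div_iff₀ (by positivity)] at this
    linarith
  have hα2 : α ^ 2 < 1 := by nlinarith
  have hα2' : 0 < α ^ 2 := by positivity
  obtain ⟨a1, a2, a3, a4⟩ := hA c hc hcp
  obtain ⟨b1, b2, b3, b4⟩ := hB c hc hcm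
  have hcS' : c * A + c * B + c * (α * K) + c = c * S := by rw [hS]; ring
  have n1 : 0 ≤ c * A := by positivity
  have n2 : 0 ≤ c * B := by positivity
  have n3 : 0 ≤ c * (α * K) := by positivity
  have hKp : quantK α c Gp Gm ≤ K := by
    rw [quantK, hK]
    have : max (stripNorm c Gp) (stripNorm 0 Gm) ≤ A + B := max_le (by linarith) (by linarith)
    gcongr
  have hKm : quantK α c Gm Gp ≤ K := by
    rw [quantK, hK]
    have : max (stripNorm c Gm) (stripNorm 0 Gp) ≤ A + B := max_le (by linarith) (by linarith)
    gcongr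
  have hp3 : α * c * quantK α c Gp Gm ≤ c * (α * K) := by
    calc _ ≤ α * c * K := by gcongr
      _ = _ := by ring
  have hm3 : α * c * quantK α c Gm Gp ≤ c * (α * K) := by
    calc _ ≤ α * c * K := by gcongr
      _ = _ := by ring
  exact ⟨Gp, Gm, hGp.mono hcp, hGm.mono hcm, hca, by linarith, by linarith, by linarith, by linarith⟩

theorem analyticAt_logProfile {α : ℝ} (hα0 : 0 < α) {φ : ℝ → ℝ} (hφ : ∀ x, 0 < x → AnalyticAt ℝ φ x)
    (x : ℝ) : AnalyticAt ℝ (logProfile α φ) x := by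
  have e : ∀ y : ℝ, α ^ y = Real.exp (Real.log α * y) := fun y => Real.rpow_def_of_pos hα0 y
  unfold logProfile
  simp_rw [e]
  refine AnalyticAt.mul (by fun_prop) ?_
  have h : AnalyticAt ℝ (fun y => Real.exp (Real.log α * y)) x :=
    (analyticAt_const.mul analyticAt_id).rexp'
  exact AnalyticAt.fun_comp (g := φ) (hφ _ (Real.exp_pos _)) h

theorem logProfile_add_one {α : ℝ} (hα0 : 0 < α) {φ : ℝ → ℝ}
    (hdil : ∀ x, 0 < x → φ (α * x) = α * φ x) (x : ℝ) :
    logProfile α φ (x + 1) = logProfile α φ x := by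
  have hx := Real.rpow_pos_of_pos hα0 x
  have e : α ^ (x + 1) = α * α ^ x := by rw [Real.rpow_add hα0, Real.rpow_one, mul_comm]
  have hα := hα0.ne'
  rw [logProfile, logProfile, e, hdil _ hx, neg_add, Real.rpow_add hα0, Real.rpow_neg_one]
  field_simp

/-! ### Measure spaces tiled by weighted copies of a fibre -/

section WeightedComp

variable {X Y : Type*} [MeasurableSpace X] [MeasurableSpace Y] {μ : Measure X} {ν : Measure Y}

theorem enorm_Lp_sq (φ : Lp ℂ 2 μ) : ‖φ‖ₑ ^ 2 = ∫⁻ x, ‖φ x‖ₑ ^ 2 ∂μ := by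
  rw [Lp.enorm_def, eLpNorm_eq_lintegral_rpow_enorm_toReal two_ne_zero ENNReal.ofNat_ne_top,
    ← ENNReal.rpow_natCast, ← ENNReal.rpow_mul]
  norm_num

/-- The change-of-variables inequality plays two roles. With g = |φ|² it is the norm bound; with g
the indicator of a null set it shows that composition with e respects almost everywhere equality
where c ≠ 0. -/
theorem exists_weightedComp {c : X → ℂ} (hc : Measurable c) {e : X → Y} (he : Measurable e)
    (h : ∀ g : Y → ENNReal, Measurable g → ∫⁻ x, ‖c x‖ₑ ^ 2 * g (e x) ∂μ ≤ ∫⁻ y, g y ∂ν) :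
    ∃ T : Lp ℂ 2 ν →L[ℂ] Lp ℂ 2 μ, ∀ φ, T φ =ᵐ[μ] fun x => c x * φ (e x) := by
  have hφm : ∀ φ : Lp ℂ 2 ν, Measurable φ := fun φ => (Lp.stronglyMeasurable φ).measurable
  have hm : ∀ φ : Lp ℂ 2 ν, Measurable fun x => c x * φ (e x) := fun φ =>
    hc.mul ((hφm φ).comp he)
  have hle : ∀ φ : Lp ℂ 2 ν, eLpNorm (fun x => c x * φ (e x)) 2 μ ≤ ‖φ‖ₑ := by
    intro φ
    have h1 : eLpNorm (fun x => c x * φ (e x)) 2 μ ^ 2 ≤ ‖φ‖ₑ ^ 2 := by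
      rw [eLpNorm_eq_lintegral_rpow_enorm_toReal two_ne_zero ENNReal.ofNat_ne_top,
        ← ENNReal.rpow_natCast, ← ENNReal.rpow_mul, enorm_Lp_sq]
      refine le_trans (le_of_eq ?_) (h (fun y => ‖φ y‖ₑ ^ 2) ((hφm φ).enorm.pow_const 2))
      norm_num [enorm_mul, mul_pow]
    exact (ENNReal.pow_right_strictMono two_ne_zero).le_iff_le.1 h1
  have hmem : ∀ φ : Lp ℂ 2 ν, MemLp (fun x => c x * φ (e x)) 2 μ := fun φ =>
    ⟨(hm φ).aestronglyMeasurable, (hle φ).trans_lt enorm_lt_top⟩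
  have hae : ∀ p : Y → Prop, (∀ᵐ y ∂ν, p y) → ∀ᵐ x ∂μ, c x ≠ 0 → p (e x) := by
    intro p hp
    obtain ⟨N, hN, hNm, hN0⟩ := exists_measurable_superset_of_null (ae_iff.1 hp)
    have h2 := h (N.indicator 1) (measurable_one.indicator hNm)
    rw [lintegral_indicator_one hNm, hN0, nonpos_iff_eq_zero,
      lintegral_eq_zero_iff (by
        exact (hc.enorm.pow_const 2).mul ((measurable_one.indicator hNm).comp he))] at h2
    filter_upwards [h2] with x hx hcx
    by_contra hpx
    have h3 : e x ∈ N := hN hpx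
    simp [h3, hcx] at hx
  let T₀ : Lp ℂ 2 ν →ₗ[ℂ] Lp ℂ 2 μ :=
    { toFun := fun φ => (hmem φ).toLp _
      map_add' := fun φ ψ => by
        rw [← MemLp.toLp_add, MemLp.toLp_eq_toLp_iff]
        filter_upwards [hae _ (Lp.coeFn_add φ ψ)] with x hx
        by_cases hcx : c x = 0
        · simp [hcx]
        · rw [hx hcx, Pi.add_apply, Pi.add_apply, mul_add]
      map_smul' := fun a φ => by
        rw [RingHom.id_apply, ← MemLp.toLp_const_smul, MemLp.toLp_eq_toLp_iff]
        filter_upwards [hae _ (Lp.coeFn_smul a φ)] with x hx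
        by_cases hcx : c x = 0
        · simp [hcx]
        · rw [hx hcx, Pi.smul_apply, Pi.smul_apply, smul_eq_mul, smul_eq_mul, mul_left_comm] }
  refine ⟨T₀.mkContinuous 1 fun φ => ?_, fun φ => (hmem φ).coeFn_toLp⟩
  show ‖(hmem φ).toLp _‖ ≤ _
  rw [Lp.norm_toLp, one_mul, ← toReal_enorm φ]
  exact ENNReal.toReal_mono enorm_ne_top (hle φ)

end WeightedComp

/-- A measure `ν` that is the sum of the images, with squared densities, of countably many copies
of `μ`. -/
structure Tiling {X Y : Type*} [MeasurableSpace X] [MeasurableSpace Y]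
    (μ : Measure X) (ν : Measure Y) where
  e : ℤ → X → Y
  idx : Y → ℤ
  crd : Y → X
  w : Y → ℝ
  measurable_e : ∀ j, Measurable (e j)
  measurable_idx : Measurable idx
  measurable_crd : Measurable crd
  measurable_w : Measurable w
  w_pos : ∀ y, 0 < w y
  idx_e : ∀ j, ∀ᵐ x ∂μ, idx (e j x) = j
  crd_e : ∀ j, ∀ᵐ x ∂μ, crd (e j x) = x
  eq_sum : ν = Measure.sum fun j =>
    (μ.withDensity fun x => ENNReal.ofReal (w (e j x) ^ 2)).map (e j)

namespace Tiling

variable {X Y : Type*} [MeasurableSpace X] [MeasurableSpace Y] {μ : Measure X} {ν : Measure Y}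
  (t : Tiling μ ν)

theorem measurable_density (j : ℤ) : Measurable fun x => ENNReal.ofReal (t.w (t.e j x) ^ 2) :=
  ((t.measurable_w.comp (t.measurable_e j)).pow_const 2).ennreal_ofReal

theorem lintegral_density (j : ℤ) {g : X → ENNReal} (hg : Measurable g) :
    ∫⁻ x, g x ∂(μ.withDensity fun x => ENNReal.ofReal (t.w (t.e j x) ^ 2)) =
      ∫⁻ x, ENNReal.ofReal (t.w (t.e j x) ^ 2) * g x ∂μ :=
  lintegral_withDensity_eq_lintegral_mul _ (t.measurable_density j) hg

theorem lintegral_eq {g : Y → ENNReal} (hg : Measurable g) :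
    ∫⁻ y, g y ∂ν = ∑' j, ∫⁻ x, ENNReal.ofReal (t.w (t.e j x) ^ 2) * g (t.e j x) ∂μ := by
  conv_lhs => rw [t.eq_sum]
  rw [lintegral_sum_measure]
  refine tsum_congr fun j => ?_
  rw [lintegral_map hg (t.measurable_e j), t.lintegral_density j
    (g := fun x => g (t.e j x)) (hg.comp (t.measurable_e j))]

theorem ae_e {p : Y → Prop} (hp : ∀ᵐ y ∂ν, p y) (j : ℤ) : ∀ᵐ x ∂μ, p (t.e j x) := by
  rw [t.eq_sum] at hp
  have h1 := ae_of_ae_map (t.measurable_e j).aemeasurable (Measure.ae_sum_iff.1 hp j)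
  rw [ae_withDensity_iff (t.measurable_density j)] at h1
  filter_upwards [h1] with x hx
  exact hx (by have := t.w_pos (t.e j x); positivity)

theorem ae_of_ae_e {p : Y → Prop} (hpm : MeasurableSet {y | p y})
    (hp : ∀ j, ∀ᵐ x ∂μ, p (t.e j x)) : ∀ᵐ y ∂ν, p y := by
  rw [t.eq_sum, Measure.ae_sum_iff]
  intro j
  rw [ae_map_iff (t.measurable_e j).aemeasurable hpm]
  exact withDensity_absolutelyContinuous _ _ (hp j)

theorem enorm_w_sq (y : Y) : ‖((t.w y : ℝ) : ℂ)‖ₑ ^ 2 = ENNReal.ofReal (t.w y ^ 2) := by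
  rw [← ofReal_norm, Complex.norm_real, Real.norm_eq_abs, abs_of_pos (t.w_pos y),
    ENNReal.ofReal_pow (t.w_pos y).le]

theorem exists_restriction (j : ℤ) : ∃ T : Lp ℂ 2 ν →L[ℂ] Lp ℂ 2 μ,
    ∀ φ, T φ =ᵐ[μ] fun x => (t.w (t.e j x) : ℂ) * φ (t.e j x) := by
  refine exists_weightedComp (c := fun x => (t.w (t.e j x) : ℂ))
    (Complex.measurable_ofReal.comp (t.measurable_w.comp (t.measurable_e j)))
    (t.measurable_e j) fun g hg => ?_
  rw [t.lintegral_eq hg]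
  simp_rw [t.enorm_w_sq]
  exact ENNReal.le_tsum (f := fun j => ∫⁻ x, ENNReal.ofReal (t.w (t.e j x) ^ 2) * g (t.e j x) ∂μ) j

theorem measurable_extensionWeight (j : ℤ) :
    Measurable fun y => if t.idx y = j then ((t.w y : ℝ) : ℂ)⁻¹ else 0 :=
  Measurable.ite (t.measurable_idx (measurableSet_singleton j))
    (Complex.measurable_ofReal.comp t.measurable_w).inv measurable_const

theorem exists_extension (j : ℤ) : ∃ T : Lp ℂ 2 μ →L[ℂ] Lp ℂ 2 ν,
    ∀ u, T u =ᵐ[ν] fun y => (if t.idx y = j then ((t.w y : ℝ) : ℂ)⁻¹ else 0) * u (t.crd y) := by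
  refine exists_weightedComp (t.measurable_extensionWeight j) t.measurable_crd fun g hg => ?_
  have hm : Measurable fun y => ‖if t.idx y = j then ((t.w y : ℝ) : ℂ)⁻¹ else 0‖ₑ ^ 2 * g (t.crd y) :=
    ((t.measurable_extensionWeight j).enorm.pow_const 2).mul (hg.comp t.measurable_crd)
  rw [t.lintegral_eq hm, tsum_eq_single j]
  · refine lintegral_mono_ae ?_
    filter_upwards [t.idx_e j, t.crd_e j] with x h1 h2
    rw [if_pos h1, h2, ← t.enorm_w_sq, ← mul_assoc, ← mul_pow, ← enorm_mul, mul_inv_cancel₀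
      (by exact_mod_cast (t.w_pos _).ne')]
    simp
  · intro k hk
    rw [lintegral_congr_ae (g := fun _ => 0), lintegral_zero]
    filter_upwards [t.idx_e k] with x h1
    rw [if_neg (by rw [h1]; exact hk)]
    simp

/-- The weighted restriction to the `j`-th tile. -/
def restriction (j : ℤ) : Lp ℂ 2 ν →L[ℂ] Lp ℂ 2 μ := (t.exists_restriction j).choose

theorem restriction_ae (j : ℤ) (φ : Lp ℂ 2 ν) :
    t.restriction j φ =ᵐ[μ] fun x => (t.w (t.e j x) : ℂ) * φ (t.e j x) :=
  (t.exists_restriction j).choose_spec φ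

/-- The weighted extension by zero from the `j`-th tile. -/
def extension (j : ℤ) : Lp ℂ 2 μ →L[ℂ] Lp ℂ 2 ν := (t.exists_extension j).choose

theorem extension_ae (j : ℤ) (u : Lp ℂ 2 μ) : t.extension j u =ᵐ[ν]
    fun y => (if t.idx y = j then ((t.w y : ℝ) : ℂ)⁻¹ else 0) * u (t.crd y) :=
  (t.exists_extension j).choose_spec u

theorem extension_e_self (j : ℤ) (u : Lp ℂ 2 μ) :
    ∀ᵐ x ∂μ, t.extension j u (t.e j x) = ((t.w (t.e j x) : ℝ) : ℂ)⁻¹ * u x := by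
  filter_upwards [t.ae_e (t.extension_ae j u) j, t.idx_e j, t.crd_e j] with x h1 h2 h3
  rw [h1, if_pos h2, h3]

theorem extension_e_of_ne {j k : ℤ} (hk : k ≠ j) (u : Lp ℂ 2 μ) :
    ∀ᵐ x ∂μ, t.extension j u (t.e k x) = 0 := by
  filter_upwards [t.ae_e (t.extension_ae j u) k, t.idx_e k] with x h1 h2
  rw [h1, if_neg (by rw [h2]; exact hk), zero_mul]

/-- The orthogonal decomposition of `L²(ν)` into the spaces of functions on the tiles. -/
def decomposition : BlockDecomposition (Lp ℂ 2 ν) (Lp ℂ 2 μ) where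
  π := t.restriction
  ι := t.extension
  π_ι_self j u := by
    refine Lp.ext ?_
    filter_upwards [t.restriction_ae j (t.extension j u), t.extension_e_self j u] with x h1 h2
    rw [h1, h2, mul_inv_cancel_left₀ (by exact_mod_cast (t.w_pos _).ne')]
  π_ι_of_ne j k hk u := by
    refine Lp.ext ?_
    filter_upwards [t.restriction_ae k (t.extension j u), t.extension_e_of_ne hk u,
      Lp.coeFn_zero ℂ 2 μ] with x h1 h2 h3
    rw [h1, h2, h3, mul_zero, Pi.zero_apply]
  hasSum_norm_sq φ := by
    have h1 : ∑' j, ‖t.restriction j φ‖ₑ ^ 2 = ‖φ‖ₑ ^ 2 := by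
      rw [enorm_Lp_sq, t.lintegral_eq ((Lp.stronglyMeasurable φ).measurable.enorm.pow_const 2)]
      refine tsum_congr fun j => ?_
      rw [enorm_Lp_sq]
      refine lintegral_congr_ae ?_
      filter_upwards [t.restriction_ae j φ] with x hx
      rw [hx, enorm_mul, mul_pow, t.enorm_w_sq]
    have h2 := ENNReal.hasSum_toReal (f := fun j => ‖t.restriction j φ‖ₑ ^ 2)
      (by rw [h1]; exact ENNReal.pow_ne_top enorm_ne_top)
    rw [← ENNReal.tsum_toReal_eq (fun j => ENNReal.pow_ne_top enorm_ne_top), h1] at h2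
    simpa using h2

theorem integral_eq_of_idx {F : Y → ℂ} (hF : Measurable F) (j : ℤ)
    (h : ∀ k, k ≠ j → ∀ᵐ x ∂μ, F (t.e k x) = 0) :
    ∫ y, F y ∂ν = ∫ x, ((t.w (t.e j x) ^ 2 : ℝ) : ℂ) * F (t.e j x) ∂μ := by
  have hs : MeasurableSet {y | t.idx y = j} := t.measurable_idx (measurableSet_singleton j)
  have e1 : ν.restrict {y | t.idx y = j} =
      (μ.withDensity fun x => ENNReal.ofReal (t.w (t.e j x) ^ 2)).map (t.e j) := by
    refine Measure.ext_of_lintegral _ fun g hg => ?_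
    rw [← lintegral_indicator hs, t.lintegral_eq (hg.indicator hs), tsum_eq_single j,
      lintegral_map hg (t.measurable_e j), t.lintegral_density j
      (g := fun x => g (t.e j x)) (hg.comp (t.measurable_e j))]
    · refine lintegral_congr_ae ?_
      filter_upwards [t.idx_e j] with x hx
      rw [Set.indicator_of_mem (show t.e j x ∈ {y | t.idx y = j} from hx)]
    · intro k hk
      rw [lintegral_congr_ae (g := fun _ => 0), lintegral_zero]
      filter_upwards [t.idx_e k] with x hx
      rw [Set.indicator_of_notMem (by rw [Set.mem_ofPred_eq, hx]; exact hk), mul_zero]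
  have e2 : ∫ y, F y ∂ν = ∫ y in {y | t.idx y = j}, F y ∂ν := by
    rw [← integral_indicator hs]
    refine integral_congr_ae ?_
    have hm : MeasurableSet {y | F y = {y | t.idx y = j}.indicator F y} :=
      measurableSet_eq_fun hF (hF.indicator hs)
    refine t.ae_of_ae_e hm fun k => ?_
    by_cases hk : k = j
    · subst hk
      filter_upwards [t.idx_e k] with x hx
      rw [Set.indicator_of_mem (show t.e k x ∈ {y | t.idx y = k} from hx)]
    · filter_upwards [t.idx_e k, h k hk] with x hx h0
      rw [Set.indicator_of_notMem (by rw [Set.mem_ofPred_eq, hx]; exact hk), h0]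
  rw [e2, e1, integral_map (t.measurable_e j).aemeasurable hF.aestronglyMeasurable,
    integral_withDensity_eq_integral_toReal_smul (t.measurable_density j)
      (ae_of_all _ fun _ => ENNReal.ofReal_lt_top)]
  refine integral_congr_ae (ae_of_all _ fun x => ?_)
  simp only []
  rw [ENNReal.toReal_ofReal (sq_nonneg _), Complex.real_smul]

end Tiling

namespace Tiling

/-! ### Integral operators that are invariant under the shift of the tiles -/

variable {X Y : Type*} [MeasurableSpace X] [MeasurableSpace Y] {μ : Measure X} {ν : Measure Y}
  (t : Tiling μ ν)

/-- With Schur weight 1/w the condition in tile coordinates involves only w_j w_l |k|, which is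
bounded by v j l. Coinciding points of one tile are excluded from the hypothesis; they are
negligible since μ has no atoms. -/
theorem schur_bound [SFinite ν] [NullSingletonClass μ] {k : Y → Y → ℂ} (hk : Measurable (Function.uncurry k))
    {S : Set X} (hS : ∀ᵐ x ∂μ, x ∈ S) {v : ℤ → ℤ → ℝ} {c : ENNReal}
    (hv : ∀ j, ∑' l, ENNReal.ofReal (v j l) = c)
    (hkv : ∀ j l, ∀ x ∈ S, ∀ y ∈ S, (j ≠ l ∨ x ≠ y) →
      ‖k (t.e j x) (t.e l y)‖ * (t.w (t.e j x) * t.w (t.e l y)) ≤ v j l) :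
    ∀ᵐ x ∂ν, ∫⁻ y, ‖k x y‖ₑ * ENNReal.ofReal (t.w y)⁻¹ ∂ν
      ≤ c * μ Set.univ * ENNReal.ofReal (t.w x)⁻¹ := by
  have hw : Measurable fun y => ENNReal.ofReal (t.w y)⁻¹ := t.measurable_w.inv.ennreal_ofReal
  have hm : Measurable fun p : Y × Y => ‖k p.1 p.2‖ₑ * ENNReal.ofReal (t.w p.2)⁻¹ :=
    hk.enorm.mul (hw.comp measurable_snd)
  refine t.ae_of_ae_e (measurableSet_le hm.lintegral_prod_right' (hw.const_mul _)) fun j => ?_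
  filter_upwards [hS] with x hx
  have hmx : Measurable fun y => ‖k (t.e j x) y‖ₑ * ENNReal.ofReal (t.w y)⁻¹ :=
    hm.comp measurable_prodMk_left
  rw [t.lintegral_eq hmx, ← hv j, ← ENNReal.tsum_mul_right,
    ← ENNReal.tsum_mul_right]
  refine ENNReal.tsum_le_tsum fun l => ?_
  rw [mul_right_comm, ← lintegral_const]
  refine lintegral_mono_ae ?_
  filter_upwards [hS, Measure.ae_ne μ x] with y hy hyx
  have h1 := t.w_pos (t.e j x)
  have h2 := t.w_pos (t.e l y)
  have h3 := hkv j l x hx y hy (Or.inr hyx.symm)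
  have h4 : 0 ≤ v j l := le_trans (by positivity) h3
  rw [← ofReal_norm, ← ENNReal.ofReal_mul (norm_nonneg _), ← ENNReal.ofReal_mul (sq_nonneg _),
    ← ENNReal.ofReal_mul h4]
  refine ENNReal.ofReal_le_ofReal ?_
  rw [← div_eq_mul_inv (v j l), le_div_iff₀ h1]
  refine le_trans (le_of_eq ?_) h3
  field_simp

/-- Multiplying the kernel by the weights at both points turns it into T_{j−l}, so row and column
sums in Schur's test are the same sum over ℤ. The weights cancel against those of the restriction
and extension maps, which leaves the block with kernel T_{l−j}. -/
theorem exists_operator [SFinite ν] [IsFiniteMeasure μ] [NullSingletonClass μ] {k : Y → Y → ℂ}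
    (hk : Measurable (Function.uncurry k)) {T : ℤ → X → X → ℂ}
    (hT : ∀ j, Measurable (Function.uncurry (T j))) {u : ℤ → ℝ} (hu : Summable u)
    (hTu : ∀ j x y, ‖T j x y‖ ≤ u j) {S : Set X} (hS : ∀ᵐ x ∂μ, x ∈ S)
    (hkT : ∀ j l, ∀ x ∈ S, ∀ y ∈ S, (j ≠ l ∨ x ≠ y) →
      (t.w (t.e j x) : ℂ) * t.w (t.e l y) * k (t.e j x) (t.e l y) = T (j - l) x y) :
    ∃ D : Lp ℂ 2 ν →L[ℂ] Lp ℂ 2 ν,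
      (∀ φ : Lp ℂ 2 ν, ∀ᵐ x ∂ν, Integrable (fun y => k x y * φ y) ν ∧
        D φ x = ∫ y, k x y * φ y ∂ν) ∧
      ∃ K : ℤ → Lp ℂ 2 μ →L[ℂ] Lp ℂ 2 μ, (∀ j, ‖K j‖ ≤ u j * μ.real Set.univ) ∧
        (∀ j φ, ∀ᵐ x ∂μ, K j φ x = ∫ y, T j x y * φ y ∂μ) ∧
        ∀ j l v, t.decomposition.π l (D (t.decomposition.ι j v)) = K (l - j) v := by
  have hkT' : ∀ j l, ∀ x ∈ S, ∀ y ∈ S, (j ≠ l ∨ x ≠ y) →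
      ‖k (t.e j x) (t.e l y)‖ * (t.w (t.e j x) * t.w (t.e l y)) ≤ u (j - l) := by
    intro j l x hx y hy h
    have h1 := t.w_pos (t.e j x)
    have h2 := t.w_pos (t.e l y)
    refine le_trans (le_of_eq ?_) (hTu (j - l) x y)
    rw [← hkT j l x hx y hy h, norm_mul, norm_mul, Complex.norm_real, Complex.norm_real,
      Real.norm_eq_abs, Real.norm_eq_abs, abs_of_pos h1, abs_of_pos h2, mul_comm]
  have h1 := t.schur_bound (c := ∑' j, ENNReal.ofReal (u j)) (v := fun j l => u (j - l)) hk hS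
    (fun j => (Equiv.subLeft j).tsum_eq fun l => ENNReal.ofReal (u l)) hkT'
  have h2 := t.schur_bound (c := ∑' j, ENNReal.ofReal (u j)) (v := fun l j => u (j - l))
    (k := fun y x => k x y) (hk.comp measurable_swap) hS
    (fun l => (Equiv.subRight l).tsum_eq fun j => ENNReal.ofReal (u j))
    (fun l j y hy x hx h => by
      rw [mul_comm (t.w (t.e l y))]
      exact hkT' j l x hx y hy (h.imp Ne.symm Ne.symm))
  obtain ⟨D, -, hD⟩ := exists_integralOperator hk (h := fun y => ENNReal.ofReal (t.w y)⁻¹)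
    t.measurable_w.inv.ennreal_ofReal (fun y => (ENNReal.ofReal_pos.2 (inv_pos.2 (t.w_pos y))).ne') (fun y => ENNReal.ofReal_ne_top) _
    (ENNReal.mul_ne_top hu.tsum_ofReal_ne_top (measure_ne_top μ _)) h1 h2
  have hKex : ∀ j, ∃ K : Lp ℂ 2 μ →L[ℂ] Lp ℂ 2 μ, ‖K‖ ≤ u j * μ.real Set.univ ∧
      ∀ φ, ∀ᵐ x ∂μ, K φ x = ∫ y, T j x y * φ y ∂μ := by
    intro j
    have hle : ∀ x y, ‖T j x y‖ₑ ≤ ENNReal.ofReal (u j) := fun x y => by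
      rw [← ofReal_norm]; exact ENNReal.ofReal_le_ofReal (hTu j x y)
    obtain ⟨K, hK1, hK2⟩ := exists_integralOperator (hT j) (h := fun _ => 1) measurable_const
      (fun _ => one_ne_zero) (fun _ => ENNReal.one_ne_top) (ENNReal.ofReal (u j) * μ Set.univ)
      (ENNReal.mul_ne_top ENNReal.ofReal_ne_top (measure_ne_top μ _))
      (ae_of_all _ fun x => by
        rw [← lintegral_const, mul_one]
        exact lintegral_mono fun y => by simpa using hle x y)
      (ae_of_all _ fun y => by
        rw [← lintegral_const, mul_one]
        exact lintegral_mono fun x => by simpa using hle x y)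
    refine ⟨K, hK1.trans (le_of_eq ?_), fun φ => (hK2 φ).mono fun x hx => hx.2⟩
    rw [ENNReal.toReal_mul]
    by_cases hX : Nonempty X
    · obtain ⟨x⟩ := hX
      rw [ENNReal.toReal_ofReal ((norm_nonneg _).trans (hTu j x x))]
      rfl
    · rw [not_nonempty_iff] at hX
      simp [Measure.real, Set.univ_eq_empty_iff.2 hX]
  choose K hK1 hK2 using hKex
  refine ⟨D, hD, K, hK1, hK2, fun j l v => Lp.ext ?_⟩
  show t.restriction l (D (t.extension j v)) =ᵐ[μ] _
  have hm : ∀ x, Measurable fun y => k x y * t.extension j v y := fun x =>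
    (hk.comp measurable_prodMk_left).mul (Lp.stronglyMeasurable _).measurable
  filter_upwards [t.restriction_ae l (D (t.extension j v)), t.ae_e (hD (t.extension j v)) l,
    hK2 (l - j) v, hS] with x e1 e2 e3 hx
  rw [e1, e2.2, e3, t.integral_eq_of_idx (hm _) j, ← integral_const_mul]
  · refine integral_congr_ae ?_
    filter_upwards [t.extension_e_self j v, hS, Measure.ae_ne μ x] with y h4 hy hyx
    have hw : (t.w (t.e j y) : ℂ) ≠ 0 := by exact_mod_cast (t.w_pos _).ne'
    rw [h4, ← hkT l j x hx y hy (Or.inr hyx.symm)]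
    push_cast
    field_simp
  · intro i hi
    filter_upwards [t.extension_e_of_ne hi v] with y hy
    rw [hy, mul_zero]

end Tiling

/-! ### The tiling of the graph -/

/-- The sign of a branch. -/
def sgn (σ : Bool) : ℝ := bif σ then 1 else -1

theorem sgn_sq (σ : Bool) : sgn σ * sgn σ = 1 := by cases σ <;> simp [sgn]

theorem abs_sgn (σ : Bool) : |sgn σ| = 1 := by cases σ <;> simp [sgn]

theorem sgn_ne_zero (σ : Bool) : sgn σ ≠ 0 := by cases σ <;> simp [sgn]

/-- The parametrisation of the graph. -/
def graphPt (f : ℝ → ℝ) (s : ℝ) : EuclideanSpace ℝ (Fin 2) := !₂[s, f s]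

theorem graphPt_zero (f : ℝ → ℝ) (s : ℝ) : graphPt f s 0 = s := rfl

theorem graphPt_one (f : ℝ → ℝ) (s : ℝ) : graphPt f s 1 = f s := rfl

theorem measurable_graphPt {f : ℝ → ℝ} (hf : Measurable f) : Measurable (graphPt f) := by
  have h : Measurable fun s : ℝ => (![s, f s] : Fin 2 → ℝ) := by
    refine measurable_pi_iff.2 fun i => ?_
    fin_cases i
    · exact measurable_id
    · exact hf
  exact (WithLp.measurable_toLp 2 _).comp h

theorem measurable_coord (i : Fin 2) : Measurable fun y : EuclideanSpace ℝ (Fin 2) => y i := by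
  fun_prop

theorem lintegral_withDensity_mul {X : Type*} [MeasurableSpace X] {μ : Measure X}
    {d g : X → ENNReal} (hd : Measurable d) (hg : Measurable g) :
    ∫⁻ x, g x ∂(μ.withDensity d) = ∫⁻ x, d x * g x ∂μ :=
  lintegral_withDensity_eq_lintegral_mul _ hd hg

theorem lintegral_fiber {g : Bool × ℝ → ENNReal} (hg : Measurable g) :
    ∫⁻ p, g p ∂fiberMeasure =
      (∫⁻ x in Set.Ioc 0 1, g (true, x)) + ∫⁻ x in Set.Ioc 0 1, g (false, x) := by
  rw [fiberMeasure, lintegral_prod _ hg.aemeasurable, lintegral_count, tsum_bool, add_comm]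

theorem lintegral_eq_tsum_Ioc (g : ℝ → ENNReal) :
    ∫⁻ x, g x = ∑' j : ℤ, ∫⁻ x in Set.Ioc 0 1, g (x + j) := by
  rw [← setLIntegral_univ, ← iUnion_Ioc_intCast ℝ, lintegral_iUnion
    (fun _ => measurableSet_Ioc) (Set.pairwise_disjoint_Ioc_intCast ℝ)]
  refine tsum_congr fun j => ?_
  rw [← lintegral_indicator measurableSet_Ioc, ← lintegral_indicator measurableSet_Ioc,
    ← lintegral_add_right_eq_self _ (j : ℝ)]
  refine lintegral_congr fun x => ?_
  by_cases hx : x ∈ Set.Ioc (0 : ℝ) 1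
  · rw [Set.indicator_of_mem hx, Set.indicator_of_mem
      (show x + j ∈ Set.Ioc (j : ℝ) (j + 1) from ⟨by linarith [hx.1], by linarith [hx.2]⟩)]
  · rw [Set.indicator_of_notMem hx, Set.indicator_of_notMem]
    exact fun h => hx ⟨by linarith [h.1], by linarith [h.2]⟩

theorem hasDerivAt_rpow_const {α : ℝ} (hα0 : 0 < α) (x : ℝ) :
    HasDerivAt (fun x : ℝ => α ^ x) (α ^ x * Real.log α) x := by
  simpa [mul_comm] using (hasDerivAt_id x).const_rpow hα0

theorem lintegral_Ioi_eq {α : ℝ} (hα0 : 0 < α) (hα1 : α < 1) (g : ℝ → ENNReal) :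
    ∫⁻ s in Set.Ioi 0, g s = ∫⁻ x : ℝ, ENNReal.ofReal (α ^ x * |Real.log α|) * g (α ^ x) := by
  have hinj : Function.Injective fun x : ℝ => α ^ x :=
    (Real.strictAnti_rpow_of_base_lt_one hα0 hα1).injective
  have himg : (fun x : ℝ => α ^ x) '' Set.univ = Set.Ioi 0 := by
    ext s
    constructor
    · rintro ⟨x, -, rfl⟩
      exact Real.rpow_pos_of_pos hα0 x
    · exact fun hs => ⟨Real.logb α s, trivial, Real.rpow_logb hα0 hα1.ne hs⟩
  rw [← himg, lintegral_image_eq_lintegral_abs_deriv_mul MeasurableSet.univ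
    (fun x _ => (hasDerivAt_rpow_const hα0 x).hasDerivWithinAt) hinj.injOn, setLIntegral_univ]
  refine lintegral_congr fun x => ?_
  rw [abs_mul, abs_of_pos (Real.rpow_pos_of_pos hα0 x)]

/-- The line without the origin is two half-lines, each parametrised by s = ±α^{x+j} with x ∈ (0, 1]
and j ∈ ℤ; the origin is a null set. -/
theorem lintegral_eq_tsum_fiber {α : ℝ} (hα0 : 0 < α) (hα1 : α < 1) {h : ℝ → ENNReal}
    (hh : Measurable h) : ∫⁻ s, h s = ∑' j : ℤ, ∫⁻ p, ENNReal.ofReal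
      (α ^ (p.2 + j) * |Real.log α|) * h (sgn p.1 * α ^ (p.2 + j)) ∂fiberMeasure := by
  have hp : Measurable fun x : ℝ => α ^ x := measurable_const.pow measurable_id
  have hs : Measurable sgn := measurable_of_finite _
  have e1 : ∀ j : ℤ, ∫⁻ p, ENNReal.ofReal (α ^ (p.2 + j) * |Real.log α|) *
        h (sgn p.1 * α ^ (p.2 + j)) ∂fiberMeasure =
      (∫⁻ x in Set.Ioc (0 : ℝ) 1, ENNReal.ofReal (α ^ (x + j) * |Real.log α|) * h (α ^ (x + j))) +
      ∫⁻ x in Set.Ioc (0 : ℝ) 1, ENNReal.ofReal (α ^ (x + j) * |Real.log α|) *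
        h (-α ^ (x + j)) := by
    intro j
    have h2 : Measurable fun p : Bool × ℝ => α ^ (p.2 + (j : ℝ)) :=
      hp.comp (measurable_snd.add_const _)
    have h3 : Measurable fun p : Bool × ℝ => ENNReal.ofReal (α ^ (p.2 + (j : ℝ)) * |Real.log α|) *
        h (sgn p.1 * α ^ (p.2 + (j : ℝ))) :=
      (h2.mul_const _).ennreal_ofReal.mul (hh.comp ((hs.comp measurable_fst).mul h2))
    rw [lintegral_fiber h3]
    simp [sgn]
  simp_rw [e1]
  rw [ENNReal.tsum_add,
    ← lintegral_eq_tsum_Ioc fun x => ENNReal.ofReal (α ^ x * |Real.log α|) * h (α ^ x),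
    ← lintegral_eq_tsum_Ioc fun x => ENNReal.ofReal (α ^ x * |Real.log α|) * h (-α ^ x),
    ← lintegral_Ioi_eq hα0 hα1 h, ← lintegral_Ioi_eq hα0 hα1 fun s => h (-s),
    ← lintegral_add_compl h (measurableSet_Ioi (a := (0 : ℝ)))]
  congr 1
  rw [Set.compl_Ioi, ← restrict_Iio_eq_restrict_Iic, ← lintegral_indicator measurableSet_Iio,
    ← lintegral_indicator measurableSet_Ioi, ← lintegral_neg_eq_self]
  refine lintegral_congr fun x => ?_
  by_cases hx : 0 < x
  · rw [Set.indicator_of_mem (show -x ∈ Set.Iio 0 from neg_lt_zero.2 hx),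
      Set.indicator_of_mem (show x ∈ Set.Ioi 0 from hx)]
  · rw [Set.indicator_of_notMem (show -x ∉ Set.Iio 0 from fun h => hx (neg_lt_zero.1 h)),
      Set.indicator_of_notMem (show x ∉ Set.Ioi 0 from hx)]

/-- The density of the tiling of the graph. -/
def graphWeight (α : ℝ) (f : ℝ → ℝ) (s : ℝ) : ℝ :=
  if s = 0 then 1 else √(√(1 + deriv f s ^ 2) * (|s| * |Real.log α|))

/-- Positivity everywhere, as a tiling demands, is the reason for the separate value at s = 0, where
the formula would vanish. -/
theorem graphWeight_pos {α : ℝ} (hα0 : 0 < α) (hα1 : α < 1) (f : ℝ → ℝ) (s : ℝ) :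
    0 < graphWeight α f s := by
  have := (Real.log_neg hα0 hα1).ne
  rw [graphWeight]
  split_ifs <;> positivity

theorem graphWeight_sq {α : ℝ} (f : ℝ → ℝ) {s : ℝ} (hs : s ≠ 0) :
    graphWeight α f s ^ 2 = √(1 + deriv f s ^ 2) * (|s| * |Real.log α|) := by
  rw [graphWeight, if_neg hs, Real.sq_sqrt (by positivity)]

/-- The logarithmic coordinate on a branch. -/
def logCoord (α s : ℝ) : ℝ := Real.log |s| / Real.log α

theorem logCoord_sgn_mul {α : ℝ} (hα0 : 0 < α) (hα1 : α < 1) (σ : Bool) (x : ℝ) :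
    logCoord α (sgn σ * α ^ x) = x := by
  rw [logCoord, abs_mul, abs_sgn, one_mul, abs_of_pos (Real.rpow_pos_of_pos hα0 x),
    Real.log_rpow hα0, mul_div_assoc, div_self (Real.log_neg hα0 hα1).ne, mul_one]

/-- The fundamental interval is open on the left and closed on the right, so the tile index is a
ceiling minus one and not a floor. -/
theorem ceil_add_sub_one {x : ℝ} (hx : x ∈ Set.Ioc (0 : ℝ) 1) (j : ℤ) : ⌈x + j⌉ - 1 = j := by
  rw [Int.ceil_add_intCast, Int.ceil_eq_iff.2 (show ((1 : ℤ) : ℝ) - 1 < x ∧ x ≤ (1 : ℤ) by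
    simpa using hx)]
  ring

/-- The tiling of a graph by the arcs `αʲ⁺¹ ≤ |s| < αʲ` of its two branches. -/
def graphTiling {α : ℝ} (hα0 : 0 < α) (hα1 : α < 1) {f : ℝ → ℝ} (hf : Measurable f) :
    Tiling fiberMeasure (graphMeasure f) where
  e j p := graphPt f (sgn p.1 * α ^ (p.2 + j))
  idx y := ⌈logCoord α (y 0)⌉ - 1
  crd y := (decide (0 < y 0), logCoord α (y 0) - (⌈logCoord α (y 0)⌉ - 1 : ℤ))
  w y := graphWeight α f (y 0)
  measurable_e j := (measurable_graphPt hf).comp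
    (((measurable_of_finite sgn).comp measurable_fst).mul
      (measurable_const.pow (measurable_snd.add_const _)))
  measurable_idx := by
    have h : Measurable fun y : EuclideanSpace ℝ (Fin 2) => logCoord α (y 0) :=
      (Real.measurable_log.comp (measurable_coord 0).abs).div_const _
    exact h.ceil.sub_const 1
  measurable_crd := by
    have h : Measurable fun y : EuclideanSpace ℝ (Fin 2) => logCoord α (y 0) :=
      (Real.measurable_log.comp (measurable_coord 0).abs).div_const _
    refine Measurable.prodMk ?_ (h.sub ((measurable_of_countable _).comp (h.ceil.sub_const 1)))
    refine measurable_to_bool ?_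
    have e : (fun y : EuclideanSpace ℝ (Fin 2) => decide (0 < y 0)) ⁻¹' {true} = {y | 0 < y 0} := by
      ext y; simp
    rw [e]
    exact measurableSet_lt measurable_const (measurable_coord 0)
  measurable_w := by
    have h := measurable_coord 0
    refine Measurable.comp (g := graphWeight α f) ?_ h
    refine Measurable.ite (measurableSet_singleton 0) measurable_const ?_
    have := measurable_deriv f
    fun_prop
  w_pos y := graphWeight_pos hα0 hα1 f _
  idx_e j := by
    filter_upwards [ae_fiber_mem] with p hp
    rw [graphPt_zero, logCoord_sgn_mul hα0 hα1, ceil_add_sub_one hp]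
  crd_e j := by
    filter_upwards [ae_fiber_mem] with p hp
    have h1 := Real.rpow_pos_of_pos hα0 (p.2 + j)
    rw [graphPt_zero, logCoord_sgn_mul hα0 hα1, ceil_add_sub_one hp, add_sub_cancel_right]
    obtain ⟨σ, x⟩ := p
    cases σ
    · simp [sgn, h1.le]
    · simp [sgn, h1]
  eq_sum := by
    have hρ : Measurable fun s => ENNReal.ofReal (√(1 + deriv f s ^ 2)) := by
      have := measurable_deriv f
      fun_prop
    have hgm := measurable_graphPt hf
    have hsm := measurable_of_finite sgn
    have hem : ∀ j : ℤ, Measurable fun p : Bool × ℝ => sgn p.1 * α ^ (p.2 + j) := fun j =>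
      (hsm.comp measurable_fst).mul (measurable_const.pow (measurable_snd.add_const _))
    have hwm : Measurable (graphWeight α f) := by
      refine Measurable.ite (measurableSet_singleton 0) measurable_const ?_
      have := measurable_deriv f
      fun_prop
    refine Measure.ext_of_lintegral _ fun g hg => ?_
    rw [lintegral_sum_measure, graphMeasure, show (fun s => !₂[s, f s]) = graphPt f from rfl,
      lintegral_map hg hgm,
      lintegral_withDensity_mul hρ (g := fun s => g (graphPt f s)) (hg.comp hgm),
      lintegral_eq_tsum_fiber hα0 hα1 (h := fun s => ENNReal.ofReal (√(1 + deriv f s ^ 2)) *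
        g (graphPt f s)) (hρ.mul (hg.comp hgm))]
    refine tsum_congr fun j => ?_
    have hgem : Measurable fun p : Bool × ℝ => graphPt f (sgn p.1 * α ^ (p.2 + (j : ℝ))) :=
      hgm.comp (hem j)
    have hwem : Measurable fun p : Bool × ℝ => ENNReal.ofReal
        (graphWeight α f (graphPt f (sgn p.1 * α ^ (p.2 + (j : ℝ))) 0) ^ 2) :=
      ((hwm.comp (hem j)).pow_const 2).ennreal_ofReal
    rw [lintegral_map hg hgem, lintegral_withDensity_mul hwem
      (g := fun p : Bool × ℝ => g (graphPt f (sgn p.1 * α ^ (p.2 + (j : ℝ))))) (hg.comp hgem)]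
    refine lintegral_congr fun p => ?_
    have h1 := Real.rpow_pos_of_pos hα0 (p.2 + j)
    rw [graphPt_zero]
    rw [graphWeight_sq f (mul_ne_zero (sgn_ne_zero _) h1.ne'), abs_mul, abs_sgn, one_mul,
      abs_of_pos h1, ENNReal.ofReal_mul (Real.sqrt_nonneg _), ← mul_assoc]
    congr 1
    exact mul_comm _ _

/-! ### The double-layer kernel in the coordinates of the tiling -/

theorem dlKernel_graphPt (f : ℝ → ℝ) (a b : ℝ) : dlKernel f (graphPt f a) (graphPt f b) =
    1 / (2 * Real.pi) * (((b - a) * deriv f b + f a - f b) / ((a - b) ^ 2 + (f a - f b) ^ 2) *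
      (√(1 + deriv f b ^ 2))⁻¹) := by
  have h1 : inner ℝ (graphPt f a - graphPt f b) (unitNormal f (graphPt f b)) =
      ((b - a) * deriv f b + f a - f b) * (√(1 + deriv f b ^ 2))⁻¹ := by
    simp only [unitNormal, graphPt_zero, PiLp.inner_apply, Fin.sum_univ_two, PiLp.sub_apply,
      graphPt_one, PiLp.smul_apply, smul_eq_mul]
    simp
    ring
  have h2 : ‖graphPt f a - graphPt f b‖ ^ 2 = (a - b) ^ 2 + (f a - f b) ^ 2 := by
    rw [EuclideanSpace.real_norm_sq_eq, Fin.sum_univ_two, PiLp.sub_apply, PiLp.sub_apply,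
      graphPt_zero, graphPt_zero, graphPt_one, graphPt_one]
  rw [dlKernel, h1, h2]
  ring

section Dilation

variable {α : ℝ} {f : ℝ → ℝ} (hα0 : 0 < α) (hdil : ∀ x : ℝ, f (α * x) = α * f x)
include hα0 hdil

theorem dilation_zpow (n : ℤ) (x : ℝ) : f (α ^ n * x) = α ^ n * f x := by
  have hα := hα0.ne'
  have hinv : ∀ x, f (α⁻¹ * x) = α⁻¹ * f x := fun x => by
    have := hdil (α⁻¹ * x)
    rw [mul_inv_cancel_left₀ hα] at this
    rw [this, inv_mul_cancel_left₀ hα]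
  induction n using Int.induction_on with
  | zero => simp
  | succ n ih => rw [zpow_add_one₀ hα, mul_comm (α ^ (n : ℤ)), mul_assoc, hdil, ih, mul_assoc]
  | pred n ih => rw [zpow_sub_one₀ hα, mul_comm (α ^ (-(n : ℤ))), mul_assoc, hinv, ih, mul_assoc]

theorem deriv_dilation_zpow (n : ℤ) (x : ℝ) : deriv f (α ^ n * x) = deriv f x := by
  have hn : α ^ n ≠ 0 := (zpow_pos hα0 n).ne'
  have h1 := deriv_comp_mul_left (α ^ n) f x
  simp_rw [dilation_zpow hα0 hdil n] at h1
  rw [deriv_const_mul_field, smul_eq_mul] at h1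
  exact (mul_left_cancel₀ hn h1).symm

theorem graphWeight_zpow (n : ℤ) {x : ℝ} (hx : x ≠ 0) :
    graphWeight α f (α ^ n * x) = √(α ^ n) * graphWeight α f x := by
  have hn : 0 < α ^ n := zpow_pos hα0 n
  rw [graphWeight, graphWeight, if_neg (mul_ne_zero hn.ne' hx), if_neg hx,
    deriv_dilation_zpow hα0 hdil, abs_mul, abs_of_pos hn, ← Real.sqrt_mul hn.le]
  congr 1
  ring

/-- Numerator and denominator of the kernel have degrees 1 and 2 under dilation. Each of the two
weights has degree 1/2, so the conjugated kernel is invariant. -/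
theorem dlKernel_zpow (n : ℤ) (a b : ℝ) :
    dlKernel f (graphPt f (α ^ n * a)) (graphPt f (α ^ n * b)) =
      (α ^ n)⁻¹ * dlKernel f (graphPt f a) (graphPt f b) := by
  have hn : α ^ n ≠ 0 := (zpow_pos hα0 n).ne'
  rw [dlKernel_graphPt, dlKernel_graphPt, deriv_dilation_zpow hα0 hdil, dilation_zpow hα0 hdil,
    dilation_zpow hα0 hdil]
  have e1 : (α ^ n * b - α ^ n * a) * deriv f b + α ^ n * f a - α ^ n * f b =
      α ^ n * ((b - a) * deriv f b + f a - f b) := by ring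
  have e2 : (α ^ n * a - α ^ n * b) ^ 2 + (α ^ n * f a - α ^ n * f b) ^ 2 =
      α ^ n * (α ^ n * ((a - b) ^ 2 + (f a - f b) ^ 2)) := by ring
  rw [e1, e2, mul_div_mul_left _ _ hn, mul_comm (α ^ n) (_ + _)]
  have aux : ∀ k p q d c : ℝ, k * (p / (q * c) * d) = c⁻¹ * (k * (p / q * d)) :=
    fun _ _ _ _ _ => by ring
  exact aux _ _ _ _ _

end Dilation

theorem branchFn_apply (f : ℝ → ℝ) (σ : Bool) (r : ℝ) : branchFn f σ r = f (sgn σ * r) := by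
  cases σ <;> simp [branchFn, sgn, fPlus, fMinus]

theorem deriv_branchFn (f : ℝ → ℝ) (σ : Bool) (r : ℝ) :
    deriv (branchFn f σ) r = sgn σ * deriv f (sgn σ * r) := by
  have e : branchFn f σ = fun r => f (sgn σ * r) := funext (branchFn_apply f σ)
  rw [e, deriv_comp_mul_left, smul_eq_mul]

theorem div_div_one_add_sq {N d m : ℝ} (hd : d ≠ 0) :
    N / d ^ 2 / (1 + (m / d) ^ 2) = N / (d ^ 2 + m ^ 2) := by
  rw [div_div, mul_add, div_pow, mul_one, mul_div_cancel₀ _ (pow_ne_zero 2 hd)]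

/-- In the signed points sgn σ · α^{x+j} and sgn τ · αʸ the formulas for equal and for opposite
branches become one, because the squares of the signs are 1. Only the diagonal is excluded, where
`pSame` and `qSame` are defined by limits. -/
theorem termR_branchFn {α : ℝ} (hα0 : 0 < α) (hα1 : α < 1) (f : ℝ → ℝ) (σ τ : Bool) (j : ℤ)
    (x y : ℝ) (h : σ = τ → x + j ≠ y) :
    termR α (branchFn f) σ τ j x y =
      ((sgn τ * α ^ y - sgn σ * α ^ (x + j)) * deriv f (sgn τ * α ^ y) + f (sgn σ * α ^ (x + j))
          - f (sgn τ * α ^ y)) /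
        ((sgn σ * α ^ (x + j) - sgn τ * α ^ y) ^ 2
          + (f (sgn σ * α ^ (x + j)) - f (sgn τ * α ^ y)) ^ 2) *
      kernelWeight α (branchFn f σ) (branchFn f τ) j x y := by
  have h1 := Real.rpow_pos_of_pos hα0 (x + j)
  have h2 := Real.rpow_pos_of_pos hα0 y
  by_cases hστ : σ = τ
  · subst hστ
    have hne : α ^ (x + j) - α ^ y ≠ 0 := sub_ne_zero.2 fun e =>
      h rfl ((Real.strictAnti_rpow_of_base_lt_one hα0 hα1).injective e)
    rw [termR, if_pos rfl, termSame, pSame, qSame, if_neg (h rfl), if_neg (h rfl),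
      div_div_one_add_sq hne, deriv_branchFn, branchFn_apply, branchFn_apply]
    congr 2
    · ring
    · linear_combination (-(α ^ (x + j) - α ^ y) ^ 2) * sgn_sq σ
  · have hs : sgn σ = -sgn τ := by cases σ <;> cases τ <;> simp_all [sgn]
    rw [termR, if_neg hστ, termCross, pCross, qCross, div_div_one_add_sq (by positivity),
      deriv_branchFn, branchFn_apply, branchFn_apply, hs]
    congr 2
    · ring
    · linear_combination (-(α ^ (x + j) + α ^ y) ^ 2) * sgn_sq τ

theorem rpow_quarter {a : ℝ} (ha : 0 ≤ a) : a ^ (1 / 4 : ℝ) = √(√a) := by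
  rw [Real.sqrt_eq_rpow, Real.sqrt_eq_rpow, ← Real.rpow_mul ha]
  norm_num

/-- The weights carry A^{1/4}B^{1/4} of the arc-length densities √A and √B at the two points, and
the normal divides by √B, leaving (A/B)^{1/4}. Dilation invariance of f′ removes j from A. -/
theorem graphWeight_mul_eq {α : ℝ} (hα0 : 0 < α) {f : ℝ → ℝ}
    (hdil : ∀ x : ℝ, f (α * x) = α * f x) (σ τ : Bool) (j : ℤ) (x y : ℝ) :
    graphWeight α f (sgn σ * α ^ (x + j)) * graphWeight α f (sgn τ * α ^ y) *
      (√(1 + deriv f (sgn τ * α ^ y) ^ 2))⁻¹ =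
      kernelWeight α (branchFn f σ) (branchFn f τ) j x y := by
  have h1 := Real.rpow_pos_of_pos hα0 (x + j)
  have h2 := Real.rpow_pos_of_pos hα0 y
  have hd : deriv f (sgn σ * α ^ (x + j)) = deriv f (sgn σ * α ^ x) := by
    rw [← deriv_dilation_zpow hα0 hdil j (sgn σ * α ^ x), Real.rpow_add hα0, Real.rpow_intCast]
    congr 1
    ring
  have hsq : ∀ ρ z, deriv (branchFn f ρ) z ^ 2 = deriv f (sgn ρ * z) ^ 2 := fun ρ z => by
    rw [deriv_branchFn, mul_pow, pow_two (sgn ρ), sgn_sq, one_mul]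
  rw [graphWeight, graphWeight, if_neg (mul_ne_zero (sgn_ne_zero σ) h1.ne'),
    if_neg (mul_ne_zero (sgn_ne_zero τ) h2.ne'), kernelWeight, hsq, hsq, hd, abs_mul, abs_mul,
    abs_sgn, abs_sgn, one_mul, one_mul, abs_of_pos h1, abs_of_pos h2]
  set A := 1 + deriv f (sgn σ * α ^ x) ^ 2 with hA
  set B := 1 + deriv f (sgn τ * α ^ y) ^ 2 with hB
  have hA0 : 0 < A := by positivity
  have hB0 : 0 < B := by positivity
  have hr : √(α ^ (x + j)) * √(α ^ y) = α ^ ((x + y + j) / 2) := by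
    rw [← Real.sqrt_mul h1.le, ← Real.rpow_add hα0, Real.sqrt_eq_rpow, ← Real.rpow_mul hα0.le]
    congr 1
    ring
  have hl : √|Real.log α| * √|Real.log α| = |Real.log α| := Real.mul_self_sqrt (abs_nonneg _)
  have hBB : √(√B) * √(√B) = √B := Real.mul_self_sqrt (Real.sqrt_nonneg _)
  have hB4 : √(√B) ≠ 0 := by positivity
  rw [rpow_quarter (by positivity), Real.sqrt_div hA0.le, Real.sqrt_div (Real.sqrt_nonneg _),
    Real.sqrt_mul (Real.sqrt_nonneg _), Real.sqrt_mul (Real.sqrt_nonneg _), Real.sqrt_mul h1.le,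
    Real.sqrt_mul h2.le, ← hr]
  nth_rewrite 2 [← hBB]
  conv_rhs => rw [← hl]
  field_simp

/-- A factor αˡ is taken out of both points: the weights contribute α^{l/2} each and the kernel
α^{−l}. What remains depends on j and l only through j − l, which is the Toeplitz structure. -/
theorem weight_mul_dlKernel {α : ℝ} (hα0 : 0 < α) (hα1 : α < 1) {f : ℝ → ℝ}
    (hdil : ∀ x : ℝ, f (α * x) = α * f x) (σ τ : Bool) (j l : ℤ) (x y : ℝ)
    (h : σ = τ → x + j ≠ y + l) :
    graphWeight α f (sgn σ * α ^ (x + j)) * graphWeight α f (sgn τ * α ^ (y + l)) *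
      dlKernel f (graphPt f (sgn σ * α ^ (x + j))) (graphPt f (sgn τ * α ^ (y + l))) =
      1 / (2 * Real.pi) * termR α (branchFn f) σ τ (j - l) x y := by
  have hn : 0 < α ^ l := zpow_pos hα0 l
  have e1 : sgn σ * α ^ (x + j) = α ^ l * (sgn σ * α ^ (x + (j - l : ℤ))) := by
    rw [← Real.rpow_intCast α l, mul_left_comm, ← Real.rpow_add hα0]
    congr 2
    push_cast
    ring
  have e2 : sgn τ * α ^ (y + l) = α ^ l * (sgn τ * α ^ y) := by
    rw [← Real.rpow_intCast α l, mul_left_comm, ← Real.rpow_add hα0, add_comm]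
  have h1 := Real.rpow_pos_of_pos hα0 (x + (j - l : ℤ))
  have h2 := Real.rpow_pos_of_pos hα0 y
  rw [e1, e2, graphWeight_zpow hα0 hdil _ (mul_ne_zero (sgn_ne_zero σ) h1.ne'),
    graphWeight_zpow hα0 hdil _ (mul_ne_zero (sgn_ne_zero τ) h2.ne'), dlKernel_zpow hα0 hdil,
    dlKernel_graphPt, termR_branchFn hα0 hα1 f σ τ (j - l) x y (fun hs e => h hs (by
      push_cast at e; linarith)), ← graphWeight_mul_eq hα0 hdil]
  have hs : √(α ^ l) * √(α ^ l) * (α ^ l)⁻¹ = 1 := by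
    rw [Real.mul_self_sqrt hn.le, mul_inv_cancel₀ hn.ne']
  have aux : ∀ s c a b k q d : ℝ, s * s * c⁻¹ = 1 →
      s * a * (s * b) * (c⁻¹ * (k * (q * d))) = k * (q * (a * b * d)) := by
    intro s c a b k q d h
    linear_combination (a * b * k * q * d) * h
  exact aux _ _ _ _ _ _ _ hs

/-! ### The double-layer operator -/

theorem measurable_dlKernel (f : ℝ → ℝ) : Measurable (Function.uncurry (dlKernel f)) := by
  have hd := measurable_deriv f
  have h0 := measurable_coord 0
  have h1 : Measurable fun y : EuclideanSpace ℝ (Fin 2) =>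
      (!₂[-deriv f (y 0), 1] : EuclideanSpace ℝ (Fin 2)) := by
    have h : Measurable fun y : EuclideanSpace ℝ (Fin 2) =>
        (![-deriv f (y 0), 1] : Fin 2 → ℝ) := by
      refine measurable_pi_iff.2 fun i => ?_
      fin_cases i
      · exact (hd.comp h0).neg
      · exact measurable_const
    exact (WithLp.measurable_toLp 2 _).comp h
  have h2 : Measurable (unitNormal f) := by
    have h3 : Measurable fun y : EuclideanSpace ℝ (Fin 2) => deriv f (y 0) := hd.comp h0
    have h4 : Measurable fun y : EuclideanSpace ℝ (Fin 2) => (√(1 + deriv f (y 0) ^ 2))⁻¹ :=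
      ((h3.pow_const 2).const_add 1).sqrt.inv
    exact Measurable.smul (X := EuclideanSpace ℝ (Fin 2)) h4 h1
  refine Measurable.const_mul (Measurable.div ?_ ?_) _
  · exact (measurable_fst.sub measurable_snd).inner (h2.comp measurable_snd)
  · exact (measurable_fst.sub measurable_snd).norm.pow_const 2

theorem dlKernel_self (f : ℝ → ℝ) (x : EuclideanSpace ℝ (Fin 2)) : dlKernel f x x = 0 := by
  simp [dlKernel]

instance (f : ℝ → ℝ) : SFinite (graphMeasure f) := by
  unfold graphMeasure; infer_instance

instance : NullSingletonClass fiberMeasure := by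
  unfold fiberMeasure; infer_instance

/-- The integral converges absolutely, so the truncated integrals converge by dominated convergence.
The point y = x, removed by every truncation, is harmless because the kernel vanishes there. -/
theorem isDoubleLayerOperator_of_integral {f : ℝ → ℝ} {D : L2Graph f →L[ℂ] L2Graph f}
    (hD : ∀ φ : L2Graph f, ∀ᵐ x ∂(graphMeasure f),
      Integrable (fun y => (dlKernel f x y : ℂ) * φ y) (graphMeasure f) ∧
        D φ x = ∫ y, (dlKernel f x y : ℂ) * φ y ∂(graphMeasure f)) :
    IsDoubleLayerOperator f D := by
  intro φ
  filter_upwards [hD φ] with x hx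
  rw [hx.2]
  have hm : ∀ ε : ℝ, MeasurableSet {y | ε < ‖x - y‖} := fun ε =>
    measurableSet_lt measurable_const (measurable_const.sub measurable_id).norm
  simp_rw [← integral_indicator (hm _)]
  refine tendsto_integral_filter_of_dominated_convergence _
    (Eventually.of_forall fun ε => hx.1.aestronglyMeasurable.indicator (hm ε))
    (Eventually.of_forall fun ε => ae_of_all _ fun y => norm_indicator_le_norm_self _ _)
    hx.1.norm (ae_of_all _ fun y => ?_)
  by_cases hxy : y = x
  · subst hxy
    refine tendsto_const_nhds.congr fun ε => ?_
    by_cases h : y ∈ {z | ε < ‖y - z‖}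
    · rw [Set.indicator_of_mem h]
    · rw [Set.indicator_of_notMem h, dlKernel_self, Complex.ofReal_zero, zero_mul]
  · have h0 : 0 < ‖x - y‖ := norm_pos_iff.2 (sub_ne_zero.2 (Ne.symm hxy))
    refine tendsto_const_nhds.congr' ?_
    filter_upwards [mem_nhdsWithin_of_mem_nhds (Iio_mem_nhds h0)] with ε hε
    rw [Set.indicator_of_mem (show y ∈ {z | ε < ‖x - z‖} from hε)]

theorem IsDoubleLayerOperator.unique {f : ℝ → ℝ} {D D' : L2Graph f →L[ℂ] L2Graph f}
    (h : IsDoubleLayerOperator f D) (h' : IsDoubleLayerOperator f D') : D = D' := by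
  refine ContinuousLinearMap.ext fun φ => Lp.ext ?_
  filter_upwards [h φ, h' φ] with x h1 h2
  exact tendsto_nhds_unique h1 h2

/-- Convergence in L² implies convergence almost everywhere along a sequence of finite partial sums,
which pins down the pointwise limit. It identifies the abstract symbol with the integral operator of
kernel `kerF`. -/
theorem ae_eq_of_hasSum_of_hasSum {X : Type*} [MeasurableSpace X] {μ : Measure X}
    {a : ℤ → Lp ℂ 2 μ} {s : Lp ℂ 2 μ} (hs : HasSum a s) {g : X → ℂ}
    (hg : ∀ᵐ x ∂μ, HasSum (fun j => a j x) (g x)) : s =ᵐ[μ] g := by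
  obtain ⟨ns, hn, hns⟩ := (tendstoInMeasure_of_tendsto_Lp
    (show Tendsto (fun S : Finset ℤ => ∑ j ∈ S, a j) atTop (𝓝 s) from hs)).exists_seq_tendsto_ae'
  have hsum : ∀ᵐ x ∂μ, ∀ i, (∑ j ∈ ns i, a j : Lp ℂ 2 μ) x = ∑ j ∈ ns i, a j x := by
    rw [ae_all_iff]
    intro i
    filter_upwards [Lp.coeFn_finsetSum (ns i) a] with x hx
    rw [hx, Finset.sum_apply]
  filter_upwards [hns, hg, hsum] with x h1 h2 h3
  refine tendsto_nhds_unique h1 ?_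
  simp_rw [h3]
  exact (show Tendsto (fun S : Finset ℤ => ∑ j ∈ S, a j x) atTop (𝓝 (g x)) from h2).comp hn

/-! ### Block Toeplitz form of the double-layer operator -/

namespace BranchPair

variable {α c : ℝ} {f : ℝ → ℝ} {G : Bool → ℂ → ℂ} (P : BranchPair α c (branchFn f) G)
include P

/-- The kernel of the `j`-th block of the double-layer operator. -/
def blockKer (α : ℝ) (φ : Bool → ℝ → ℝ) (j : ℤ) (p q : Bool × ℝ) : ℂ :=
  ((1 / (2 * Real.pi) * termR α φ p.1 q.1 j (clamp p.2) (clamp q.2) : ℝ) : ℂ)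

omit P in
theorem measurable_blockKer (hφ : ∀ σ, Measurable (branchFn f σ)) (j : ℤ) :
    Measurable (Function.uncurry (blockKer α (branchFn f) j)) :=
  measurable_fiber_kernel (a := fun σ τ x y =>
    ((1 / (2 * Real.pi) * termR α (branchFn f) σ τ j (clamp x) (clamp y) : ℝ) : ℂ)) fun σ τ =>
    Complex.measurable_ofReal.comp (((measurable_termR hφ σ τ j).comp
      ((measurable_clamp.comp measurable_fst).prodMk
        (measurable_clamp.comp measurable_snd))).const_mul _)

theorem exists_blockKer_bound : ∃ v : ℤ → ℝ, Summable v ∧ (∃ C, ∀ j, v j ≤ C * √α ^ j.natAbs) ∧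
    ∀ j p q, ‖blockKer α (branchFn f) j p q‖ ≤ v j := by
  choose u hu0 hu1 hu2 _ _ hu using P.exists_majorant_real
  choose C hC0 hC using hu1
  refine ⟨fun j => 1 / (2 * Real.pi) * ∑ σ, ∑ τ, u σ τ j.natAbs,
    (summable_sum fun σ _ => summable_sum fun τ _ => hu2 σ τ).mul_left _,
    ⟨1 / (2 * Real.pi) * ∑ σ, ∑ τ, C σ τ, fun j => ?_⟩, fun j p q => ?_⟩
  · rw [mul_assoc, Finset.sum_mul]
    refine mul_le_mul_of_nonneg_left (Finset.sum_le_sum fun σ _ => ?_) (by positivity)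
    rw [Finset.sum_mul]
    exact Finset.sum_le_sum fun τ _ => hC σ τ _
  · rw [blockKer, Complex.norm_real, Real.norm_eq_abs, abs_mul, abs_of_pos (by positivity)]
    refine mul_le_mul_of_nonneg_left
      ((hu p.1 q.1 j _ _ (clamp_mem _) (clamp_mem _)).trans ?_) (by positivity)
    refine (Finset.single_le_sum (f := fun τ => u p.1 τ j.natAbs) (fun τ _ => hu0 _ _ _)
      (Finset.mem_univ q.1)).trans ?_
    exact Finset.single_le_sum (f := fun σ => ∑ τ, u σ τ j.natAbs)
      (fun σ _ => Finset.sum_nonneg fun τ _ => hu0 _ _ _) (Finset.mem_univ p.1)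

omit P in
theorem kerF_eq_tsum (t : ℝ) (p q : Bool × ℝ) : kerF α (branchFn f) t p q =
    ∑' j : ℤ, Complex.exp (Complex.I * j * t) * blockKer α (branchFn f) j p q := by
  rw [kerF, kerR, ← tsum_mul_left]
  refine tsum_congr fun j => ?_
  rw [blockKer]
  push_cast
  ring

theorem exists_doubleLayerOperator (hf : Measurable f) (hφ : ∀ σ, Measurable (branchFn f σ))
    (hdil : ∀ x : ℝ, f (α * x) = α * f x) (hα0 : 0 < α) (hα1 : α < 1) :
    ∃ D : L2Graph f →L[ℂ] L2Graph f, IsDoubleLayerOperator f D ∧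
      ∃ K : ℤ → Lp ℂ 2 fiberMeasure →L[ℂ] Lp ℂ 2 fiberMeasure,
        (∃ C, ∀ j, ‖K j‖ ≤ C * √α ^ j.natAbs) ∧
        (∀ j l v, (graphTiling hα0 hα1 hf).decomposition.π l
          (D ((graphTiling hα0 hα1 hf).decomposition.ι j v)) = K (l - j) v) ∧
        ∀ t u, symbol K t u =ᵐ[fiberMeasure]
          fun p => ∫ q, kerF α (branchFn f) t p q * u q ∂fiberMeasure := by
  obtain ⟨v, hvs, ⟨C, hC⟩, hv⟩ := P.exists_blockKer_bound
  obtain ⟨D, hD, K, hK1, hK2, hDK⟩ := (graphTiling hα0 hα1 hf).exists_operator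
    (k := fun x y => (dlKernel f x y : ℂ)) (T := blockKer α (branchFn f))
    (S := {p | p.2 ∈ Set.Ioc (0 : ℝ) 1})
    (Complex.measurable_ofReal.comp (measurable_dlKernel f))
    (measurable_blockKer hφ) hvs hv ae_fiber_mem (by
      rintro j l ⟨σ, x⟩ hx ⟨τ, y⟩ hy h
      have h1 := weight_mul_dlKernel hα0 hα1 hdil σ τ j l x y (by
        rintro rfl e
        -- Both positions lie in (0, 1], so equal logarithmic coordinates force equal tile indices
        -- and then equal positions; that case has been excluded.
        have hjl : j = l := by
          rw [← ceil_add_sub_one hx j, ← ceil_add_sub_one hy l, e]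
        subst hjl
        simp_all)
      rw [blockKer, clamp_of_mem ⟨hx.1.le, hx.2⟩, clamp_of_mem ⟨hy.1.le, hy.2⟩, ← h1]
      push_cast
      rfl)
  have hK3 : ∀ j, ‖K j‖ ≤ C * 2 * √α ^ j.natAbs := fun j => by
    refine (hK1 j).trans ?_
    rw [fiberMeasure_univ, mul_right_comm]
    exact mul_le_mul_of_nonneg_right (hC j) zero_le_two
  have hKs : Summable fun j => ‖K j‖ :=
    Summable.of_nonneg_of_le (fun _ => norm_nonneg _) hK1 (hvs.mul_right _)
  refine ⟨D, isDoubleLayerOperator_of_integral hD, K, ⟨_, hK3⟩, hDK, fun t u => ?_⟩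
  refine ae_eq_of_hasSum_of_hasSum (BlockDecomposition.hasSum_symbol K hKs t u) ?_
  have hu : Integrable u fiberMeasure := (Lp.memLp u).integrable (by norm_num)
  have hsm : ∀ᵐ p ∂fiberMeasure, ∀ j : ℤ, (Complex.exp (Complex.I * j * t) • K j u) p =
      Complex.exp (Complex.I * j * t) * K j u p := by
    rw [ae_all_iff]
    exact fun j => Lp.coeFn_smul _ _
  filter_upwards [hsm, ae_all_iff.2 fun j => hK2 j u] with p h1 h2
  have hint : ∀ j : ℤ, Integrable (fun q => Complex.exp (Complex.I * (j : ℂ) * t) *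
      (blockKer α (branchFn f) j p q * u q)) fiberMeasure := fun j =>
    (integrable_kernel_mul (measurable_blockKer hφ j) (hv j) p hu).const_mul _
  have h3 := hasSum_integral_of_summable_integral_norm (F := fun (j : ℤ) q =>
    Complex.exp (Complex.I * j * t) * (blockKer α (branchFn f) j p q * u q)) hint (by
      refine Summable.of_nonneg_of_le (fun j => integral_nonneg fun q => norm_nonneg _)
        (fun j => ?_) (hvs.mul_right (∫ q, ‖u q‖ ∂fiberMeasure))
      rw [← integral_const_mul]
      refine integral_mono (hint j).norm (hu.norm.const_mul _) fun q => ?_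
      simp only []
      rw [norm_mul, norm_mul, norm_expI_mul, one_mul]
      exact mul_le_mul_of_nonneg_right (hv j p q) (norm_nonneg _))
  convert! h3 using 1
  · ext j
    rw [h1, h2, integral_const_mul]
  · refine integral_congr_ae (ae_of_all _ fun q => ?_)
    simp only []
    rw [kerF_eq_tsum, ← tsum_mul_right]
    exact tsum_congr fun j => mul_assoc _ _ _

end BranchPair

theorem measurable_of_analyticOnNhd_compl {f : ℝ → ℝ} (hf : AnalyticOnNhd ℝ f {0}ᶜ) :
    Measurable f :=
  measurable_of_continuousOn_compl_singleton 0 hf.continuousOn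

theorem measurable_branchFn {f : ℝ → ℝ} (hf : Measurable f) (σ : Bool) :
    Measurable (branchFn f σ) := by
  cases σ
  · exact hf.comp measurable_neg
  · exact hf

theorem analyticAt_branchFn {f : ℝ → ℝ} (hf : AnalyticOnNhd ℝ f {0}ᶜ) (σ : Bool) (x : ℝ)
    (hx : 0 < x) : AnalyticAt ℝ (branchFn f σ) x := by
  cases σ
  · exact AnalyticAt.fun_comp (g := f) (hf (-x) (neg_ne_zero.2 hx.ne')) analyticAt_id.neg
  · exact hf x hx.ne'

theorem branchFn_dilation {α : ℝ} {f : ℝ → ℝ} (hdil : ∀ x : ℝ, f (α * x) = α * f x) (σ : Bool)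
    (x : ℝ) : branchFn f σ (α * x) = α * branchFn f σ x := by
  rw [branchFn_apply, branchFn_apply, ← hdil, mul_left_comm]

theorem branchPair_of_admissibleWidth {α c : ℝ} {f : ℝ → ℝ} {Gp Gm : ℂ → ℂ} (hα0 : 0 < α)
    (hα1 : α < 1) (hc : 0 < c) (hdil : ∀ x : ℝ, f (α * x) = α * f x)
    (hp : IsStripContinuation c (logProfile α (fPlus f)) Gp)
    (hm : IsStripContinuation c (logProfile α (fMinus f)) Gm) (h : AdmissibleWidth α c Gp Gm) :
    BranchPair α c (branchFn f) fun σ => bif σ then Gp else Gm where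
  branch σ := by
    refine ⟨hα0, hα1, hc, h.1, fun x _ => branchFn_dilation hdil σ x, ?_, ?_⟩
    · cases σ
      · exact hm
      · exact hp
    · cases σ
      · exact h.2.2.1
      · exact h.2.1
  cross_lt σ τ hστ := by
    cases σ <;> cases τ
    · exact absurd rfl hστ
    · exact h.2.2.2.2
    · exact h.2.2.2.1
    · exact absurd rfl hστ

theorem exists_admissibleWidth {α : ℝ} {f : ℝ → ℝ} (hα0 : 0 < α) (hα1 : α < 1)
    (hf : AnalyticOnNhd ℝ f {0}ᶜ) (hdil : ∀ x : ℝ, f (α * x) = α * f x) :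
    ∃ c₀ : ℝ, 0 < c₀ ∧ ∀ c : ℝ, 0 < c → c ≤ c₀ → ∃ Gp Gm : ℂ → ℂ,
      IsStripContinuation c (logProfile α (fPlus f)) Gp ∧
      IsStripContinuation c (logProfile α (fMinus f)) Gm ∧ AdmissibleWidth α c Gp Gm :=
  exists_admissible hα0 hα1
    (analyticAt_logProfile hα0 (analyticAt_branchFn hf true))
    (logProfile_add_one hα0 fun x _ => branchFn_dilation hdil true x)
    (analyticAt_logProfile hα0 (analyticAt_branchFn hf false))
    (logProfile_add_one hα0 fun x _ => branchFn_dilation hdil false x)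

theorem Lp_coeFn_sub_smul {X : Type*} [MeasurableSpace X] {μ : Measure X} (ψ φ : Lp ℂ 2 μ) (z : ℂ) :
    (ψ - z • φ : Lp ℂ 2 μ) =ᵐ[μ] fun x => ψ x - z * φ x := by
  filter_upwards [Lp.coeFn_sub ψ (z • φ), Lp.coeFn_smul z φ] with x h1 h2
  rw [h1, Pi.sub_apply, h2, Pi.smul_apply, smul_eq_mul]

end DilationGraph

end

open DilationGraph

theorem mainTheorem1 (f : ℝ → ℝ) (α : ℝ) (hα0 : 0 < α) (hα1 : α < 1)
    (hf : AnalyticOnNhd ℝ f {0}ᶜ) (hf0 : f 0 = 0) (hdil : ∀ x : ℝ, f (α * x) = α * f x) :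
    -- the double-layer operator is well defined and bounded on `L²(Γ)`
    (∃! D : L2Graph f →L[ℂ] L2Graph f, IsDoubleLayerOperator f D) ∧
    -- continuations and admissible widths `c` exist
    (∃ c₀ : ℝ, 0 < c₀ ∧ ∀ c : ℝ, 0 < c → c ≤ c₀ → ∃ Gp Gm : ℂ → ℂ,
      IsStripContinuation c (logProfile α (fPlus f)) Gp ∧
      IsStripContinuation c (logProfile α (fMinus f)) Gm ∧
      AdmissibleWidth α c Gp Gm) ∧
    ∀ D : L2Graph f →L[ℂ] L2Graph f, IsDoubleLayerOperator f D →
      essSpectralRadius D = spectralRadius ℂ D ∧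
      ∀ (c : ℝ) (Gp Gm : ℂ → ℂ), 0 < c →
        IsStripContinuation c (logProfile α (fPlus f)) Gp →
        IsStripContinuation c (logProfile α (fMinus f)) Gm →
        AdmissibleWidth α c Gp Gm →
        ∀ ρ₀ : ℝ, 0 < ρ₀ →
          -- the computable criterion implies `ρ(D_Γ) < ρ₀`
          (∀ m M N : ℕ, 1 ≤ m → 2 ≤ M → 1 ≤ N →
            (∀ k : Fin m,
              spectralRadius ℂ (nystromMatrix α f (sampleT m k) M N) < ENNReal.ofReal ρ₀) →
            0 < resolventGap α f Gp Gm ρ₀ m M N →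
            lhsL α c Gp Gm N < rhsR α f Gp Gm ρ₀ m M N →
            spectralRadius ℂ D < ENNReal.ofReal ρ₀) ∧
          -- conversely, the criterion holds for all large `m`, `M`, `N` if `ρ(D_Γ) < ρ₀`
          (spectralRadius ℂ D < ENNReal.ofReal ρ₀ →
            ∃ m₀ M₀ N₀ : ℕ, ∀ m M N : ℕ, m₀ ≤ m → M₀ ≤ M → N₀ ≤ N →
              (∀ t ∈ Set.Icc 0 Real.pi,
                spectralRadius ℂ (nystromMatrix α f t M N) < ENNReal.ofReal ρ₀) ∧
              0 < resolventGap α f Gp Gm ρ₀ m M N ∧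
              lhsL α c Gp Gm N < rhsR α f Gp Gm ρ₀ m M N) := by
  have hfm := measurable_of_analyticOnNhd_compl hf
  have hφ := measurable_branchFn hfm
  have hadm := exists_admissibleWidth hα0 hα1 hf hdil
  -- One admissible width is enough to construct the operator. Its blocks and symbols do not mention
  -- the width, so they can be used with every other c.
  obtain ⟨D₀, hD₀, K, ⟨C, hK⟩, hDK, hsym⟩ : ∃ D : L2Graph f →L[ℂ] L2Graph f,
      IsDoubleLayerOperator f D ∧
      ∃ K : ℤ → Lp ℂ 2 fiberMeasure →L[ℂ] Lp ℂ 2 fiberMeasure,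
        (∃ C, ∀ j, ‖K j‖ ≤ C * √α ^ j.natAbs) ∧
        (∀ j l v, (graphTiling hα0 hα1 hfm).decomposition.π l
          (D ((graphTiling hα0 hα1 hfm).decomposition.ι j v)) = K (l - j) v) ∧
        ∀ t u, symbol K t u =ᵐ[fiberMeasure]
          fun p => ∫ q, kerF α (branchFn f) t p q * u q ∂fiberMeasure := by
    obtain ⟨c₀, hc₀, h⟩ := hadm
    obtain ⟨Gp, Gm, hp, hm, hw⟩ := h c₀ hc₀ le_rfl
    exact (branchPair_of_admissibleWidth hα0 hα1 hc₀ hdil hp hm hw).exists_doubleLayerOperator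
      hfm hφ hdil hα0 hα1
  have hq0 : 0 < √α := Real.sqrt_pos.2 hα0
  have hq1 : √α < 1 := by rw [Real.sqrt_lt' one_pos]; simpa using hα1
  have hKs := BlockDecomposition.summable_norm_of_le_geometric K hq0.le hq1 hK
  refine ⟨⟨D₀, hD₀, fun D hD => hD.unique hD₀⟩, hadm, fun D hD => ?_⟩
  obtain rfl : D = D₀ := hD.unique hD₀
  refine ⟨BlockDecomposition.essSpectralRadius_eq _ D (BlockDecomposition.comm_shift _ D K hDK),
    fun c Gp Gm hc hp hm hw ρ₀ hρ => ?_⟩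
  have P := branchPair_of_admissibleWidth hα0 hα1 hc hdil hp hm hw
  refine ⟨fun m M N h1 h2 h3 h4 h5 h6 => ?_, fun hlt => ?_⟩
  -- The bound on the fibres is uniform in t ∈ [−π, π], so it passes to D and gives the spectral
  -- radius.
  · obtain ⟨δ, hδ, hb⟩ := P.fiber_bounded_below hφ hρ h1 h2 h3 h4 h5 h6
    refine spectralRadius_lt_of_bounded_below D ρ₀ hρ fun z hz => ⟨δ, hδ, ?_⟩
    refine BlockDecomposition.bounded_below_of_symbol _ D K hKs hDK z δ hδ.le fun t ht u => ?_
    refine hb t ht z hz u _ ?_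
    filter_upwards [Lp_coeFn_sub_smul (symbol K t u) u z, hsym t u] with x e1 e2
    rw [e1, e2]
  -- Here δ is uniform in |z| ≥ ρ₀ and passes to every symbol, so the Nyström matrices inherit one
  -- common lower bound.
  · obtain ⟨δ, hδ, hb⟩ := bounded_below_of_spectralRadius_lt D ρ₀ hlt
    refine P.criterion_of_fiber_bounded_below hφ hρ hδ fun t z hz φ ω hω => ?_
    have e : ω = symbol K t φ - z • φ := by
      refine Lp.ext ?_
      filter_upwards [Lp_coeFn_sub_smul (symbol K t φ) φ z, hsym t φ, hω] with x e1 e2 e3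
      rw [e1, e2, e3]
    rw [e]
    exact BlockDecomposition.symbol_bounded_below _ D K hq0 hq1 hK hDK z δ hδ.le (hb z hz) t φ
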